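/- Let $K$ be a field of characteristic $0$ that is complete with respect to a nontrivial nonarchimedean absolute value. Let $G$ be a compact locally $K$-analytic Lie group (finite dimensional, Hausdorff) with Lie algebra $\mathfrak g$. Manifolds are paracompact, Hausdorff, finite dimensional locally $K$-analytic manifolds. Let $V$ be a barrelled, separated, locally convex $K$-vector space. A function $f\colon X\to V$ on a manifold $X$ is called analytic if, locally on $X$, it factors through a $K$-Banach space $W$ with a continuous linear injection $W\hookrightarrow V$, as a function to $W$ given in charts by convergent power series. A locally analytic representation of $G$ on $V$ is an action of $G$ on $V$ by continuous linear automorphisms all of whose orbit maps $g\mapsto gv$ are analytic. Given such a representation, an analytic function $f\colon X\to V$ is admissible if $G\times X\to V$, $(g,x)\mapsto g f(x)$, is analytic; $\underline V(X)$ denotes the group of admissible functions $X\to V$. Then $\underline V$ is a sheaf on the category of manifolds for the topology generated by open coverings, and the sheaf of groups $y(G)$, where $y(G)(X)$ is the group of analytic maps $\rho\colon X\to G$, acts on it by $(\rho f)(x)=\rho(x)f(x)$. So $\underline V$ is an abelian group object of the topos $BG$ of sheaves with $y(G)$-action. The locally analytic group cohomology of $G$ with coefficients in $V$ is $$H^n_{\mathrm{an}}(G,V):=(R^n\Gamma)(\underline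 V),$$ where $\Gamma=\mathrm{Hom}_{BG}(*,-)$ is the global section functor on the abelian group objects of $BG$. The Lie algebra $\mathfrak g$ acts on $V$ by differentiating the orbit maps at $1$, and $H^n(\mathfrak g,V)$ denotes Lie algebra cohomology, i.e. the cohomology of the Chevalley–Eilenberg complex $\mathrm{Hom}_K(\bigwedge^{\bullet}\mathfrak g,V)$. The group $G$ acts on $H^n(\mathfrak g,V)$ through the adjoint action on $\mathfrak g$ and the given action on $V$: $(g\eta)(x_1,\dots,x_n)=g\,\eta(\mathrm{Ad}(g^{-1})x_1,\dots,\mathrm{Ad}(g^{-1})x_n)$. Then for every $n\ge 0$ there is an isomorphism of $K$-vector spaces $$H^n_{\mathrm{an}}(G,V)\;\cong\;H^n(\mathfrak g,V)^G,$$ natural in $V$, i.e. compatible with continuous $K$-linear $G$-equivariant maps between locally analytic representations of $G$ on barrelled, separated, locally convex $K$-vector spaces. -/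

import Mathlib

open CategoryTheory Opposite Topology Filter
open scoped Manifold ContDiff

universe u

namespace LocAnCohom

/-! ### Locally analytic manifolds -/

/-- A (paracompact, Hausdorff, finite dimensional) locally `K`-analytic manifold. -/
structure AnMfd (K : Type u) [NontriviallyNormedField K] where
  carrier : Type u
  model : Type u
  [normedAddCommGroup : NormedAddCommGroup model]
  [normedSpace : NormedSpace K model]
  [finiteDimensional : FiniteDimensional K model]
  [topologicalSpace : TopologicalSpace carrier]
  [chartedSpace : ChartedSpace model carrier]
  [isManifold : IsManifold 𝓘(K, model) ω carrier]
  [t2Space : T2Space carrier]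
  [paracompactSpace : ParacompactSpace carrier]

namespace AnMfd

attribute [instance] normedAddCommGroup normedSpace finiteDimensional topologicalSpace
  chartedSpace isManifold t2Space paracompactSpace

variable {K : Type u} [NontriviallyNormedField K]

instance : CoeSort (AnMfd K) (Type u) := ⟨AnMfd.carrier⟩

/-- The category of manifolds; morphisms are the locally analytic maps. -/
instance category : Category.{u} (AnMfd K) where
  Hom X Y := C^ω⟮𝓘(K, X.model), X; 𝓘(K, Y.model), Y⟯
  id _ := ContMDiffMap.id
  comp f g := ContMDiffMap.comp g f

instance (X Y : AnMfd K) : FunLike (X ⟶ Y) X Y :=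
  inferInstanceAs (FunLike C^ω⟮𝓘(K, X.model), X; 𝓘(K, Y.model), Y⟯ X Y)

theorem hom_contMDiff {X Y : AnMfd K} (f : X ⟶ Y) :
    ContMDiff 𝓘(K, X.model) 𝓘(K, Y.model) ω f :=
  f.2

@[simp] theorem id_apply (X : AnMfd K) (x : X) : (𝟙 X : X ⟶ X) x = x := rfl

@[simp] theorem comp_apply {X Y Z : AnMfd K} (f : X ⟶ Y) (g : Y ⟶ Z) (x : X) :
    (f ≫ g) x = g (f x) := rfl

theorem hom_ext {X Y : AnMfd K} {f g : X ⟶ Y} (h : ∀ x, f x = g x) : f = g :=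
  ContMDiffMap.ext h

/-- The one-point manifold. -/
def pt : AnMfd K where
  carrier := PUnit
  model := PUnit

/-- The map from the one-point manifold with image `x`. -/
def ptTo (X : AnMfd K) (x : X) : (pt : AnMfd K) ⟶ X := ⟨fun _ => x, contMDiff_const⟩

/-- The map to the one-point manifold. -/
def toPt (X : AnMfd K) : X ⟶ (pt : AnMfd K) := ⟨fun _ => PUnit.unit, contMDiff_const⟩

/-- Small open submanifolds exist in the category; `r` is a retraction defined on all of `X`. -/
theorem exists_open (X : AnMfd K) (x : X) (U : Set X) (hU : IsOpen U) (hx : x ∈ U) :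
    ∃ (Y : AnMfd K) (j : Y ⟶ X) (r : X → Y),
      Set.range j ⊆ U ∧ IsOpen (Set.range j) ∧ x ∈ Set.range j ∧ Function.Injective j ∧
      IsOpenMap j ∧
      ∀ y ∈ Set.range j, j (r y) = y ∧ ContMDiffAt 𝓘(K, X.model) 𝓘(K, Y.model) ω r y := by
  classical
  let O : TopologicalSpace.Opens X := ⟨U ∩ (chartAt X.model x).source,
    hU.inter (chartAt X.model x).open_source⟩
  have hxO : x ∈ O := ⟨hx, mem_chart_source _ x⟩
  have hmet : TopologicalSpace.MetrizableSpace O := by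
    have he : IsEmbedding (fun y : O => (chartAt X.model x) y.1) := by
      have h1 := (chartAt X.model x).toHomeomorphSourceTarget.isEmbedding
      have h2 : IsEmbedding (Set.inclusion (s := (O : Set X))
        (t := (chartAt X.model x).source) Set.inter_subset_right) :=
        IsEmbedding.inclusion _
      exact IsEmbedding.subtypeVal.comp (h1.comp h2)
    exact he.metrizableSpace
  have hpc : ParacompactSpace O := by
    let _ := TopologicalSpace.metrizableSpaceMetric O
    infer_instance
  let Y : AnMfd K := { carrier := O, model := X.model }
  let j : Y ⟶ X :=
    (⟨Subtype.val, contMDiff_subtype_val⟩ : C^ω⟮𝓘(K, X.model), O; 𝓘(K, X.model), X⟯)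
  let r : X → Y := fun y => if h : y ∈ O then ⟨y, h⟩ else ⟨x, hxO⟩
  have hrange : Set.range j = (O : Set X) := Subtype.range_coe
  refine ⟨Y, j, r, ?_, ?_, ?_, Subtype.val_injective, O.isOpen.isOpenMap_subtype_val, ?_⟩
  · rw [hrange]; exact Set.inter_subset_left
  · rw [hrange]; exact O.isOpen
  · rw [hrange]; exact hxO
  · intro y hy
    rw [hrange] at hy
    have hy' : y ∈ O := hy
    refine ⟨?_, ?_⟩
    · change ((r y : O) : X) = y
      simp [r, hy']
    · refine (contMDiffAt_subtype_iff (U := O) (x := ⟨y, hy'⟩)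
        (I' := 𝓘(K, X.model)) (f := r)).1 ?_
      have : (fun z : O => r z) = id := by
        funext z
        simp [r]
      rw [this]
      exact contMDiffAt_id

/-- The Grothendieck topology generated by the open coverings: a sieve covers `X` iff every point
of `X` has an open neighbourhood `U` such that all analytic maps with image in `U` belong to the
sieve, that is, iff the sieve contains the inclusions of the members of an open covering. -/
def topology (K : Type u) [NontriviallyNormedField K] : GrothendieckTopology (AnMfd K) where
  sieves X := {S | ∀ x : X, ∃ U : Set X, IsOpen U ∧ x ∈ U ∧
    ∀ (Y : AnMfd K) (f : Y ⟶ X), Set.range f ⊆ U → S f}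
  top_mem' X x := ⟨Set.univ, isOpen_univ, trivial, fun _ _ _ => trivial⟩
  pullback_stable' := by
    intro X Y S f hS y
    obtain ⟨U, hU, hy, h⟩ := hS (f y)
    refine ⟨f ⁻¹' U, hU.preimage (hom_contMDiff f).continuous, hy, fun Z k hk => ?_⟩
    refine h Z (k ≫ f) ?_
    rintro _ ⟨z, rfl⟩
    exact hk ⟨z, rfl⟩
  transitive' := by
    intro X S hS R hR x
    obtain ⟨U, hU, hx, h⟩ := hS x
    obtain ⟨Y, j, r, hjU, hjo, ⟨y, rfl⟩, hinj, hopen, hr⟩ := exists_open X x U hU hx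
    obtain ⟨U', hU', hy, h'⟩ := hR (h Y j hjU) y
    refine ⟨j '' U', hopen _ hU', ⟨y, hy, rfl⟩, fun Z k hk => ?_⟩
    have hkr : ∀ z, k z ∈ Set.range j := fun z => Set.image_subset_range _ _ (hk ⟨z, rfl⟩)
    let k' : Z ⟶ Y := ⟨fun z => r (k z), fun z =>
      (hr _ (hkr z)).2.comp z ((hom_contMDiff k) z)⟩
    have hk' : k' ≫ j = k := hom_ext fun z => (hr _ (hkr z)).1
    have := h' Z k' ?_
    · rw [Sieve.pullback_apply, hk'] at this
      exact this
    · rintro _ ⟨z, rfl⟩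
      obtain ⟨w, hw, hwk⟩ := hk ⟨z, rfl⟩
      have : k' z = w := hinj (by rw [hwk]; exact (hr _ (hkr z)).1)
      rw [this]; exact hw

end AnMfd

/-! ### The classifying topos of a Lie group: sheaves with an action of `y(G)` -/

section ClassifyingTopos

variable (K : Type u) [NontriviallyNormedField K]
  (E : Type u) [NormedAddCommGroup E] [NormedSpace K E]
  (G : Type u) [TopologicalSpace G] [ChartedSpace E G] [Group G] [LieGroup 𝓘(K, E) ω G]

/-- The group `y(G)(X)` of locally analytic maps `X → G`. -/
abbrev Pts (X : AnMfd K) : Type u := C^ω⟮𝓘(K, X.model), X; 𝓘(K, E), G⟯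

variable {K E G}

/-- Restriction of `G`-valued maps along a map of manifolds. -/
def Pts.res {X Y : AnMfd K} (f : X ⟶ Y) (ρ : Pts K E G Y) : Pts K E G X :=
  ContMDiffMap.comp ρ f

variable (K E G)

/-- An abelian group object of the classifying topos `BG`: an abelian sheaf on the site of
manifolds with an action of the sheaf of groups `y(G)` by group automorphisms. (The site is large
relative to `u`, so the sheaves take values in the next universe.) -/
structure EquivSheaf where
  /-- the underlying abelian sheaf -/
  sheaf : Sheaf (AnMfd.topology K) AddCommGrpCat.{u + 1}
  /-- the action of `y(G)(X)` on the sections over `X` -/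
  act (X : AnMfd K) : Pts K E G X →* AddMonoid.End (sheaf.obj.obj (op X))
  act_res {X Y : AnMfd K} (f : X ⟶ Y) (ρ : Pts K E G Y) (s : sheaf.obj.obj (op Y)) :
    sheaf.obj.map f.op (act Y ρ s) = act X (ρ.res f) (sheaf.obj.map f.op s)

namespace EquivSheaf

variable {K E G}

/-- Morphisms are the equivariant morphisms of sheaves. -/
@[ext] structure Hom (A B : EquivSheaf K E G) where
  hom : A.sheaf ⟶ B.sheaf
  equivariant (X : AnMfd K) (ρ : Pts K E G X) (s : A.sheaf.obj.obj (op X)) :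
    hom.hom.app (op X) (A.act X ρ s) = B.act X ρ (hom.hom.app (op X) s)

instance : Category (EquivSheaf K E G) where
  Hom := Hom
  id A := ⟨𝟙 _, fun _ _ _ => rfl⟩
  comp f g := ⟨f.hom ≫ g.hom, fun X ρ s => by
    have h1 := f.equivariant X ρ s
    have h2 := g.equivariant X ρ (f.hom.hom.app (op X) s)
    simp only [ObjectProperty.FullSubcategory.comp_hom, NatTrans.comp_app,
      ConcreteCategory.comp_apply]
    rw [h1, h2]⟩

@[simp] theorem id_hom (A : EquivSheaf K E G) : Hom.hom (𝟙 A) = 𝟙 _ := rfl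

@[simp] theorem comp_hom {A B C : EquivSheaf K E G} (f : A ⟶ B) (g : B ⟶ C) :
    Hom.hom (f ≫ g) = Hom.hom f ≫ Hom.hom g := rfl

theorem hom_ext {A B : EquivSheaf K E G} {f g : A ⟶ B} (h : Hom.hom f = Hom.hom g) : f = g :=
  Hom.ext h

end EquivSheaf

/-! The category `EquivSheaf` is abelian with enough injectives. To see this we identify it with the
category of abelian sheaves on the full subcategory of `BG` on the objects `G × X`. -/

/-- The manifold `X`, regarded as the object `G × X` of `BG`. -/
structure Tw (K : Type u) [NontriviallyNormedField K] (E G : Type u) where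
  mfd : AnMfd K

namespace Tw

variable {K E G}

/-- Equivariant maps `G × X → G × Y` are of the form `(g, x) ↦ (g * ρ x, f x)`. -/
@[ext] structure Hom (X Y : Tw K E G) where
  pts : Pts K E G X.mfd
  map : X.mfd ⟶ Y.mfd

instance category : Category.{u} (Tw K E G) where
  Hom X Y := Hom X Y
  id _ := ⟨1, 𝟙 _⟩
  comp f g := ⟨f.pts * g.pts.res f.map, f.map ≫ g.map⟩
  id_comp _ := Hom.ext (ContMDiffMap.ext fun _ => one_mul _) (Category.id_comp _)
  comp_id _ := Hom.ext (ContMDiffMap.ext fun _ => mul_one _) (Category.comp_id _)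
  assoc _ _ _ := Hom.ext (ContMDiffMap.ext fun _ => mul_assoc _ _ _) (Category.assoc _ _ _)

@[simp] theorem comp_pts {X Y Z : Tw K E G} (f : X ⟶ Y) (g : Y ⟶ Z) :
    Hom.pts (f ≫ g) = f.pts * g.pts.res f.map := rfl

@[simp] theorem comp_map {X Y Z : Tw K E G} (f : X ⟶ Y) (g : Y ⟶ Z) :
    Hom.map (f ≫ g) = f.map ≫ g.map := rfl

@[simp] theorem id_pts (X : Tw K E G) : Hom.pts (𝟙 X) = 1 := rfl

@[simp] theorem id_map (X : Tw K E G) : Hom.map (𝟙 X) = 𝟙 _ := rfl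

theorem hom_ext {X Y : Tw K E G} {f g : X ⟶ Y} (h : f.pts = g.pts) (h' : f.map = g.map) : f = g :=
  Hom.ext h h'

/-- The map `id × f : G × X → G × Y`. -/
def lift {X Y : Tw K E G} (f : X.mfd ⟶ Y.mfd) : X ⟶ Y := ⟨1, f⟩

/-- The automorphism of `G × X` given by right multiplication by `ρ : X → G`. -/
def mulBy (X : Tw K E G) (ρ : Pts K E G X.mfd) : X ⟶ X := ⟨ρ, 𝟙 _⟩

theorem lift_id (X : Tw K E G) : lift (𝟙 X.mfd) = 𝟙 X := rfl

theorem lift_comp {X Y Z : Tw K E G} (f : X.mfd ⟶ Y.mfd) (g : Y.mfd ⟶ Z.mfd) :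
    (lift (f ≫ g) : X ⟶ Z) = (lift f : X ⟶ Y) ≫ lift g :=
  hom_ext (ContMDiffMap.ext fun _ => (one_mul _).symm) rfl

theorem mulBy_mul (X : Tw K E G) (ρ σ : Pts K E G X.mfd) :
    mulBy X (ρ * σ) = mulBy X ρ ≫ mulBy X σ := rfl

theorem mulBy_one (X : Tw K E G) : mulBy X 1 = 𝟙 X := rfl

theorem lift_mulBy {X Y : Tw K E G} (f : X.mfd ⟶ Y.mfd) (ρ : Pts K E G Y.mfd) :
    (lift f : X ⟶ Y) ≫ mulBy Y ρ = mulBy X (ρ.res f) ≫ lift f :=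
  hom_ext (ContMDiffMap.ext fun _ => (one_mul _).trans (mul_one _).symm) rfl

theorem hom_eq {X Y : Tw K E G} (f : X ⟶ Y) : f = mulBy X f.pts ≫ lift f.map :=
  hom_ext (ContMDiffMap.ext fun _ => (mul_one _).symm) rfl

theorem lift_map_eq {X Y : Tw K E G} (f : X ⟶ Y) : lift f.map = mulBy X f.pts⁻¹ ≫ f :=
  hom_ext (ContMDiffMap.ext fun _ => (inv_mul_cancel _).symm) rfl

/-- The sieve of manifolds induced by a sieve of objects `G × X`. -/
def base {X : Tw K E G} (S : Sieve X) : Sieve X.mfd where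
  arrows Y f := S (lift (X := ⟨Y⟩) f)
  downward_closed {Y Z f} hf g := by
    have := S.downward_closed hf (lift (X := ⟨Z⟩) (Y := ⟨Y⟩) g)
    rwa [← lift_comp] at this

theorem base_iff {X Y : Tw K E G} (S : Sieve X) (f : Y ⟶ X) : base S f.map ↔ S f := by
  constructor
  · intro h
    have h' : S (lift f.map) := h
    rw [hom_eq f]
    exact S.downward_closed h' _
  · intro h
    change S (lift f.map)
    rw [lift_map_eq]
    exact S.downward_closed h _

theorem base_pullback {X Y : Tw K E G} (S : Sieve X) (f : Y ⟶ X) :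
    base (S.pullback f) = (base S).pullback f.map := by
  ext Z k
  exact (base_iff S (lift (X := ⟨Z⟩) k ≫ f)).symm

/-- The topology on the objects `G × X`. -/
def topology (K : Type u) [NontriviallyNormedField K]
    (E : Type u) [NormedAddCommGroup E] [NormedSpace K E]
    (G : Type u) [TopologicalSpace G] [ChartedSpace E G] [Group G] [LieGroup 𝓘(K, E) ω G] :
    GrothendieckTopology (Tw K E G) where
  sieves X := {S | base S ∈ AnMfd.topology K X.mfd}
  top_mem' X := (AnMfd.topology K).top_mem X.mfd
  pullback_stable' := by
    intro X Y S f hS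
    change base (S.pullback f) ∈ AnMfd.topology K Y.mfd
    rw [base_pullback]
    exact (AnMfd.topology K).pullback_stable f.map hS
  transitive' := by
    intro X S hS R hR
    refine (AnMfd.topology K).transitive hS _ ?_
    intro Y f hf
    have h1 : base (R.pullback (lift (X := ⟨Y⟩) f)) ∈ AnMfd.topology K Y := hR hf
    rw [base_pullback] at h1
    exact h1

/-- The sieve of objects `G × X` induced by a sieve of manifolds. -/
def up {X : Tw K E G} (S : Sieve X.mfd) : Sieve X where
  arrows _ f := S f.map
  downward_closed hf g := S.downward_closed hf g.map

theorem base_up {X : Tw K E G} (S : Sieve X.mfd) : base (up S) = S := rfl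

end Tw

namespace EquivSheaf

variable {K E G}

/-- The presheaf on the objects `G × X` attached to a sheaf with action. -/
def toPresheaf (A : EquivSheaf K E G) : (Tw K E G)ᵒᵖ ⥤ AddCommGrpCat.{u + 1} where
  obj X := A.sheaf.obj.obj (op X.unop.mfd)
  map {X Y} f := A.sheaf.obj.map f.unop.map.op ≫ AddCommGrpCat.ofHom (A.act _ f.unop.pts)
  map_id X := by
    ext s
    change A.act _ 1 (A.sheaf.obj.map (𝟙 _) s) = s
    simp
  map_comp {X Y Z} f g := by
    ext s
    change A.act _ (g.unop.pts * f.unop.pts.res g.unop.map)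
        (A.sheaf.obj.map (f.unop.map.op ≫ g.unop.map.op) s) =
      A.act _ g.unop.pts (A.sheaf.obj.map g.unop.map.op
        (A.act _ f.unop.pts (A.sheaf.obj.map f.unop.map.op s)))
    rw [A.act_res, map_mul, Functor.map_comp]
    rfl

theorem toPresheaf_map (A : EquivSheaf K E G) {X Y : Tw K E G} (f : X ⟶ Y)
    (s : A.sheaf.obj.obj (op Y.mfd)) :
    A.toPresheaf.map f.op s = A.act _ f.pts (A.sheaf.obj.map f.map.op s) := rfl

theorem toPresheaf_map_lift (A : EquivSheaf K E G) {X Y : Tw K E G} (f : X.mfd ⟶ Y.mfd)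
    (s : A.sheaf.obj.obj (op Y.mfd)) :
    A.toPresheaf.map (Tw.lift f : X ⟶ Y).op s = A.sheaf.obj.map f.op s := by
  rw [toPresheaf_map]
  change A.act _ 1 _ = _
  rw [map_one]
  rfl

theorem toPresheaf_map_mulBy (A : EquivSheaf K E G) (X : Tw K E G) (ρ : Pts K E G X.mfd)
    (s : A.sheaf.obj.obj (op X.mfd)) :
    A.toPresheaf.map (Tw.mulBy X ρ).op s = A.act _ ρ s := by
  rw [toPresheaf_map]
  change A.act _ ρ (A.sheaf.obj.map (𝟙 _) s) = _
  rw [A.sheaf.obj.map_id]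
  rfl

theorem isSheaf_toPresheaf (A : EquivSheaf K E G) :
    Presheaf.IsSheaf (Tw.topology K E G) A.toPresheaf := by
  rw [Presheaf.isSheaf_iff_isSheaf_forget _ _ (forget AddCommGrpCat.{u + 1}),
    isSheaf_iff_isSheaf_of_type]
  have hA := A.sheaf.property
  rw [Presheaf.isSheaf_iff_isSheaf_forget _ _ (forget AddCommGrpCat.{u + 1}),
    isSheaf_iff_isSheaf_of_type] at hA
  intro X S hS x hx
  have hS' : Tw.base S ∈ AnMfd.topology K X.mfd := hS
  let x' : Presieve.FamilyOfElements (A.sheaf.obj ⋙ forget AddCommGrpCat.{u + 1})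
    (Tw.base S).arrows := fun Y f hf => x (Tw.lift (X := ⟨Y⟩) f) hf
  have hx' : x'.Compatible := by
    intro Y₁ Y₂ Z g₁ g₂ f₁ f₂ h₁ h₂ e
    have := hx (Y₁ := ⟨Y₁⟩) (Y₂ := ⟨Y₂⟩) (Z := ⟨Z⟩) (Tw.lift g₁) (Tw.lift g₂) h₁ h₂
      (by rw [← Tw.lift_comp, ← Tw.lift_comp, e])
    have h3 := A.toPresheaf_map_lift (X := ⟨Z⟩) (Y := ⟨Y₁⟩) g₁ (x' f₁ h₁)
    have h4 := A.toPresheaf_map_lift (X := ⟨Z⟩) (Y := ⟨Y₂⟩) g₂ (x' f₂ h₂)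
    exact h3.symm.trans (this.trans h4)
  obtain ⟨t, ht, htu⟩ := hA _ hS' x' hx'
  refine ⟨t, ?_, ?_⟩
  · intro Y f hf
    have hb : Tw.base S f.map := (Tw.base_iff S f).2 hf
    have h1 : A.sheaf.obj.map f.map.op t = x (Tw.lift (X := ⟨Y.mfd⟩) f.map) hb := ht f.map hb
    have h2 := hx (Y₁ := Y) (Y₂ := Y) (Z := Y) (Tw.mulBy Y f.pts) (𝟙 Y) (f₁ := Tw.lift f.map)
      (f₂ := f) hb hf (by rw [← Tw.hom_eq, Category.id_comp])
    change A.toPresheaf.map f.op t = x f hf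
    rw [A.toPresheaf_map, h1]
    have h3 := A.toPresheaf_map_mulBy Y f.pts (x (Tw.lift f.map) hb)
    have h4 : A.toPresheaf.map (𝟙 Y).op (x f hf) = x f hf := by
      rw [op_id, A.toPresheaf.map_id]
      rfl
    exact h3.symm.trans (h2.trans h4)
  · intro t' ht'
    refine htu t' ?_
    intro Y f hf
    have := ht' (Tw.lift (X := ⟨Y⟩) f) hf
    exact (A.toPresheaf_map_lift (X := ⟨Y⟩) f t').symm.trans this

end EquivSheaf

namespace EquivSheaf

variable {K E G}

/-- The functor to abelian sheaves on the objects `G × X`. -/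
def toTw (K : Type u) [NontriviallyNormedField K]
    (E : Type u) [NormedAddCommGroup E] [NormedSpace K E]
    (G : Type u) [TopologicalSpace G] [ChartedSpace E G] [Group G] [LieGroup 𝓘(K, E) ω G] :
    EquivSheaf K E G ⥤ Sheaf (Tw.topology K E G) AddCommGrpCat.{u + 1} where
  obj A := ⟨A.toPresheaf, A.isSheaf_toPresheaf⟩
  map {A B} f := ⟨{
    app X := f.hom.hom.app (op X.unop.mfd)
    naturality X Y k := by
      ext s
      change f.hom.hom.app _ (A.act _ k.unop.pts (A.sheaf.obj.map k.unop.map.op s)) =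
        B.act _ k.unop.pts (B.sheaf.obj.map k.unop.map.op (f.hom.hom.app _ s))
      rw [f.equivariant]
      exact congrArg (B.act _ k.unop.pts)
        (NatTrans.naturality_apply f.hom.hom k.unop.map.op s) }⟩

theorem map_map (P : (Tw K E G)ᵒᵖ ⥤ AddCommGrpCat.{u + 1}) {X Y Z : Tw K E G} (f : X ⟶ Y)
    (g : Y ⟶ Z) (s : P.obj (op Z)) : P.map f.op (P.map g.op s) = P.map (f ≫ g).op s := by
  rw [op_comp, P.map_comp]
  rfl

/-- The functor `toTw` is fully faithful. -/
def fullyFaithfulToTw : (toTw K E G).FullyFaithful where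
  preimage {A B} φ :=
    { hom := ⟨{
        app X := φ.hom.app (op ⟨X.unop⟩)
        naturality X Y k := by
          ext s
          have h := NatTrans.naturality_apply φ.hom
            (Tw.lift (X := ⟨Y.unop⟩) (Y := ⟨X.unop⟩) k.unop).op s
          have h1 := A.toPresheaf_map_lift (X := ⟨Y.unop⟩) (Y := ⟨X.unop⟩) k.unop s
          have h2 := B.toPresheaf_map_lift (X := ⟨Y.unop⟩) (Y := ⟨X.unop⟩) k.unop
            (φ.hom.app (op ⟨X.unop⟩) s)
          exact (congrArg (φ.hom.app (op ⟨Y.unop⟩)) h1).symm.trans (h.trans h2) }⟩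
      equivariant X ρ s := by
        have h := NatTrans.naturality_apply φ.hom (Tw.mulBy (⟨X⟩ : Tw K E G) ρ).op s
        have h1 := A.toPresheaf_map_mulBy ⟨X⟩ ρ s
        have h2 := B.toPresheaf_map_mulBy ⟨X⟩ ρ (φ.hom.app (op ⟨X⟩) s)
        exact (congrArg (φ.hom.app (op ⟨X⟩)) h1).symm.trans (h.trans h2) }
  map_preimage _ := rfl
  preimage_map _ := rfl

instance : (toTw K E G).Faithful := fullyFaithfulToTw.faithful

instance : (toTw K E G).Full := fullyFaithfulToTw.full

/-- The sheaf on manifolds underlying a sheaf on the objects `G × X`. -/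
def ofTwPresheaf (P : (Tw K E G)ᵒᵖ ⥤ AddCommGrpCat.{u + 1}) :
    (AnMfd K)ᵒᵖ ⥤ AddCommGrpCat.{u + 1} where
  obj X := P.obj (op ⟨X.unop⟩)
  map {X Y} f := P.map (Tw.lift (X := ⟨Y.unop⟩) (Y := ⟨X.unop⟩) f.unop).op
  map_id X := P.map_id _
  map_comp {X Y Z} f g := by
    rw [← P.map_comp, ← op_comp, ← Tw.lift_comp]
    rfl

theorem isSheaf_ofTwPresheaf (P : (Tw K E G)ᵒᵖ ⥤ AddCommGrpCat.{u + 1})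
    (hP : Presheaf.IsSheaf (Tw.topology K E G) P) :
    Presheaf.IsSheaf (AnMfd.topology K) (ofTwPresheaf P) := by
  rw [Presheaf.isSheaf_iff_isSheaf_forget _ _ (forget AddCommGrpCat.{u + 1}),
    isSheaf_iff_isSheaf_of_type] at hP ⊢
  intro X S hS x hx
  have hS' : Tw.up (X := (⟨X⟩ : Tw K E G)) S ∈ Tw.topology K E G ⟨X⟩ := hS
  let x' : Presieve.FamilyOfElements (P ⋙ forget AddCommGrpCat.{u + 1})
      (Tw.up (X := (⟨X⟩ : Tw K E G)) S).arrows :=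
    fun Y f hf => P.map (Tw.mulBy Y f.pts).op (x f.map hf)
  have hx' : x'.Compatible := by
    intro Y₁ Y₂ Z g₁ g₂ f₁ f₂ h₁ h₂ e
    have key : ∀ {Y : Tw K E G} (g : Z ⟶ Y) (f : Y ⟶ ⟨X⟩) (h : S f.map),
        P.map g.op (P.map (Tw.mulBy Y f.pts).op (x f.map h)) =
          P.map (Tw.mulBy Z (g ≫ f).pts).op (P.map (Tw.lift g.map : Z ⟶ Y).op (x f.map h)) := by
      intro Y g f h
      have : g ≫ Tw.mulBy Y f.pts = Tw.mulBy Z (g ≫ f).pts ≫ Tw.lift g.map := by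
        conv_lhs => rw [Tw.hom_eq g]
        rw [Category.assoc, Tw.lift_mulBy, ← Category.assoc, ← Tw.mulBy_mul]
        rfl
      refine (map_map P g (Tw.mulBy Y f.pts) _).trans (Eq.trans ?_ (map_map P _ _ _).symm)
      rw [this]
    have h3 := hx g₁.map g₂.map (f₁ := f₁.map) (f₂ := f₂.map) h₁ h₂ (congrArg Tw.Hom.map e)
    have h3' : P.map (Tw.lift g₁.map : Z ⟶ Y₁).op (x f₁.map h₁) =
      P.map (Tw.lift g₂.map : Z ⟶ Y₂).op (x f₂.map h₂) := h3
    refine (key g₁ f₁ h₁).trans (Eq.trans ?_ (key g₂ f₂ h₂).symm)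
    rw [h3', e]
  obtain ⟨t, ht, htu⟩ := hP _ hS' x' hx'
  have hone : ∀ (Y : Tw K E G) (s : P.obj (op Y)), P.map (Tw.mulBy Y 1).op s = s := by
    intro Y s
    rw [Tw.mulBy_one, op_id, P.map_id]
    rfl
  refine ⟨t, ?_, ?_⟩
  · intro Y f hf
    have h1 := ht (Tw.lift (X := (⟨Y⟩ : Tw K E G)) (Y := ⟨X⟩) f) hf
    exact h1.trans (hone _ _)
  · intro t' ht'
    refine htu t' ?_
    intro Y f hf
    have h1 : P.map (Tw.lift f.map : Y ⟶ ⟨X⟩).op t' = x f.map hf := ht' f.map hf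
    change P.map f.op t' = P.map (Tw.mulBy Y f.pts).op (x f.map hf)
    rw [← h1]
    refine Eq.trans ?_ (map_map P (Tw.mulBy Y f.pts) (Tw.lift f.map) t').symm
    rw [← Tw.hom_eq]

/-- The sheaf with action attached to a sheaf on the objects `G × X`. -/
def ofTw (P : Sheaf (Tw.topology K E G) AddCommGrpCat.{u + 1}) : EquivSheaf K E G where
  sheaf := ⟨ofTwPresheaf P.obj, isSheaf_ofTwPresheaf P.obj P.property⟩
  act X :=
    { toFun ρ := (P.obj.map (Tw.mulBy (⟨X⟩ : Tw K E G) ρ).op).hom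
      map_one' := by
        rw [Tw.mulBy_one, op_id, P.obj.map_id]
        rfl
      map_mul' ρ σ := by
        rw [Tw.mulBy_mul, op_comp, P.obj.map_comp]
        rfl }
  act_res {X Y} f ρ s := by
    change P.obj.map (Tw.lift (X := (⟨X⟩ : Tw K E G)) (Y := ⟨Y⟩) f).op
        (P.obj.map (Tw.mulBy (⟨Y⟩ : Tw K E G) ρ).op s) =
      P.obj.map (Tw.mulBy (⟨X⟩ : Tw K E G) (ρ.res f)).op
        (P.obj.map (Tw.lift (X := (⟨X⟩ : Tw K E G)) (Y := ⟨Y⟩) f).op s)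
    refine (map_map P.obj (Tw.lift f) (Tw.mulBy _ ρ) s).trans
      (Eq.trans ?_ (map_map P.obj _ (Tw.lift f) s).symm)
    rw [Tw.lift_mulBy]

instance : (toTw K E G).EssSurj where
  mem_essImage P := by
    refine ⟨ofTw P, ⟨(fullyFaithfulSheafToPresheaf _ _).preimageIso
      (NatIso.ofComponents (fun X => Iso.refl _) ?_)⟩⟩
    intro X Y f
    refine (Category.comp_id _).trans (Eq.trans ?_ (Category.id_comp _).symm)
    change P.obj.map _ ≫ P.obj.map _ = P.obj.map f
    rw [← P.obj.map_comp, ← op_comp]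
    exact congrArg P.obj.map (congrArg Quiver.Hom.op (Tw.hom_eq f.unop).symm)

instance : (toTw K E G).IsEquivalence where

noncomputable instance : Preadditive (EquivSheaf K E G) :=
  .ofFullyFaithful fullyFaithfulToTw

instance : (toTw K E G).Additive :=
  fullyFaithfulToTw.additive_ofFullyFaithful

theorem add_hom_app {A B : EquivSheaf K E G} (f g : A ⟶ B) (X : (AnMfd K)ᵒᵖ)
    (s : A.sheaf.obj.obj X) :
    (Hom.hom (f + g)).hom.app X s = (Hom.hom f).hom.app X s + (Hom.hom g).hom.app X s := by
  have h : (toTw K E G).map (f + g) = (toTw K E G).map f + (toTw K E G).map g :=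
    (toTw K E G).map_add
  have h' := congrArg (fun φ => φ.hom.app (op ⟨X.unop⟩) s) h
  exact h'

instance : Limits.HasFiniteProducts (EquivSheaf K E G) :=
  ⟨fun _ => Adjunction.hasLimitsOfShape_of_equivalence (toTw K E G)⟩

noncomputable instance : Abelian (EquivSheaf K E G) := abelianOfEquivalence (toTw K E G)

instance : EnoughInjectives (EquivSheaf K E G) := by
  have h : EssentiallySmall.{u + 1} (Tw K E G) := inferInstance
  have h2 : IsGrothendieckAbelian.{u + 1} (Sheaf (Tw.topology K E G) AddCommGrpCat.{u + 1}) :=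
    Sheaf.isGrothendieckAbelian_of_essentiallySmall (Tw.topology K E G) AddCommGrpCat.{u + 1}
  exact EnoughInjectives.of_equivalence (toTw K E G)

/-- The global sections `Hom_{BG}(*, A)`: the sections over the point that are invariant under the
group object `y(G)`, that is, under all its points. -/
def invariants (A : EquivSheaf K E G) : AddSubgroup (A.sheaf.obj.obj (op AnMfd.pt)) where
  carrier := {s | ∀ (X : AnMfd K) (ρ : Pts K E G X),
    A.act X ρ (A.sheaf.obj.map X.toPt.op s) = A.sheaf.obj.map X.toPt.op s}
  zero_mem' X ρ := by rw [map_zero, map_zero]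
  add_mem' {s t} hs ht X ρ := by rw [map_add, map_add, hs X ρ, ht X ρ]
  neg_mem' {s} hs X ρ := by rw [map_neg, map_neg, hs X ρ]

variable (K E G)

/-- The global section functor `Γ` on the abelian group objects of `BG`. -/
def globalSections : EquivSheaf K E G ⥤ AddCommGrpCat.{u + 1} where
  obj A := AddCommGrpCat.of A.invariants
  map {A B} f := AddCommGrpCat.ofHom
    { toFun s := ⟨(Hom.hom f).hom.app (op AnMfd.pt) s.1, fun X ρ => by
        have h := s.2 X ρ
        rw [← NatTrans.naturality_apply, ← Hom.equivariant f, h]⟩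
      map_zero' := Subtype.ext (map_zero _)
      map_add' s t := Subtype.ext (map_add _ _ _) }
  map_id _ := rfl
  map_comp _ _ := rfl

instance : (globalSections K E G).Additive where
  map_add {A B f g} := by
    refine AddCommGrpCat.hom_ext (AddMonoidHom.ext fun s => ?_)
    exact Subtype.ext (add_hom_app f g _ (Subtype.val (p := (· ∈ A.invariants)) s))

/-- The cohomology `Hⁿ(G, A) = (RⁿΓ)(A)`. -/
noncomputable def cohomology (n : ℕ) : EquivSheaf K E G ⥤ AddCommGrpCat.{u + 1} :=
  (globalSections K E G).rightDerived n

end EquivSheaf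
end ClassifyingTopos

/-! ### Analytic functions with values in a locally convex space -/

section Functions

variable (K : Type u) [NontriviallyNormedField K]
  (V : Type u) [AddCommGroup V] [Module K V] [TopologicalSpace V]

/-- The topology of `V` is locally convex in the nonarchimedean sense: the neighbourhoods of `0`
that are modules over the unit ball of `K` form a fundamental system. -/
def IsLocConvex : Prop :=
  ∀ U ∈ 𝓝 (0 : V), ∃ L : AddSubgroup V, (∀ a : K, ‖a‖ ≤ 1 → ∀ v ∈ L, a • v ∈ L) ∧
    (L : Set V) ∈ 𝓝 (0 : V) ∧ (L : Set V) ⊆ U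

/-- Nonarchimedean barrelledness: closed absorbing modules over the unit ball of `K` are open. -/
def IsBarrelled : Prop :=
  ∀ L : AddSubgroup V, (∀ a : K, ‖a‖ ≤ 1 → ∀ v ∈ L, a • v ∈ L) → IsClosed (L : Set V) →
    (∀ v : V, ∃ a : K, a ≠ 0 ∧ a • v ∈ L) → IsOpen (L : Set V)

/-- A BH-space for `V`: a (nonarchimedean) Banach space with a continuous linear injection
into `V`. -/
structure BHSpace where
  carrier : Type u
  [normedAddCommGroup : NormedAddCommGroup carrier]
  [normedSpace : NormedSpace K carrier]
  [isUltrametricDist : IsUltrametricDist carrier]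
  [completeSpace : CompleteSpace carrier]
  incl : carrier →L[K] V
  incl_injective : Function.Injective incl

attribute [instance] BHSpace.normedAddCommGroup BHSpace.normedSpace
  BHSpace.isUltrametricDist BHSpace.completeSpace

variable {K V}
variable {F : Type u} [NormedAddCommGroup F] [NormedSpace K F]
  {H : Type u} [TopologicalSpace H] (I : ModelWithCorners K F H)
  {M : Type u} [TopologicalSpace M] [ChartedSpace H M]

variable (K) in
/-- `f` is analytic at `x`: near `x` it factors through a BH-space `W`, as a `W`-valued function
given in charts by a convergent power series at `x`. -/
def IsAnAt (f : M → V) (x : M) : Prop :=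
  ∃ (W : BHSpace K V) (φ : M → W.carrier),
    ContMDiffAt I 𝓘(K, W.carrier) ω φ x ∧ f =ᶠ[𝓝 x] fun y => W.incl (φ y)

variable (K) in
/-- Locally analytic functions on a manifold with values in `V`. -/
def IsAn (f : M → V) : Prop := ∀ x, IsAnAt K I f x

variable {I}

theorem isUltrametricDist_quotient {W : Type u} [NormedAddCommGroup W] [NormedSpace K W]
    [IsUltrametricDist W] (S : Submodule K W) [IsClosed (S : Set W)] :
    IsUltrametricDist (W ⧸ S) := by
  refine IsUltrametricDist.isUltrametricDist_of_forall_norm_add_le_max_norm fun x y => ?_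
  refine le_of_forall_pos_le_add fun ε hε => ?_
  obtain ⟨a, rfl, ha⟩ := Submodule.Quotient.norm_mk_lt x hε
  obtain ⟨b, rfl, hb⟩ := Submodule.Quotient.norm_mk_lt y hε
  rw [← Submodule.Quotient.mk_add]
  have h1 : ‖(Submodule.Quotient.mk (a + b) : W ⧸ S)‖ ≤ ‖a + b‖ := Submodule.Quotient.norm_mk_le S _
  have h2 := IsUltrametricDist.norm_add_le_max a b
  rcases le_total ‖a‖ ‖b‖ with h | h
  · rw [max_eq_right h] at h2
    exact (h1.trans (h2.trans hb.le)).trans (add_le_add_left (le_max_right _ _) ε)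
  · rw [max_eq_left h] at h2
    exact (h1.trans (h2.trans ha.le)).trans (add_le_add_left (le_max_left _ _) ε)

/-- Factorization through a Banach space with a not necessarily injective map suffices. -/
theorem IsAnAt.of_factor [T2Space V] {W : Type u} [NormedAddCommGroup W] [NormedSpace K W]
    [IsUltrametricDist W] [CompleteSpace W] (L : W →L[K] V) {f : M → V} {x : M} (φ : M → W)
    (hφ : ContMDiffAt I 𝓘(K, W) ω φ x) (hf : f =ᶠ[𝓝 x] fun y => L (φ y)) : IsAnAt K I f x := by
  have hcl : IsClosed ((LinearMap.ker L.toLinearMap : Submodule K W) : Set W) := L.isClosed_ker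
  have := isUltrametricDist_quotient (LinearMap.ker L.toLinearMap)
  let π : W →L[K] W ⧸ LinearMap.ker L.toLinearMap :=
    (LinearMap.ker L.toLinearMap).mkQL
  let W' : BHSpace K V :=
    { carrier := W ⧸ LinearMap.ker L.toLinearMap
      incl := (LinearMap.ker L.toLinearMap).liftQL L le_rfl
      incl_injective := by
        intro a b h
        exact LinearMap.ker_eq_bot.1 (Submodule.ker_liftQ_eq_bot _ _ _ le_rfl) h }
  refine ⟨W', fun y => π (φ y), ?_, ?_⟩
  · exact π.contMDiff.contMDiffAt.comp x hφ
  · filter_upwards [hf] with y hy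
    rw [hy]
    rfl

theorem IsAnAt.add [T2Space V] [ContinuousAdd V] {f g : M → V} {x : M} (hf : IsAnAt K I f x)
    (hg : IsAnAt K I g x) : IsAnAt K I (fun y => f y + g y) x := by
  obtain ⟨W₁, φ₁, h₁, e₁⟩ := hf
  obtain ⟨W₂, φ₂, h₂, e₂⟩ := hg
  have : IsUltrametricDist (W₁.carrier × W₂.carrier) := by
    refine IsUltrametricDist.isUltrametricDist_of_forall_norm_add_le_max_norm fun x y => ?_
    refine max_le ?_ ?_
    · exact (IsUltrametricDist.norm_add_le_max x.1 y.1).trans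
        (max_le_max (norm_fst_le x) (norm_fst_le y))
    · exact (IsUltrametricDist.norm_add_le_max x.2 y.2).trans
        (max_le_max (norm_snd_le x) (norm_snd_le y))
  refine IsAnAt.of_factor (W₁.incl.coprod W₂.incl) (fun y => (φ₁ y, φ₂ y))
    (h₁.prodMk_space h₂) ?_
  filter_upwards [e₁, e₂] with y hy₁ hy₂
  rw [hy₁, hy₂]
  rfl

/-- Composition with a continuous linear map. -/
theorem IsAnAt.clm_comp {V' : Type u} [AddCommGroup V'] [Module K V'] [TopologicalSpace V']
    [T2Space V'] (T : V →L[K] V') {f : M → V} {x : M} (hf : IsAnAt K I f x) :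
    IsAnAt K I (fun y => T (f y)) x := by
  obtain ⟨W, φ, h, e⟩ := hf
  refine IsAnAt.of_factor (T.comp W.incl) φ h ?_
  filter_upwards [e] with y hy
  rw [hy]
  rfl

/-- Composition with an analytic map of manifolds. -/
theorem IsAnAt.comp {F' : Type u} [NormedAddCommGroup F'] [NormedSpace K F']
    {H' : Type u} [TopologicalSpace H'] {I' : ModelWithCorners K F' H'}
    {N : Type u} [TopologicalSpace N] [ChartedSpace H' N] {f : M → V} {r : N → M} {y : N}
    (hf : IsAnAt K I f (r y)) (hr : ContMDiffAt I' I ω r y) : IsAnAt K I' (fun z => f (r z)) y := by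
  obtain ⟨W, φ, h, e⟩ := hf
  exact ⟨W, fun z => φ (r z), h.comp y hr, hr.continuousAt.eventually e⟩

theorem IsAnAt.congr {f g : M → V} {x : M} (hf : IsAnAt K I f x) (h : f =ᶠ[𝓝 x] g) :
    IsAnAt K I g x := by
  obtain ⟨W, φ, hφ, e⟩ := hf
  exact ⟨W, φ, hφ, h.symm.trans e⟩

theorem isAnAt_zero [T2Space V] (x : M) : IsAnAt K I (fun _ => (0 : V)) x := by
  have : IsUltrametricDist PUnit.{u + 1} := ⟨fun _ _ _ => le_max_of_le_left (le_of_eq rfl)⟩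
  exact IsAnAt.of_factor (W := PUnit) 0 (fun _ => 0) contMDiffAt_const
    (.of_forall fun _ => rfl)

end Functions

/-! ### Locally analytic representations and their sheaves of admissible functions -/

section Representations

variable (K : Type u) [NontriviallyNormedField K]
  (E : Type u) [NormedAddCommGroup E] [NormedSpace K E]
  (G : Type u) [TopologicalSpace G] [ChartedSpace E G] [Group G]

/-- A locally analytic representation of `G` on a barrelled separated locally convex `K`-vector
space: an action by continuous linear automorphisms all of whose orbit maps are analytic. -/
structure LocAnRep where
  carrier : Type u
  [addCommGroup : AddCommGroup carrier]
  [module : Module K carrier]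
  [topologicalSpace : TopologicalSpace carrier]
  [isTopologicalAddGroup : IsTopologicalAddGroup carrier]
  [continuousSMul : ContinuousSMul K carrier]
  [t2Space : T2Space carrier]
  isLocConvex : IsLocConvex K carrier
  isBarrelled : IsBarrelled K carrier
  ρ : G →* (carrier ≃L[K] carrier)
  isAn_orbit (v : carrier) : IsAn K 𝓘(K, E) fun g : G => ρ g v

namespace LocAnRep

attribute [instance] addCommGroup module topologicalSpace isTopologicalAddGroup continuousSMul
  t2Space

variable {K E G}

instance : CoeSort (LocAnRep K E G) (Type u) := ⟨LocAnRep.carrier⟩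

/-- Morphisms are the continuous equivariant linear maps. -/
@[ext] structure Hom (V V' : LocAnRep K E G) where
  toCLM : V →L[K] V'
  equivariant (g : G) (v : V) : toCLM (V.ρ g v) = V'.ρ g (toCLM v)

instance : Category.{u} (LocAnRep K E G) where
  Hom := Hom
  id V := ⟨ContinuousLinearMap.id K V, fun _ _ => rfl⟩
  comp S T := ⟨T.toCLM.comp S.toCLM, fun g v => by
    simp only [ContinuousLinearMap.comp_apply, S.equivariant, T.equivariant]⟩

/-- Multiplication by a scalar. -/
def scalar (V : LocAnRep K E G) (a : K) : V ⟶ V :=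
  ⟨a • ContinuousLinearMap.id K V, fun g v => by simp⟩

theorem ρ_mul (V : LocAnRep K E G) (g h : G) (v : V) : V.ρ (g * h) v = V.ρ g (V.ρ h v) := by
  rw [map_mul]
  rfl

theorem ρ_one (V : LocAnRep K E G) (v : V) : V.ρ 1 v = v := by
  rw [map_one]
  rfl

/-- A function `f : X → V` is admissible if `f` and `(g, x) ↦ g • f x` are analytic. -/
def IsAdmissible (V : LocAnRep K E G) (X : AnMfd K) (f : X → V) : Prop :=
  IsAn K 𝓘(K, X.model) f ∧
    IsAn K (𝓘(K, E).prod 𝓘(K, X.model)) fun p : G × X => V.ρ p.1 (f p.2)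

/-- The group `C^ad(X, V)` of admissible functions. -/
def admissible (V : LocAnRep K E G) (X : AnMfd K) : AddSubgroup (X → V) where
  carrier := {f | V.IsAdmissible X f}
  zero_mem' := ⟨fun x => isAnAt_zero x, fun x =>
    (isAnAt_zero x).congr (.of_forall fun p => (map_zero (V.ρ p.1)).symm)⟩
  add_mem' hf hg := ⟨fun x => (hf.1 x).add (hg.1 x), fun x =>
    ((hf.2 x).add (hg.2 x)).congr (.of_forall fun p => (map_add (V.ρ p.1) _ _).symm)⟩
  neg_mem' hf := ⟨fun x => (hf.1 x).clm_comp (-ContinuousLinearMap.id K V), fun x =>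
    ((hf.2 x).clm_comp (-ContinuousLinearMap.id K V)).congr
      (.of_forall fun p => (map_neg (V.ρ p.1) _).symm)⟩

/-- Restriction of admissible functions. -/
def admRes (V : LocAnRep K E G) {X Y : AnMfd K} (f : X ⟶ Y) : V.admissible Y →+ V.admissible X where
  toFun s := ⟨fun x => s.1 (f x), fun x => (s.2.1 (f x)).comp (AnMfd.hom_contMDiff f x), fun p =>
    (s.2.2 (p.1, f p.2)).comp (r := fun q : G × X => (q.1, f q.2))
      (contMDiffAt_fst.prodMk ((AnMfd.hom_contMDiff f p.2).comp p contMDiffAt_snd))⟩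
  map_zero' := rfl
  map_add' _ _ := rfl

/-- The action of analytic maps `ρ : X → G` on admissible functions, `(ρ f)(x) = ρ(x) f(x)`. -/
def admAct [LieGroup 𝓘(K, E) ω G] (V : LocAnRep K E G) (X : AnMfd K) :
    Pts K E G X →* AddMonoid.End (V.admissible X) where
  toFun ρ :=
    { toFun s := ⟨fun x => V.ρ (ρ x) (s.1 x),
        fun x => (s.2.2 (ρ x, x)).comp (r := fun y => (ρ y, y))
          ((ρ.contMDiff x).prodMk contMDiffAt_id),
        fun p => ((s.2.2 (p.1 * ρ p.2, p.2)).comp (r := fun q : G × X => (q.1 * ρ q.2, q.2))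
          ((contMDiffAt_fst.mul ((ρ.contMDiff p.2).comp p contMDiffAt_snd)).prodMk
            contMDiffAt_snd)).congr (.of_forall fun q => V.ρ_mul _ _ _)⟩
      map_zero' := Subtype.ext (funext fun x => map_zero (V.ρ (ρ x)))
      map_add' s t := Subtype.ext (funext fun x => map_add (V.ρ (ρ x)) _ _) }
  map_one' := by
    ext s : 1
    exact Subtype.ext (funext fun x => V.ρ_one _)
  map_mul' ρ σ := by
    ext s : 1
    exact Subtype.ext (funext fun x => V.ρ_mul _ _ _)

/-- The presheaf of admissible functions. -/
def admPresheaf (V : LocAnRep K E G) : (AnMfd K)ᵒᵖ ⥤ AddCommGrpCat.{u + 1} where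
  obj X := AddCommGrpCat.of (ULift.{u + 1} (V.admissible X.unop))
  map f := AddCommGrpCat.ofHom
    (AddEquiv.ulift.symm.toAddMonoidHom.comp
      ((V.admRes f.unop).comp AddEquiv.ulift.toAddMonoidHom))
  map_id _ := rfl
  map_comp _ _ := rfl

theorem isSheaf_admPresheaf (V : LocAnRep K E G) :
    Presheaf.IsSheaf (AnMfd.topology K) V.admPresheaf := by
  rw [Presheaf.isSheaf_iff_isSheaf_forget _ _ (forget AddCommGrpCat.{u + 1}),
    isSheaf_iff_isSheaf_of_type]
  intro X S hS x hx
  have hpt : ∀ p : X, S (AnMfd.ptTo X p) := by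
    intro p
    obtain ⟨U, hU, hp, h⟩ := hS p
    refine h _ _ ?_
    rintro _ ⟨z, rfl⟩
    exact hp
  let val : ∀ {Y : AnMfd K} (f : Y ⟶ X), S f → Y → V := fun f hf => (ULift.down (x f hf)).1
  have hval : ∀ {Y : AnMfd K} (f : Y ⟶ X) (hf : S f), V.IsAdmissible Y (val f hf) :=
    fun f hf => (ULift.down (x f hf)).2
  let t : X → V := fun p => val (AnMfd.ptTo X p) (hpt p) PUnit.unit
  have ht : ∀ {Y : AnMfd K} (f : Y ⟶ X) (hf : S f) (y : Y), t (f y) = val f hf y := by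
    intro Y f hf y
    have h := hx (𝟙 _) (AnMfd.ptTo Y y) (hpt (f y)) hf (by rfl)
    exact congrFun (congrArg (fun s : ULift.{u + 1} (V.admissible AnMfd.pt) => s.down.1) h)
      PUnit.unit
  have hadm : V.IsAdmissible X t := by
    have key : ∀ p : X, ∃ (Y : AnMfd K) (f : Y ⟶ X) (hf : S f) (r : X → Y),
        (∀ᶠ q in 𝓝 p, t q = val f hf (r q)) ∧ ContMDiffAt 𝓘(K, X.model) 𝓘(K, Y.model) ω r p := by
      intro p
      obtain ⟨U, hU, hp, h⟩ := hS p
      obtain ⟨Y, j, r, hjU, hjo, hpj, -, -, hr⟩ := AnMfd.exists_open X p U hU hp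
      refine ⟨Y, j, h Y j hjU, r, ?_, (hr p hpj).2⟩
      filter_upwards [hjo.mem_nhds hpj] with q hq
      rw [← ht, (hr q hq).1]
    refine ⟨fun p => ?_, fun p => ?_⟩
    · obtain ⟨Y, f, hf, r, h1, h2⟩ := key p
      exact (((hval f hf).1 (r p)).comp h2).congr (h1.mono fun q hq => hq.symm)
    · obtain ⟨Y, f, hf, r, h1, h2⟩ := key p.2
      refine (((hval f hf).2 (p.1, r p.2)).comp (r := fun q : G × X => (q.1, r q.2))
        (contMDiffAt_fst.prodMk (h2.comp p contMDiffAt_snd))).congr ?_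
      filter_upwards [continuous_snd.continuousAt.eventually h1] with q hq
      rw [hq]
  refine ⟨ULift.up ⟨t, hadm⟩, ?_, ?_⟩
  · intro Y f hf
    exact ULift.ext _ _ (Subtype.ext (funext fun y => ht f hf y))
  · intro t' ht'
    refine ULift.ext _ _ (Subtype.ext (funext fun p => ?_))
    have h := ht' (AnMfd.ptTo X p) (hpt p)
    exact congrFun (congrArg (fun s : ULift.{u + 1} (V.admissible AnMfd.pt) => s.down.1) h)
      PUnit.unit

variable (K E G) in
/-- The functor sending `V` to the sheaf `X ↦ C^ad(X, V)` of admissible functions with its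
action of `y(G)`, an abelian group object of `BG`. -/
def admSheaf [LieGroup 𝓘(K, E) ω G] : LocAnRep K E G ⥤ EquivSheaf K E G where
  obj V :=
    { sheaf := ⟨V.admPresheaf, V.isSheaf_admPresheaf⟩
      act X :=
        { toFun ρ := AddEquiv.ulift.symm.toAddMonoidHom.comp
            ((show V.admissible X →+ V.admissible X from V.admAct X ρ).comp
              AddEquiv.ulift.toAddMonoidHom)
          map_one' := by
            rw [map_one]
            rfl
          map_mul' ρ σ := by
            rw [map_mul]
            rfl }
      act_res f ρ s := rfl }
  map {V V'} T :=
    { hom := ⟨{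
        app X := AddCommGrpCat.ofHom
          { toFun s := ULift.up ⟨fun x => T.toCLM (s.down.1 x),
              fun x => (s.down.2.1 x).clm_comp T.toCLM,
              fun p => ((s.down.2.2 p).clm_comp T.toCLM).congr
                (.of_forall fun q => T.equivariant _ _)⟩
            map_zero' := ULift.ext _ _ (Subtype.ext (funext fun x => map_zero T.toCLM))
            map_add' s t := ULift.ext _ _ (Subtype.ext (funext fun x => map_add T.toCLM _ _)) }
        naturality _ _ _ := rfl }⟩
      equivariant X ρ s :=
        ULift.ext _ _ (Subtype.ext (funext fun x => T.equivariant _ _)) }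
  map_id _ := rfl
  map_comp _ _ := rfl

/-- Locally analytic group cohomology `Hⁿ_an(G, V) = Hⁿ(G, C^ad(-, V))`. -/
noncomputable def anCohomology [LieGroup 𝓘(K, E) ω G] (V : LocAnRep K E G) (n : ℕ) : Type (u + 1) :=
  (EquivSheaf.cohomology K E G n).obj ((admSheaf K E G).obj V)

noncomputable instance [LieGroup 𝓘(K, E) ω G] (V : LocAnRep K E G) (n : ℕ) :
    AddCommGroup (V.anCohomology n) :=
  inferInstanceAs (AddCommGroup ((EquivSheaf.cohomology K E G n).obj ((admSheaf K E G).obj V)))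

/-- The map on locally analytic group cohomology induced by a map of representations. -/
noncomputable def anCohomologyMap [LieGroup 𝓘(K, E) ω G] {V V' : LocAnRep K E G} (T : V ⟶ V')
    (n : ℕ) : V.anCohomology n →+ V'.anCohomology n :=
  ((EquivSheaf.cohomology K E G n).map ((admSheaf K E G).map T)).hom

end LocAnRep

end Representations

/-! ### Lie algebra cohomology -/

section LieAlgebraCohomology

variable {K : Type u} [NontriviallyNormedField K]
  {E : Type u} [NormedAddCommGroup E] [NormedSpace K E]
  {G : Type u} [TopologicalSpace G] [ChartedSpace E G] [Group G]

/-- The curve through `1` that is a straight line with direction `X` in the chart at `1`. -/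
noncomputable def chartLine (K : Type u) [NontriviallyNormedField K] (E : Type u)
    [NormedAddCommGroup E] [NormedSpace K E] {G : Type u} [TopologicalSpace G] [ChartedSpace E G]
    [Group G] (X : E) (t : K) : G :=
  (extChartAt 𝓘(K, E) (1 : G)).symm (extChartAt 𝓘(K, E) (1 : G) 1 + t • X)

theorem tendsto_chartLine (K : Type u) [NontriviallyNormedField K] (E : Type u)
    [NormedAddCommGroup E] [NormedSpace K E] {G : Type u} [TopologicalSpace G] [ChartedSpace E G]
    [Group G] (X : E) :
    Tendsto (fun t : K => (chartLine K E X t : G)) (𝓝[≠] (0 : K)) (𝓝 1) := by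
  have hcont : ContinuousAt (fun t : K => (chartLine K E X t : G)) 0 := by
    have hl : ContinuousAt (fun t : K => extChartAt 𝓘(K, E) (1 : G) 1 + t • X) 0 := by fun_prop
    refine ContinuousAt.comp (g := (extChartAt 𝓘(K, E) (1 : G)).symm) ?_ hl
    rw [zero_smul, add_zero]
    exact continuousAt_extChartAt_symm (I := 𝓘(K, E)) (1 : G)
  have h := hcont.tendsto
  have h0 : (chartLine K E X 0 : G) = 1 := by
    rw [chartLine, zero_smul, add_zero, extChartAt_to_inv]
  rw [h0] at h
  exact h.mono_left nhdsWithin_le_nhds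

namespace LocAnRep

/-- The action of the Lie algebra on `V`: `lieAct V X v` is the derivative of the orbit map
`g ↦ g v` at `1` in the direction of the tangent vector `X`, computed in the chart at `1`. -/
noncomputable def lieAct (V : LocAnRep K E G) (X : GroupLieAlgebra 𝓘(K, E) G) (v : V) : V :=
  limUnder (𝓝[≠] (0 : K)) fun t : K => t⁻¹ •
    (V.ρ (chartLine K E X t) v - v)

theorem tendsto_lieAct_aux (V : LocAnRep K E G) (v : V) {W : Type u} [NormedAddCommGroup W]
    [NormedSpace K W] (L : W →L[K] V) (φ : G → W) (hφ : MDifferentiableAt 𝓘(K, E) 𝓘(K, W) φ 1)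
    (h : (fun g : G => V.ρ g v) =ᶠ[𝓝 1] fun g => L (φ g)) (X : GroupLieAlgebra 𝓘(K, E) G) :
    Tendsto (fun t : K => t⁻¹ • (V.ρ (chartLine K E X t) v - v)) (𝓝[≠] (0 : K))
      (𝓝 (L (mfderiv 𝓘(K, E) 𝓘(K, W) φ 1 X))) := by
  let D : E →L[K] W := mfderiv 𝓘(K, E) 𝓘(K, W) φ 1
  have h1 : HasFDerivWithinAt (writtenInExtChartAt 𝓘(K, E) 𝓘(K, W) 1 φ) D
    (Set.range 𝓘(K, E)) (extChartAt 𝓘(K, E) (1 : G) 1) := hφ.hasMFDerivAt.2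
  rw [ModelWithCorners.range_eq_univ, hasFDerivWithinAt_univ] at h1
  have h2 := (h1.hasLineDerivAt X).tendsto_slope_zero
  have h3 := (L.continuous.tendsto _).comp h2
  refine h3.congr' ?_
  have hv : v = L (φ 1) := by
    have := h.self_of_nhds
    simp only [ρ_one] at this
    exact this
  have hc : Tendsto (fun t : K => (chartLine K E X t : G)) (𝓝[≠] (0 : K)) (𝓝 1) :=
    tendsto_chartLine K E X
  filter_upwards [hc.eventually h] with t ht
  simp only [Function.comp_apply, writtenInExtChartAt, extChartAt_model_space_eq_id,
    PartialEquiv.refl_coe, id_eq, extChartAt_to_inv, map_smul, map_sub]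
  rw [ht, ← hv]
  rfl

theorem lieAct_eq (V : LocAnRep K E G) (v : V) {W : Type u} [NormedAddCommGroup W]
    [NormedSpace K W] (L : W →L[K] V) (φ : G → W) (hφ : MDifferentiableAt 𝓘(K, E) 𝓘(K, W) φ 1)
    (h : (fun g : G => V.ρ g v) =ᶠ[𝓝 1] fun g => L (φ g)) (X : GroupLieAlgebra 𝓘(K, E) G) :
    V.lieAct X v = L (mfderiv 𝓘(K, E) 𝓘(K, W) φ 1 X) :=
  (V.tendsto_lieAct_aux v L φ hφ h X).limUnder_eq

theorem tendsto_lieAct (V : LocAnRep K E G) (X : GroupLieAlgebra 𝓘(K, E) G) (v : V) :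
    Tendsto (fun t : K => t⁻¹ • (V.ρ (chartLine K E X t) v - v)) (𝓝[≠] (0 : K))
      (𝓝 (V.lieAct X v)) := by
  obtain ⟨W, φ, hφ, h⟩ := V.isAn_orbit v 1
  have hd := hφ.mdifferentiableAt (by simp)
  rw [V.lieAct_eq v W.incl φ hd h X]
  exact V.tendsto_lieAct_aux v W.incl φ hd h X

theorem lieAct_add (V : LocAnRep K E G) (X : GroupLieAlgebra 𝓘(K, E) G) (v w : V) :
    V.lieAct X (v + w) = V.lieAct X v + V.lieAct X w := by
  refine tendsto_nhds_unique (V.tendsto_lieAct X (v + w)) ?_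
  refine ((V.tendsto_lieAct X v).add (V.tendsto_lieAct X w)).congr fun t => ?_
  rw [map_add, ← smul_add]
  congr 1
  abel

theorem map_lieAct {V V' : LocAnRep K E G} (T : V ⟶ V') (X : GroupLieAlgebra 𝓘(K, E) G) (v : V) :
    T.toCLM (V.lieAct X v) = V'.lieAct X (T.toCLM v) := by
  refine tendsto_nhds_unique ?_ (V'.tendsto_lieAct X (T.toCLM v))
  refine ((T.toCLM.continuous.tendsto _).comp (V.tendsto_lieAct X v)).congr fun t => ?_
  rw [Function.comp_apply, map_smul, map_sub, T.equivariant]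

theorem lieAct_smul (V : LocAnRep K E G) (X : GroupLieAlgebra 𝓘(K, E) G) (a : K) (v : V) :
    V.lieAct X (a • v) = a • V.lieAct X v :=
  (map_lieAct (V.scalar a) X v).symm

/-- The Chevalley-Eilenberg differential
`(dη)(x₀, …, xₙ) = ∑ᵢ (-1)ⁱ xᵢ η(…, x̂ᵢ, …) + ∑_{i<j} (-1)^(i+j) η([xᵢ, xⱼ], …, x̂ᵢ, …, x̂ⱼ, …)`.
In the second sum the bracket is moved to position `i`, which changes the sign to `(-1)ʲ`. -/
noncomputable def ceD (V : LocAnRep K E G) {n : ℕ}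
    (η : GroupLieAlgebra 𝓘(K, E) G [⋀^Fin n]→ₗ[K] V)
    (x : Fin (n + 1) → GroupLieAlgebra 𝓘(K, E) G) : V :=
  ∑ i : Fin (n + 1), (-1 : ℤ) ^ (i : ℕ) • V.lieAct (x i) (η (i.removeNth x)) +
    ∑ j : Fin (n + 1), ∑ i ∈ Finset.Iio j, (-1 : ℤ) ^ (j : ℕ) •
      η (j.removeNth (Function.update x i ⁅x i, x j⁆))

theorem ceD_add (V : LocAnRep K E G) {n : ℕ}
    (η θ : GroupLieAlgebra 𝓘(K, E) G [⋀^Fin n]→ₗ[K] V)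
    (x : Fin (n + 1) → GroupLieAlgebra 𝓘(K, E) G) :
    V.ceD (η + θ) x = V.ceD η x + V.ceD θ x := by
  simp only [ceD, AlternatingMap.add_apply, lieAct_add, smul_add, Finset.sum_add_distrib]
  abel

theorem ceD_smul (V : LocAnRep K E G) {n : ℕ} (a : K)
    (η : GroupLieAlgebra 𝓘(K, E) G [⋀^Fin n]→ₗ[K] V)
    (x : Fin (n + 1) → GroupLieAlgebra 𝓘(K, E) G) :
    V.ceD (a • η) x = a • V.ceD η x := by
  simp only [ceD, AlternatingMap.smul_apply, lieAct_smul, smul_add, Finset.smul_sum,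
    smul_comm a]

theorem ceD_comp {V V' : LocAnRep K E G} (T : V ⟶ V') {n : ℕ}
    (η : GroupLieAlgebra 𝓘(K, E) G [⋀^Fin n]→ₗ[K] V)
    (x : Fin (n + 1) → GroupLieAlgebra 𝓘(K, E) G) :
    V'.ceD (T.toCLM.toLinearMap.compAlternatingMap η) x = T.toCLM (V.ceD η x) := by
  simp only [ceD, map_add, map_sum, map_zsmul, map_lieAct]
  rfl

/-- Lie algebra cocycles. -/
noncomputable def cocycles (V : LocAnRep K E G) (n : ℕ) :
    Submodule K (GroupLieAlgebra 𝓘(K, E) G [⋀^Fin n]→ₗ[K] V) where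
  carrier := {η | ∀ x, V.ceD η x = 0}
  zero_mem' x := by simpa using V.ceD_smul 0 0 x
  add_mem' {η θ} hη hθ x := by rw [ceD_add, hη x, hθ x, add_zero]
  smul_mem' a η hη x := by rw [ceD_smul, hη x, smul_zero]

/-- Lie algebra coboundaries. -/
noncomputable def coboundaries (V : LocAnRep K E G) : (n : ℕ) →
    Submodule K (GroupLieAlgebra 𝓘(K, E) G [⋀^Fin n]→ₗ[K] V)
  | 0 => ⊥
  | n + 1 =>
    { carrier := {θ | ∃ η : GroupLieAlgebra 𝓘(K, E) G [⋀^Fin n]→ₗ[K] V, ∀ x, θ x = V.ceD η x}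
      zero_mem' := ⟨0, fun x => by simpa using (V.ceD_smul 0 0 x).symm⟩
      add_mem' := by
        rintro θ θ' ⟨η, h⟩ ⟨η', h'⟩
        exact ⟨η + η', fun x => by rw [ceD_add, ← h, ← h', AlternatingMap.add_apply]⟩
      smul_mem' := by
        rintro a θ ⟨η, h⟩
        exact ⟨a • η, fun x => by rw [ceD_smul, ← h, AlternatingMap.smul_apply]⟩ }

/-- Lie algebra cohomology `Hⁿ(𝔤, V)`. -/
abbrev lieCohomology (V : LocAnRep K E G) (n : ℕ) : Type u :=
  V.cocycles n ⧸ (V.coboundaries n).submoduleOf (V.cocycles n)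

end LocAnRep
end LieAlgebraCohomology

section AdjointAction

variable {K : Type u} [NontriviallyNormedField K]
  {E : Type u} [NormedAddCommGroup E] [NormedSpace K E]
  {G : Type u} [TopologicalSpace G] [ChartedSpace E G] [Group G]

/-- The adjoint action of `G` on its Lie algebra: the derivative at `1` of `h ↦ g h g⁻¹`. -/
noncomputable def Ad (g : G) : GroupLieAlgebra 𝓘(K, E) G →ₗ[K] GroupLieAlgebra 𝓘(K, E) G where
  toFun X := mfderiv 𝓘(K, E) 𝓘(K, E) (fun h : G => g * h * g⁻¹) 1 X
  map_add' X Y := map_add (mfderiv 𝓘(K, E) 𝓘(K, E) (fun h : G => g * h * g⁻¹) 1) X Y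
  map_smul' a X := map_smul (mfderiv 𝓘(K, E) 𝓘(K, E) (fun h : G => g * h * g⁻¹) 1) a X

theorem mfderiv_comp_one {F' : Type u} [NormedAddCommGroup F'] [NormedSpace K F'] {N : Type u}
    [TopologicalSpace N] [ChartedSpace F' N] (φ : G → N) (f : G → G) (hf1 : f 1 = 1)
    (hφ : MDifferentiableAt 𝓘(K, E) 𝓘(K, F') φ 1) (hf : MDifferentiableAt 𝓘(K, E) 𝓘(K, E) f 1)
    (X : E) : (mfderiv 𝓘(K, E) 𝓘(K, F') (fun h => φ (f h)) 1 X : F') =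
      (mfderiv 𝓘(K, E) 𝓘(K, F') φ 1 : E →L[K] F') ((mfderiv 𝓘(K, E) 𝓘(K, E) f 1 : E →L[K] E) X) := by
  have hφ' : MDifferentiableAt 𝓘(K, E) 𝓘(K, F') φ (f 1) := by rw [hf1]; exact hφ
  have h := mfderiv_comp (I' := 𝓘(K, E)) 1 hφ' hf
  have h' : (mfderiv 𝓘(K, E) 𝓘(K, F') φ (f 1) : E →L[K] F') =
      (mfderiv 𝓘(K, E) 𝓘(K, F') φ 1 : E →L[K] F') := by
    rw [hf1]
  exact (congrArg (fun D : E →L[K] F' => D X) h).trans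
    (congrArg (fun D : E →L[K] F' => D ((mfderiv 𝓘(K, E) 𝓘(K, E) f 1 : E →L[K] E) X)) h')

theorem Ad_one (X : GroupLieAlgebra 𝓘(K, E) G) : Ad (K := K) (1 : G) X = X := by
  have h : (fun h : G => (1 : G) * h * (1 : G)⁻¹) = id := by
    funext h
    simp
  change mfderiv 𝓘(K, E) 𝓘(K, E) (fun h : G => (1 : G) * h * (1 : G)⁻¹) 1 X = X
  have h' : (mfderiv 𝓘(K, E) 𝓘(K, E) (fun h : G => (1 : G) * h * (1 : G)⁻¹) 1 : E →L[K] E) =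
    (mfderiv 𝓘(K, E) 𝓘(K, E) (id : G → G) 1 : E →L[K] E) := by rw [h]
  refine (congrArg (fun D : E →L[K] E => D X) h').trans ?_
  rw [mfderiv_id]
  rfl

variable [LieGroup 𝓘(K, E) ω G]

theorem contMDiff_conj (g : G) : ContMDiff 𝓘(K, E) 𝓘(K, E) ω fun h : G => g * h * g⁻¹ :=
  (contMDiff_const.mul contMDiff_id).mul contMDiff_const

theorem mdiff_conj (g h : G) :
    MDifferentiableAt 𝓘(K, E) 𝓘(K, E) (fun h : G => g * h * g⁻¹) h :=
  (contMDiff_conj g h).mdifferentiableAt (by simp)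

theorem Ad_mul (g k : G) (X : GroupLieAlgebra 𝓘(K, E) G) :
    Ad (K := K) (g * k) X = Ad g (Ad k X) := by
  have h : (fun h : G => (g * k) * h * (g * k)⁻¹) = fun h => g * (k * h * k⁻¹) * g⁻¹ := by
    funext h
    group
  have h' : (mfderiv 𝓘(K, E) 𝓘(K, E) (fun h : G => (g * k) * h * (g * k)⁻¹) 1 : E →L[K] E) =
    (mfderiv 𝓘(K, E) 𝓘(K, E) (fun h : G => g * (k * h * k⁻¹) * g⁻¹) 1 : E →L[K] E) := by rw [h]
  exact (congrArg (fun D : E →L[K] E => D X) h').trans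
    (mfderiv_comp_one (E := E) (fun h : G => g * h * g⁻¹) (fun h => k * h * k⁻¹) (by group)
      (mdiff_conj (E := E) g 1) (mdiff_conj (E := E) k 1) X)

theorem Ad_inv_Ad (g : G) (X : GroupLieAlgebra 𝓘(K, E) G) : Ad (K := K) g⁻¹ (Ad g X) = X := by
  rw [← Ad_mul, inv_mul_cancel, Ad_one]

theorem Ad_Ad_inv (g : G) (X : GroupLieAlgebra 𝓘(K, E) G) : Ad (K := K) g (Ad g⁻¹ X) = X := by
  rw [← Ad_mul, mul_inv_cancel, Ad_one]

theorem isInvertible_mfderiv_conj (g h : G) : ContinuousLinearMap.IsInvertible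
    (mfderiv 𝓘(K, E) 𝓘(K, E) (fun h : G => g * h * g⁻¹) h : E →L[K] E) := by
  have hinv : ∀ k : G, MDifferentiableAt 𝓘(K, E) 𝓘(K, E) (fun h : G => g⁻¹ * h * g) k := by
    intro k
    simpa using mdiff_conj (K := K) (E := E) g⁻¹ k
  have e1 : (fun h : G => g⁻¹ * h * g) ∘ (fun h : G => g * h * g⁻¹) = id := by
    funext k
    simp only [Function.comp_apply, id_eq]
    group
  have e2 : (fun h : G => g * h * g⁻¹) ∘ (fun h : G => g⁻¹ * h * g) = id := by
    funext k
    simp only [Function.comp_apply, id_eq]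
    group
  have A : mfderiv 𝓘(K, E) 𝓘(K, E)
      ((fun h : G => g⁻¹ * h * g) ∘ (fun h : G => g * h * g⁻¹)) h =
      (ContinuousLinearMap.id K E : E →L[K] E) := by
    rw [e1, mfderiv_id]
    rfl
  have B : mfderiv 𝓘(K, E) 𝓘(K, E)
      ((fun h : G => g * h * g⁻¹) ∘ (fun h : G => g⁻¹ * h * g)) (g * h * g⁻¹) =
      (ContinuousLinearMap.id K E : E →L[K] E) := by
    rw [e2, mfderiv_id]
    rfl
  rw [mfderiv_comp (I' := 𝓘(K, E)) _ (hinv _) (mdiff_conj g h)] at A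
  rw [mfderiv_comp (I' := 𝓘(K, E)) _ (mdiff_conj g _) (hinv _)] at B
  have hh : g⁻¹ * (g * h * g⁻¹) * g = h := by group
  rw [hh] at B
  exact ContinuousLinearMap.IsInvertible.of_inverse B A

theorem mpullback_conj (g : G) (v : GroupLieAlgebra 𝓘(K, E) G) :
    VectorField.mpullback 𝓘(K, E) 𝓘(K, E) (fun h : G => g * h * g⁻¹)
      (mulInvariantVectorField (Ad (K := K) g v)) = mulInvariantVectorField v := by
  funext h
  have hL : ∀ a k : G, MDifferentiableAt 𝓘(K, E) 𝓘(K, E) (fun b : G => a * b) k := fun a k =>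
    (contMDiff_mul_left (n := ω) (I := 𝓘(K, E)) k).mdifferentiableAt (by simp)
  -- both sides are mapped to the same vector by the derivative of conjugation at `h`
  have h1 : (mfderiv 𝓘(K, E) 𝓘(K, E) (fun b : G => g * (h * b) * g⁻¹) 1 : E →L[K] E) =
      (mfderiv 𝓘(K, E) 𝓘(K, E) (fun b : G => g * h * g⁻¹ * (g * b * g⁻¹)) 1 : E →L[K] E) := by
    have : (fun b : G => g * (h * b) * g⁻¹) = fun b => g * h * g⁻¹ * (g * b * g⁻¹) := by
      funext b
      group
    rw [this]
  have h2 : (mfderiv 𝓘(K, E) 𝓘(K, E) (fun b : G => g * h * g⁻¹ * (g * b * g⁻¹)) 1 : E →L[K] E) v =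
      (mfderiv 𝓘(K, E) 𝓘(K, E) (fun b : G => g * h * g⁻¹ * b) 1 : E →L[K] E) (Ad (K := K) g v) :=
    mfderiv_comp_one (E := E) (fun b : G => g * h * g⁻¹ * b) (fun b => g * b * g⁻¹) (by group)
      (hL _ _) (mdiff_conj (E := E) g 1) v
  have h3 : (mfderiv 𝓘(K, E) 𝓘(K, E) (fun b : G => g * (h * b) * g⁻¹) 1 : E →L[K] E) =
      (mfderiv 𝓘(K, E) 𝓘(K, E) (fun b : G => g * b * g⁻¹) h : E →L[K] E).comp
        (mfderiv 𝓘(K, E) 𝓘(K, E) (fun b : G => h * b) 1 : E →L[K] E) := by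
    have h4 := mfderiv_comp (I' := 𝓘(K, E)) (1 : G) (g := fun b : G => g * b * g⁻¹)
      (f := fun b : G => h * b) (mdiff_conj g _) (hL _ _)
    have h5 : (mfderiv 𝓘(K, E) 𝓘(K, E) (fun b : G => g * b * g⁻¹) (h * 1) : E →L[K] E) =
      (mfderiv 𝓘(K, E) 𝓘(K, E) (fun b : G => g * b * g⁻¹) h : E →L[K] E) := by rw [mul_one]
    exact h4.trans (congrArg (fun D : E →L[K] E =>
      D.comp (mfderiv 𝓘(K, E) 𝓘(K, E) (fun b : G => h * b) 1 : E →L[K] E)) h5)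
  have h6 : (mfderiv 𝓘(K, E) 𝓘(K, E) (fun b : G => g * h * g⁻¹ * b) 1 : E →L[K] E)
        (Ad (K := K) g v) =
      (mfderiv 𝓘(K, E) 𝓘(K, E) (fun b : G => g * b * g⁻¹) h : E →L[K] E)
        ((mfderiv 𝓘(K, E) 𝓘(K, E) (fun b : G => h * b) 1 : E →L[K] E) v) :=
    h2.symm.trans ((congrArg (fun D : E →L[K] E => D v) h1).symm.trans
      (congrArg (fun D : E →L[K] E => D v) h3))
  change (mfderiv 𝓘(K, E) 𝓘(K, E) (fun b : G => g * b * g⁻¹) h : E →L[K] E).inverse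
    ((mfderiv 𝓘(K, E) 𝓘(K, E) (fun b : G => g * h * g⁻¹ * b) 1 : E →L[K] E) (Ad (K := K) g v)) =
    (mfderiv 𝓘(K, E) 𝓘(K, E) (fun b : G => h * b) 1 : E →L[K] E) v
  rw [h6]
  exact ContinuousLinearMap.IsInvertible.inverse_apply_self (isInvertible_mfderiv_conj g h) _

theorem Ad_bracket [CompleteSpace E] (g : G) (v w : GroupLieAlgebra 𝓘(K, E) G) :
    Ad (K := K) g ⁅v, w⁆ = ⁅Ad g v, Ad g w⁆ := by
  have hG : LieGroup 𝓘(K, E) (minSmoothness K 3) G := LieGroup.of_le (n := ω) le_top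
  have h := VectorField.mpullback_mlieBracket (n := ω) (I := 𝓘(K, E)) (I' := 𝓘(K, E))
    (f := fun h : G => g * h * g⁻¹) (x₀ := (1 : G))
    (V := mulInvariantVectorField (Ad (K := K) g v))
    (W := mulInvariantVectorField (Ad (K := K) g w))
    (mdifferentiableAt_mulInvariantVectorField _) (mdifferentiableAt_mulInvariantVectorField _)
    (contMDiff_conj g 1) le_top
  rw [mpullback_conj, mpullback_conj] at h
  rw [GroupLieAlgebra.bracket_def, ← h]
  have h1 : ∀ k : G, k = 1 →
      (VectorField.mlieBracket 𝓘(K, E) (mulInvariantVectorField (Ad (K := K) g v))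
        (mulInvariantVectorField (Ad (K := K) g w)) k : E) =
      (VectorField.mlieBracket 𝓘(K, E) (mulInvariantVectorField (Ad (K := K) g v))
        (mulInvariantVectorField (Ad (K := K) g w)) 1 : E) := by
    rintro k rfl
    rfl
  exact (ContinuousLinearMap.IsInvertible.self_apply_inverse
    (isInvertible_mfderiv_conj (E := E) g 1) _).trans (h1 _ (by group))

end AdjointAction

section GroupActionOnCohomology

variable {K : Type u} [NontriviallyNormedField K]
  {E : Type u} [NormedAddCommGroup E] [NormedSpace K E]
  {G : Type u} [TopologicalSpace G] [ChartedSpace E G] [Group G]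

namespace LocAnRep

theorem lieAct_Ad [LieGroup 𝓘(K, E) ω G] (V : LocAnRep K E G) (g : G) (X : GroupLieAlgebra 𝓘(K, E) G) (v : V) :
    V.lieAct (Ad g X) (V.ρ g v) = V.ρ g (V.lieAct X v) := by
  obtain ⟨W, φ, hφ, h⟩ := V.isAn_orbit v 1
  have hd : MDifferentiableAt 𝓘(K, E) 𝓘(K, W.carrier) φ 1 := hφ.mdifferentiableAt (by simp)
  have hc1 : g⁻¹ * 1 * g⁻¹⁻¹ = 1 := by group
  have hd' : MDifferentiableAt 𝓘(K, E) 𝓘(K, W.carrier) φ (g⁻¹ * 1 * g⁻¹⁻¹) := by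
    rw [hc1]
    exact hd
  rw [V.lieAct_eq v W.incl φ hd h X,
    V.lieAct_eq (V.ρ g v) ((V.ρ g : V →L[K] V).comp W.incl) (fun k => φ (g⁻¹ * k * g⁻¹⁻¹))
      (hd'.comp (1 : G) (mdiff_conj g⁻¹ 1)) ?_ (Ad g X)]
  · have h1 := mfderiv_comp_one (E := E) φ (fun k : G => g⁻¹ * k * g⁻¹⁻¹) hc1 hd
      (mdiff_conj (E := E) g⁻¹ 1) (Ad (K := K) g X)
    have h2 : (mfderiv 𝓘(K, E) 𝓘(K, E) (fun k : G => g⁻¹ * k * g⁻¹⁻¹) 1 : E →L[K] E)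
      (Ad (K := K) g X) = X := Ad_inv_Ad g X
    rw [h2] at h1
    exact congrArg (fun w => V.ρ g (W.incl w)) h1
  · have hcont : Tendsto (fun k : G => g⁻¹ * k * g⁻¹⁻¹) (𝓝 1) (𝓝 1) := by
      have := (contMDiff_conj (K := K) (E := E) g⁻¹).continuous.tendsto (1 : G)
      rwa [hc1] at this
    filter_upwards [hcont.eventually h] with k hk
    rw [ContinuousLinearMap.comp_apply, ← hk]
    change _ = V.ρ g _
    rw [← ρ_mul, ← ρ_mul]
    congr 2
    group

/-- The action of `g : G` on cochains, `(g η)(x₁, …, xₙ) = g (η(Ad(g⁻¹) x₁, …, Ad(g⁻¹) xₙ))`. -/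
noncomputable def cochainAct (V : LocAnRep K E G) (n : ℕ) (g : G) :
    (GroupLieAlgebra 𝓘(K, E) G [⋀^Fin n]→ₗ[K] V) →ₗ[K]
      (GroupLieAlgebra 𝓘(K, E) G [⋀^Fin n]→ₗ[K] V) where
  toFun η := (V.ρ g).toLinearMap.compAlternatingMap (η.compLinearMap (Ad g⁻¹))
  map_add' η θ := by
    ext x
    exact map_add (V.ρ g) _ _
  map_smul' a η := by
    ext x
    exact map_smul (V.ρ g) _ _

theorem cochainAct_apply (V : LocAnRep K E G) {n : ℕ} (g : G)
    (η : GroupLieAlgebra 𝓘(K, E) G [⋀^Fin n]→ₗ[K] V) (x : Fin n → GroupLieAlgebra 𝓘(K, E) G) :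
    V.cochainAct n g η x = V.ρ g (η fun i => Ad g⁻¹ (x i)) := rfl

/-- The map on cochains induced by a map of representations. -/
noncomputable def cochainMap {V V' : LocAnRep K E G} (T : V ⟶ V') (n : ℕ) :
    (GroupLieAlgebra 𝓘(K, E) G [⋀^Fin n]→ₗ[K] V) →ₗ[K]
      (GroupLieAlgebra 𝓘(K, E) G [⋀^Fin n]→ₗ[K] V') where
  toFun η := T.toCLM.toLinearMap.compAlternatingMap η
  map_add' η θ := by
    ext x
    exact map_add T.toCLM _ _
  map_smul' a η := by
    ext x
    exact map_smul T.toCLM _ _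

theorem cochainMap_mem_cocycles {V V' : LocAnRep K E G} (T : V ⟶ V') (n : ℕ) :
    V.cocycles n ≤ (V'.cocycles n).comap (cochainMap T n) := fun η hη x => by
  refine (ceD_comp T η x).trans ?_
  rw [hη x, map_zero]

theorem cochainMap_mem_coboundaries {V V' : LocAnRep K E G} (T : V ⟶ V') (n : ℕ) :
    V.coboundaries n ≤ (V'.coboundaries n).comap (cochainMap T n) := by
  cases n with
  | zero => exact bot_le
  | succ n =>
    rintro θ ⟨η, h⟩
    refine ⟨cochainMap T n η, fun x => ?_⟩
    refine Eq.trans ?_ (ceD_comp T η x).symm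
    rw [← h]
    rfl

/-- The map on Lie algebra cohomology induced by a map of representations. -/
noncomputable def lieCohomologyMap {V V' : LocAnRep K E G} (T : V ⟶ V') (n : ℕ) :
    V.lieCohomology n →ₗ[K] V'.lieCohomology n :=
  Submodule.mapQ _ _ ((cochainMap T n).restrict (cochainMap_mem_cocycles T n))
    fun _ hη => cochainMap_mem_coboundaries T n hη

variable [CompleteSpace K] [FiniteDimensional K E] [LieGroup 𝓘(K, E) ω G]

theorem ceD_cochainAct (V : LocAnRep K E G) {n : ℕ} (g : G)
    (η : GroupLieAlgebra 𝓘(K, E) G [⋀^Fin n]→ₗ[K] V)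
    (x : Fin (n + 1) → GroupLieAlgebra 𝓘(K, E) G) :
    V.ceD (V.cochainAct n g η) x = V.ρ g (V.ceD η fun i => Ad g⁻¹ (x i)) := by
  have hE : CompleteSpace E := FiniteDimensional.complete K E
  simp only [ceD, map_add, map_sum, map_zsmul]
  congr 1
  · refine Finset.sum_congr rfl fun i _ => ?_
    rw [← lieAct_Ad, Ad_Ad_inv]
    rfl
  · refine Finset.sum_congr rfl fun j _ => Finset.sum_congr rfl fun i _ => ?_
    rw [cochainAct_apply]
    congr 3
    funext k
    change Ad g⁻¹ (Function.update x i ⁅x i, x j⁆ (j.succAbove k)) =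
      Function.update (fun i => Ad g⁻¹ (x i)) i ⁅Ad g⁻¹ (x i), Ad g⁻¹ (x j)⁆ (j.succAbove k)
    rw [← Ad_bracket]
    by_cases hk : j.succAbove k = i
    · rw [hk, Function.update_self, Function.update_self]
    · rw [Function.update_of_ne hk, Function.update_of_ne hk]

theorem cochainAct_mem_cocycles (V : LocAnRep K E G) (n : ℕ) (g : G) :
    V.cocycles n ≤ (V.cocycles n).comap (V.cochainAct n g) := fun η hη x => by
  rw [ceD_cochainAct, hη, map_zero]

theorem cochainAct_mem_coboundaries (V : LocAnRep K E G) (n : ℕ) (g : G) :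
    V.coboundaries n ≤ (V.coboundaries n).comap (V.cochainAct n g) := by
  cases n with
  | zero => exact bot_le
  | succ n =>
    rintro θ ⟨η, h⟩
    refine ⟨V.cochainAct n g η, fun x => ?_⟩
    rw [ceD_cochainAct, ← h, cochainAct_apply]

/-- The action of `G` on `Hⁿ(𝔤, V)` induced by the adjoint action on `𝔤` and the action on `V`. -/
noncomputable def lieCohomologyRep (V : LocAnRep K E G) (n : ℕ) :
    Representation K G (V.lieCohomology n) where
  toFun g := Submodule.mapQ _ _ ((V.cochainAct n g).restrict (V.cochainAct_mem_cocycles n g))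
    fun _ hη => V.cochainAct_mem_coboundaries n g hη
  map_one' := by
    refine Submodule.linearMap_qext _ (LinearMap.ext fun η => ?_)
    refine congrArg (Submodule.Quotient.mk) (Subtype.ext ?_)
    ext x
    change V.ρ 1 (η.1 fun i => Ad (1 : G)⁻¹ (x i)) = η.1 x
    simp only [ρ_one, inv_one, Ad_one]
  map_mul' g h := by
    refine Submodule.linearMap_qext _ (LinearMap.ext fun η => ?_)
    refine congrArg (Submodule.Quotient.mk) (Subtype.ext ?_)
    ext x
    change V.ρ (g * h) (η.1 fun i => Ad (g * h)⁻¹ (x i)) =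
      V.ρ g (V.ρ h (η.1 fun i => Ad h⁻¹ (Ad g⁻¹ (x i))))
    simp only [ρ_mul, mul_inv_rev, Ad_mul]

end LocAnRep
end GroupActionOnCohomology
end LocAnCohom

set_option linter.unusedSectionVars false

/-! ### The Euler equation for analytic functions over a nonarchimedean field -/

section Euler

/-! Write 1 for the constant sheaf of integers in BG. The functor of global sections is Hom(1, -),
so the cohomology of G is Ext^n(1, -) (`exists_unit`, `cohomologyEquivExt`). The comparison passes
through a sheaf larger than that of admissible functions: `closedSheaf`, whose sections over X are
the admissible families, parametrized by X, of closed (that is, locally constant) functions from G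
to V. Here y(G) acts by left translation and on the values.

De Rham side. The sheaf `closedSheaf` is resolved by sheaves of V-valued differential forms on G.
Exactness is a Poincaré lemma with parameters. Its primitives come from solving q u + D_e u(e) = f
on power series: the part of degree k in e is divided by q + k, which is possible in characteristic
0 and preserves a positive radius of convergence because |n| is at least c^n for some c > 0.
Solutions are unique (`map_eq_of_euler`), hence compatible with the action of G on V, and this makes
the primitives admissible. Since G is compact with a basis of clopen sets, local primitives along G
are put together over the disjoint cosets of an open subgroup. Each sheaf of forms is a retract of
the coinduced sheaf X ↦ A(X × G) and is therefore acyclic (`ext_comp_toCoind`,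
`subsingleton_ext_of_retract`). Its global sections are the left equivariant forms, which are
determined by their value at 1, and on them d is the Chevalley-Eilenberg differential
(`Form.d_ofCochain_one`). Hence Ext^n(1, `closedSheaf`) is the Lie algebra cohomology of V
(`extEquivLie`). Right translation of functions by g corresponds to the action of g on it
(`extEquivLie_trans`).

Averaging. Admissible functions embed into `closedSheaf` as the functions constant along G, and the
average over the cosets of a small open subgroup is an equivariant retraction. So the cohomology of
G injects into Lie algebra cohomology. The image consists of invariants because right translations
fix constants. Conversely, `closedSheaf` is the directed union, over open subgroups H, of the
functions invariant under right multiplication by H, and by compactness of G every class comes from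
one such H (`IsDirectedUnion.exists_ext_comp`). On that subsheaf [G : H] times the average is a sum
of [G : H] right translations (`card_smul_avgMap_constIncl`). An invariant class is thus equal to
its average, and lies in the image. -/

theorem exists_pow_le_norm_natCast (K : Type*) [NontriviallyNormedField K] [IsUltrametricDist K]
    [CharZero K] : ∃ c : ℝ, 0 < c ∧ c ≤ 1 ∧ ∀ n : ℕ, n ≠ 0 → c ^ n ≤ ‖(n : K)‖ := by
  classical
  have hle (n : ℕ) : ‖(n : K)‖ ≤ 1 := IsUltrametricDist.norm_natCast_le_one K n
  by_cases h : ∃ n : ℕ, n ≠ 0 ∧ ‖(n : K)‖ < 1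
  -- All positive integers below the least p with |p| < 1 have norm 1. Division with remainder then
  -- gives either |n| = 1 or |n| = |p| |n / p|, and induction applies with c = |p|.
  · let p := Nat.find h
    obtain ⟨hp0, hp1⟩ : p ≠ 0 ∧ ‖(p : K)‖ < 1 := Nat.find_spec h
    have hp2 : 1 < p := by
      rcases Nat.lt_or_ge 1 p with h | h
      · exact h
      · have : p = 1 := by omega
        rw [this] at hp1
        simp at hp1
    have hpos : 0 < ‖(p : K)‖ := norm_pos_iff.2 (Nat.cast_ne_zero.2 hp0)
    refine ⟨‖(p : K)‖, hpos, hp1.le, fun n => ?_⟩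
    induction n using Nat.strong_induction_on with
    | _ n ih =>
    intro hn
    have hdm := Nat.div_add_mod n p
    by_cases hr : n % p = 0
    · rw [hr, add_zero] at hdm
      have hm : n / p ≠ 0 := by
        rintro h0
        rw [h0, mul_zero] at hdm
        exact hn hdm.symm
      have hlt : n / p < n := Nat.div_lt_self (Nat.pos_of_ne_zero hn) hp2
      calc ‖(p : K)‖ ^ n ≤ ‖(p : K)‖ ^ (n / p + 1) := pow_le_pow_of_le_one hpos.le hp1.le hlt
        _ = ‖(p : K)‖ * ‖(p : K)‖ ^ (n / p) := by rw [pow_succ, mul_comm]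
        _ ≤ ‖(p : K)‖ * ‖((n / p : ℕ) : K)‖ := by gcongr; exact ih _ hlt hm
        _ = ‖(n : K)‖ := by rw [← norm_mul, ← Nat.cast_mul, hdm]
    · have h1 : ‖((n % p : ℕ) : K)‖ = 1 := by
        by_contra h1
        exact Nat.find_min h (Nat.mod_lt n (Nat.pos_of_ne_zero hp0))
          ⟨hr, lt_of_le_of_ne (hle _) h1⟩
      have h2 : ‖((p * (n / p) : ℕ) : K)‖ < 1 := by
        rw [Nat.cast_mul, norm_mul]
        exact mul_lt_one_of_nonneg_of_lt_one_left (norm_nonneg _) hp1 (hle _)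
      have h3 : ‖(n : K)‖ = 1 := by
        rw [← hdm, Nat.cast_add, IsUltrametricDist.norm_add_eq_max_of_norm_ne_norm, h1,
          max_eq_right h2.le]
        rw [h1]
        exact h2.ne
      rw [h3]
      exact pow_le_one₀ hpos.le hp1.le
  · push Not at h
    exact ⟨1, one_pos, le_rfl, fun n hn => by simpa using h n hn⟩

variable {K : Type*} [NontriviallyNormedField K]
  {F : Type*} [NormedAddCommGroup F] [NormedSpace K F]
  {E : Type*} [NormedAddCommGroup E] [NormedSpace K E]
  {W : Type*} [NormedAddCommGroup W] [NormedSpace K W]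

/-- The derivative series sums over the subsets of size n of the 1 + n slots, which are the
complements of single slots; the omitted slot receives v. As `p` need not be symmetric, the sum over
slots cannot be collapsed. -/
theorem FormalMultilinearSeries.derivSeries_apply_apply (p : FormalMultilinearSeries K E W) (n : ℕ)
    (z v : E) : p.derivSeries n (fun _ => z) v =
      ∑ i : Fin (1 + n), p (1 + n) (Function.update (fun _ => z) i v) := by
  classical
  simp only [derivSeries, ContinuousLinearMap.compFormalMultilinearSeries_apply,
    changeOriginSeries, ContinuousLinearMap.compContinuousMultilinearMap_coe,
    ContinuousLinearEquiv.coe_coe, LinearIsometryEquiv.coe_coe, Function.comp_apply,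
    sum_apply, map_sum]
  have hc (i : Fin (1 + n)) : (({i}ᶜ : Finset (Fin (1 + n)))).card = n := by
    rw [Finset.card_compl, Finset.card_singleton, Fintype.card_fin]
    omega
  symm
  refine Fintype.sum_bijective (fun i => ⟨{i}ᶜ, hc i⟩) ⟨fun i j h => ?_, fun s => ?_⟩ _ _
    fun i => ?_
  · simpa using congrArg Subtype.val h
  · have h1 : (s.1)ᶜ.card = 1 := by
      rw [Finset.card_compl, s.2, Fintype.card_fin]
      omega
    obtain ⟨i, hi⟩ := Finset.card_eq_one.1 h1
    exact ⟨i, Subtype.ext (by simp only [← hi, compl_compl])⟩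
  · have h := p.changeOriginSeriesTerm_apply 1 n {i}ᶜ (hc i) z v
    refine Eq.trans ?_ h.symm
    congr 1
    funext j
    by_cases hj : j = i
    · subst hj
      simp
    · simp [hj]

theorem FormalMultilinearSeries.radius_pos_of_le_geometric (p : FormalMultilinearSeries K E W)
    {C r : ℝ} (hr : 0 < r) (h : ∀ n, ‖p n‖ ≤ C * r ^ n) : 0 < p.radius := by
  have h0 : 0 < r⁻¹ := inv_pos.2 hr
  refine lt_of_lt_of_le ?_ (p.le_radius_of_bound C (r := ⟨r⁻¹, h0.le⟩) fun n => ?_)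
  · exact ENNReal.coe_pos.2 h0
  · change ‖p n‖ * r⁻¹ ^ n ≤ C
    calc ‖p n‖ * r⁻¹ ^ n ≤ C * r ^ n * r⁻¹ ^ n := by gcongr; exact h n
      _ = C := by rw [mul_assoc, ← mul_pow, mul_inv_cancel₀ hr.ne', one_pow, mul_one]

/-- The series whose sum `u` solves `q u(y, e) + D_e u(y, e) e = f(y, e)`, where `f` is the sum
of `p`. -/
noncomputable def FormalMultilinearSeries.eulerSeries (p : FormalMultilinearSeries K (F × E) W)
    (q : ℕ) : FormalMultilinearSeries K (F × E) W := fun n =>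
  -- Expand `p n` at (y, e) = (y, 0) + (0, e), with s the set of slots that receive (0, e). This
  -- summand is homogeneous of degree s.card in e, so the Euler operator multiplies it by q +
  -- s.card.
  ∑ s : Finset (Fin n), ((q + s.card : ℕ) : K)⁻¹ • (p n).compContinuousLinearMap
    fun i => if i ∈ s then (ContinuousLinearMap.inr K F E).comp (ContinuousLinearMap.snd K F E)
      else (ContinuousLinearMap.inl K F E).comp (ContinuousLinearMap.fst K F E)

namespace FormalMultilinearSeries

variable (p : FormalMultilinearSeries K (F × E) W) (q : ℕ)

theorem eulerSeries_apply (n : ℕ) (w : Fin n → F × E) : p.eulerSeries q n w =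
    ∑ s : Finset (Fin n), ((q + s.card : ℕ) : K)⁻¹ •
      p n (s.piecewise (fun i => (0, (w i).2)) fun i => ((w i).1, 0)) := by
  simp only [eulerSeries, sum_apply, _root_.smul_apply,
    ContinuousMultilinearMap.compContinuousLinearMap_apply]
  refine Finset.sum_congr rfl fun s _ => ?_
  congr 2
  funext i
  by_cases hi : i ∈ s <;> simp [hi]

/-- Degree n has 2^n summands, each divided by an integer of norm at least c^(q + n). The loss is
only geometric. -/
theorem eulerSeries_radius_pos [IsUltrametricDist K] [CharZero K] (hq : q ≠ 0)
    (hp : 0 < p.radius) : 0 < (p.eulerSeries q).radius := by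
  obtain ⟨C, r, hC, hr, hb⟩ := p.le_mul_pow_of_radius_pos hp
  obtain ⟨c, hc0, hc1, hc⟩ := exists_pow_le_norm_natCast K
  refine radius_pos_of_le_geometric (C := C * c⁻¹ ^ q) (r := r * c⁻¹ * 2) _ (by positivity)
    fun n => ?_
  refine (norm_sum_le _ _).trans ?_
  have hterm (s : Finset (Fin n)) : ‖((q + s.card : ℕ) : K)⁻¹ • (p n).compContinuousLinearMap
      (fun i => if i ∈ s then
        (ContinuousLinearMap.inr K F E).comp (ContinuousLinearMap.snd K F E)
      else (ContinuousLinearMap.inl K F E).comp (ContinuousLinearMap.fst K F E))‖ ≤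
      (c⁻¹ ^ q * c⁻¹ ^ n) * (C * r ^ n) := by
    rw [norm_smul]
    have h1 : ‖((q + s.card : ℕ) : K)⁻¹‖ ≤ c⁻¹ ^ q * c⁻¹ ^ n := by
      rw [norm_inv, ← pow_add, inv_pow]
      have hcard : s.card ≤ n := by simpa using s.card_le_univ
      refine inv_anti₀ (by positivity) ?_
      exact (pow_le_pow_of_le_one hc0.le hc1 (by omega)).trans (hc (q + s.card) (by omega))
    have h2 : ‖(p n).compContinuousLinearMap (fun i => if i ∈ s then
        (ContinuousLinearMap.inr K F E).comp (ContinuousLinearMap.snd K F E)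
      else (ContinuousLinearMap.inl K F E).comp (ContinuousLinearMap.fst K F E))‖ ≤ ‖p n‖ := by
      refine ((p n).norm_compContinuousLinearMap_le _).trans ?_
      refine mul_le_of_le_one_right (norm_nonneg _) (Finset.prod_le_one (fun _ _ => norm_nonneg _)
        fun i _ => ?_)
      refine ContinuousLinearMap.opNorm_le_bound _ zero_le_one fun z => ?_
      rw [one_mul]
      split_ifs
      · simpa using norm_snd_le z
      · simpa using norm_fst_le z
    gcongr
    exact h2.trans (hb n)
  refine (Finset.sum_le_sum fun s _ => hterm s).trans (le_of_eq ?_)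
  rw [Finset.sum_const, Finset.card_univ, Fintype.card_finset, Fintype.card_fin, nsmul_eq_mul]
  push_cast
  rw [mul_pow, mul_pow]
  ring

theorem eulerSeries_zero_apply [CharZero K] (hq : q ≠ 0) (w : Fin 0 → F × E) :
    (q : K) • p.eulerSeries q 0 w = p 0 w := by
  rw [eulerSeries_apply, Finset.sum_eq_single ∅ (fun s _ hs => absurd (s.eq_empty_of_isEmpty) hs)
    (fun h => absurd (Finset.mem_univ _) h), smul_smul, Finset.card_empty, add_zero, mul_inv_cancel₀ (Nat.cast_ne_zero.2 hq),
    one_smul]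
  congr 1
  exact Subsingleton.elim _ _

/-- Differentiating the summand of s along (0, e) reproduces it once for every slot in s and gives 0
for the others, which see only the first component. Together with q this is the factor q + s.card
that was divided out. -/
theorem eulerSeries_succ_apply [CharZero K] (hq : q ≠ 0) (n : ℕ) (z : F × E) :
    (q : K) • p.eulerSeries q (1 + n) (fun _ => z) +
      (p.eulerSeries q).derivSeries n (fun _ => z) (0, z.2) = p (1 + n) fun _ => z := by
  classical
  rw [derivSeries_apply_apply]
  simp only [eulerSeries_apply]
  rw [Finset.sum_comm, Finset.smul_sum, ← Finset.sum_add_distrib]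
  have hz : p (1 + n) (fun _ => z) = ∑ s : Finset (Fin (1 + n)),
      p (1 + n) (s.piecewise (fun _ => (0, z.2)) fun _ => (z.1, 0)) := by
    rw [← ContinuousMultilinearMap.map_add_univ]
    congr 1
    funext i
    simp
  rw [hz]
  refine Finset.sum_congr rfl fun s _ => ?_
  have h1 (i : Fin (1 + n)) : p (1 + n) (s.piecewise
      (fun j => ((0 : F), (Function.update (fun _ => z) i ((0 : F), z.2) j).2))
      fun j => ((Function.update (fun _ => z) i ((0 : F), z.2) j).1, (0 : E))) =
      if i ∈ s then p (1 + n) (s.piecewise (fun _ => ((0 : F), z.2)) fun _ => (z.1, (0 : E)))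
      else 0 := by
    split_ifs with hi
    · congr 1
      funext j
      by_cases hj : j = i
      · subst hj
        simp [hi]
      · by_cases hjs : j ∈ s <;> simp [hj, hjs]
    · refine (p (1 + n)).map_coord_zero i ?_
      simp [hi]
  simp only [h1]
  rw [← Finset.smul_sum, Finset.sum_ite_mem, Finset.univ_inter, Finset.sum_const, smul_comm,
    ← smul_add, ← Nat.cast_smul_eq_nsmul K, ← add_smul, smul_smul, ← Nat.cast_add,
    inv_mul_cancel₀ (Nat.cast_ne_zero.2 (by omega)), one_smul]

end FormalMultilinearSeries

/-- The slices `f(y, ·)` of an analytic function have power series with a common radius. -/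
theorem AnalyticAt.exists_slice {f : F × E → W} {y₀ : F} [CompleteSpace W]
    (hf : AnalyticAt K f (y₀, 0)) : ∃ r : ℝ, 0 < r ∧ ∀ y ∈ Metric.ball y₀ r,
      ∃ p : FormalMultilinearSeries K E W,
        HasFPowerSeriesOnBall (fun e => f (y, e)) p 0 (ENNReal.ofReal r) := by
  obtain ⟨p, R, hp⟩ := hf
  obtain ⟨ρ, hρ0, hρR⟩ := ENNReal.lt_iff_exists_real_btwn.1 hp.r_pos
  have hρ : 0 < ρ := ENNReal.ofReal_pos.1 hρR.1
  -- Moving the centre by less than ρ / 2 costs at most ρ / 2 of the radius, so ρ / 2 remains for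
  -- every y in the ball.
  refine ⟨ρ / 2, half_pos hρ, fun y hy => ?_⟩
  have hn : ‖((y - y₀, 0) : F × E)‖ < ρ / 2 := by
    rw [Prod.norm_mk, norm_zero, max_eq_left (norm_nonneg _), ← dist_eq_norm]
    exact hy
  have hn' : (‖((y - y₀, 0) : F × E)‖₊ : ENNReal) < ENNReal.ofReal (ρ / 2) := by
    rw [← enorm_eq_nnnorm, ← ofReal_norm]
    exact (ENNReal.ofReal_lt_ofReal_iff (half_pos hρ)).2 hn
  have hR : ENNReal.ofReal (ρ / 2) + ENNReal.ofReal (ρ / 2) ≤ R := by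
    rw [← ENNReal.ofReal_add (half_pos hρ).le (half_pos hρ).le, add_halves]
    exact hρR.2.le
  have h1 := hp.changeOrigin (y := (y - y₀, 0))
    (hn'.trans_le (le_trans (le_add_right le_rfl) hR))
  have h2 := h1.mono (ENNReal.ofReal_pos.2 (half_pos hρ))
    (ENNReal.le_sub_of_add_le_left (by simp) ((add_le_add_left hn'.le _).trans hR))
  have h3 : ((y₀, 0) : F × E) + (y - y₀, 0) = (y, 0) := by simp
  rw [h3] at h2
  have h4 : HasFPowerSeriesOnBall (fun z => f ((y, 0) + z)) (p.changeOrigin (y - y₀, 0)) 0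
      (ENNReal.ofReal (ρ / 2)) := by
    refine ⟨h2.r_le, h2.r_pos, fun {z} hz => ?_⟩
    simpa using h2.hasSum hz
  refine ⟨(p.changeOrigin (y - y₀, 0)).compContinuousLinearMap (ContinuousLinearMap.inr K F E),
    ?_, h2.r_pos, fun {e} he => ?_⟩
  · refine h2.r_le.trans (FormalMultilinearSeries.radius_le_of_le fun {n} => ?_)
    refine ((p.changeOrigin (y - y₀, 0) n).norm_compContinuousLinearMap_le _).trans ?_
    refine mul_le_of_le_one_right (norm_nonneg _) (Finset.prod_le_one (fun _ _ => norm_nonneg _)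
      fun i _ => ContinuousLinearMap.norm_inr_le_one K F E)
  · have he' : ((0 : F), e) ∈ Metric.eball (0 : F × E) (ENNReal.ofReal (ρ / 2)) := by
      simpa [Prod.edist_eq] using he
    have := h4.hasSum he'
    simp only [zero_add, Prod.mk_add_mk, add_zero] at this ⊢
    exact this

/-- Existence of solutions of the Euler equation. -/
theorem AnalyticAt.exists_euler [IsUltrametricDist K] [CharZero K] [CompleteSpace W]
    {f : F × E → W} {y₀ : F} (hf : AnalyticAt K f (y₀, 0)) {q : ℕ} (hq : q ≠ 0) :
    ∃ u : F × E → W, AnalyticAt K u (y₀, 0) ∧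
      ∀ᶠ z in 𝓝 (y₀, (0 : E)), (q : K) • u z + fderiv K u z (0, z.2) = f z := by
  obtain ⟨p, R, hp⟩ := hf
  have hq0 := p.eulerSeries_radius_pos q hq hp.radius_pos
  have hu := (p.eulerSeries q).hasFPowerSeriesOnBall hq0
  have hu' := (hu.comp_sub (y₀, (0 : E)))
  rw [zero_add] at hu'
  refine ⟨_, hu'.analyticAt, ?_⟩
  have hmin : 0 < min R (p.eulerSeries q).radius := lt_min hp.r_pos hq0
  filter_upwards [Metric.eball_mem_nhds (y₀, (0 : E)) hmin] with z hz
  obtain ⟨w, rfl⟩ : ∃ w, z = (y₀, 0) + w := ⟨z - (y₀, 0), by abel⟩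
  have hw : w ∈ Metric.eball (0 : F × E) (min R (p.eulerSeries q).radius) := by
    simpa [edist_eq_enorm_sub] using hz
  have hw1 : w ∈ Metric.eball (0 : F × E) R := Metric.eball_subset_eball (min_le_left _ _) hw
  have hw2 : w ∈ Metric.eball (0 : F × E) (p.eulerSeries q).radius :=
    Metric.eball_subset_eball (min_le_right _ _) hw
  have s1 := hp.hasSum hw1
  have s2 := hu'.hasSum hw2
  have s3 := (hu'.fderiv.hasSum hw2).mapL (ContinuousLinearMap.apply K W ((0 : F), w.2))
  have e2 : ((y₀, (0 : E)) + w).2 = w.2 := by simp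
  rw [e2]
  refine HasSum.unique ?_ s1
  -- The constant term is split off because term n of the derivative series is to be paired with
  -- term n + 1 of the solution.
  rw [← hasSum_nat_add_iff' 1] at s2 ⊢
  simp only [Finset.range_one, Finset.sum_singleton] at s2 ⊢
  have s4 := (s2.const_smul (q : K)).add s3
  rw [← p.eulerSeries_zero_apply q hq]
  convert! s4 using 1
  · funext n
    have := p.eulerSeries_succ_apply q hq n w
    rw [add_comm 1 n] at this
    exact this.symm
  · simp only [smul_sub, ContinuousLinearMap.apply_apply]
    abel

/-- Uniqueness of solutions of the Euler equation. -/
theorem HasFPowerSeriesOnBall.eq_of_euler [IsUltrametricDist K] [CharZero K] [CompleteSpace W]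
    {u : E → W} {p : FormalMultilinearSeries K E W} {r : ENNReal}
    (hu : HasFPowerSeriesOnBall u p 0 r) (q : ℕ)
    (h : ∀ e ∈ Metric.eball (0 : E) r, (q : K) • u e + fderiv K u e e = 0) :
    ∀ e ∈ Metric.eball (0 : E) r, u e = if q = 0 then u 0 else 0 := by
  -- This is the series of q u + D_e u(e). Its sum is zero, so its diagonal values vanish, and in
  -- characteristic 0 so do those of `p n` unless q + n = 0.
  let s : FormalMultilinearSeries K E W := fun n => ((q + n : ℕ) : K) • p n
  have hs : HasFPowerSeriesOnBall (fun _ => (0 : W)) s 0 r := by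
    refine ⟨hu.r_le.trans (FormalMultilinearSeries.radius_le_of_le fun {n} => ?_), hu.r_pos,
      fun {e} he => ?_⟩
    · rw [norm_smul]
      exact mul_le_of_le_one_left (norm_nonneg _) (IsUltrametricDist.norm_natCast_le_one K _)
    · have s2 := hu.hasSum he
      have s3 := (hu.fderiv.hasSum he).mapL (ContinuousLinearMap.apply K W e)
      have h0 := h e he
      rw [zero_add] at s2 s3
      rw [← hasSum_nat_add_iff' 1] at s2 ⊢
      simp only [Finset.range_one, Finset.sum_singleton] at s2 ⊢
      convert! (s2.const_smul (q : K)).add s3 using 1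
      · funext n
        simp only [s, ContinuousLinearMap.apply_apply, p.derivSeries_apply_diag, _root_.smul_apply]
        rw [← Nat.cast_smul_eq_nsmul K, ← add_smul]
        push_cast
        rfl
      · simp only [s, _root_.smul_apply, smul_sub, ContinuousLinearMap.apply_apply]
        rw [sub_add_eq_add_sub, h0]
        simp
  intro e he
  have hz (n : ℕ) (hn : q + n ≠ 0) : p n (fun _ => e) = 0 := by
    have := hs.hasFPowerSeriesAt.apply_eq_zero n e
    exact (smul_eq_zero.1 this).resolve_left (Nat.cast_ne_zero.2 hn)
  have s2 := hu.hasSum he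
  rw [zero_add] at s2
  split_ifs with hq
  · have := hasSum_single (f := fun n => p n fun _ => e) 0 fun n hn => hz n (by omega)
    rw [s2.unique this]
    rw [← hu.coeff_zero fun _ => e]
  · have : HasSum (fun n => p n fun _ => e) 0 := by
      simp only [fun n => hz n (by omega)]
      exact hasSum_zero
    exact s2.unique this

end Euler

/-! ### The Poincaré lemma with parameters -/

section Poincare

variable {K : Type*} [NontriviallyNormedField K]
  {F : Type*} [NormedAddCommGroup F] [NormedSpace K F]
  {E : Type*} [NormedAddCommGroup E] [NormedSpace K E]
  {W : Type*} [NormedAddCommGroup W] [NormedSpace K W]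

open ContinuousAlternatingMap in
/-- The Cartan formula for the Euler vector field. -/
theorem extDeriv_curryLeft_apply {q : ℕ} {Ω : E → E [⋀^Fin (q + 1)]→L[K] W} {e : E}
    (h : DifferentiableAt K Ω e) :
    extDeriv (fun e => (Ω e).curryLeft e) e =
      ((q + 1 : ℕ) : K) • Ω e + fderiv K Ω e e - (extDeriv Ω e).curryLeft e := by
  let c : (E [⋀^Fin (q + 1)]→L[K] W) →L[K] E →L[K] E [⋀^Fin q]→L[K] W :=
    curryLeftLI.toContinuousLinearMap
  have h1 : HasFDerivAt (fun e => c (Ω e)) (c.comp (fderiv K Ω e)) e :=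
    HasFDerivAt.comp (g := c) e c.hasFDerivAt h.hasFDerivAt
  have h2 := (h1.clm_apply (hasFDerivAt_id e)).fderiv
  have h3 : fderiv K (fun e => (Ω e).curryLeft e) e = _ := h2
  ext v
  rw [extDeriv, h3, alternatizeUncurryFin_apply]
  change _ = ((q + 1 : ℕ) : K) • Ω e v + fderiv K Ω e e v - extDeriv Ω e (Matrix.vecCons e v)
  rw [extDeriv, alternatizeUncurryFin_apply, Fin.sum_univ_succ (n := q + 1)]
  -- These terms come from differentiating the contracting vector e itself. Moving v i back to slot
  -- i cancels the sign, so the q + 1 terms all equal Ω(v).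
  have h4 (i : Fin (q + 1)) : (-1 : ℤ) ^ (i : ℕ) • Ω e (Matrix.vecCons (v i) (i.removeNth v)) =
      Ω e v := by
    rw [← ContinuousAlternatingMap.map_insertNth, Fin.insertNth_self_removeNth]
  have h5 : ∑ i : Fin (q + 1), (-1 : ℤ) ^ (i : ℕ) • Ω e (Matrix.vecCons (v i) (i.removeNth v)) =
      ((q + 1 : ℕ) : K) • Ω e v := by
    simp only [h4]
    rw [Finset.sum_const, Finset.card_univ, Fintype.card_fin, Nat.cast_smul_eq_nsmul]
  have h6 (i : Fin (q + 1)) : (i.succ.removeNth (Matrix.vecCons e v) : Fin (q + 1) → E) =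
      Matrix.vecCons e (i.removeNth v) := by
    funext j
    refine Fin.cases ?_ (fun j => ?_) j
    · simp [Fin.removeNth]
    · simp [Fin.removeNth]
  have h7 : (Fin.removeNth 0 (Matrix.vecCons e v) : Fin (q + 1) → E) = v := by
    funext j
    simp [Fin.removeNth]
  rw [← h5, h7]
  simp only [h6, Matrix.cons_val_zero, Matrix.cons_val_succ, Fin.val_zero, pow_zero, one_smul,
    Fin.val_succ, pow_succ, mul_neg, mul_one, neg_smul, Finset.sum_neg_distrib]
  have h8 (i : Fin (q + 1)) :
      (-1 : ℤ) ^ (i : ℕ) • ((fderiv K Ω e) (v i)) (Matrix.vecCons e (i.removeNth v)) +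
        (-1 : ℤ) ^ (i : ℕ) • Ω e (Matrix.vecCons (v i) (i.removeNth v)) =
      (-1 : ℤ) ^ (i : ℕ) • ((c (Ω e)).comp (ContinuousLinearMap.id K E) +
        (c.comp (fderiv K Ω e)).flip (id e)) (v i) (i.removeNth v) := by
    rw [add_comm, ← smul_add]
    rfl
  rw [← Finset.sum_congr rfl fun i _ => h8 i, Finset.sum_add_distrib]
  abel

/-- The Lie derivative along the Euler vector field commutes with the exterior derivative. -/
theorem extDeriv_fderiv_apply_self {q : ℕ} {Ω : E → E [⋀^Fin q]→L[K] W} {e : E}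
    (h : ContDiffAt K ω Ω e) :
    extDeriv (fun e => fderiv K Ω e e) e = extDeriv Ω e + fderiv K (extDeriv Ω) e e := by
  have hd : DifferentiableAt K (fderiv K Ω) e :=
    (h.fderiv_right (m := ω) le_rfl).differentiableAt (by simp)
  have h1 := (hd.hasFDerivAt.clm_apply (hasFDerivAt_id e)).fderiv
  have h1' : fderiv K (fun e => fderiv K Ω e e) e = _ := h1
  have h2 : fderiv K (extDeriv Ω) e = _ :=
    ((ContinuousAlternatingMap.alternatizeUncurryFinCLM (n := q) K E W).hasFDerivAt.comp e
      hd.hasFDerivAt).fderiv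
  -- Symmetry of the second derivative exchanges the direction e with the direction that is then
  -- alternated.
  have hs : (fderiv K (fderiv K Ω) e).flip e = fderiv K (fderiv K Ω) e e := by
    ext1 v
    exact (h.isSymmSndFDerivAt_of_omega).eq v e
  rw [h2, extDeriv, h1']
  simp only [id_eq, hs]
  rw [extDeriv, ContinuousLinearMap.comp_id, ContinuousAlternatingMap.alternatizeUncurryFin_add]
  rfl

theorem ContDiffAt.clm_apply_fun {A B C : Type*} [NormedAddCommGroup A] [NormedSpace K A]
    [NormedAddCommGroup B] [NormedSpace K B] [NormedAddCommGroup C] [NormedSpace K C] {f : A → B}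
    {n : WithTop ℕ∞} {x : A} (c : B →L[K] C) (hf : ContDiffAt K n f x) :
    ContDiffAt K n (fun z => c (f z)) x :=
  c.contDiff.contDiffAt.comp x hf

theorem fderiv_slice {W : Type*} [NormedAddCommGroup W] [NormedSpace K W] {f : F × E → W}
    {z : F × E} (h : DifferentiableAt K f z) :
    fderiv K (fun e => f (z.1, e)) z.2 = (fderiv K f z).comp (ContinuousLinearMap.inr K F E) := by
  have h1 : HasFDerivAt (fun e : E => (z.1, e)) (ContinuousLinearMap.inr K F E) z.2 :=
    hasFDerivAt_prodMk_right z.1 z.2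
  exact (HasFDerivAt.comp (g := f) z.2 h.hasFDerivAt h1).fderiv

variable [IsUltrametricDist K] [CharZero K] [CompleteSpace W]

/-- An analytic function that solves the homogeneous Euler equation near `(y₀, 0)` vanishes
near `(y₀, 0)`. -/
theorem AnalyticAt.eventually_eq_of_euler {W : Type*} [NormedAddCommGroup W] [NormedSpace K W]
    [CompleteSpace W] {u : F × E → W} {y₀ : F} (hu : AnalyticAt K u (y₀, 0)) (q : ℕ)
    (h : ∀ᶠ z in 𝓝 (y₀, (0 : E)), (q : K) • u z + fderiv K u z (0, z.2) = 0) :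
    ∀ᶠ z in 𝓝 (y₀, (0 : E)), u z = if q = 0 then u (z.1, 0) else 0 := by
  -- Uniqueness is applied on each slice separately; the common radius of the slices is what yields
  -- a neighbourhood of (y₀, 0).
  obtain ⟨r, hr, hs⟩ := hu.exists_slice
  obtain ⟨R, hR, hball⟩ := Metric.eventually_nhds_iff_ball.1 (h.and hu.eventually_analyticAt)
  have hm : 0 < min r R := lt_min hr hR
  filter_upwards [Metric.ball_mem_nhds (y₀, (0 : E)) hm] with z hz
  rw [← ball_prod_same] at hz
  obtain ⟨p, hp⟩ := hs z.1 (Metric.ball_subset_ball (min_le_left _ _) hz.1)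
  have hp' := hp.mono (ENNReal.ofReal_pos.2 hm) (ENNReal.ofReal_le_ofReal (min_le_left _ _))
  refine hp'.eq_of_euler q (fun e he => ?_) z.2 ?_
  · have hmem : (z.1, e) ∈ Metric.ball (y₀, (0 : E)) R := by
      rw [← ball_prod_same]
      refine ⟨Metric.ball_subset_ball (min_le_right _ _) hz.1, ?_⟩
      rw [Metric.eball_ofReal] at he
      exact Metric.ball_subset_ball (min_le_right _ _) he
    have h1 := (hball _ hmem).1
    have h2 := fderiv_slice (hball _ hmem).2.differentiableAt
    rw [h2]
    exact h1
  · rw [Metric.eball_ofReal]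
    exact hz.2

/-- The Poincaré lemma with parameters: the contraction of the solution `Ω` of the Euler equation
with the Euler vector field is a primitive of the closed form `θ`. -/
theorem exists_primitive {q : ℕ} {θ : F × E → E [⋀^Fin (q + 1)]→L[K] W} {y₀ : F}
    (hθ : AnalyticAt K θ (y₀, 0))
    (hd : ∀ᶠ z in 𝓝 (y₀, (0 : E)), extDeriv (fun e => θ (z.1, e)) z.2 = 0) :
    ∃ Ω : F × E → E [⋀^Fin (q + 1)]→L[K] W, AnalyticAt K Ω (y₀, 0) ∧
      (∀ᶠ z in 𝓝 (y₀, (0 : E)), ((q + 1 : ℕ) : K) • Ω z + fderiv K Ω z (0, z.2) = θ z) ∧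
      ∀ᶠ z in 𝓝 (y₀, (0 : E)), extDeriv (fun e => (Ω (z.1, e)).curryLeft e) z.2 = θ z := by
  obtain ⟨Ω, hΩ, he⟩ := hθ.exists_euler q.succ_ne_zero
  refine ⟨Ω, hΩ, he, ?_⟩
  -- η is dΩ along E. Applying d to the Euler equation of Ω and using dθ = 0 gives (q + 2) η + D_e
  -- η(e) = 0, so η = 0 near the base point. The Cartan formula then reads d(ι_e Ω) = (q + 1) Ω +
  -- D_e Ω(e) = θ.
  let η : F × E → E [⋀^Fin (q + 2)]→L[K] W := fun z =>
    ContinuousAlternatingMap.alternatizeUncurryFinCLM K E W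
      ((fderiv K Ω z).comp (ContinuousLinearMap.inr K F E))
  have hη : AnalyticAt K η (y₀, 0) :=
    (ContDiffAt.clm_apply_fun (B := E →L[K] E [⋀^Fin (q + 1)]→L[K] W)
      (ContinuousAlternatingMap.alternatizeUncurryFinCLM K E W)
      ((hΩ.fderiv.contDiffAt (n := ω)).clm_comp contDiffAt_const)).analyticAt
  have hηe : ∀ᶠ z in 𝓝 (y₀, (0 : E)), extDeriv (fun e => Ω (z.1, e)) z.2 = η z := by
    filter_upwards [hΩ.eventually_analyticAt] with z hz
    rw [extDeriv, fderiv_slice hz.differentiableAt]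
    rfl
  have hη0 : ∀ᶠ z in 𝓝 (y₀, (0 : E)), ((q + 2 : ℕ) : K) • η z + fderiv K η z (0, z.2) = 0 := by
    filter_upwards [hΩ.eventually_analyticAt, hd, he.eventually_nhds, hηe.eventually_nhds,
      hη.eventually_analyticAt] with z hz hdz hez hηz hηa
    have hsl : ContDiffAt K ω (fun e => Ω (z.1, e)) z.2 :=
      ContDiffAt.comp z.2 hz.contDiffAt (contDiffAt_const.prodMk contDiffAt_id)
    have hto : Tendsto (fun e : E => (z.1, e)) (𝓝 z.2) (𝓝 z) :=
      (Continuous.prodMk_right z.1).tendsto z.2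
    have h1 : (fun e => θ (z.1, e)) =ᶠ[𝓝 z.2] (fun e => ((q + 1 : ℕ) : K) • Ω (z.1, e)) +
        fun e => fderiv K (fun e => Ω (z.1, e)) e e := by
      filter_upwards [hto.eventually hez, hto.eventually hz.eventually_analyticAt] with e h1 h2
      rw [← h1]
      change _ = _ + fderiv K (fun e => Ω (z.1, e)) e e
      rw [fderiv_slice (z := (z.1, e)) h2.differentiableAt]
      rfl
    have h2 : (fun e => extDeriv (fun e => Ω (z.1, e)) e) =ᶠ[𝓝 z.2] fun e => η (z.1, e) := by
      filter_upwards [hto.eventually hηz] with e he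
      exact he
    have hdd : DifferentiableAt K (fun e => fderiv K (fun e => Ω (z.1, e)) e e) z.2 :=
      ((hsl.fderiv_right (m := ω) le_rfl).differentiableAt (by simp)).clm_apply
        differentiableAt_id
    have h3 : extDeriv (fun e => ((q + 1 : ℕ) : K) • Ω (z.1, e)) z.2 =
        ((q + 1 : ℕ) : K) • extDeriv (fun e => Ω (z.1, e)) z.2 := extDeriv_fun_smul _ _
    have h4 : DifferentiableAt K (fun e => ((q + 1 : ℕ) : K) • Ω (z.1, e)) z.2 :=
      (hsl.differentiableAt (by simp)).fun_const_smul _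
    rw [h1.extDeriv_eq, extDeriv_add h4 hdd, h3,
      extDeriv_fderiv_apply_self hsl, h2.fderiv_eq, hηz.self_of_nhds,
      fderiv_slice hηa.differentiableAt] at hdz
    rw [← hdz]
    push_cast
    have : ((q : K) + 2) = (q + 1) + 1 := by ring
    rw [this, add_smul _ (1 : K), one_smul]
    change _ = _ + (_ + fderiv K η z (0, z.2))
    abel
  have hvan := hη.eventually_eq_of_euler (q + 2) hη0
  filter_upwards [hΩ.eventually_analyticAt, he, hηe, hvan] with z hz hez hηz hv
  have hsl : DifferentiableAt K (fun e => Ω (z.1, e)) z.2 :=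
    DifferentiableAt.comp z.2 hz.differentiableAt
      ((differentiableAt_const _).prodMk differentiableAt_id)
  rw [extDeriv_curryLeft_apply hsl, hηz, hv, fderiv_slice hz.differentiableAt, ← hez]
  simp

end Poincare

namespace LocAnCohom

/-! ### Coordinates on the group near the identity -/

section Coordinates

variable (K : Type u) [NontriviallyNormedField K]
  {E : Type u} [NormedAddCommGroup E] [NormedSpace K E]
  {G : Type u} [TopologicalSpace G] [ChartedSpace E G] [Group G]

/-- The inverse of the chart at `1`, centered at the origin. -/
noncomputable def coord (e : E) : G :=
  (extChartAt 𝓘(K, E) (1 : G)).symm (extChartAt 𝓘(K, E) (1 : G) 1 + e)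

variable (E) in
/-- The chart at `1`, centered at the origin. -/
noncomputable def coordInv (g : G) : E :=
  extChartAt 𝓘(K, E) (1 : G) g - extChartAt 𝓘(K, E) (1 : G) 1

theorem coord_zero : (coord K (0 : E) : G) = 1 := by
  rw [coord, add_zero, extChartAt_to_inv]

theorem chartLine_eq_coord (X : E) (t : K) : (chartLine K E X t : G) = coord K (t • X) := rfl

theorem coordInv_one : coordInv K E (1 : G) = 0 := sub_self _

theorem eventually_add_mem_target :
    ∀ᶠ e in 𝓝 (0 : E), extChartAt 𝓘(K, E) (1 : G) 1 + e ∈ (extChartAt 𝓘(K, E) (1 : G)).target := by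
  have h : Tendsto (fun e : E => extChartAt 𝓘(K, E) (1 : G) 1 + e) (𝓝 0)
      (𝓝 (extChartAt 𝓘(K, E) (1 : G) 1)) := by
    have : Continuous (fun e : E => extChartAt 𝓘(K, E) (1 : G) 1 + e) := by fun_prop
    simpa using this.tendsto 0
  exact h.eventually (extChartAt_target_mem_nhds (I := 𝓘(K, E)) (1 : G))

theorem eventually_coordInv_coord : ∀ᶠ e in 𝓝 (0 : E), coordInv K E (coord K e : G) = e := by
  filter_upwards [eventually_add_mem_target K (E := E) (G := G)] with e he
  rw [coordInv, coord, PartialEquiv.right_inv _ he, add_sub_cancel_left]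

theorem eventually_coord_coordInv : ∀ᶠ g in 𝓝 (1 : G), coord K (coordInv K E g) = g := by
  filter_upwards [extChartAt_source_mem_nhds (I := 𝓘(K, E)) (1 : G)] with g hg
  rw [coordInv, coord, add_sub_cancel, PartialEquiv.left_inv _ hg]

section
variable [IsManifold 𝓘(K, E) ω G]

theorem eventually_contMDiffAt_coord :
    ∀ᶠ e in 𝓝 (0 : E), ContMDiffAt 𝓘(K, E) 𝓘(K, E) ω (coord K : E → G) e := by
  filter_upwards [eventually_add_mem_target K (E := E) (G := G)] with e he
  have h1 : ContMDiffAt 𝓘(K, E) 𝓘(K, E) ω (extChartAt 𝓘(K, E) (1 : G)).symm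
      (extChartAt 𝓘(K, E) (1 : G) 1 + e) :=
    (contMDiffOn_extChartAt_symm (1 : G)).contMDiffAt
      ((isOpen_extChartAt_target (I := 𝓘(K, E)) (1 : G)).mem_nhds he)
  exact h1.comp e (f := fun e : E => extChartAt 𝓘(K, E) (1 : G) 1 + e)
    (contMDiffAt_const.add contMDiffAt_id)

theorem eventually_contMDiffAt_coordInv :
    ∀ᶠ g in 𝓝 (1 : G), ContMDiffAt 𝓘(K, E) 𝓘(K, E) ω (coordInv K E : G → E) g := by
  filter_upwards [(isOpen_extChartAt_source (I := 𝓘(K, E)) (1 : G)).mem_nhds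
    (mem_extChartAt_source (I := 𝓘(K, E)) (1 : G))] with g hg
  rw [extChartAt_source] at hg
  exact (contMDiffAt_extChartAt' hg).sub contMDiffAt_const

theorem tendsto_coord : Tendsto (coord K : E → G) (𝓝 0) (𝓝 1) := by
  have h := (eventually_contMDiffAt_coord K (E := E) (G := G)).self_of_nhds.continuousAt
  rwa [ContinuousAt, coord_zero] at h

theorem tendsto_coordInv : Tendsto (coordInv K E : G → E) (𝓝 1) (𝓝 0) := by
  have h := (eventually_contMDiffAt_coordInv K (E := E) (G := G)).self_of_nhds.continuousAt
  rwa [ContinuousAt, coordInv_one] at h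

/-- The tangent space at 1 is identified with E through the chart at 1, and `coord` is the inverse
of that chart up to a translation of E. Thus vectors of E and elements of the Lie algebra need no
conversion. -/
theorem mfderiv_coord_zero :
    (mfderiv 𝓘(K, E) 𝓘(K, E) (coord K : E → G) 0 : E →L[K] E) = ContinuousLinearMap.id K E := by
  have hd : MDifferentiableAt 𝓘(K, E) 𝓘(K, E) (coord K : E → G) 0 :=
    (eventually_contMDiffAt_coord K (E := E) (G := G)).self_of_nhds.mdifferentiableAt (by simp)
  let D : E →L[K] E := mfderiv 𝓘(K, E) 𝓘(K, E) (coord K : E → G) 0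
  have h : HasFDerivWithinAt (writtenInExtChartAt 𝓘(K, E) 𝓘(K, E) 0 (coord K : E → G))
    D (Set.range 𝓘(K, E)) (extChartAt 𝓘(K, E) (0 : E) 0) := hd.hasMFDerivAt.2
  rw [ModelWithCorners.range_eq_univ, hasFDerivWithinAt_univ] at h
  refine h.unique ?_
  have h2 : HasFDerivAt (fun e : E => extChartAt 𝓘(K, E) (1 : G) 1 + e)
      (ContinuousLinearMap.id K E) (extChartAt 𝓘(K, E) (0 : E) 0) :=
    (hasFDerivAt_id _).const_add _
  refine h2.congr_of_eventuallyEq ?_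
  have h3 : extChartAt 𝓘(K, E) (0 : E) 0 = 0 := by
    rw [extChartAt_model_space_eq_id]
    rfl
  rw [h3]
  filter_upwards [eventually_add_mem_target K (E := E) (G := G)] with e he
  simp only [writtenInExtChartAt, Function.comp_apply, coord_zero]
  simp only [extChartAt_model_space_eq_id, PartialEquiv.refl_symm, PartialEquiv.refl_coe, id_eq]
  exact PartialEquiv.right_inv _ he

end

variable (G) in
/-- Multiplication in coordinates. -/
noncomputable def mulC (z : E × E) : E := coordInv K E (coord K z.1 * coord K z.2 : G)

variable (G) in
/-- The left invariant vector fields in coordinates: `frame e ξ` is the value at `e` of the left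
invariant vector field attached to the tangent vector `ξ` at the identity. -/
noncomputable def frame (e : E) : E →L[K] E := fderiv K (fun e' => mulC K G (e, e')) 0

theorem eventually_mulC_zero : ∀ᶠ e in 𝓝 (0 : E), mulC K G (e, 0) = e := by
  filter_upwards [eventually_coordInv_coord K (E := E) (G := G)] with e he
  rw [mulC, coord_zero, mul_one, he]

theorem frame_zero : frame K G (0 : E) = ContinuousLinearMap.id K E := by
  have h : (fun e' : E => mulC K G (0, e')) =ᶠ[𝓝 0] id := by
    filter_upwards [eventually_coordInv_coord K (E := E) (G := G)] with e he
    rw [mulC, coord_zero, one_mul, he, id]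
  rw [frame, h.fderiv_eq, fderiv_id]

variable [LieGroup 𝓘(K, E) ω G]

theorem tendsto_coord_mul :
    Tendsto (fun z : E × E => (coord K z.1 * coord K z.2 : G)) (𝓝 (0, 0)) (𝓝 1) := by
  have : ContinuousMul G := ⟨(contMDiff_mul 𝓘(K, E) (n := ω) (G := G)).continuous⟩
  have h : Tendsto (fun z : E × E => ((coord K z.1 : G), (coord K z.2 : G))) (𝓝 (0, 0))
      (𝓝 (1, 1)) :=
    ((tendsto_coord K).comp (continuous_fst.tendsto _)).prodMk_nhds
      ((tendsto_coord K).comp (continuous_snd.tendsto _))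
  have := (continuous_mul (M := G)).tendsto (1, 1)
  rw [mul_one] at this
  exact this.comp h

theorem eventually_coord_mulC :
    ∀ᶠ z in 𝓝 ((0, 0) : E × E), (coord K (mulC K G z) : G) = coord K z.1 * coord K z.2 :=
  (tendsto_coord_mul K).eventually (eventually_coord_coordInv K)

theorem contDiffAt_mulC : ContDiffAt K ω (mulC K G : E × E → E) (0, 0) := by
  have h := (eventually_contMDiffAt_coord K (E := E) (G := G)).self_of_nhds
  have h2 : ContMDiffAt (𝓘(K, E).prod 𝓘(K, E)) 𝓘(K, E) ω
      (fun z : E × E => (coord K z.1 * coord K z.2 : G)) (0, 0) :=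
    (h.comp (0, 0) (f := Prod.fst) contMDiffAt_fst).mul
      (h.comp (0, 0) (f := Prod.snd) contMDiffAt_snd)
  have h3 : ContMDiffAt 𝓘(K, E) 𝓘(K, E) ω (coordInv K E : G → E)
      (coord K (0 : E) * coord K (0 : E)) := by
    rw [coord_zero, mul_one]
    exact (eventually_contMDiffAt_coordInv K (E := E) (G := G)).self_of_nhds
  have h4 : ContMDiffAt (𝓘(K, E).prod 𝓘(K, E)) 𝓘(K, E) ω (mulC K G : E × E → E) (0, 0) :=
    h3.comp ((0, 0) : E × E) h2
  rw [← modelWithCornersSelf_prod, chartedSpaceSelf_prod] at h4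
  exact contMDiffAt_iff_contDiffAt.1 h4

theorem eventually_contDiffAt_mulC :
    ∀ᶠ e in 𝓝 (0 : E), ContDiffAt K ω (mulC K G : E × E → E) (e, 0) := by
  have h := (contDiffAt_mulC K (E := E) (G := G)).eventually (by simp)
  exact (Continuous.tendsto (f := fun e : E => (e, (0 : E))) (by fun_prop) 0).eventually h

theorem eventually_hasFDerivAt_frame :
    ∀ᶠ e in 𝓝 (0 : E), HasFDerivAt (fun e' => mulC K G (e, e')) (frame K G e) 0 := by
  filter_upwards [eventually_contDiffAt_mulC K (E := E) (G := G)] with e he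
  have h1 := he.differentiableAt (by simp)
  exact (h1.comp (0 : E) (f := fun e' : E => (e, e')) (by fun_prop)).hasFDerivAt

theorem contDiffAt_frame : ContDiffAt K ω (frame K G : E → E →L[K] E) 0 := by
  have h1 : ContDiffAt K ω (fun e : E => (fderiv K (mulC K G : E × E → E) (e, 0)).comp
      (ContinuousLinearMap.inr K E E)) 0 := by
    have h2 : ContDiffAt K ω (fderiv K (mulC K G : E × E → E)) (0, 0) :=
      (contDiffAt_mulC K).fderiv_right (m := ω) le_top
    have h3 : ContDiffAt K ω (fun e : E => (e, (0 : E))) 0 :=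
      contDiffAt_id.prodMk contDiffAt_const
    exact (ContDiffAt.comp (0 : E) (f := fun e : E => (e, (0 : E))) h2 h3).clm_comp
      contDiffAt_const
  refine h1.congr_of_eventuallyEq ?_
  filter_upwards [eventually_contDiffAt_mulC K (E := E) (G := G)] with e he
  have h4 : HasFDerivAt (fun e' : E => (e, e')) (ContinuousLinearMap.inr K E E) 0 :=
    hasFDerivAt_prodMk_right e 0
  exact ((he.differentiableAt (by simp)).hasFDerivAt.comp (0 : E) h4).fderiv

theorem eventually_contDiffAt_frame :
    ∀ᶠ e in 𝓝 (0 : E), ContDiffAt K ω (frame K G : E → E →L[K] E) e :=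
  (contDiffAt_frame K).eventually (by simp)

theorem contDiffAt_frame_inverse [CompleteSpace E] :
    ContDiffAt K ω (fun e : E => (frame K G e).inverse) 0 := by
  have h : ContDiffAt K ω (ContinuousLinearMap.inverse : (E →L[K] E) → E →L[K] E)
      (frame K G (0 : E)) := by
    rw [frame_zero]
    exact contDiffAt_map_inverse (ContinuousLinearEquiv.refl K E)
  exact h.comp (0 : E) (contDiffAt_frame K)

theorem eventually_frame_isInvertible [CompleteSpace E] :
    ∀ᶠ e in 𝓝 (0 : E), (frame K G e).IsInvertible := by
  have h := (contDiffAt_frame K (E := E) (G := G)).continuousAt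
  rw [ContinuousAt, frame_zero] at h
  exact h.eventually (ContinuousLinearEquiv.nhds (ContinuousLinearEquiv.refl K E))

/-- Left invariant vector fields in coordinates. -/
theorem eventually_mpullback_coord :
    ∀ᶠ e in 𝓝 (0 : E), ∀ ξ : GroupLieAlgebra 𝓘(K, E) G,
      VectorField.mpullback 𝓘(K, E) 𝓘(K, E) (coord K : E → G) (mulInvariantVectorField ξ) e =
        frame (E := E) K G e ξ := by
  have hc := eventually_contMDiffAt_coord K (E := E) (G := G)
  have hci := (tendsto_coord K (E := E) (G := G)).eventually
    (eventually_contMDiffAt_coordInv K (E := E) (G := G))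
  have e1 := (eventually_coordInv_coord K (E := E) (G := G)).eventually_nhds
  have e2 := (tendsto_coord K (E := E) (G := G)).eventually
    (eventually_coord_coordInv K (E := E) (G := G)).eventually_nhds
  have e3 : ∀ᶠ e in 𝓝 (0 : E), ∀ᶠ e' in 𝓝 (0 : E),
      (coord K (mulC K G (e, e')) : G) = coord K e * coord K e' :=
    (eventually_coord_mulC K (E := E) (G := G)).curry_nhds
  filter_upwards [hc, hci, e1, e2, e3, eventually_mulC_zero K (E := E) (G := G),
    eventually_hasFDerivAt_frame K (E := E) (G := G)] with e hc hci e1 e2 e3 e4 e5 ξ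
  have hd : MDifferentiableAt 𝓘(K, E) 𝓘(K, E) (coord K : E → G) e :=
    hc.mdifferentiableAt (by simp)
  have hdi : MDifferentiableAt 𝓘(K, E) 𝓘(K, E) (coordInv K E) (coord K e : G) :=
    hci.mdifferentiableAt (by simp)
  have hinv : ContinuousLinearMap.IsInvertible
      (mfderiv 𝓘(K, E) 𝓘(K, E) (coord K : E → G) e : E →L[K] E) := by
    have A : mfderiv 𝓘(K, E) 𝓘(K, E) (coordInv K E ∘ (coord K : E → G)) e =
        (ContinuousLinearMap.id K E : E →L[K] E) := by
      have : (coordInv K E ∘ (coord K : E → G)) =ᶠ[𝓝 e] id := e1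
      rw [this.mfderiv_eq, mfderiv_id]
      rfl
    have B : mfderiv 𝓘(K, E) 𝓘(K, E) ((coord K : E → G) ∘ (coordInv K E : G → E)) (coord K e) =
        (ContinuousLinearMap.id K E : E →L[K] E) := by
      have : ((coord K : E → G) ∘ (coordInv K E : G → E)) =ᶠ[𝓝 (coord K e)] id := e2
      rw [this.mfderiv_eq, mfderiv_id]
      rfl
    have hd' : MDifferentiableAt 𝓘(K, E) 𝓘(K, E) (coord K : E → G)
        (coordInv K E (coord K e : G)) := by rw [e1.self_of_nhds]; exact hd
    rw [mfderiv_comp (I' := 𝓘(K, E)) _ hdi hd] at A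
    rw [mfderiv_comp (I' := 𝓘(K, E)) _ hd' hdi] at B
    have B' : (mfderiv 𝓘(K, E) 𝓘(K, E) (coord K : E → G) (coordInv K E (coord K e : G)) : E →L[K] E) =
        (mfderiv 𝓘(K, E) 𝓘(K, E) (coord K : E → G) e : E →L[K] E) := by
      rw [e1.self_of_nhds]
    have B := (congrArg (fun D : E →L[K] E => D.comp
      (mfderiv 𝓘(K, E) 𝓘(K, E) (coordInv K E) (coord K e : G) : E →L[K] E)) B').symm.trans B
    exact ContinuousLinearMap.IsInvertible.of_inverse B A
  let D : E →L[K] E := mfderiv 𝓘(K, E) 𝓘(K, E) (coord K : E → G) e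
  -- Differentiate `coord` (mulC (e, e')) = `coord` e * `coord` e' in e' at 0.
  have h1 : D (frame (E := E) K G e ξ) =
      (mfderiv 𝓘(K, E) 𝓘(K, E) (fun b : G => coord K e * b) 1 : E →L[K] E) ξ := by
    have hL : MDifferentiableAt 𝓘(K, E) 𝓘(K, E) (fun b : G => coord K e * b) 1 :=
      (contMDiff_mul_left (n := ω) (I := 𝓘(K, E)) (1 : G)).mdifferentiableAt (by simp)
    have hL0 : MDifferentiableAt 𝓘(K, E) 𝓘(K, E) (fun b : G => coord K e * b) (coord K (0 : E)) := by
      rw [coord_zero]; exact hL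
    have hd0 : MDifferentiableAt 𝓘(K, E) 𝓘(K, E) (coord K : E → G) 0 :=
      (eventually_contMDiffAt_coord K (E := E) (G := G)).self_of_nhds.mdifferentiableAt (by simp)
    have hm : MDifferentiableAt 𝓘(K, E) 𝓘(K, E) (fun e' : E => mulC K G (e, e')) 0 :=
      e5.differentiableAt.mdifferentiableAt
    have hd' : MDifferentiableAt 𝓘(K, E) 𝓘(K, E) (coord K : E → G) (mulC K G (e, 0)) := by
      rw [e4]; exact hd
    have h2 : (mfderiv 𝓘(K, E) 𝓘(K, E) ((coord K : E → G) ∘ fun e' : E => mulC K G (e, e')) 0 :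
        E →L[K] E) = D.comp (frame K G e) := by
      refine (mfderiv_comp (I' := 𝓘(K, E)) (0 : E) hd' hm).trans ?_
      rw [mfderiv_eq_fderiv, e5.fderiv, e4]
      rfl
    have h3 : (mfderiv 𝓘(K, E) 𝓘(K, E) ((fun b : G => coord K e * b) ∘ (coord K : E → G)) 0 :
        E →L[K] E) = (mfderiv 𝓘(K, E) 𝓘(K, E) (fun b : G => coord K e * b) 1 : E →L[K] E) := by
      refine (mfderiv_comp (I' := 𝓘(K, E)) (0 : E) hL0 hd0).trans ?_
      rw [mfderiv_coord_zero, coord_zero]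
      rfl
    have h4 : ((coord K : E → G) ∘ fun e' => mulC K G (e, e')) =ᶠ[𝓝 0]
        ((fun b : G => coord K e * b) ∘ (coord K : E → G)) := e3
    have h5 : (mfderiv 𝓘(K, E) 𝓘(K, E) ((coord K : E → G) ∘ fun e' : E => mulC K G (e, e')) 0 :
        E →L[K] E) =
        (mfderiv 𝓘(K, E) 𝓘(K, E) ((fun b : G => coord K e * b) ∘ (coord K : E → G)) 0 :
        E →L[K] E) := h4.mfderiv_eq
    exact congrArg (fun D : E →L[K] E => D ξ) (h2.symm.trans (h5.trans h3))
  change (mfderiv 𝓘(K, E) 𝓘(K, E) (coord K : E → G) e : E →L[K] E).inverse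
    ((mfderiv 𝓘(K, E) 𝓘(K, E) (fun b : G => coord K e * b) 1 : E →L[K] E) ξ) = _
  rw [← h1]
  exact hinv.inverse_apply_self _

/-- Pullback along the local diffeomorphism `coord` respects brackets, and left invariant fields
bracket to left invariant fields. Hence the frame has constant structure constants, those of the Lie
algebra. -/
theorem eventually_lieBracket_frame [CompleteSpace E] :
    ∀ᶠ e in 𝓝 (0 : E), ∀ ξ η : GroupLieAlgebra 𝓘(K, E) G,
      VectorField.lieBracket K (fun e => frame (E := E) K G e ξ) (fun e => frame (E := E) K G e η) e =
        frame (E := E) K G e (⁅ξ, η⁆ : GroupLieAlgebra 𝓘(K, E) G) := by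
  have hG : LieGroup 𝓘(K, E) (minSmoothness K 3) G := LieGroup.of_le (n := ω) le_top
  have hp := eventually_mpullback_coord K (E := E) (G := G)
  filter_upwards [hp.eventually_nhds, eventually_contMDiffAt_coord K (E := E) (G := G)]
    with e hp hc ξ η
  have h := VectorField.mpullback_mlieBracket (n := ω) (I := 𝓘(K, E)) (I' := 𝓘(K, E))
    (f := (coord K : E → G)) (x₀ := e)
    (V := mulInvariantVectorField ξ) (W := mulInvariantVectorField η)
    (mdifferentiableAt_mulInvariantVectorField _) (mdifferentiableAt_mulInvariantVectorField _)
    hc le_top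
  rw [← mulInvariantVector_mlieBracket, ← GroupLieAlgebra.bracket_def,
    hp.self_of_nhds ⁅ξ, η⁆] at h
  have h1 : VectorField.mpullback 𝓘(K, E) 𝓘(K, E) (coord K : E → G)
      (mulInvariantVectorField ξ) =ᶠ[𝓝 e] fun e => frame (E := E) K G e ξ := hp.mono fun _ h => h ξ
  have h2 : VectorField.mpullback 𝓘(K, E) 𝓘(K, E) (coord K : E → G)
      (mulInvariantVectorField η) =ᶠ[𝓝 e] fun e => frame (E := E) K G e η := hp.mono fun _ h => h η
  rw [h1.mlieBracket_vectorField_eq h2] at h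
  have h3 := VectorField.mlieBracketWithin_eq_lieBracketWithin (𝕜 := K) (E := E)
    (V := fun e => frame (E := E) K G e ξ) (W := fun e => frame (E := E) K G e η) (s := Set.univ)
  rw [VectorField.lieBracketWithin_univ] at h3
  exact (congrFun h3 e).symm.trans h.symm

end Coordinates

end LocAnCohom

/-! ### Multilinear algebra of alternating maps -/

section Alternating

variable {K : Type*} [NontriviallyNormedField K]
  {E : Type*} [NormedAddCommGroup E] [NormedSpace K E]
  {W : Type*} [NormedAddCommGroup W] [NormedSpace K W]

/-- Alternatization of continuous multilinear maps is continuous. -/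
noncomputable def ContinuousMultilinearMap.alternatizationL (K E W : Type*)
    [NontriviallyNormedField K] [NormedAddCommGroup E] [NormedSpace K E]
    [NormedAddCommGroup W] [NormedSpace K W] (q : ℕ) :
    ContinuousMultilinearMap K (fun _ : Fin q => E) W →L[K] E [⋀^Fin q]→L[K] W :=
  LinearMap.mkContinuous
    { toFun f := ContinuousMultilinearMap.alternatization f
      map_add' f g := map_add _ f g
      map_smul' a f := by
        ext v
        simp only [ContinuousMultilinearMap.alternatization_apply_apply, RingHom.id_apply,
          ContinuousAlternatingMap.smul_apply, _root_.smul_apply,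
          Finset.smul_sum]
        exact Finset.sum_congr rfl fun σ _ => smul_comm _ _ _ }
    (Fintype.card (Equiv.Perm (Fin q))) fun f => by
      refine ContinuousAlternatingMap.opNorm_le_bound _ (by positivity) fun m => ?_
      simp only [LinearMap.coe_mk, AddHom.coe_mk,
        ContinuousMultilinearMap.alternatization_apply_apply]
      refine (norm_sum_le _ _).trans ?_
      have : ∀ σ ∈ (Finset.univ : Finset (Equiv.Perm (Fin q))),
          ‖Equiv.Perm.sign σ • f (m ∘ σ)‖ ≤ ‖f‖ * ∏ i, ‖m i‖ := by
        intro σ _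
        have h1 : ‖Equiv.Perm.sign σ • f (m ∘ σ)‖ = ‖f (m ∘ σ)‖ := by
          rcases Int.units_eq_one_or (Equiv.Perm.sign σ) with h | h <;> simp [h]
        rw [h1]
        refine (f.le_opNorm _).trans (le_of_eq ?_)
        congr 1
        exact Equiv.prod_comp σ fun i => ‖m i‖
      refine (Finset.sum_le_card_nsmul _ _ _ this).trans (le_of_eq ?_)
      rw [nsmul_eq_mul, Finset.card_univ, mul_assoc]

/-- In characteristic zero, the projection of multilinear onto alternating maps. -/
noncomputable def ContinuousMultilinearMap.altProj (K E W : Type*)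
    [NontriviallyNormedField K] [NormedAddCommGroup E] [NormedSpace K E]
    [NormedAddCommGroup W] [NormedSpace K W] (q : ℕ) :
    ContinuousMultilinearMap K (fun _ : Fin q => E) W →L[K] E [⋀^Fin q]→L[K] W :=
  ((q.factorial : K)⁻¹) • ContinuousMultilinearMap.alternatizationL K E W q

theorem ContinuousMultilinearMap.altProj_apply {q : ℕ}
    (f : ContinuousMultilinearMap K (fun _ : Fin q => E) W) (v : Fin q → E) :
    ContinuousMultilinearMap.altProj K E W q f v =
      (q.factorial : K)⁻¹ • ∑ σ : Equiv.Perm (Fin q), Equiv.Perm.sign σ • f (v ∘ σ) := by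
  rw [← ContinuousMultilinearMap.alternatization_apply_apply]
  rfl

theorem AlternatingMap.inv_factorial_smul_sum [CharZero K] {E' V : Type*} [AddCommGroup E']
    [Module K E'] [AddCommGroup V] [Module K V] {q : ℕ} (η : E' [⋀^Fin q]→ₗ[K] V) (v : Fin q → E') :
    (q.factorial : K)⁻¹ • ∑ σ : Equiv.Perm (Fin q), Equiv.Perm.sign σ • η (v ∘ σ) = η v := by
  have h : ∀ σ ∈ (Finset.univ : Finset (Equiv.Perm (Fin q))),
      Equiv.Perm.sign σ • η (v ∘ σ) = η v := by
    intro σ _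
    rw [η.map_perm, smul_smul, Int.units_mul_self, one_smul]
  rw [Finset.sum_congr rfl h, Finset.sum_const, Finset.card_univ, Fintype.card_perm,
    Fintype.card_fin, ← Nat.cast_smul_eq_nsmul K, smul_smul, inv_mul_cancel₀, one_smul]
  exact_mod_cast q.factorial_ne_zero

theorem ContinuousMultilinearMap.altProj_coe [CharZero K] {q : ℕ} (f : E [⋀^Fin q]→L[K] W) :
    ContinuousMultilinearMap.altProj K E W q f.toContinuousMultilinearMap = f := by
  ext v
  rw [altProj_apply]
  exact f.toAlternatingMap.inv_factorial_smul_sum v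

/-- Pullback of alternating forms is analytic in the form and the linear map. -/
theorem ContDiffAt.compContinuousLinearMap_alternating [CharZero K] {F : Type*}
    [NormedAddCommGroup F] [NormedSpace K F] {q : ℕ} {φ : F → E [⋀^Fin q]→L[K] W}
    {a : F → E →L[K] E} {z : F} (hφ : ContDiffAt K ω φ z) (ha : ContDiffAt K ω a z) :
    ContDiffAt K ω (fun z => (φ z).compContinuousLinearMap (a z)) z := by
  -- Composition is polynomial on multilinear maps. The result is brought back to alternating maps
  -- by the projection `altProj`, which requires characteristic 0 and is the identity on alternating
  -- maps.
  let P := ContinuousMultilinearMap.altProj K E W q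
  let C := ContinuousMultilinearMap.compContinuousLinearMapContinuousMultilinear K
    (fun _ : Fin q => E) (fun _ : Fin q => E) W
  let ι := ContinuousAlternatingMap.toContinuousMultilinearMapCLM (𝕜 := K) K (E := E) (F := W)
    (ι := Fin q)
  have h1 : ContDiffAt K ω (fun z => C (fun _ => a z)) z :=
    ContDiffAt.comp z (g := C) C.contDiff.contDiffAt (contDiffAt_pi.2 fun _ => ha)
  have h2 : ContDiffAt K ω (fun z => ι (φ z)) z :=
    ContDiffAt.comp z (g := ι) ι.contDiff.contDiffAt hφ
  have h3 : ContDiffAt K ω (fun z => P (C (fun _ => a z) (ι (φ z)))) z :=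
    ContDiffAt.comp z (g := P) P.contDiff.contDiffAt (h1.clm_apply h2)
  refine h3.congr_of_eventuallyEq (.of_forall fun z => ?_)
  exact (ContinuousMultilinearMap.altProj_coe ((φ z).compContinuousLinearMap (a z))).symm

/-- Pairs i < j correspond to pairs i ≤ j - 1. This matches the indexing of the Chevalley-Eilenberg
sum with that of the formula for d on vector fields. -/
theorem Fin.sum_sum_Iio_eq {N : Type*} [AddCommMonoid N] {n : ℕ}
    (f : Fin (n + 2) → Fin (n + 2) → N) :
    ∑ j, ∑ i ∈ Finset.Iio j, f i j =
      ∑ i : Fin (n + 1), ∑ j ∈ Finset.Ici i, f i.castSucc j.succ := by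
  have h0 : (Finset.Iio (0 : Fin (n + 2))) = ∅ := by
    ext i; simp
  rw [Fin.sum_univ_succ, h0, Finset.sum_empty, zero_add,
    Finset.sum_comm' (t' := Finset.univ) (s' := fun j => Finset.Iic j) (by simp)]
  refine Finset.sum_congr rfl fun j _ => ?_
  have : Finset.Iio j.succ = (Finset.Iic j).map Fin.castSuccEmb := by
    rw [Fin.map_castSuccEmb_Iic]
    ext i
    simp [Fin.lt_def, Fin.le_def]
  rw [this, Finset.sum_map]
  rfl

/-- Moving the bracket from position i to the front takes i transpositions. One side is the
convention of the Chevalley-Eilenberg differential, the other that of the exterior derivative. -/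
theorem ContinuousAlternatingMap.map_removeNth_update {q : ℕ} (φ : E [⋀^Fin (q + 1)]→L[K] W)
    (x : Fin (q + 2) → E) (b : E) {i j : Fin (q + 1)} (hij : i ≤ j) :
    φ (j.succ.removeNth (Function.update x i.castSucc b)) =
      (-1 : ℤ) ^ (i : ℕ) • φ (Matrix.vecCons b (j.removeNth (i.castSucc.removeNth x))) := by
  have h : j.succ.removeNth (Function.update x i.castSucc b) =
      i.insertNth b (j.removeNth (i.castSucc.removeNth x)) := by
    funext k
    refine Fin.succAboveCases i ?_ (fun l => ?_) k
    · rw [Fin.insertNth_apply_same, Fin.removeNth, Fin.succAbove_of_castSucc_lt _ _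
        (Fin.castSucc_lt_succ_iff.2 hij), Function.update_self]
    · rw [Fin.insertNth_apply_succAbove, Fin.removeNth, Fin.removeNth, Fin.removeNth]
      have e1 : j.succ.succAbove (i.succAbove l) = i.castSucc.succAbove (j.succAbove l) := by
        ext
        simp only [Fin.succAbove, Fin.lt_def, Fin.val_castSucc, Fin.val_succ]
        have := Fin.le_def.1 hij
        split_ifs <;> simp_all <;> omega
      rw [e1, Function.update_of_ne (Fin.succAbove_ne _ _)]
  rw [h, φ.map_insertNth]

/-- The Chevalley-Eilenberg expression in a frame. -/
noncomputable def ceFrame (a : E → E →L[K] E) (br : E → E → E) {q : ℕ}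
    (φ : E → E [⋀^Fin q]→L[K] W) (e : E) (x : Fin (q + 1) → E) : W :=
  ∑ i : Fin (q + 1), (-1 : ℤ) ^ (i : ℕ) • fderiv K φ e (a e (x i)) (i.removeNth x) +
    ∑ j : Fin (q + 1), ∑ i ∈ Finset.Iio j, (-1 : ℤ) ^ (j : ℕ) •
      φ e (j.removeNth (Function.update x i (br (x i) (x j))))

/-- The exterior derivative in a frame of vector fields with constant structure constants. -/
theorem extDeriv_frame {a : E → E →L[K] E} {br : E → E → E} {e : E} {q : ℕ}
    {φ : E → E [⋀^Fin q]→L[K] W} (ha : DifferentiableAt K a e)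
    (hinv : ∀ᶠ e' in 𝓝 e, (a e').IsInvertible)
    (hai : DifferentiableAt K (fun e => (a e).inverse) e)
    (hbr : ∀ ξ η, VectorField.lieBracket K (fun e => a e ξ) (fun e => a e η) e = a e (br ξ η))
    (hφ : DifferentiableAt K φ e) (x : Fin (q + 1) → E) :
    extDeriv (fun e => (φ e).compContinuousLinearMap (a e).inverse) e (fun i => a e (x i)) =
      ceFrame a br φ e x := by
  have hθ : DifferentiableAt K (fun e => (φ e).compContinuousLinearMap (a e).inverse) e :=
    hφ.continuousAlternatingMapCompContinuousLinearMap hai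
  have hV : ∀ i, DifferentiableAt K (fun e => a e (x i)) e := fun i =>
    ha.clm_apply (differentiableAt_const _)
  -- On frame fields the inverse frame cancels, leaving φ on constant vectors, so only φ gets
  -- differentiated.
  have hfirst : ∀ i : Fin (q + 1), fderiv K (fun e => (φ e).compContinuousLinearMap (a e).inverse
      (i.removeNth fun j => a e (x j))) e (a e (x i)) =
        fderiv K φ e (a e (x i)) (i.removeNth x) := by
    intro i
    have h1 : (fun e => (φ e).compContinuousLinearMap (a e).inverse
        (i.removeNth fun j => a e (x j))) =ᶠ[𝓝 e] fun e => φ e (i.removeNth x) := by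
      filter_upwards [hinv] with e' he'
      rw [ContinuousAlternatingMap.compContinuousLinearMap_apply]
      congr 1
      funext k
      exact he'.inverse_apply_self _
    let ev := ContinuousAlternatingMap.apply K E W (i.removeNth x)
    have h2 : HasFDerivAt (fun e => φ e (i.removeNth x)) (ev.comp (fderiv K φ e)) e :=
      HasFDerivAt.comp (g := ev) e ev.hasFDerivAt hφ.hasFDerivAt
    rw [h1.fderiv_eq, h2.fderiv]
    rfl
  -- For q = 0 there is a single vector field and the bracket sum is empty; the general formula
  -- needs at least two fields.
  cases q with
  | zero =>
    have h := extDeriv_apply_vectorField_of_pairwise_commute (V := fun i e => a e (x i)) hθ hV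
      (fun i j hij => absurd (Subsingleton.elim (α := Fin 1) i j) hij)
    rw [h, ceFrame]
    have h0 : ∑ j : Fin (0 + 1), ∑ i ∈ Finset.Iio j, (-1 : ℤ) ^ (j : ℕ) •
        φ e (j.removeNth (Function.update x i (br (x i) (x j)))) = 0 := by
      refine Finset.sum_eq_zero fun j _ => Finset.sum_eq_zero fun i hi => ?_
      rw [Subsingleton.elim (α := Fin 1) i j] at hi
      simp at hi
    rw [h0, add_zero]
    exact Finset.sum_congr rfl fun i _ => by rw [hfirst i]
  | succ q =>
    have h := extDeriv_apply_vectorField (V := fun i e => a e (x i)) hθ hV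
    rw [h, ceFrame, sub_eq_add_neg]
    congr 1
    · exact Finset.sum_congr rfl fun i _ => by rw [hfirst i]
    · rw [Fin.sum_sum_Iio_eq, ← Finset.sum_neg_distrib]
      refine Finset.sum_congr rfl fun i _ => ?_
      rw [← Finset.sum_neg_distrib]
      refine Finset.sum_congr rfl fun j hj => ?_
      rw [ContinuousAlternatingMap.map_removeNth_update _ _ _ (Finset.mem_Ici.1 hj), smul_smul,
        ← pow_add, hbr, ContinuousAlternatingMap.compContinuousLinearMap_apply, Fin.val_succ]
      have h1 : (fun k => (a e).inverse (Matrix.vecCons (a e (br (x i.castSucc) (x j.succ)))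
          (j.removeNth (i.castSucc.removeNth fun i => a e (x i))) k)) =
          Matrix.vecCons (br (x i.castSucc) (x j.succ)) (j.removeNth (i.castSucc.removeNth x)) := by
        funext k
        refine Fin.cases ?_ (fun l => ?_) k
        · exact hinv.self_of_nhds.inverse_apply_self _
        · exact hinv.self_of_nhds.inverse_apply_self _
      have h2 : (-1 : ℤ) ^ ((j : ℕ) + 1 + (i : ℕ)) = - (-1 : ℤ) ^ ((i : ℕ) + (j : ℕ)) := by ring
      rw [h2, neg_smul]
      congr 3

end Alternating

namespace LocAnCohom

/-! ### Analytic families of alternating forms factor through one Banach space -/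

section Factor

variable {K : Type u} [NontriviallyNormedField K] [CompleteSpace K]
  {E : Type u} [NormedAddCommGroup E] [NormedSpace K E] [FiniteDimensional K E]
  {V : Type u} [AddCommGroup V] [Module K V] [TopologicalSpace V] [T2Space V]
  [IsTopologicalAddGroup V] [ContinuousSMul K V]
  {F : Type u} [NormedAddCommGroup F] [NormedSpace K F]
  {H : Type u} [TopologicalSpace H] {I : ModelWithCorners K F H}
  {M : Type u} [TopologicalSpace M] [ChartedSpace H M]

/-- A finite family of analytic functions factors through a single Banach space. -/
theorem exists_pi_factor {ι : Type} [Fintype ι] [DecidableEq ι] (f : ι → M → V) (x : M)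
    (hf : ∀ i, IsAnAt K I (f i) x) :
    ∃ (W : ι → BHSpace K V) (φ : M → ∀ i, (W i).carrier),
      ContMDiffAt I 𝓘(K, ∀ i, (W i).carrier) ω φ x ∧
        ∀ᶠ y in 𝓝 x, ∀ i, f i y = (W i).incl (φ y i) := by
  choose W φ hφ h using hf
  exact ⟨W, fun y i => φ i y, contMDiffAt_pi_space.2 hφ, eventually_all.2 h⟩

/-- Over a basis of E, finitely many values determine the form, so the product of their Banach
spaces carries the whole family. Since `L` adds up the inclusions it need not be injective, and φ is
only multilinear; both defects are repaired in `exists_alternating_factor`. -/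
theorem exists_multilinear_factor {q : ℕ} (f : M → E [⋀^Fin q]→ₗ[K] V) (x : M)
    (hf : ∀ ξ, IsAnAt K I (fun y => f y ξ) x) :
    ∃ (W : Type u) (_ : NormedAddCommGroup W) (_ : NormedSpace K W) (_ : IsUltrametricDist W)
      (_ : CompleteSpace W) (L : W →L[K] V)
      (φ : M → ContinuousMultilinearMap K (fun _ : Fin q => E) W),
      ContMDiffAt I 𝓘(K, ContinuousMultilinearMap K (fun _ : Fin q => E) W) ω φ x ∧
        ∀ᶠ y in 𝓝 x, ∀ ξ, f y ξ = L (φ y ξ) := by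
  classical
  let b := Module.finBasis K E
  let ι := Fin q → Fin (Module.finrank K E)
  obtain ⟨W, φ, hφ, h⟩ := exists_pi_factor (I := I) (fun (c : ι) y => f y fun i => b (c i)) x
    fun c => hf _
  let m : ι → ContinuousMultilinearMap K (fun _ : Fin q => E) K := fun c =>
    (ContinuousMultilinearMap.mkPiAlgebra K (Fin q) K).compContinuousLinearMap
      fun i => LinearMap.toContinuousLinearMap (b.coord (c i))
  let T : (∀ c, (W c).carrier) →L[K] ContinuousMultilinearMap K (fun _ : Fin q => E)
      (∀ c, (W c).carrier) :=
    ∑ c, (ContinuousMultilinearMap.smulRightL K (fun _ : Fin q => E) (∀ c, (W c).carrier) (m c)).comp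
      ((ContinuousLinearMap.single K (fun c => (W c).carrier) c).comp
        (ContinuousLinearMap.proj c))
  let L : (∀ c, (W c).carrier) →L[K] V := ∑ c, (W c).incl.comp (ContinuousLinearMap.proj c)
  refine ⟨∀ c, (W c).carrier, inferInstance, inferInstance, inferInstance, inferInstance,
    L, fun y => T (φ y), ?_, ?_⟩
  · exact T.contMDiff.contMDiffAt.comp x hφ
  · filter_upwards [h] with y hy ξ
    have h1 : T (φ y) ξ = ∑ c, m c ξ • Pi.single c (φ y c) := by
      simp [T, sum_apply]
    have h2 : ∀ c w, L (Pi.single c w) = (W c).incl w := by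
      intro c w
      simp only [L, sum_apply, ContinuousLinearMap.comp_apply,
        ContinuousLinearMap.proj_apply]
      rw [Finset.sum_eq_single c]
      · rw [Pi.single_eq_same]
      · intro d _ hd
        rw [Pi.single_eq_of_ne hd, map_zero]
      · simp
    rw [h1, map_sum]
    simp only [map_smul, h2]
    have h3 : ξ = fun i => ∑ j, b.repr (ξ i) j • b j := by
      funext i
      exact (b.sum_repr (ξ i)).symm
    conv_lhs => rw [h3]
    have h4 := (f y).toMultilinearMap.map_sum fun (i : Fin q) j => b.repr (ξ i) j • b j
    refine h4.trans ?_
    refine Finset.sum_congr rfl fun c _ => ?_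
    have h5 := (f y).toMultilinearMap.map_smul_univ (fun i => b.repr (ξ i) (c i)) fun i => b (c i)
    refine h5.trans ?_
    rw [← hy c]
    simp [m]

/-- An analytic family of alternating forms factors through a BH-space. -/
theorem exists_alternating_factor [CharZero K] {q : ℕ} (f : M → E [⋀^Fin q]→ₗ[K] V) (x : M)
    (hf : ∀ ξ, IsAnAt K I (fun y => f y ξ) x) :
    ∃ (W : BHSpace K V) (φ : M → E [⋀^Fin q]→L[K] W.carrier),
      ContMDiffAt I 𝓘(K, E [⋀^Fin q]→L[K] W.carrier) ω φ x ∧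
        ∀ᶠ y in 𝓝 x, ∀ ξ, f y ξ = W.incl (φ y ξ) := by
  obtain ⟨W, i1, i2, i3, i4, L, φ, hφ, h⟩ := exists_multilinear_factor (I := I) f x hf
  have hcl : IsClosed ((LinearMap.ker L.toLinearMap : Submodule K W) : Set W) := L.isClosed_ker
  have := isUltrametricDist_quotient (LinearMap.ker L.toLinearMap)
  let π : W →L[K] W ⧸ LinearMap.ker L.toLinearMap := (LinearMap.ker L.toLinearMap).mkQL
  let W' : BHSpace K V :=
    { carrier := W ⧸ LinearMap.ker L.toLinearMap
      incl := (LinearMap.ker L.toLinearMap).liftQL L le_rfl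
      incl_injective := by
        intro a b h
        exact LinearMap.ker_eq_bot.1 (Submodule.ker_liftQ_eq_bot _ _ _ le_rfl) h }
  -- Dividing by the kernel of `L` has made the map to V injective. Antisymmetrizing φ does not
  -- change its image in V, because f is alternating there.
  let A : ContinuousMultilinearMap K (fun _ : Fin q => E) W →L[K] E [⋀^Fin q]→L[K] W'.carrier :=
    (ContinuousMultilinearMap.altProj K E W'.carrier q).comp
      (ContinuousLinearMap.compContinuousMultilinearMapL K (fun _ : Fin q => E) W
        (W ⧸ LinearMap.ker L.toLinearMap) π)
  refine ⟨W', fun y => A (φ y), ?_, ?_⟩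
  · exact A.contMDiff.contMDiffAt.comp x hφ
  · filter_upwards [h] with y hy ξ
    have h1 : A (φ y) ξ = (q.factorial : K)⁻¹ •
        ∑ σ : Equiv.Perm (Fin q), Equiv.Perm.sign σ • π (φ y (ξ ∘ σ)) :=
      ContinuousMultilinearMap.altProj_apply _ _
    have h2 : ∀ w, W'.incl (π w) = L w := fun w => rfl
    rw [h1, map_smul, map_sum, ← (f y).inv_factorial_smul_sum ξ]
    congr 1
    refine Finset.sum_congr rfl fun σ _ => ?_
    rw [Units.smul_def, Units.smul_def, map_zsmul, h2, hy]

/-- The previous factorization in coordinates on the first factor. -/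
theorem exists_alternating_factor_coord [CharZero K] [I.Boundaryless] [IsManifold I ω M] {q : ℕ}
    (f : M → E → E [⋀^Fin q]→ₗ[K] V) (x : M)
    (hf : ∀ ξ, IsAnAt K (I.prod 𝓘(K, E)) (fun p : M × E => f p.1 p.2 ξ) (x, 0)) :
    ∃ (W : BHSpace K V) (φ : F × E → E [⋀^Fin q]→L[K] W.carrier),
      AnalyticAt K φ (extChartAt I x x, 0) ∧
        ∀ᶠ p in 𝓝 (x, (0 : E)), ∀ ξ, f p.1 p.2 ξ = W.incl (φ (extChartAt I x p.1, p.2) ξ) := by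
  obtain ⟨W, φ, hφ, h⟩ := exists_alternating_factor (I := I.prod 𝓘(K, E))
    (fun p : M × E => f p.1 p.2) (x, 0) hf
  refine ⟨W, fun z => φ ((extChartAt I x).symm z.1, z.2), ?_, ?_⟩
  · have h1 : ContMDiffAt 𝓘(K, F) I ω (extChartAt I x).symm (extChartAt I x x) :=
      (contMDiffOn_extChartAt_symm x).contMDiffAt (extChartAt_target_mem_nhds x)
    have h2 : ContMDiffAt (𝓘(K, F).prod 𝓘(K, E)) (I.prod 𝓘(K, E)) ω
        (fun z : F × E => ((extChartAt I x).symm z.1, z.2)) (extChartAt I x x, 0) :=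
      (h1.comp (extChartAt I x x, (0 : E)) (f := Prod.fst) contMDiffAt_fst).prodMk contMDiffAt_snd
    have h3 : ContMDiffAt (I.prod 𝓘(K, E)) 𝓘(K, E [⋀^Fin q]→L[K] W.carrier) ω φ
        ((extChartAt I x).symm (extChartAt I x x), 0) := by
      rw [extChartAt_to_inv]; exact hφ
    have h4 := h3.comp ((extChartAt I x x, 0) : F × E) h2
    rw [← modelWithCornersSelf_prod, chartedSpaceSelf_prod] at h4
    exact (contMDiffAt_iff_contDiffAt.1 h4).analyticAt
  · have h1 : ∀ᶠ p in 𝓝 (x, (0 : E)), p.1 ∈ (extChartAt I x).source :=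
      (continuous_fst.tendsto _).eventually (extChartAt_source_mem_nhds x)
    filter_upwards [h, h1] with p hp hs ξ
    rw [hp]
    simp only [PartialEquiv.left_inv _ hs]

end Factor

end LocAnCohom

/-- The derivative of the slice is the full derivative in the direction (0, a e x), so the
expression stays analytic in parameters and coordinates jointly. This is why d preserves
admissibility. -/
theorem contDiffAt_ceFrame {K : Type*} [NontriviallyNormedField K]
    {E : Type*} [NormedAddCommGroup E] [NormedSpace K E]
    {W : Type*} [NormedAddCommGroup W] [NormedSpace K W]
    {F : Type*} [NormedAddCommGroup F] [NormedSpace K F]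
    {a : E → E →L[K] E} (br : E → E → E) {q : ℕ} {φ : F × E → E [⋀^Fin q]→L[K] W} {z : F × E}
    (hφ : ContDiffAt K ω φ z) (ha : ContDiffAt K ω a z.2) (x : Fin (q + 1) → E) :
    ContDiffAt K ω (fun z => ceFrame a br (fun e => φ (z.1, e)) z.2 x) z := by
  have ha' : ContDiffAt K ω (fun z : F × E => a z.2) z := ha.comp z contDiffAt_snd
  have h1 : ∀ (c : Fin q → E) (y : E),
      ContDiffAt K ω (fun z : F × E => fderiv K φ z (0, a z.2 y) c) z := by
    intro c y
    have h2 : ContDiffAt K ω (fderiv K φ) z := hφ.fderiv_right (m := ω) le_top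
    exact ContDiffAt.clm_apply_fun (B := E [⋀^Fin q]→L[K] W)
      (ContinuousAlternatingMap.apply K E W c)
      (h2.clm_apply (contDiffAt_const.prodMk (ha'.clm_apply contDiffAt_const)))
  have h3 : ∀ c : Fin q → E, ContDiffAt K ω (fun z : F × E => φ z c) z := fun c =>
    ContDiffAt.clm_apply_fun (B := E [⋀^Fin q]→L[K] W) (ContinuousAlternatingMap.apply K E W c) hφ
  have h4 : ContDiffAt K ω (fun z : F × E =>
      ∑ i : Fin (q + 1), (-1 : ℤ) ^ (i : ℕ) • fderiv K φ z (0, a z.2 (x i)) (i.removeNth x) +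
    ∑ j : Fin (q + 1), ∑ i ∈ Finset.Iio j, (-1 : ℤ) ^ (j : ℕ) •
      φ z (j.removeNth (Function.update x i (br (x i) (x j))))) z := by
    have hz : ∀ (m : ℤ) {f : F × E → W}, ContDiffAt K ω f z →
        ContDiffAt K ω (fun z => m • f z) z := by
      intro m f hf
      refine (hf.const_smul (m : K)).congr_of_eventuallyEq (.of_forall fun z => ?_)
      exact (Int.cast_smul_eq_zsmul K m (f z)).symm
    refine ContDiffAt.add (ContDiffAt.sum fun i _ => hz _ (h1 _ _))
      (ContDiffAt.sum fun j _ => ContDiffAt.sum fun i _ => hz _ (h3 _))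
  refine h4.congr_of_eventuallyEq ?_
  filter_upwards [hφ.eventually (by simp)] with z hz
  simp only [ceFrame]
  rw [fderiv_slice (hz.differentiableAt (by simp))]
  rfl

namespace LocAnCohom

/-! ### Left invariant derivatives -/

section LeftDerivative

variable {K : Type u} [NontriviallyNormedField K]
  {E : Type u} [NormedAddCommGroup E] [NormedSpace K E]
  {G : Type u} [TopologicalSpace G] [ChartedSpace E G] [Group G]
  {V : Type u} [AddCommGroup V] [Module K V] [TopologicalSpace V]

variable (K G) in
/-- The Lie bracket of `𝔤`, as an operation on the model space. -/
noncomputable def lieBr (ξ η : E) : E :=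
  Bracket.bracket (L := GroupLieAlgebra 𝓘(K, E) G) (M := GroupLieAlgebra 𝓘(K, E) G) ξ η

variable (K G) in
/-- A coordinate vector near which coordinates, multiplication and frame behave as expected. -/
structure IsRegularCoord (e : E) : Prop where
  contMDiffAt_coord : ContMDiffAt 𝓘(K, E) 𝓘(K, E) ω (coord K : E → G) e
  contMDiffAt_coordInv : ContMDiffAt 𝓘(K, E) 𝓘(K, E) ω (coordInv K E : G → E) (coord K e)
  coordInv_coord : coordInv K E (coord K e : G) = e
  coord_coordInv : ∀ᶠ g in 𝓝 (coord K e : G), coord K (coordInv K E g) = g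
  mulC_zero : mulC K G (e, 0) = e
  coord_mulC : ∀ᶠ e' in 𝓝 (0 : E), (coord K (mulC K G (e, e')) : G) = coord K e * coord K e'
  hasFDerivAt_mulC : HasFDerivAt (fun e' => mulC K G (e, e')) (frame K G e) 0
  contDiffAt_frame : ContDiffAt K ω (frame K G : E → E →L[K] E) e
  contDiffAt_frame_inverse : ContDiffAt K ω (fun e : E => (frame K G e).inverse) e
  isInvertible : ∀ᶠ e' in 𝓝 e, (frame K G e').IsInvertible
  lieBracket_frame : ∀ ξ η : E, VectorField.lieBracket K (fun e => frame K G e ξ)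
    (fun e => frame K G e η) e = frame K G e (lieBr K G ξ η)

theorem eventually_isRegularCoord [LieGroup 𝓘(K, E) ω G] [CompleteSpace E] :
    ∀ᶠ e in 𝓝 (0 : E), IsRegularCoord K G e := by
  filter_upwards [eventually_contMDiffAt_coord K (E := E) (G := G),
    (tendsto_coord K (E := E) (G := G)).eventually
      (eventually_contMDiffAt_coordInv K (E := E) (G := G)),
    eventually_coordInv_coord K (E := E) (G := G),
    (tendsto_coord K (E := E) (G := G)).eventually
      (eventually_coord_coordInv K (E := E) (G := G)).eventually_nhds,
    eventually_mulC_zero K (E := E) (G := G),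
    (eventually_coord_mulC K (E := E) (G := G)).curry_nhds,
    eventually_hasFDerivAt_frame K (E := E) (G := G),
    eventually_contDiffAt_frame K (E := E) (G := G),
    (contDiffAt_frame_inverse K (E := E) (G := G)).eventually (by simp),
    (eventually_frame_isInvertible K (E := E) (G := G)).eventually_nhds,
    eventually_lieBracket_frame K (E := E) (G := G)] with e h1 h2 h3 h4 h5 h6 h7 h8 h9 h10 h11
  exact ⟨h1, h2, h3, h4, h5, h6, h7, h8, h9, h10, h11⟩

variable (K) in
/-- The derivative of `ψ` at `h` along the left invariant vector field attached to `ξ`. -/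
noncomputable def lDeriv (ξ : E) (ψ : G → V) (h : G) : V :=
  limUnder (𝓝[≠] (0 : K)) fun t : K => t⁻¹ • (ψ (h * chartLine K E ξ t) - ψ h)

variable {W : Type u} [NormedAddCommGroup W] [NormedSpace K W]

/-- Moving from h₀ * `coord` e along the left invariant field means replacing e by `mulC` (e, tξ),
so the chain rule produces the frame. As `lDeriv` is defined by `limUnder`, convergence has to be
proved before its value means anything. -/
theorem tendsto_lDeriv_aux (L : W →L[K] V) {φ : E → W} {e : E} (he : IsRegularCoord K G e)
    (hφ : DifferentiableAt K φ e) (h₀ : G) {ψ : G → V}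
    (hψ : ∀ᶠ e' in 𝓝 e, ψ (h₀ * coord K e') = L (φ e')) (ξ : E) :
    Tendsto (fun t : K => t⁻¹ • (ψ (h₀ * coord K e * chartLine K E ξ t) - ψ (h₀ * coord K e)))
      (𝓝[≠] 0) (𝓝 (L (fderiv K φ e (frame K G e ξ)))) := by
  have h1 : HasFDerivAt (fun e' => φ (mulC K G (e, e'))) ((fderiv K φ e).comp (frame K G e)) 0 := by
    have h2 : HasFDerivAt φ (fderiv K φ e) (mulC K G (e, 0)) := by
      rw [he.mulC_zero]; exact hφ.hasFDerivAt
    exact h2.comp (0 : E) he.hasFDerivAt_mulC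
  have h2 := (h1.hasLineDerivAt ξ).tendsto_slope_zero
  have h3 := (L.continuous.tendsto _).comp h2
  refine h3.congr' ?_
  have ht : Tendsto (fun t : K => t • ξ) (𝓝[≠] 0) (𝓝 0) := by
    have : Continuous fun t : K => t • ξ := by fun_prop
    have := this.tendsto 0
    rw [zero_smul] at this
    exact this.mono_left nhdsWithin_le_nhds
  have hm : Tendsto (fun e' => mulC K G (e, e')) (𝓝 0) (𝓝 e) := by
    have := he.hasFDerivAt_mulC.continuousAt
    rwa [ContinuousAt, he.mulC_zero] at this
  filter_upwards [ht.eventually he.coord_mulC, ht.eventually (hm.eventually hψ)] with t h4 h5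
  simp only [Function.comp_apply, zero_add, map_smul, map_sub, he.mulC_zero]
  rw [← h5, h4, ← hψ.self_of_nhds, chartLine_eq_coord, mul_assoc]

theorem lDeriv_eq [T2Space V] (L : W →L[K] V) {φ : E → W} {e : E} (he : IsRegularCoord K G e)
    (hφ : DifferentiableAt K φ e) (h₀ : G) {ψ : G → V}
    (hψ : ∀ᶠ e' in 𝓝 e, ψ (h₀ * coord K e') = L (φ e')) (ξ : E) :
    lDeriv K ξ ψ (h₀ * coord K e) = L (fderiv K φ e (frame K G e ξ)) :=
  (tendsto_lDeriv_aux L he hφ h₀ hψ ξ).limUnder_eq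

/-- The Chevalley-Eilenberg differential of forms on `G`, expressed in the frame of left invariant
vector fields. -/
noncomputable def dRaw {q : ℕ} (s : G → GroupLieAlgebra 𝓘(K, E) G [⋀^Fin q]→ₗ[K] V) (h : G)
    (x : Fin (q + 1) → GroupLieAlgebra 𝓘(K, E) G) : V :=
  ∑ i : Fin (q + 1), (-1 : ℤ) ^ (i : ℕ) • lDeriv K (E := E) (x i) (fun h => s h (i.removeNth x)) h +
    ∑ j : Fin (q + 1), ∑ i ∈ Finset.Iio j, (-1 : ℤ) ^ (j : ℕ) •
      s h (j.removeNth (Function.update x i ⁅x i, x j⁆))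

theorem dRaw_eq [T2Space V] {q : ℕ} (L : W →L[K] V) {φ : E → E [⋀^Fin q]→L[K] W} {e : E}
    (he : IsRegularCoord K G e) (hφ : DifferentiableAt K φ e) (h₀ : G)
    {s : G → GroupLieAlgebra 𝓘(K, E) G [⋀^Fin q]→ₗ[K] V}
    (hs : ∀ᶠ e' in 𝓝 e, ∀ ξ : Fin q → E, s (h₀ * coord K e') ξ = L (φ e' ξ))
    (x : Fin (q + 1) → GroupLieAlgebra 𝓘(K, E) G) :
    dRaw s (h₀ * coord K e) x = L (ceFrame (frame K G) (lieBr K G) φ e x) := by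
  unfold dRaw ceFrame
  rw [map_add, map_sum, map_sum]
  congr 1
  · refine Finset.sum_congr rfl fun i _ => ?_
    rw [map_zsmul]
    congr 1
    let ev := ContinuousAlternatingMap.apply K E W (i.removeNth (α := fun _ => E) x)
    have h2 : HasFDerivAt (fun e => φ e (i.removeNth (α := fun _ => E) x))
        (ev.comp (fderiv K φ e)) e :=
      HasFDerivAt.comp (g := ev) e ev.hasFDerivAt hφ.hasFDerivAt
    refine (lDeriv_eq L he h2.differentiableAt h₀ (hs.mono fun e' h => h _) (x i)).trans ?_
    rw [h2.fderiv]
    rfl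
  · refine Finset.sum_congr rfl fun j _ => ?_
    rw [map_sum]
    refine Finset.sum_congr rfl fun i _ => ?_
    rw [map_zsmul]
    congr 1
    exact hs.self_of_nhds _

/-- The form with left invariant coefficients φ is φ composed with the inverse frame. The expression
`dRaw` is its exterior derivative evaluated on frame vectors, so theorems about `extDeriv` transfer
to G. -/
theorem dRaw_eq_extDeriv [T2Space V] {q : ℕ} (L : W →L[K] V) {φ : E → E [⋀^Fin q]→L[K] W} {e : E}
    (he : IsRegularCoord K G e) (hφ : DifferentiableAt K φ e) (h₀ : G)
    {s : G → GroupLieAlgebra 𝓘(K, E) G [⋀^Fin q]→ₗ[K] V}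
    (hs : ∀ᶠ e' in 𝓝 e, ∀ ξ : Fin q → E, s (h₀ * coord K e') ξ = L (φ e' ξ))
    (x : Fin (q + 1) → GroupLieAlgebra 𝓘(K, E) G) :
    dRaw s (h₀ * coord K e) x =
      L (extDeriv (fun e => (φ e).compContinuousLinearMap (frame K G e).inverse) e
        (fun i => frame K G e (x i : E))) := by
  rw [dRaw_eq L he hφ h₀ hs x]
  congr 1
  exact (extDeriv_frame (he.contDiffAt_frame.differentiableAt (by simp)) he.isInvertible
    (he.contDiffAt_frame_inverse.differentiableAt (by simp)) he.lieBracket_frame hφ _).symm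

end LeftDerivative

/-! ### Admissible forms -/

section AdmissibleForms

variable {K : Type u} [NontriviallyNormedField K]
  {E : Type u} [NormedAddCommGroup E] [NormedSpace K E]
  {G : Type u} [TopologicalSpace G] [ChartedSpace E G] [Group G]

namespace LocAnRep

/-- Lie algebra cochains. -/
abbrev Cochain (V : LocAnRep K E G) (q : ℕ) : Type u :=
  GroupLieAlgebra 𝓘(K, E) G [⋀^Fin q]→ₗ[K] V

/-- Admissible families, parametrized by `X`, of differential forms on `G` with values in `V`. -/
def IsAdmForm (V : LocAnRep K E G) {q : ℕ} (X : AnMfd K) (f : X → G → V.Cochain q) : Prop :=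
  ∀ ξ, IsAn K (𝓘(K, E).prod (𝓘(K, X.model).prod 𝓘(K, E)))
    fun p : G × (X × G) => V.ρ p.1 (f p.2.1 p.2.2 ξ)

theorem ρ_inv_ρ (V : LocAnRep K E G) (g : G) (v : V) : V.ρ g⁻¹ (V.ρ g v) = v := by
  rw [← ρ_mul, inv_mul_cancel, ρ_one]

theorem ρ_ρ_inv (V : LocAnRep K E G) (g : G) (v : V) : V.ρ g (V.ρ g⁻¹ v) = v := by
  rw [← ρ_mul, mul_inv_cancel, ρ_one]

variable [LieGroup 𝓘(K, E) ω G] {V : LocAnRep K E G} {q : ℕ} {X : AnMfd K}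

/-- The group element g is kept as a parameter next to x, because acting by g need not preserve a
Banach space through which f factors. Admissibility provides one Banach space for all g near a given
point. -/
theorem IsAdmForm.exists_factor [CompleteSpace K] [FiniteDimensional K E] [CharZero K]
    {f : X → G → V.Cochain q} (hf : V.IsAdmForm X f) (y : G × X) (h₀ : G) :
    ∃ (W : BHSpace K V) (φ : (E × X.model) × E → E [⋀^Fin q]→L[K] W.carrier),
      AnalyticAt K φ (extChartAt (𝓘(K, E).prod 𝓘(K, X.model)) y y, 0) ∧
        ∀ᶠ p in 𝓝 (y, (0 : E)), ∀ ξ : Fin q → E,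
          V.ρ p.1.1 (f p.1.2 (h₀ * coord K p.2) ξ) =
            W.incl (φ (extChartAt (𝓘(K, E).prod 𝓘(K, X.model)) y p.1, p.2) ξ) := by
  have hm : ∀ ξ : Fin q → E, IsAnAt K ((𝓘(K, E).prod 𝓘(K, X.model)).prod 𝓘(K, E))
      (fun p : (G × X) × E => V.ρ p.1.1 (f p.1.2 (h₀ * coord K p.2) ξ)) (y, 0) := by
    intro ξ
    refine (hf ξ (y.1, (y.2, h₀ * coord K (0 : E)))).comp
      (r := fun p : (G × X) × E => (p.1.1, (p.1.2, h₀ * coord K p.2))) (y := (y, (0 : E))) ?_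
    have h1 : ContMDiffAt ((𝓘(K, E).prod 𝓘(K, X.model)).prod 𝓘(K, E)) 𝓘(K, E) ω
        (fun p : (G × X) × E => (coord K p.2 : G)) (y, 0) :=
      (eventually_contMDiffAt_coord K (E := E) (G := G)).self_of_nhds.comp (y, (0 : E))
        (f := Prod.snd) contMDiffAt_snd
    exact (contMDiffAt_fst.comp (y, (0 : E)) contMDiffAt_fst).prodMk
      ((contMDiffAt_snd.comp (y, (0 : E)) contMDiffAt_fst).prodMk (contMDiffAt_const.mul h1))
  exact exists_alternating_factor_coord (E := E)
    (fun (y : G × X) e => (V.ρ y.1 : V →L[K] V).toLinearMap.compAlternatingMap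
      (f y.2 (h₀ * coord K e))) y hm

/-- Analyticity can be checked in the coordinates given by left translates of the chart at `1`. -/
theorem isAnAt_of_coord {ψ : G × (X × G) → V} {W : BHSpace K V} (y₀ : G × X) {y : G × X}
    (hy : y ∈ (extChartAt (𝓘(K, E).prod 𝓘(K, X.model)) y₀).source) {e : E}
    (he : IsRegularCoord K G e) (h₀ : G) {φ : (E × X.model) × E → W.carrier}
    (hφ : ContDiffAt K ω φ (extChartAt (𝓘(K, E).prod 𝓘(K, X.model)) y₀ y, e))
    (h : ∀ᶠ p in 𝓝 (y, e), ψ (p.1.1, (p.1.2, h₀ * coord K p.2)) =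
      W.incl (φ (extChartAt (𝓘(K, E).prod 𝓘(K, X.model)) y₀ p.1, p.2))) :
    IsAnAt K (𝓘(K, E).prod (𝓘(K, X.model).prod 𝓘(K, E))) ψ (y.1, (y.2, h₀ * coord K e)) := by
  have hG : ContinuousMul G := ⟨(contMDiff_mul 𝓘(K, E) (n := ω) (G := G)).continuous⟩
  have hleft : ContMDiffAt (𝓘(K, E).prod (𝓘(K, X.model).prod 𝓘(K, E))) 𝓘(K, E) ω
      (fun p : G × (X × G) => h₀⁻¹ * p.2.2) (y.1, (y.2, h₀ * coord K e)) :=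
    contMDiffAt_const.mul (contMDiffAt_snd.comp _ contMDiffAt_snd)
  have hinv : ContMDiffAt 𝓘(K, E) 𝓘(K, E) ω (coordInv K E : G → E)
      (h₀⁻¹ * (h₀ * coord K e)) := by
    rw [inv_mul_cancel_left]; exact he.contMDiffAt_coordInv
  have hr2 : ContMDiffAt (𝓘(K, E).prod (𝓘(K, X.model).prod 𝓘(K, E))) 𝓘(K, E) ω
      (fun p : G × (X × G) => coordInv K E (h₀⁻¹ * p.2.2)) (y.1, (y.2, h₀ * coord K e)) :=
    hinv.comp (y.1, (y.2, h₀ * coord K e)) hleft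
  have hr1 : ContMDiffAt (𝓘(K, E).prod (𝓘(K, X.model).prod 𝓘(K, E)))
      (𝓘(K, E).prod 𝓘(K, X.model)) ω
      (fun p : G × (X × G) => (p.1, p.2.1)) (y.1, (y.2, h₀ * coord K e)) :=
    contMDiffAt_fst.prodMk (contMDiffAt_fst.comp _ contMDiffAt_snd)
  have hχ : ContMDiffAt (𝓘(K, E).prod 𝓘(K, X.model)) 𝓘(K, E × X.model) ω
      (extChartAt (𝓘(K, E).prod 𝓘(K, X.model)) y₀) (y.1, y.2) :=
    contMDiffAt_extChartAt' (by rwa [extChartAt_source] at hy)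
  have h1 : ContMDiffAt (𝓘(K, E).prod (𝓘(K, X.model).prod 𝓘(K, E))) 𝓘(K, (E × X.model) × E) ω
      (fun p : G × (X × G) => (extChartAt (𝓘(K, E).prod 𝓘(K, X.model)) y₀ (p.1, p.2.1),
        coordInv K E (h₀⁻¹ * p.2.2))) (y.1, (y.2, h₀ * coord K e)) :=
    (hχ.comp (y.1, (y.2, h₀ * coord K e)) hr1).prodMk_space hr2
  have e0 : coordInv K E (h₀⁻¹ * (h₀ * coord K e)) = e := by
    rw [inv_mul_cancel_left, he.coordInv_coord]
  refine IsAnAt.of_factor W.incl (fun p : G × (X × G) =>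
    φ (extChartAt (𝓘(K, E).prod 𝓘(K, X.model)) y₀ (p.1, p.2.1), coordInv K E (h₀⁻¹ * p.2.2)))
    ?_ ?_
  · have h2 : ContMDiffAt 𝓘(K, (E × X.model) × E) 𝓘(K, W.carrier) ω φ
        (extChartAt (𝓘(K, E).prod 𝓘(K, X.model)) y₀ (y.1, y.2),
          coordInv K E (h₀⁻¹ * (h₀ * coord K e))) := by
      rw [e0]; exact hφ.contMDiffAt
    exact h2.comp (y.1, (y.2, h₀ * coord K e)) h1
  · have hr : Tendsto (fun p : G × (X × G) => ((p.1, p.2.1), coordInv K E (h₀⁻¹ * p.2.2)))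
        (𝓝 (y.1, (y.2, h₀ * coord K e))) (𝓝 (y, e)) := by
      have := hr1.continuousAt.prodMk hr2.continuousAt
      rw [ContinuousAt, e0] at this
      exact this
    have hl : Tendsto (fun p : G × (X × G) => h₀⁻¹ * p.2.2)
        (𝓝 (y.1, (y.2, h₀ * coord K e))) (𝓝 (coord K e)) := by
      have := hleft.continuousAt
      rwa [ContinuousAt, inv_mul_cancel_left] at this
    filter_upwards [hr.eventually h, hl.eventually he.coord_coordInv] with p h2 h3
    rw [← h2, h3, mul_inv_cancel_left]

variable [CompleteSpace K] [FiniteDimensional K E] [CharZero K]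

/-- For fixed g the family f itself factors through g⁻¹ ∘ `W.incl`. Its differential is computed
there, and the continuous linear automorphism g moves it back. -/
theorem IsAdmForm.ρ_dRaw {f : X → G → V.Cochain q} {W : BHSpace K V}
    {φ : (E × X.model) × E → E [⋀^Fin q]→L[K] W.carrier} {y₀ : G × X} {h₀ : G}
    {p : (G × X) × E}
    (h : ∀ᶠ p in 𝓝 p, ∀ ξ : Fin q → E,
          V.ρ p.1.1 (f p.1.2 (h₀ * coord K p.2) ξ) =
            W.incl (φ (extChartAt (𝓘(K, E).prod 𝓘(K, X.model)) y₀ p.1, p.2) ξ))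
    (he : IsRegularCoord K G p.2)
    (hφ : DifferentiableAt K φ (extChartAt (𝓘(K, E).prod 𝓘(K, X.model)) y₀ p.1, p.2))
    (x : Fin (q + 1) → GroupLieAlgebra 𝓘(K, E) G) :
    V.ρ p.1.1 (dRaw (f p.1.2) (h₀ * coord K p.2) x) = W.incl (ceFrame (frame K G) (lieBr K G)
      (fun e => φ (extChartAt (𝓘(K, E).prod 𝓘(K, X.model)) y₀ p.1, e)) p.2 x) := by
  have h1 : ∀ᶠ e' in 𝓝 p.2, ∀ ξ : Fin q → E, f p.1.2 (h₀ * coord K e') ξ =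
      ((V.ρ p.1.1⁻¹ : V →L[K] V).comp W.incl)
        (φ (extChartAt (𝓘(K, E).prod 𝓘(K, X.model)) y₀ p.1, e') ξ) := by
    have : Tendsto (fun e' : E => (p.1, e')) (𝓝 p.2) (𝓝 p) :=
      (Continuous.tendsto (f := fun e' : E => (p.1, e')) (by fun_prop) p.2)
    filter_upwards [this.eventually h] with e' he' ξ
    rw [ContinuousLinearMap.comp_apply, ← he' ξ]
    exact (V.ρ_inv_ρ _ _).symm
  have h2 : DifferentiableAt K
      (fun e => φ (extChartAt (𝓘(K, E).prod 𝓘(K, X.model)) y₀ p.1, e)) p.2 :=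
    DifferentiableAt.comp (g := φ) p.2 hφ
      (f := fun e => (extChartAt (𝓘(K, E).prod 𝓘(K, X.model)) y₀ p.1, e)) (by fun_prop)
  rw [dRaw_eq _ he h2 h₀ h1 x]
  exact V.ρ_ρ_inv _ _

/-- Near any point the differential is the frame expression `ceFrame` of an analytic family with
values in a Banach space, with g among its parameters. -/
theorem IsAdmForm.isAn_dRaw {f : X → G → V.Cochain q} (hf : V.IsAdmForm X f)
    (x : Fin (q + 1) → GroupLieAlgebra 𝓘(K, E) G) :
    IsAn K (𝓘(K, E).prod (𝓘(K, X.model).prod 𝓘(K, E)))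
      fun p : G × (X × G) => V.ρ p.1 (dRaw (f p.2.1) p.2.2 x) := by
  have hE : CompleteSpace E := FiniteDimensional.complete K E
  rintro ⟨g₀, x₀, h₀⟩
  obtain ⟨W, φ, hφ, h⟩ := hf.exists_factor (g₀, x₀) h₀
  have hreg := eventually_isRegularCoord (K := K) (E := E) (G := G)
  have key := isAnAt_of_coord (V := V) (X := X) (W := W)
    (ψ := fun p => V.ρ p.1 (dRaw (f p.2.1) p.2.2 x)) (g₀, x₀)
    (mem_extChartAt_source (I := 𝓘(K, E).prod 𝓘(K, X.model)) (g₀, x₀)) hreg.self_of_nhds h₀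
    (contDiffAt_ceFrame (lieBr K G) (hφ.contDiffAt (n := ω)) (contDiffAt_frame K (G := G)) x) ?_
  · simpa only [coord_zero, mul_one] using key
  · have hχ : Tendsto (fun p : (G × X) × E =>
        (extChartAt (𝓘(K, E).prod 𝓘(K, X.model)) (g₀, x₀) p.1, p.2)) (𝓝 ((g₀, x₀), 0))
        (𝓝 (extChartAt (𝓘(K, E).prod 𝓘(K, X.model)) (g₀, x₀) (g₀, x₀), 0)) :=
      ((continuousAt_extChartAt (g₀, x₀)).tendsto.comp (continuous_fst.tendsto _)).prodMk_nhds
        (continuous_snd.tendsto _)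
    filter_upwards [h.eventually_nhds, (continuous_snd.tendsto _).eventually hreg,
      hχ.eventually hφ.eventually_analyticAt] with p h1 h2 h3
    exact IsAdmForm.ρ_dRaw h1 h2 h3.differentiableAt x

end LocAnRep

end AdmissibleForms

end LocAnCohom

namespace LocAnCohom

/-! ### Differential forms on G: differential, left and right translation, equivariant forms -/

section Forms

variable {K : Type u} [NontriviallyNormedField K]
  {E : Type u} [NormedAddCommGroup E] [NormedSpace K E]
  {G : Type u} [TopologicalSpace G] [ChartedSpace E G] [Group G]

section
variable {V V' : Type u} [AddCommGroup V] [Module K V] [TopologicalSpace V]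
  [AddCommGroup V'] [Module K V'] [TopologicalSpace V'] [T2Space V']

/-- The derivative multiplies the argument by small elements on the right, so it commutes with left
translation; continuity lets T pass through the limit. -/
theorem lDeriv_clm (T : V →L[K] V') (k : G) {ψ : G → V} {ξ : E} {h : G}
    (hψ : Tendsto (fun t : K => t⁻¹ • (ψ (k * h * chartLine K E ξ t) - ψ (k * h))) (𝓝[≠] 0)
      (𝓝 (lDeriv K ξ ψ (k * h)))) :
    lDeriv K ξ (fun h => T (ψ (k * h))) h = T (lDeriv K ξ ψ (k * h)) := by
  refine Tendsto.limUnder_eq (((T.continuous.tendsto _).comp hψ).congr fun t => ?_)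
  rw [Function.comp_apply, map_smul, map_sub, mul_assoc]

end

/-- Both `coord` and `coordInv` have the identity as derivative at their base points, so conjugation
by g in coordinates still has derivative Ad(g). -/
theorem hasFDerivAt_conj_coord [LieGroup 𝓘(K, E) ω G] (g : G) :
    HasFDerivAt (fun e : E => coordInv K E (g * coord K e * g⁻¹ : G))
      (mfderiv 𝓘(K, E) 𝓘(K, E) (fun h : G => g * h * g⁻¹) 1 : E →L[K] E) 0 := by
  have hc : MDifferentiableAt 𝓘(K, E) 𝓘(K, E) (coord K : E → G) 0 :=
    (eventually_contMDiffAt_coord K (E := E) (G := G)).self_of_nhds.mdifferentiableAt (by simp)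
  have hi : MDifferentiableAt 𝓘(K, E) 𝓘(K, E) (coordInv K E : G → E) 1 :=
    (eventually_contMDiffAt_coordInv K (E := E) (G := G)).self_of_nhds.mdifferentiableAt (by simp)
  let D : E →L[K] E := mfderiv 𝓘(K, E) 𝓘(K, E) (coordInv K E : G → E) 1
  let A : E →L[K] E := mfderiv 𝓘(K, E) 𝓘(K, E) (fun h : G => g * h * g⁻¹) 1
  have hpt : ∀ k : G, k = 1 → (mfderiv 𝓘(K, E) 𝓘(K, E) (coordInv K E : G → E) k : E →L[K] E) = D := by
    rintro _ rfl
    rfl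
  have hpt' : ∀ k : G, k = 1 →
      (mfderiv 𝓘(K, E) 𝓘(K, E) (fun h : G => g * h * g⁻¹) k : E →L[K] E) = A := by
    rintro _ rfl
    rfl
  have hD : D = ContinuousLinearMap.id K E := by
    have h1 : (coordInv K E ∘ (coord K : E → G)) =ᶠ[𝓝 0] id :=
      eventually_coordInv_coord K (E := E) (G := G)
    have hi' : MDifferentiableAt 𝓘(K, E) 𝓘(K, E) (coordInv K E : G → E) (coord K (0 : E)) := by
      rw [coord_zero]; exact hi
    have h2 := mfderiv_comp (I' := 𝓘(K, E)) (0 : E) hi' hc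
    rw [h1.mfderiv_eq, mfderiv_id] at h2
    have h3 : (mfderiv 𝓘(K, E) 𝓘(K, E) (coordInv K E : G → E) (coord K (0 : E)) : E →L[K] E) = D := by
      exact hpt _ (coord_zero K)
    have h4 : ContinuousLinearMap.id K E = D.comp
        (mfderiv 𝓘(K, E) 𝓘(K, E) (coord K : E → G) 0 : E →L[K] E) :=
      h2.trans (congrArg (fun D : E →L[K] E => D.comp
        (mfderiv 𝓘(K, E) 𝓘(K, E) (coord K : E → G) 0 : E →L[K] E)) h3)
    rw [mfderiv_coord_zero] at h4
    exact h4.symm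
  have hg1 : g * (1 : G) * g⁻¹ = 1 := by group
  have hcj : MDifferentiableAt 𝓘(K, E) 𝓘(K, E) (fun h : G => g * h * g⁻¹) (coord K (0 : E)) :=
    mdiff_conj g _
  have h5 : MDifferentiableAt 𝓘(K, E) 𝓘(K, E) (fun e : E => (g * coord K e * g⁻¹ : G)) 0 :=
    hcj.comp (0 : E) hc
  have hi' : MDifferentiableAt 𝓘(K, E) 𝓘(K, E) (coordInv K E : G → E)
      (g * coord K (0 : E) * g⁻¹) := by
    rw [coord_zero, hg1]; exact hi
  have h6 : MDifferentiableAt 𝓘(K, E) 𝓘(K, E)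
      (fun e : E => coordInv K E (g * coord K e * g⁻¹ : G)) 0 := hi'.comp (0 : E) h5
  have h7 := h6.differentiableAt.hasFDerivAt
  have h8 : fderiv K (fun e : E => coordInv K E (g * coord K e * g⁻¹ : G)) 0 = A := by
    rw [← mfderiv_eq_fderiv]
    have h9 := mfderiv_comp (I' := 𝓘(K, E)) (0 : E) hi' h5
    have h10 := mfderiv_comp (I' := 𝓘(K, E)) (0 : E) hcj hc
    have h11 : (mfderiv 𝓘(K, E) 𝓘(K, E) (coordInv K E : G → E) (g * coord K (0 : E) * g⁻¹) :
        E →L[K] E) = D := by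
      exact hpt _ (by rw [coord_zero, hg1])
    have h12 : (mfderiv 𝓘(K, E) 𝓘(K, E) (fun h : G => g * h * g⁻¹) (coord K (0 : E)) :
        E →L[K] E) = A := by
      exact hpt' _ (coord_zero K)
    have h13 : (mfderiv 𝓘(K, E) 𝓘(K, E) (fun e : E => (g * coord K e * g⁻¹ : G)) 0 :
        E →L[K] E) = A := by
      refine h10.trans ((congrArg (fun D : E →L[K] E => D.comp
        (mfderiv 𝓘(K, E) 𝓘(K, E) (coord K : E → G) 0 : E →L[K] E)) h12).trans ?_)
      exact (congrArg (fun B : E →L[K] E => A.comp B) (mfderiv_coord_zero K)).trans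
        (ContinuousLinearMap.comp_id A)
    refine h9.trans ((congrArg₂ (fun D A : E →L[K] E => D.comp A) h11 h13).trans ?_)
    rw [hD, ContinuousLinearMap.id_comp]
  rw [h8] at h7
  exact h7

/-- For a curve c through 1, h c(t) g = (h g)(g⁻¹ c(t) g). Right translation by g thus turns the
direction ξ into Ad(g⁻¹) ξ. -/
theorem lDeriv_mul_right [LieGroup 𝓘(K, E) ω G] {V : Type u} [AddCommGroup V] [Module K V]
    [TopologicalSpace V] [T2Space V] {W : Type u} [NormedAddCommGroup W] [NormedSpace K W]
    (he : IsRegularCoord K G (0 : E))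
    (L : W →L[K] V) {φ : E → W} (hφ : DifferentiableAt K φ 0) (h g : G) {ψ : G → V}
    (hψ : ∀ᶠ e' in 𝓝 (0 : E), ψ (h * g * coord K e') = L (φ e')) (ξ : E) :
    lDeriv K ξ (fun h => ψ (h * g)) h =
      lDeriv K (E := E) (mfderiv 𝓘(K, E) 𝓘(K, E) (fun h : G => g⁻¹ * h * g⁻¹⁻¹) 1 ξ) ψ (h * g) := by
  let A : E →L[K] E := mfderiv 𝓘(K, E) 𝓘(K, E) (fun h : G => g⁻¹ * h * g⁻¹⁻¹) 1
  have h1 := lDeriv_eq L he hφ (h * g) hψ (A ξ)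
  rw [frame_zero, coord_zero, mul_one] at h1
  refine Eq.trans ?_ h1.symm
  let c : E → E := fun e => coordInv K E (g⁻¹ * coord K e * g⁻¹⁻¹ : G)
  have hc : HasFDerivAt c A 0 := hasFDerivAt_conj_coord g⁻¹
  have hc0 : c 0 = 0 := by
    simp only [c, coord_zero]
    rw [← coordInv_one K (E := E) (G := G)]
    congr 1
    group
  have h2 : HasFDerivAt (fun e => φ (c e)) ((fderiv K φ 0).comp A) 0 := by
    have : HasFDerivAt φ (fderiv K φ 0) (c 0) := by rw [hc0]; exact hφ.hasFDerivAt
    exact this.comp (0 : E) hc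
  have h3 := (L.continuous.tendsto _).comp (h2.hasLineDerivAt ξ).tendsto_slope_zero
  refine Tendsto.limUnder_eq (h3.congr' ?_)
  have ht : Tendsto (fun t : K => t • ξ) (𝓝[≠] 0) (𝓝 0) := by
    have : Continuous fun t : K => t • ξ := by fun_prop
    have := this.tendsto 0
    rw [zero_smul] at this
    exact this.mono_left nhdsWithin_le_nhds
  have hc' : Tendsto c (𝓝 0) (𝓝 0) := by
    have := hc.continuousAt
    rwa [ContinuousAt, hc0] at this
  have hcj : Tendsto (fun e : E => (g⁻¹ * coord K e * g⁻¹⁻¹ : G)) (𝓝 0) (𝓝 1) := by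
    have h5 := (contMDiff_conj (K := K) (E := E) g⁻¹).continuous.tendsto (1 : G)
    have h6 : g⁻¹ * (1 : G) * g⁻¹⁻¹ = 1 := by group
    rw [h6] at h5
    exact h5.comp (tendsto_coord K)
  filter_upwards [ht.eventually (hc'.eventually hψ),
    ht.eventually (hcj.eventually (eventually_coord_coordInv K (E := E)))] with t h4 h5
  simp only [Function.comp_apply, zero_add, map_smul, map_sub, hc0]
  rw [← h4, ← hψ.self_of_nhds, coord_zero, mul_one, h5, chartLine_eq_coord]
  congr 3
  group

namespace LocAnRep

variable [LieGroup 𝓘(K, E) ω G] {V : LocAnRep K E G} {q : ℕ} {X : AnMfd K}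

theorem isAdmForm_zero : V.IsAdmForm X (fun _ _ => (0 : V.Cochain q)) := fun _ p =>
  (isAnAt_zero p).congr (.of_forall fun p => (map_zero (V.ρ p.1)).symm)

theorem IsAdmForm.add {f f' : X → G → V.Cochain q} (hf : V.IsAdmForm X f)
    (hf' : V.IsAdmForm X f') : V.IsAdmForm X (fun x h => f x h + f' x h) := fun ξ p =>
  ((hf ξ p).add (hf' ξ p)).congr (.of_forall fun p => (map_add (V.ρ p.1) _ _).symm)

theorem IsAdmForm.map {V' : LocAnRep K E G} (T : V ⟶ V') {f : X → G → V.Cochain q}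
    (hf : V.IsAdmForm X f) : V'.IsAdmForm X (fun x h => cochainMap T q (f x h)) := fun ξ p =>
  ((hf ξ p).clm_comp T.toCLM).congr (.of_forall fun _ => T.equivariant _ _)

theorem IsAdmForm.neg {f : X → G → V.Cochain q} (hf : V.IsAdmForm X f) :
    V.IsAdmForm X (fun x h => - f x h) := fun ξ p =>
  ((hf ξ p).clm_comp (-ContinuousLinearMap.id K V)).congr
      (.of_forall fun p => (map_neg (V.ρ p.1) _).symm)

theorem IsAdmForm.res {Y : AnMfd K} {f : Y → G → V.Cochain q} (hf : V.IsAdmForm Y f) (k : X ⟶ Y) :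
    V.IsAdmForm X (fun x h => f (k x) h) := fun ξ p =>
  (hf ξ (p.1, (k p.2.1, p.2.2))).comp (r := fun p : G × (X × G) => (p.1, (k p.2.1, p.2.2)))
    (contMDiffAt_fst.prodMk ((((AnMfd.hom_contMDiff k) _).comp p
      (contMDiffAt_fst.comp p contMDiffAt_snd)).prodMk (contMDiffAt_snd.comp p contMDiffAt_snd)))

/-- The group variable in the definition of admissibility absorbs the action: g is replaced by g
ρ(x). -/
theorem IsAdmForm.act {f : X → G → V.Cochain q} (hf : V.IsAdmForm X f) (ρ : Pts K E G X) :
    V.IsAdmForm X (fun x h => (V.ρ (ρ x) : V →L[K] V).toLinearMap.compAlternatingMap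
      (f x ((ρ x)⁻¹ * h))) := fun ξ p => by
  refine ((hf ξ (p.1 * ρ p.2.1, (p.2.1, (ρ p.2.1)⁻¹ * p.2.2))).comp
    (r := fun p : G × (X × G) => (p.1 * ρ p.2.1, (p.2.1, (ρ p.2.1)⁻¹ * p.2.2)))
    ?_).congr (.of_forall fun p => V.ρ_mul _ _ _)
  have h1 : ContMDiffAt (𝓘(K, E).prod (𝓘(K, X.model).prod 𝓘(K, E))) 𝓘(K, X.model) ω
      (fun p : G × (X × G) => p.2.1) p := contMDiffAt_fst.comp p contMDiffAt_snd
  have h2 : ContMDiffAt (𝓘(K, E).prod (𝓘(K, X.model).prod 𝓘(K, E))) 𝓘(K, E) ω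
      (fun p : G × (X × G) => ρ p.2.1) p := (ρ.contMDiff p.2.1).comp p h1
  exact (contMDiffAt_fst.mul h2).prodMk
    (h1.prodMk (h2.inv.mul (contMDiffAt_snd.comp p contMDiffAt_snd)))

variable (V q) in
/-- Analytic differential forms of degree `q` on `G`, in the left invariant trivialization. -/
def Form : AddSubgroup (G → V.Cochain q) where
  carrier := {s | V.IsAdmForm (AnMfd.pt : AnMfd K) fun _ => s}
  zero_mem' := isAdmForm_zero
  add_mem' {s t} hs ht := IsAdmForm.add (f := fun _ => s) (f' := fun _ => t) hs ht
  neg_mem' {s} hs := IsAdmForm.neg (f := fun _ => s) hs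

theorem Form.isAdmForm (s : V.Form q) : V.IsAdmForm (AnMfd.pt : AnMfd K) fun _ => s.1 := s.2

theorem IsAdmForm.mem_form {f : X → G → V.Cochain q} (hf : V.IsAdmForm X f) (x : X) :
    f x ∈ V.Form q := hf.res (AnMfd.ptTo X x)

/-- The action of `G` on forms by left translation and the action on the coefficients. -/
noncomputable instance : DistribMulAction G (V.Form q) where
  smul g s := ⟨fun h => (V.ρ g : V →L[K] V).toLinearMap.compAlternatingMap (s.1 (g⁻¹ * h)),
    IsAdmForm.act (Form.isAdmForm s) ⟨fun _ => g, contMDiff_const⟩⟩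
  one_smul s := by
    refine Subtype.ext (funext fun h => AlternatingMap.ext fun ξ => ?_)
    change V.ρ 1 (s.1 (1⁻¹ * h) ξ) = _
    rw [ρ_one, inv_one, one_mul]
  mul_smul g g' s := by
    refine Subtype.ext (funext fun h => AlternatingMap.ext fun ξ => ?_)
    change V.ρ (g * g') (s.1 ((g * g')⁻¹ * h) ξ) = V.ρ g (V.ρ g' (s.1 (g'⁻¹ * (g⁻¹ * h)) ξ))
    rw [ρ_mul, mul_inv_rev, mul_assoc]
  smul_zero g := Subtype.ext (funext fun h => AlternatingMap.ext fun ξ => map_zero (V.ρ g))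
  smul_add g s t := Subtype.ext (funext fun h => AlternatingMap.ext fun ξ => map_add (V.ρ g) _ _)

theorem Form.smul_apply (g : G) (s : V.Form q) (h : G) (ξ : Fin q → GroupLieAlgebra 𝓘(K, E) G) :
    (g • s).1 h ξ = V.ρ g (s.1 (g⁻¹ * h) ξ) := rfl

section
variable [CompleteSpace K] [FiniteDimensional K E] [CharZero K]

theorem isRegularCoord_zero : IsRegularCoord K G (0 : E) :=
  have : CompleteSpace E := FiniteDimensional.complete K E
  eventually_isRegularCoord.self_of_nhds

theorem Form.exists_factor (s : V.Form q) (h₀ : G) :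
    ∃ (W : BHSpace K V) (φ : E → E [⋀^Fin q]→L[K] W.carrier), AnalyticAt K φ 0 ∧
      ∀ᶠ e in 𝓝 (0 : E), ∀ ξ : Fin q → E, s.1 (h₀ * coord K e) ξ = W.incl (φ e ξ) := by
  obtain ⟨W, φ, hφ, h⟩ := IsAdmForm.exists_factor (Form.isAdmForm s) ((1, PUnit.unit) : G × (AnMfd.pt : AnMfd K)) h₀
  refine ⟨W, fun e => φ (_, e), hφ.curry_right, ?_⟩
  have : Tendsto (fun e : E => (((1, PUnit.unit) : G × (AnMfd.pt : AnMfd K)), e)) (𝓝 0)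
      (𝓝 ((1, PUnit.unit), 0)) := (Continuous.tendsto (by fun_prop) 0)
  filter_upwards [this.eventually h] with e he ξ
  rw [← he ξ, ρ_one]

theorem Form.tendsto_lDeriv (s : V.Form q) (ξ : Fin q → GroupLieAlgebra 𝓘(K, E) G) (x : E) (h : G) :
    Tendsto (fun t : K => t⁻¹ • (s.1 (h * chartLine K E x t) ξ - s.1 h ξ)) (𝓝[≠] 0)
      (𝓝 (lDeriv K x (fun h => s.1 h ξ) h)) := by
  obtain ⟨W, φ, hφ, hs⟩ := Form.exists_factor s h
  let ev := ContinuousAlternatingMap.apply K E W.carrier ξ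
  have h2 : HasFDerivAt (fun e => φ e ξ) (ev.comp (fderiv K φ 0)) 0 :=
    HasFDerivAt.comp (g := ev) 0 ev.hasFDerivAt hφ.differentiableAt.hasFDerivAt
  have h3 := tendsto_lDeriv_aux W.incl isRegularCoord_zero h2.differentiableAt h
    (ψ := fun h => s.1 h ξ) (hs.mono fun _ h => h _) x
  rw [coord_zero, mul_one] at h3
  have h4 := h3.limUnder_eq
  rw [lDeriv, h4]
  exact h3

/-- Multilinearity and alternation in x are hidden by the limits in `dRaw`. They are read off from
the exterior derivative at e = 0, where the frame is the identity. -/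
theorem Form.exists_dRaw (s : V.Form q) (h : G) :
    ∃ η : V.Cochain (q + 1), ∀ x, η x = dRaw s.1 h x := by
  obtain ⟨W, φ, hφ, hs⟩ := Form.exists_factor s h
  let θ := extDeriv (fun e => (φ e).compContinuousLinearMap (frame K G e).inverse) 0
  let η : E [⋀^Fin (q + 1)]→ₗ[K] V := W.incl.toLinearMap.compAlternatingMap θ.toAlternatingMap
  refine ⟨η, fun x => ?_⟩
  have h1 := dRaw_eq_extDeriv W.incl isRegularCoord_zero hφ.differentiableAt h hs x
  rw [coord_zero, mul_one] at h1
  refine Eq.trans ?_ h1.symm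
  simp only [frame_zero]
  rfl

/-- The exterior differential of a form on `G`. -/
noncomputable def Form.d : V.Form q →+ V.Form (q + 1) where
  toFun s := ⟨fun h => (Form.exists_dRaw s h).choose, fun ξ => by
    have h1 := IsAdmForm.isAn_dRaw (Form.isAdmForm s) ξ
    have h2 : (fun p : G × (AnMfd.carrier (AnMfd.pt : AnMfd K) × G) =>
      V.ρ p.1 ((Form.exists_dRaw s p.2.2).choose ξ)) =
        fun p : G × (AnMfd.carrier (AnMfd.pt : AnMfd K) × G) => V.ρ p.1 (dRaw s.1 p.2.2 ξ) := by
      funext p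
      rw [(Form.exists_dRaw s p.2.2).choose_spec]
    rw [h2]
    exact h1⟩
  map_zero' := by
    refine Subtype.ext (funext fun h => AlternatingMap.ext fun ξ => ?_)
    refine ((Form.exists_dRaw (0 : V.Form q) h).choose_spec ξ).trans ?_
    have : ∀ x : GroupLieAlgebra 𝓘(K, E) G, lDeriv K (E := E) x (fun _ : G => (0 : V)) h = 0 := fun x => by
      refine Tendsto.limUnder_eq (tendsto_const_nhds.congr fun t => ?_)
      rw [sub_zero, smul_zero]
    simp only [dRaw, ZeroMemClass.coe_zero, Pi.zero_apply, AlternatingMap.zero_apply, this,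
      smul_zero, Finset.sum_const_zero, add_zero]
  map_add' s t := by
    refine Subtype.ext (funext fun h => AlternatingMap.ext fun ξ => ?_)
    refine ((Form.exists_dRaw (s + t) h).choose_spec ξ).trans ?_
    change _ = (Form.exists_dRaw s h).choose ξ + (Form.exists_dRaw t h).choose ξ
    rw [(Form.exists_dRaw s h).choose_spec ξ, (Form.exists_dRaw t h).choose_spec ξ]
    have : ∀ (x : GroupLieAlgebra 𝓘(K, E) G) (c : Fin q → GroupLieAlgebra 𝓘(K, E) G),
        lDeriv K (E := E) x (fun h : G => s.1 h c + t.1 h c) h =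
          lDeriv K (E := E) x (fun h : G => s.1 h c) h +
            lDeriv K (E := E) x (fun h : G => t.1 h c) h := fun x c => by
      refine Tendsto.limUnder_eq (((Form.tendsto_lDeriv s c x h).add (Form.tendsto_lDeriv t c x h)).congr
        fun a => ?_)
      rw [← smul_add, add_sub_add_comm]
    simp only [dRaw, AddSubgroup.coe_add, Pi.add_apply, AlternatingMap.add_apply, this,
      smul_add, Finset.sum_add_distrib]
    exact add_add_add_comm _ _ _ _

theorem Form.d_apply (s : V.Form q) (h : G) (x : Fin (q + 1) → GroupLieAlgebra 𝓘(K, E) G) :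
    (Form.d s).1 h x = dRaw s.1 h x := (Form.exists_dRaw s h).choose_spec x

/-- With k = g⁻¹ and T the action of g this gives equivariance of d; with k = 1 it gives naturality
in V. -/
theorem dRaw_clm {V' : LocAnRep K E G} (T : V →L[K] V') (k : G) (s : V.Form q) (h : G)
    (x : Fin (q + 1) → GroupLieAlgebra 𝓘(K, E) G) (s' : G → V'.Cochain q)
    (hs : ∀ h ξ, s' h ξ = T (s.1 (k * h) ξ)) :
    dRaw s' h x = T (dRaw s.1 (k * h) x) := by
  have h1 : ∀ (ξ : Fin q → GroupLieAlgebra 𝓘(K, E) G) (y : GroupLieAlgebra 𝓘(K, E) G),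
      lDeriv K (E := E) y (fun h => T (s.1 (k * h) ξ)) h =
        T (lDeriv K (E := E) y (fun h => s.1 h ξ) (k * h)) := by
    intro ξ y
    exact lDeriv_clm (E := E) T k (ψ := fun h => s.1 h ξ) (Form.tendsto_lDeriv s ξ y (k * h))
  simp only [dRaw, map_add, map_sum, map_zsmul, hs, h1]

theorem Form.d_smul (g : G) (s : V.Form q) : Form.d (g • s) = g • Form.d s := by
  refine Subtype.ext (funext fun h => AlternatingMap.ext fun x => ?_)
  rw [Form.smul_apply, Form.d_apply, Form.d_apply]
  exact dRaw_clm (V.ρ g : V →L[K] V) g⁻¹ s h x _ fun _ _ => rfl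

/-- The map on forms induced by a map of representations. -/
noncomputable def Form.map {V' : LocAnRep K E G} (T : V ⟶ V') : V.Form q →+ V'.Form q where
  toFun s := ⟨fun h => cochainMap T q (s.1 h), IsAdmForm.map T (Form.isAdmForm s)⟩
  map_zero' := Subtype.ext (funext fun _ => map_zero (cochainMap T q))
  map_add' _ _ := Subtype.ext (funext fun _ => map_add (cochainMap T q) _ _)

theorem Form.map_smul {V' : LocAnRep K E G} (T : V ⟶ V') (g : G) (s : V.Form q) :
    Form.map T (g • s) = g • Form.map T s :=
  Subtype.ext (funext fun _ => AlternatingMap.ext fun _ => T.equivariant _ _)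

theorem Form.d_map {V' : LocAnRep K E G} (T : V ⟶ V') (s : V.Form q) :
    Form.d (Form.map T s) = Form.map T (Form.d s) := by
  refine Subtype.ext (funext fun h => AlternatingMap.ext fun x => ?_)
  refine (Form.d_apply _ _ _).trans (Eq.trans ?_ (congrArg T.toCLM (Form.d_apply s h x)).symm)
  have h1 := dRaw_clm T.toCLM 1 s h x (Form.map T s).1 fun h ξ => by
    rw [one_mul]
    rfl
  rwa [one_mul] at h1

/-- Right translation of forms. -/
noncomputable def Form.rTrans (g : G) : V.Form q →+ V.Form q where
  toFun s := ⟨fun h => (s.1 (h * g)).compLinearMap (Ad g⁻¹), fun ξ p =>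
    (Form.isAdmForm s (fun i => Ad g⁻¹ (ξ i)) (p.1, (p.2.1, p.2.2 * g))).comp
      (r := fun p : G × (AnMfd.carrier (AnMfd.pt : AnMfd K) × G) => (p.1, (p.2.1, p.2.2 * g)))
      (contMDiffAt_fst.prodMk ((contMDiffAt_fst.comp p contMDiffAt_snd).prodMk
        ((contMDiffAt_snd.comp p contMDiffAt_snd).mul contMDiffAt_const)))⟩
  map_zero' := rfl
  map_add' _ _ := rfl

theorem Form.rTrans_apply (g : G) (s : V.Form q) (h : G)
    (x : Fin q → GroupLieAlgebra 𝓘(K, E) G) :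
    (Form.rTrans g s).1 h x = s.1 (h * g) fun i => Ad g⁻¹ (x i) := rfl

theorem Form.rTrans_smul (g k : G) (s : V.Form q) :
    Form.rTrans g (k • s) = k • Form.rTrans g s := by
  refine Subtype.ext (funext fun h => AlternatingMap.ext fun x => ?_)
  rw [Form.rTrans_apply, Form.smul_apply, Form.smul_apply, Form.rTrans_apply, mul_assoc]

/-- In the left invariant trivialization, right translation twists the arguments by Ad(g⁻¹). The
derivative terms transform by `lDeriv_mul_right`, the bracket terms because Ad(g⁻¹) preserves
brackets. -/
theorem Form.d_rTrans (g : G) (s : V.Form q) :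
    Form.d (Form.rTrans g s) = Form.rTrans g (Form.d s) := by
  have hE : CompleteSpace E := FiniteDimensional.complete K E
  refine Subtype.ext (funext fun h => AlternatingMap.ext fun x => ?_)
  rw [Form.rTrans_apply, Form.d_apply, Form.d_apply, dRaw, dRaw]
  congr 1
  · refine Finset.sum_congr rfl fun i _ => ?_
    congr 1
    obtain ⟨W, φ, hφ, hs⟩ := Form.exists_factor s (h * g)
    let c : Fin q → GroupLieAlgebra 𝓘(K, E) G := i.removeNth fun i => Ad g⁻¹ (x i)
    let ev := ContinuousAlternatingMap.apply K E W.carrier c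
    have h2 : HasFDerivAt (fun e => φ e c) (ev.comp (fderiv K φ 0)) 0 :=
      HasFDerivAt.comp (g := ev) 0 ev.hasFDerivAt hφ.differentiableAt.hasFDerivAt
    exact lDeriv_mul_right isRegularCoord_zero W.incl h2.differentiableAt h g
      (ψ := fun h => s.1 h c) (hs.mono fun _ h => h _) (x i)
  · refine Finset.sum_congr rfl fun j _ => Finset.sum_congr rfl fun i _ => ?_
    rw [Form.rTrans_apply]
    congr 2
    funext k
    change Ad g⁻¹ (Function.update x i ⁅x i, x j⁆ (j.succAbove k)) =
      Function.update (fun i => Ad g⁻¹ (x i)) i ⁅Ad g⁻¹ (x i), Ad g⁻¹ (x j)⁆ (j.succAbove k)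
    rw [← Ad_bracket]
    by_cases hk : j.succAbove k = i
    · rw [hk, Function.update_self, Function.update_self]
    · rw [Function.update_of_ne hk, Function.update_of_ne hk]

/-- In coordinates the form is θ and its differential, in the left invariant trivialization, is dθ
composed with the frame. The inverse frame undoes this composition, so the claim becomes ddθ = 0,
with no use of the Jacobi identity. -/
theorem Form.d_d (s : V.Form q) : Form.d (Form.d s) = 0 := by
  have hE : CompleteSpace E := FiniteDimensional.complete K E
  refine Subtype.ext (funext fun h => AlternatingMap.ext fun x => ?_)
  rw [Form.d_apply]
  obtain ⟨W, φ, hφ, hs⟩ := Form.exists_factor s h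
  let θ : E → E [⋀^Fin q]→L[K] W.carrier :=
    fun e => (φ e).compContinuousLinearMap (frame K G e).inverse
  have hθ : ContDiffAt K ω θ 0 := (hφ.contDiffAt (n := ω)).compContinuousLinearMap_alternating
    (contDiffAt_frame_inverse K)
  have hdθ : ContDiffAt K ω (extDeriv θ) 0 :=
    ContDiffAt.clm_apply_fun (B := E →L[K] E [⋀^Fin q]→L[K] W.carrier)
      (ContinuousAlternatingMap.alternatizeUncurryFinCLM K E W.carrier)
      (hθ.fderiv_right (m := ω) le_top)
  let φ' : E → E [⋀^Fin (q + 1)]→L[K] W.carrier :=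
    fun e => (extDeriv θ e).compContinuousLinearMap (frame K G e)
  have hφ' : ContDiffAt K ω φ' 0 := hdθ.compContinuousLinearMap_alternating (contDiffAt_frame K)
  have hs' : ∀ᶠ e in 𝓝 (0 : E), ∀ ξ : Fin (q + 1) → E,
      (Form.d s).1 (h * coord K e) ξ = W.incl (φ' e ξ) := by
    filter_upwards [hs.eventually_nhds, eventually_isRegularCoord (K := K) (G := G),
      hφ.eventually_analyticAt] with e h1 h2 h3 ξ
    refine (Form.d_apply _ _ _).trans ?_
    rw [dRaw_eq_extDeriv W.incl h2 h3.differentiableAt h h1 ξ]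
    rfl
  have h1 := dRaw_eq_extDeriv W.incl isRegularCoord_zero (hφ'.differentiableAt (by simp)) h hs' x
  rw [coord_zero, mul_one] at h1
  rw [h1]
  have h2 : (fun e => (φ' e).compContinuousLinearMap (frame K G e).inverse) =ᶠ[𝓝 0]
      extDeriv θ := by
    filter_upwards [eventually_frame_isInvertible K (E := E) (G := G)] with e he
    ext v
    simp only [φ', ContinuousAlternatingMap.compContinuousLinearMap_apply]
    congr 1
    funext i
    exact he.self_apply_inverse _
  have h3 : extDeriv (fun e => (φ' e).compContinuousLinearMap (frame K G e).inverse) 0 =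
      extDeriv (extDeriv θ) 0 := h2.extDeriv_eq
  have h4 : extDeriv (extDeriv θ) 0 = 0 := extDeriv_extDeriv_apply hθ le_top
  rw [h3, h4]
  exact map_zero W.incl

/-- The left equivariant form with a given value at `1`. -/
noncomputable def Form.ofCochain : V.Cochain q →+ V.Form q where
  toFun η := ⟨fun h => (V.ρ h : V →L[K] V).toLinearMap.compAlternatingMap η, fun ξ p =>
    ((V.isAn_orbit (η ξ) (p.1 * p.2.2)).comp
      (r := fun p : G × (AnMfd.carrier (AnMfd.pt : AnMfd K) × G) => p.1 * p.2.2)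
      (contMDiffAt_fst.mul (contMDiffAt_snd.comp p contMDiffAt_snd))).congr
        (.of_forall fun _ => V.ρ_mul _ _ _)⟩
  map_zero' := Subtype.ext (funext fun h => AlternatingMap.ext fun _ => map_zero (V.ρ h))
  map_add' _ _ := Subtype.ext (funext fun h => AlternatingMap.ext fun _ => map_add (V.ρ h) _ _)

theorem Form.ofCochain_apply (η : V.Cochain q) (h : G) (ξ) :
    (Form.ofCochain η).1 h ξ = V.ρ h (η ξ) := rfl

theorem Form.smul_ofCochain (g : G) (η : V.Cochain q) :
    g • Form.ofCochain η = Form.ofCochain η := by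
  refine Subtype.ext (funext fun h => AlternatingMap.ext fun x => ?_)
  rw [Form.smul_apply, Form.ofCochain_apply, Form.ofCochain_apply, ← ρ_mul, mul_inv_cancel_left]

/-- Invariance under h carries the value at 1 to the value at h. -/
theorem Form.eq_ofCochain (s : V.Form q) (hs : ∀ g : G, g • s = s) :
    s = Form.ofCochain (s.1 1) := by
  refine Subtype.ext (funext fun h => AlternatingMap.ext fun x => ?_)
  rw [Form.ofCochain_apply]
  conv_lhs => rw [← hs h]
  rw [Form.smul_apply, inv_mul_cancel]

/-- At 1 the derivative of h ↦ h v along ξ is the very limit that defines the action of ξ on v. So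
the complex of left equivariant forms is the Chevalley-Eilenberg complex. -/
theorem Form.d_ofCochain_one (η : V.Cochain q) (x) :
    (Form.d (Form.ofCochain η)).1 1 x = V.ceD η x := by
  rw [Form.d_apply, dRaw, ceD]
  congr 1
  · refine Finset.sum_congr rfl fun i _ => ?_
    simp only [lDeriv, lieAct, Form.ofCochain_apply, one_mul, ρ_one]
  · refine Finset.sum_congr rfl fun j _ => Finset.sum_congr rfl fun i _ => ?_
    rw [Form.ofCochain_apply, ρ_one]

/-- This is how the action of G on Lie algebra cohomology appears geometrically: it is right
translation of equivariant forms. -/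
theorem Form.rTrans_ofCochain (g : G) (η : V.Cochain q) :
    Form.rTrans g (Form.ofCochain η) = Form.ofCochain (V.cochainAct q g η) := by
  refine Subtype.ext (funext fun h => AlternatingMap.ext fun x => ?_)
  rw [Form.rTrans_apply, Form.ofCochain_apply, Form.ofCochain_apply, cochainAct_apply, ρ_mul]

end

end LocAnRep

end Forms

end LocAnCohom

namespace LocAnCohom

/-! ### Open subgroups -/

section Topology

/-- The norm of E need not be ultrametric. In coordinates with respect to a basis the sup norm is,
and its balls are clopen. -/
theorem exists_isClopen_subset_of_finiteDimensional
    (K : Type u) [NontriviallyNormedField K] [IsUltrametricDist K] [CompleteSpace K]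
    (E : Type u) [NormedAddCommGroup E] [NormedSpace K E] [FiniteDimensional K E]
    {U : Set E} {x : E} (hU : U ∈ 𝓝 x) :
    ∃ C : Set E, IsClopen C ∧ x ∈ C ∧ C ⊆ U := by
  let Φ := (Module.finBasis K E).equivFunL
  have h1 : Φ.symm ⁻¹' U ∈ 𝓝 (Φ x) := by
    refine Φ.symm.continuous.continuousAt.preimage_mem_nhds ?_
    rwa [Φ.symm_apply_apply]
  obtain ⟨r, hr, hb⟩ := Metric.mem_nhds_iff.1 h1
  refine ⟨Φ ⁻¹' Metric.ball (Φ x) r, (IsUltrametricDist.isClopen_ball _ _).preimage Φ.continuous,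
    Metric.mem_ball_self hr, fun y hy => ?_⟩
  have := hb hy
  rwa [Set.mem_preimage, Φ.symm_apply_apply] at this

theorem exists_isClopen_subset
    (K : Type u) [NontriviallyNormedField K] [IsUltrametricDist K] [CompleteSpace K]
    (E : Type u) [NormedAddCommGroup E] [NormedSpace K E] [FiniteDimensional K E]
    {G : Type u} [TopologicalSpace G] [ChartedSpace E G] [T2Space G] [CompactSpace G]
    {U : Set G} {x : G} (hU : U ∈ 𝓝 x) :
    ∃ C : Set G, IsClopen C ∧ x ∈ C ∧ C ⊆ U := by
  let c := chartAt E x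
  obtain ⟨A, hA, hAc, hAU⟩ := exists_mem_nhds_isClosed_subset
    (inter_mem hU (c.open_source.mem_nhds (mem_chart_source E x)))
  have h1 : c.symm ⁻¹' A ∩ c.target ∈ 𝓝 (c x) := by
    refine inter_mem ((c.continuousAt_symm (mem_chart_target E x)).preimage_mem_nhds ?_)
      (c.open_target.mem_nhds (mem_chart_target E x))
    rwa [c.left_inv (mem_chart_source E x)]
  obtain ⟨B, hB, hxB, hBA⟩ := exists_isClopen_subset_of_finiteDimensional K E h1
  have hsrc : A ⊆ c.source := fun y hy => (hAU hy).2
  -- The first description shows that the set is closed, as a part of the closed set A inside the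
  -- chart domain; the second shows that it is open.
  have heq : A ∩ c ⁻¹' B = c.source ∩ c ⁻¹' B := by
    ext y
    refine ⟨fun h => ⟨hsrc h.1, h.2⟩, fun h => ⟨?_, h.2⟩⟩
    have := (hBA h.2).1
    rwa [Set.mem_preimage, c.left_inv h.1] at this
  refine ⟨A ∩ c ⁻¹' B, ⟨?_, ?_⟩, ⟨mem_of_mem_nhds hA, hxB⟩, fun y hy => (hAU hy.1).1⟩
  · exact (c.continuousOn.mono hsrc).preimage_isClosed_of_isClosed hAc hB.isClosed
  · rw [heq]
    exact c.isOpen_inter_preimage hB.isOpen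

theorem exists_openSubgroup_subset
    (K : Type u) [NontriviallyNormedField K] [IsUltrametricDist K] [CompleteSpace K]
    (E : Type u) [NormedAddCommGroup E] [NormedSpace K E] [FiniteDimensional K E]
    {G : Type u} [TopologicalSpace G] [ChartedSpace E G] [T2Space G] [CompactSpace G]
    [Group G] [LieGroup 𝓘(K, E) ω G]
    {U : Set G} (hU : U ∈ 𝓝 (1 : G)) :
    ∃ H : OpenSubgroup G, (H : Set G) ⊆ U := by
  have : IsTopologicalGroup G := topologicalGroup_of_lieGroup 𝓘(K, E) ω
  obtain ⟨C, hC, h1, hCU⟩ := exists_isClopen_subset K E hU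
  obtain ⟨H, hH⟩ := IsTopologicalGroup.exist_openSubgroup_sub_clopen_nhds_of_one hC h1
  exact ⟨H, hH.trans hCU⟩

/-- Every covering of `G` by neighbourhoods of its points is refined by the cosets of an open
subgroup. -/
theorem exists_openSubgroup_refining
    (K : Type u) [NontriviallyNormedField K] [IsUltrametricDist K] [CompleteSpace K]
    (E : Type u) [NormedAddCommGroup E] [NormedSpace K E] [FiniteDimensional K E]
    {G : Type u} [TopologicalSpace G] [ChartedSpace E G] [T2Space G] [CompactSpace G]
    [Group G] [LieGroup 𝓘(K, E) ω G]
    (N : G → Set G) (hN : ∀ h, N h ∈ 𝓝 h) :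
    ∃ (H : OpenSubgroup G) (t : Finset G), ∀ h, ∃ h₀ ∈ t, ∀ k ∈ H, h * k ∈ N h₀ := by
  have hG : IsTopologicalGroup G := topologicalGroup_of_lieGroup 𝓘(K, E) ω
  have h1 : ∀ h : G, ∃ H : OpenSubgroup G, ∀ k ∈ H, h * k ∈ N h := by
    intro h
    have h2 : (fun k => h * k) ⁻¹' N h ∈ 𝓝 (1 : G) := by
      refine (continuous_const_mul h).continuousAt.preimage_mem_nhds ?_
      rw [mul_one]
      exact hN h
    obtain ⟨H, hH⟩ := exists_openSubgroup_subset K E h2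
    exact ⟨H, fun k hk => hH hk⟩
  choose H hH using h1
  obtain ⟨t, ht⟩ := isCompact_univ.elim_finite_subcover
    (fun h : G => (fun k => h⁻¹ * k) ⁻¹' (H h : Set G))
    (fun h => (H h).isOpen.preimage (continuous_const_mul _))
    (fun h _ => Set.mem_iUnion.2 ⟨h, by simp [one_mem]⟩)
  -- Every h lies in some coset h₀ * H h₀ with h₀ in the finite set t, and right multiplication by
  -- the intersection of these subgroups stays in that coset.
  refine ⟨t.inf H, t, fun h => ?_⟩
  obtain ⟨h₀, h₀t, hh⟩ := Set.mem_iUnion₂.1 (ht (Set.mem_univ h))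
  refine ⟨h₀, h₀t, fun k hk => ?_⟩
  have hk' : k ∈ H h₀ := (Finset.inf_le h₀t : t.inf H ≤ H h₀) hk
  have := hH h₀ (h₀⁻¹ * h * k) (mul_mem hh hk')
  rwa [mul_assoc, mul_inv_cancel_left] at this

end Topology

end LocAnCohom

/-! ### Comparison in V of solutions living in different Banach spaces -/

/-- Two solutions of the Euler equation with values in different Banach spaces mapping to `V` agree
in `V` if their right hand sides do. -/
theorem map_eq_of_euler {K : Type*} [NontriviallyNormedField K] [IsUltrametricDist K] [CharZero K]
    {E : Type*} [NormedAddCommGroup E] [NormedSpace K E]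
    {V : Type*} [AddCommGroup V] [Module K V] [TopologicalSpace V] [IsTopologicalAddGroup V]
    [ContinuousSMul K V] [T2Space V]
    {W₁ W₂ : Type*} [NormedAddCommGroup W₁] [NormedSpace K W₁] [CompleteSpace W₁]
    [NormedAddCommGroup W₂] [NormedSpace K W₂] [CompleteSpace W₂]
    (T₁ : W₁ →L[K] V) (T₂ : W₂ →L[K] V) {u₁ : E → W₁} {u₂ : E → W₂}
    {p₁ : FormalMultilinearSeries K E W₁} {p₂ : FormalMultilinearSeries K E W₂} {r : ENNReal}
    (h₁ : HasFPowerSeriesOnBall u₁ p₁ 0 r) (h₂ : HasFPowerSeriesOnBall u₂ p₂ 0 r)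
    {q : ℕ} (hq : q ≠ 0)
    (h : ∀ e ∈ Metric.eball (0 : E) r,
      T₁ ((q : K) • u₁ e + fderiv K u₁ e e) = T₂ ((q : K) • u₂ e + fderiv K u₂ e e))
    {e : E} (he : e ∈ Metric.eball (0 : E) r) : T₁ (u₁ e) = T₂ (u₂ e) := by
  -- V carries no norm, so the difference of the two solutions is studied in the Banach space (W₁ ×
  -- W₂) / ker D, which injects into V. There the pair solves the homogeneous equation and must
  -- vanish.
  let D : W₁ × W₂ →L[K] V :=
    T₁.comp (ContinuousLinearMap.fst K W₁ W₂) - T₂.comp (ContinuousLinearMap.snd K W₁ W₂)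
  have hcl : IsClosed ((LinearMap.ker D.toLinearMap : Submodule K (W₁ × W₂)) : Set (W₁ × W₂)) :=
    D.isClosed_ker
  let π : W₁ × W₂ →L[K] (W₁ × W₂) ⧸ LinearMap.ker D.toLinearMap :=
    (LinearMap.ker D.toLinearMap).mkQL
  have hπ : ∀ w, π w = 0 ↔ D w = 0 := fun w => by
    change (LinearMap.ker D.toLinearMap).mkQ w = 0 ↔ _
    rw [Submodule.mkQ_apply, Submodule.Quotient.mk_eq_zero]
    exact LinearMap.mem_ker
  have hu := π.comp_hasFPowerSeriesOnBall (h₁.prod h₂)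
  have hr : min r r = r := min_self r
  rw [hr] at hu
  have h0 := hu.eq_of_euler q (fun e he => ?_) e he
  · rw [if_neg hq] at h0
    have := (hπ _).1 h0
    exact sub_eq_zero.1 this
  · have d₁ : HasFDerivAt u₁ (fderiv K u₁ e) e :=
      (h₁.analyticAt_of_mem he).differentiableAt.hasFDerivAt
    have d₂ : HasFDerivAt u₂ (fderiv K u₂ e) e :=
      (h₂.analyticAt_of_mem he).differentiableAt.hasFDerivAt
    have d : HasFDerivAt (π ∘ fun x => (u₁ x, u₂ x))
        (π.comp ((fderiv K u₁ e).prod (fderiv K u₂ e))) e :=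
      π.hasFDerivAt.comp e (d₁.prodMk d₂)
    rw [d.fderiv]
    have h3 : (q : K) • (π ∘ fun x => (u₁ x, u₂ x)) e +
        (π.comp ((fderiv K u₁ e).prod (fderiv K u₂ e))) e =
        π ((q : K) • u₁ e + fderiv K u₁ e e, (q : K) • u₂ e + fderiv K u₂ e e) := by
      rw [Function.comp_apply, ContinuousLinearMap.comp_apply, ← map_smul, ← map_add]
      rfl
    rw [h3, hπ]
    exact sub_eq_zero.2 (h e he)

theorem AnalyticAt.euler_slice {K : Type*} [NontriviallyNormedField K]
    {E : Type*} [NormedAddCommGroup E] [NormedSpace K E]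
    {W F : Type*} [NormedAddCommGroup W] [NormedSpace K W] [NormedAddCommGroup F] [NormedSpace K F]
    {q : ℕ} {Ω : F × E → E [⋀^Fin (q + 1)]→L[K] W} {c : F} {e : E} (hΩ : AnalyticAt K Ω (c, e))
    (v : Fin (q + 1) → E) :
    ((q + 1 : ℕ) : K) • ((ContinuousAlternatingMap.apply K E W v) ∘ fun e => Ω (c, e)) e +
      fderiv K ((ContinuousAlternatingMap.apply K E W v) ∘ fun e => Ω (c, e)) e e =
    (((q + 1 : ℕ) : K) • Ω (c, e) + fderiv K Ω (c, e) (0, e)) v := by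
  let ev := ContinuousAlternatingMap.apply K E W v
  have b1 := fderiv_slice (z := (c, e)) hΩ.differentiableAt
  have b2 : DifferentiableAt K (fun e => Ω (c, e)) e :=
    DifferentiableAt.comp (g := Ω) e hΩ.differentiableAt (f := fun e => (c, e)) (by fun_prop)
  have b3 : HasFDerivAt (ev ∘ fun e => Ω (c, e)) (ev.comp (fderiv K (fun e => Ω (c, e)) e)) e :=
    HasFDerivAt.comp (g := ev) e ev.hasFDerivAt b2.hasFDerivAt
  rw [b3.fderiv, b1]
  rfl

/-- On each slice this is `map_eq_of_euler`, and the slices have a common radius. The map T₁ may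
vary with y without any continuity: it will be the action of g following an inclusion, with g part
of y. -/
theorem eventually_map_eq_of_euler {K : Type*} [NontriviallyNormedField K] [IsUltrametricDist K]
    [CharZero K] [CompleteSpace K] {E : Type*} [NormedAddCommGroup E] [NormedSpace K E]
    {V : Type*} [AddCommGroup V] [Module K V] [TopologicalSpace V] [IsTopologicalAddGroup V]
    [ContinuousSMul K V] [T2Space V]
    {W₁ W₂ : Type*} [NormedAddCommGroup W₁] [NormedSpace K W₁] [CompleteSpace W₁]
    [NormedAddCommGroup W₂] [NormedSpace K W₂] [CompleteSpace W₂]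
    {F₁ F₂ : Type*} [NormedAddCommGroup F₁] [NormedSpace K F₁]
    [NormedAddCommGroup F₂] [NormedSpace K F₂]
    {Y : Type*} [TopologicalSpace Y] {y₀ : Y} {c₁ : Y → F₁} {c₂ : Y → F₂}
    (hc₁ : ContinuousAt c₁ y₀) (hc₂ : ContinuousAt c₂ y₀)
    (T₁ : Y → W₁ →L[K] V) (T₂ : W₂ →L[K] V) {q : ℕ}
    {Ω₁ θ₁ : F₁ × E → E [⋀^Fin (q + 1)]→L[K] W₁} {Ω₂ θ₂ : F₂ × E → E [⋀^Fin (q + 1)]→L[K] W₂}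
    (hΩ₁ : AnalyticAt K Ω₁ (c₁ y₀, 0)) (hΩ₂ : AnalyticAt K Ω₂ (c₂ y₀, 0))
    (he₁ : ∀ᶠ z in 𝓝 (c₁ y₀, (0 : E)),
      ((q + 1 : ℕ) : K) • Ω₁ z + fderiv K Ω₁ z (0, z.2) = θ₁ z)
    (he₂ : ∀ᶠ z in 𝓝 (c₂ y₀, (0 : E)),
      ((q + 1 : ℕ) : K) • Ω₂ z + fderiv K Ω₂ z (0, z.2) = θ₂ z)
    (hθ : ∀ᶠ p in 𝓝 (y₀, (0 : E)), ∀ v, T₁ p.1 (θ₁ (c₁ p.1, p.2) v) = T₂ (θ₂ (c₂ p.1, p.2) v)) :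
    ∀ᶠ p in 𝓝 (y₀, (0 : E)), ∀ v, T₁ p.1 (Ω₁ (c₁ p.1, p.2) v) = T₂ (Ω₂ (c₂ p.1, p.2) v) := by
  obtain ⟨r₁, hr₁, hs₁⟩ := hΩ₁.exists_slice
  obtain ⟨r₂, hr₂, hs₂⟩ := hΩ₂.exists_slice
  have t₁ : Tendsto (fun p : Y × E => (c₁ p.1, p.2)) (𝓝 (y₀, 0)) (𝓝 (c₁ y₀, 0)) :=
    (hc₁.tendsto.comp (continuous_fst.tendsto _)).prodMk_nhds (continuous_snd.tendsto _)
  have t₂ : Tendsto (fun p : Y × E => (c₂ p.1, p.2)) (𝓝 (y₀, 0)) (𝓝 (c₂ y₀, 0)) :=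
    (hc₂.tendsto.comp (continuous_fst.tendsto _)).prodMk_nhds (continuous_snd.tendsto _)
  have hall := (hθ.and (t₁.eventually (he₁.and hΩ₁.eventually_analyticAt))).and
    (t₂.eventually (he₂.and hΩ₂.eventually_analyticAt))
  rw [nhds_prod_eq] at hall
  obtain ⟨U, hU, S, hS, hUS⟩ := mem_prod_iff.1 hall
  obtain ⟨R, hR, hRS⟩ := Metric.mem_nhds_iff.1 hS
  let r := min (min r₁ r₂) R
  have hr : 0 < r := lt_min (lt_min hr₁ hr₂) hR
  have u₁ : ∀ᶠ y in 𝓝 y₀, c₁ y ∈ Metric.ball (c₁ y₀) r₁ :=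
    hc₁.tendsto.eventually (Metric.ball_mem_nhds _ hr₁)
  have u₂ : ∀ᶠ y in 𝓝 y₀, c₂ y ∈ Metric.ball (c₂ y₀) r₂ :=
    hc₂.tendsto.eventually (Metric.ball_mem_nhds _ hr₂)
  rw [nhds_prod_eq]
  refine mem_prod_iff.2 ⟨_, inter_mem hU (inter_mem u₁ u₂), _, Metric.ball_mem_nhds 0 hr, ?_⟩
  rintro ⟨y, e⟩ ⟨⟨hyU, hy₁, hy₂⟩, he⟩ v
  obtain ⟨p₁, hp₁⟩ := hs₁ _ hy₁
  obtain ⟨p₂, hp₂⟩ := hs₂ _ hy₂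
  have hrpos : 0 < ENNReal.ofReal r := ENNReal.ofReal_pos.2 hr
  have hp₁' := hp₁.mono hrpos (ENNReal.ofReal_le_ofReal ((min_le_left _ _).trans (min_le_left _ _)))
  have hp₂' := hp₂.mono hrpos (ENNReal.ofReal_le_ofReal ((min_le_left _ _).trans (min_le_right _ _)))
  let ev₁ := ContinuousAlternatingMap.apply K E W₁ v
  let ev₂ := ContinuousAlternatingMap.apply K E W₂ v
  have key := map_eq_of_euler (T₁ y) T₂
    (ev₁.comp_hasFPowerSeriesOnBall hp₁') (ev₂.comp_hasFPowerSeriesOnBall hp₂') q.succ_ne_zero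
    (fun e he => ?_) (e := e) ?_
  · exact key
  · have he' : e ∈ Metric.ball (0 : E) r := by
      rwa [Metric.eball_ofReal] at he
    obtain ⟨⟨a1, a2, a3⟩, a4, a5⟩ :=
      hUS (Set.mk_mem_prod hyU (hRS (Metric.ball_subset_ball (min_le_right _ _) he')))
    rw [AnalyticAt.euler_slice a3, AnalyticAt.euler_slice a5]
    simp only at a2 a4
    rw [a2, a4]
    exact a1 v
  · rwa [Metric.eball_ofReal]

namespace LocAnCohom

/-! ### Closed forms in coordinates -/

section Primitive

variable {K : Type u} [NontriviallyNormedField K] [IsUltrametricDist K] [CompleteSpace K]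
  [CharZero K] {E : Type u} [NormedAddCommGroup E] [NormedSpace K E] [FiniteDimensional K E]
  {G : Type u} [TopologicalSpace G] [ChartedSpace E G] [Group G] [LieGroup 𝓘(K, E) ω G]

namespace LocAnRep

variable {V : LocAnRep K E G} {q : ℕ} {X : AnMfd K}

/-- The chart of `G × X` at a point. -/
noncomputable abbrev chartGX (K : Type u) [NontriviallyNormedField K]
    (E : Type u) [NormedAddCommGroup E] [NormedSpace K E] {G : Type u} [TopologicalSpace G]
    [ChartedSpace E G] {X : AnMfd K} (y₀ y : G × X) : E × X.model :=
  extChartAt (𝓘(K, E).prod 𝓘(K, X.model)) y₀ y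

theorem tendsto_chartGX (y : G × X) :
    Tendsto (fun p : (G × X) × E => (chartGX K E y p.1, p.2)) (𝓝 (y, 0)) (𝓝 (chartGX K E y y, 0)) :=
  ((continuousAt_extChartAt y).tendsto.comp (continuous_fst.tendsto _)).prodMk_nhds
    (continuous_snd.tendsto _)

/-- An eventual property of points of `G × X` translates to an eventual property of the
coordinates. -/
theorem eventually_of_chartGX {y : G × X} {P : (E × X.model) × E → Prop}
    (h : ∀ᶠ p in 𝓝 (y, (0 : E)), P (chartGX K E y p.1, p.2)) : ∀ᶠ z in 𝓝 (chartGX K E y y, (0 : E)), P z := by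
  have h1 : Tendsto (fun z : (E × X.model) × E =>
      ((extChartAt (𝓘(K, E).prod 𝓘(K, X.model)) y).symm z.1, z.2)) (𝓝 (chartGX K E y y, 0))
      (𝓝 (y, 0)) := by
    have h2 := (continuousAt_extChartAt_symm (I := 𝓘(K, E).prod 𝓘(K, X.model)) y).tendsto
    rw [extChartAt_to_inv] at h2
    exact (h2.comp (continuous_fst.tendsto _)).prodMk_nhds (continuous_snd.tendsto _)
  have h3 : ∀ᶠ z in 𝓝 (chartGX K E y y, (0 : E)),
      z.1 ∈ (extChartAt (𝓘(K, E).prod 𝓘(K, X.model)) y).target :=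
    (continuous_fst.tendsto _).eventually
      (extChartAt_target_mem_nhds (I := 𝓘(K, E).prod 𝓘(K, X.model)) y)
  filter_upwards [h1.eventually h, h3] with z hz hz'
  rw [chartGX, PartialEquiv.right_inv _ hz'] at hz
  exact hz

/-- A closed admissible form is locally given by a closed family of forms with values in a
BH-space. -/
theorem IsAdmForm.exists_closed_factor {f : X → G → V.Cochain q} (hf : V.IsAdmForm X f)
    (hd : ∀ x h ξ, dRaw (f x) h ξ = 0) (y : G × X) (h₀ : G) :
    ∃ (W : BHSpace K V) (θ : (E × X.model) × E → E [⋀^Fin q]→L[K] W.carrier),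
      AnalyticAt K θ (chartGX K E y y, 0) ∧
      (∀ᶠ z in 𝓝 (chartGX K E y y, (0 : E)), extDeriv (fun e => θ (z.1, e)) z.2 = 0) ∧
      ∀ᶠ p in 𝓝 (y, (0 : E)), ∀ ξ : Fin q → E, V.ρ p.1.1 (f p.1.2 (h₀ * coord K p.2) ξ) =
        W.incl (θ (chartGX K E y p.1, p.2) fun i => frame K G p.2 (ξ i)) := by
  have hE : CompleteSpace E := FiniteDimensional.complete K E
  obtain ⟨W, φ, hφ, h⟩ := hf.exists_factor y h₀
  have hreg : ∀ᶠ p in 𝓝 (y, (0 : E)), IsRegularCoord K G p.2 :=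
    (continuous_snd.tendsto _).eventually eventually_isRegularCoord
  -- Composing with the inverse frame turns the left invariant coefficients into an actual form on
  -- E, to which the Poincaré lemma applies.
  refine ⟨W, fun z => (φ z).compContinuousLinearMap (frame K G z.2).inverse, ?_, ?_, ?_⟩
  · have h1 : ContDiffAt K ω (fun z : (E × X.model) × E => (frame K G z.2).inverse)
        (chartGX K E y y, 0) :=
      ContDiffAt.comp (chartGX K E y y, (0 : E)) (g := fun e : E => (frame K G e).inverse)
        (contDiffAt_frame_inverse K) contDiffAt_snd
    exact ((hφ.contDiffAt (n := ω)).compContinuousLinearMap_alternating h1).analyticAt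
  · refine eventually_of_chartGX ?_
    filter_upwards [h.eventually_nhds, hreg,
      (tendsto_chartGX y).eventually hφ.eventually_analyticAt] with p h1 h2 h3
    have h4 : DifferentiableAt K (fun e => φ (chartGX K E y p.1, e)) p.2 :=
      DifferentiableAt.comp (g := φ) p.2 h3.differentiableAt
        (f := fun e => (chartGX K E y p.1, e)) (by fun_prop)
    ext v
    have h5 := extDeriv_frame (h2.contDiffAt_frame.differentiableAt (by simp)) h2.isInvertible
      (h2.contDiffAt_frame_inverse.differentiableAt (by simp)) h2.lieBracket_frame h4
      (fun i => (frame K G p.2).inverse (v i))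
    have h6 := IsAdmForm.ρ_dRaw h1 h2 h3.differentiableAt
      (fun i => (frame K G p.2).inverse (v i))
    -- Closedness is known only in V; injectivity of the inclusion transfers it to W.
    have h7 := W.incl_injective ((h6.symm.trans ((congrArg (V.ρ _) (hd _ _ _)).trans
      (map_zero _))).trans (map_zero W.incl).symm)
    have h8 : (fun i => frame K G p.2 ((frame K G p.2).inverse (v i))) = v := by
      funext i
      exact h2.isInvertible.self_of_nhds.self_apply_inverse _
    rw [h8] at h5
    exact h5.trans h7
  · filter_upwards [h, hreg] with p h1 h2 ξ
    rw [h1 ξ, ContinuousAlternatingMap.compContinuousLinearMap_apply]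
    congr 2
    funext i
    exact (h2.isInvertible.self_of_nhds.inverse_apply_self _).symm

end LocAnRep

end Primitive

end LocAnCohom

namespace LocAnCohom

/-! ### Admissible primitives of closed forms, and closed functions -/

section Primitive

variable {K : Type u} [NontriviallyNormedField K] [IsUltrametricDist K] [CompleteSpace K]
  [CharZero K] {E : Type u} [NormedAddCommGroup E] [NormedSpace K E] [FiniteDimensional K E]
  {G : Type u} [TopologicalSpace G] [ChartedSpace E G] [Group G] [LieGroup 𝓘(K, E) ω G]

theorem lDeriv_congr {V : Type u} [AddCommGroup V] [Module K V] [TopologicalSpace V]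
    {ψ ψ' : G → V} {h : G} (hψ : ψ =ᶠ[𝓝 h] ψ') (ξ : E) : lDeriv K ξ ψ h = lDeriv K ξ ψ' h := by
  have hG : ContinuousMul G := ⟨(contMDiff_mul 𝓘(K, E) (n := ω) (G := G)).continuous⟩
  have ht : Tendsto (fun t : K => h * (chartLine K E ξ t : G)) (𝓝[≠] 0) (𝓝 h) := by
    have := (tendsto_chartLine K E (G := G) ξ).const_mul h
    rwa [mul_one] at this
  unfold lDeriv limUnder
  congr 1
  refine Filter.map_congr ?_
  filter_upwards [ht.eventually hψ] with t h1
  rw [h1, hψ.self_of_nhds]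

theorem dRaw_congr {V : Type u} [AddCommGroup V] [Module K V] [TopologicalSpace V] {q : ℕ}
    {s s' : G → GroupLieAlgebra 𝓘(K, E) G [⋀^Fin q]→ₗ[K] V} {h : G} (hs : s =ᶠ[𝓝 h] s') :
    dRaw s h = dRaw s' h := by
  funext x
  unfold dRaw
  congr 1
  · refine Finset.sum_congr rfl fun i _ => ?_
    congr 1
    exact lDeriv_congr (hs.mono fun h' hh => congrArg (fun η => η (i.removeNth x)) hh) _
  · rw [hs.self_of_nhds]

namespace LocAnRep

variable {V : LocAnRep K E G} {q : ℕ} {X : AnMfd K}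

/-- The contraction of a family of forms with the Euler vector field, expressed in the left
invariant frame. -/
noncomputable def eulerContraction {W F : Type u} [NormedAddCommGroup W] [NormedSpace K W]
    (G : Type u) [TopologicalSpace G] [ChartedSpace E G] [Group G]
    (Ω : F × E → E [⋀^Fin (q + 1)]→L[K] W) (z : F × E) : E [⋀^Fin q]→L[K] W :=
  ((Ω z).curryLeft z.2).compContinuousLinearMap (frame K G z.2)

theorem contDiffAt_eulerContraction {W F : Type u} [NormedAddCommGroup W] [NormedSpace K W]
    [CompleteSpace W]
    [NormedAddCommGroup F] [NormedSpace K F] {Ω : F × E → E [⋀^Fin (q + 1)]→L[K] W} {z : F × E}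
    (hΩ : AnalyticAt K Ω z) (hz : ContDiffAt K ω (frame K G : E → E →L[K] E) z.2) :
    ContDiffAt K ω (eulerContraction (K := K) G Ω) z := by
  let c : (E [⋀^Fin (q + 1)]→L[K] W) →L[K] E →L[K] E [⋀^Fin q]→L[K] W :=
    ContinuousAlternatingMap.curryLeftLI.toContinuousLinearMap
  have h1 : ContDiffAt K ω (fun z => c (Ω z)) z :=
    ContDiffAt.clm_apply_fun (A := F × E) (B := E [⋀^Fin (q + 1)]→L[K] W)
      (C := E →L[K] E [⋀^Fin q]→L[K] W) c (hΩ.contDiffAt (n := ω))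
  have h2 : ContDiffAt K ω (fun z => c (Ω z) z.2) z := h1.clm_apply contDiffAt_snd
  exact ContDiffAt.compContinuousLinearMap_alternating (φ := fun z => c (Ω z) z.2) h2
    (ContDiffAt.comp z (g := frame K G) hz contDiffAt_snd)

/-- The primitive is constructed at g = 1 only. Near another g₀ the family g f factors through a
different Banach space and has its own Euler solution; by uniqueness that solution agrees in V with
g applied to the first one, which is thereby analytic near g₀. Compactness of G provides a
neighbourhood of (x₀, h₀) that works for all g. -/
theorem IsAdmForm.exists_primitive_near [CompactSpace G] {f : X → G → V.Cochain (q + 1)}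
    (hf : V.IsAdmForm X f) (hd : ∀ x h ξ, dRaw (f x) h ξ = 0) (x₀ : X) (h₀ : G) :
    ∃ p : X → G → V.Cochain q, ∀ᶠ y in 𝓝 (x₀, h₀),
      (∀ g ξ, IsAnAt K (𝓘(K, E).prod (𝓘(K, X.model).prod 𝓘(K, E)))
        (fun p' : G × (X × G) => V.ρ p'.1 (p p'.2.1 p'.2.2 ξ)) (g, y)) ∧
      ∀ ξ, dRaw (p y.1) y.2 ξ = f y.1 y.2 ξ := by
  have hE : CompleteSpace E := FiniteDimensional.complete K E
  have hG : ContinuousMul G := ⟨(contMDiff_mul 𝓘(K, E) (n := ω) (G := G)).continuous⟩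
  have hreg := eventually_isRegularCoord (K := K) (E := E) (G := G)
  obtain ⟨W₁, θ₁, hθ₁, hc₁, hfθ₁⟩ := hf.exists_closed_factor hd ((1 : G), x₀) h₀
  obtain ⟨Ω₁, hΩ₁, he₁, hd₁⟩ := exists_primitive hθ₁ hc₁
  let c : X → E × X.model := fun x => chartGX K E ((1 : G), x₀) (1, x)
  have hcont : ContinuousAt c x₀ :=
    (continuousAt_extChartAt (I := 𝓘(K, E).prod 𝓘(K, X.model)) ((1 : G), x₀)).comp
      (f := fun x : X => ((1 : G), x)) (x := x₀)
      (Continuous.continuousAt (by fun_prop))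
  have hct : Tendsto (fun p : X × E => (c p.1, p.2)) (𝓝 (x₀, 0)) (𝓝 (c x₀, 0)) :=
    (hcont.tendsto.comp (continuous_fst.tendsto _)).prodMk_nhds (continuous_snd.tendsto _)
  let β := eulerContraction (K := K) G Ω₁
  let p : X → G → V.Cochain q := fun x h =>
    (W₁.incl.toLinearMap.compAlternatingMap (β (c x, coordInv K E (h₀⁻¹ * h))).toAlternatingMap)
  have hp : ∀ (x : X) (e : E), IsRegularCoord K G e → ∀ ξ : Fin q → E,
      p x (h₀ * coord K e) ξ = W₁.incl (β (c x, e) ξ) := by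
    intro x e he ξ
    change W₁.incl (β (c x, coordInv K E (h₀⁻¹ * (h₀ * coord K e))) ξ) = _
    rw [inv_mul_cancel_left, he.coordInv_coord]
  have hfθ : ∀ᶠ z in 𝓝 (x₀, (0 : E)), ∀ ξ : Fin (q + 1) → E, f z.1 (h₀ * coord K z.2) ξ =
      W₁.incl (θ₁ (c z.1, z.2) fun i => frame K G z.2 (ξ i)) := by
    have ht : Tendsto (fun z : X × E => (((1 : G), z.1), z.2)) (𝓝 (x₀, 0)) (𝓝 ((1, x₀), 0)) :=
      Continuous.tendsto (f := fun z : X × E => (((1 : G), z.1), z.2)) (by fun_prop) (x₀, (0 : E))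
    filter_upwards [ht.eventually hfθ₁] with z hz ξ
    have := hz ξ
    rw [ρ_one] at this
    exact this
  have han : ∀ g₀ : G, ∀ᶠ z in 𝓝 ((x₀, (0 : E)), g₀), ∀ ξ : Fin q → E,
      IsAnAt K (𝓘(K, E).prod (𝓘(K, X.model).prod 𝓘(K, E)))
        (fun p' : G × (X × G) => V.ρ p'.1 (p p'.2.1 p'.2.2 ξ))
        (z.2, (z.1.1, h₀ * coord K z.1.2)) := by
    intro g₀
    -- The independent factorization at g₀, to be compared with the translate of the one at 1.
    obtain ⟨W₂, θ₂, hθ₂, hc₂, hfθ₂⟩ := hf.exists_closed_factor hd (g₀, x₀) h₀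
    obtain ⟨Ω₂, hΩ₂, he₂, hd₂⟩ := exists_primitive hθ₂ hc₂
    have t1 : Tendsto (fun z : (G × X) × E => (z.1.2, z.2)) (𝓝 ((g₀, x₀), 0)) (𝓝 (x₀, 0)) :=
      Continuous.tendsto (f := fun z : (G × X) × E => (z.1.2, z.2)) (by fun_prop)
        ((g₀, x₀), (0 : E))
    have t2 := tendsto_chartGX (K := K) (E := E) (g₀, x₀)
    have t3 : Tendsto (fun z : (G × X) × E => z.2) (𝓝 ((g₀, x₀), 0)) (𝓝 0) :=
      continuous_snd.tendsto _
    have hΩ := eventually_map_eq_of_euler (Y := G × X) (y₀ := (g₀, x₀)) (c₁ := fun y => c y.2)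
      (c₂ := fun y => chartGX K E (g₀, x₀) y)
      (ContinuousAt.comp (g := c) (f := Prod.snd) (x := (g₀, x₀)) hcont continuousAt_snd)
      (continuousAt_extChartAt (I := 𝓘(K, E).prod 𝓘(K, X.model)) (g₀, x₀))
      (fun y => (V.ρ y.1 : V →L[K] V).comp W₁.incl) W₂.incl hΩ₁ hΩ₂ he₁ he₂ (by
        filter_upwards [hfθ₂, t1.eventually hfθ, t3.eventually hreg] with z h1 h2 h3 v
        have h4 : (fun i => frame K G z.2 ((frame K G z.2).inverse (v i))) = v := by
          funext i
          exact h3.isInvertible.self_of_nhds.self_apply_inverse _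
        have h5 := h1 (fun i => (frame K G z.2).inverse (v i))
        have h6 := h2 (fun i => (frame K G z.2).inverse (v i))
        rw [h4] at h5 h6
        rw [← h5]
        exact congrArg (V.ρ z.1.1) h6.symm)
    have hloc : ∀ᶠ z in 𝓝 ((g₀, x₀), (0 : E)), ∀ ξ : Fin q → E,
        V.ρ z.1.1 (p z.1.2 (h₀ * coord K z.2) ξ) =
          W₂.incl (eulerContraction (K := K) G Ω₂ (chartGX K E (g₀, x₀) z.1, z.2) ξ) := by
      filter_upwards [hΩ, t3.eventually hreg] with z h1 h2 ξ
      rw [hp _ _ h2]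
      exact h1 _
    have hsrc : ∀ᶠ z in 𝓝 ((g₀, x₀), (0 : E)),
        z.1 ∈ (extChartAt (𝓘(K, E).prod 𝓘(K, X.model)) (g₀, x₀)).source :=
      (continuous_fst.tendsto ((g₀, x₀), (0 : E))).eventually (extChartAt_source_mem_nhds (g₀, x₀))
    have hfin : ∀ᶠ z in 𝓝 ((g₀, x₀), (0 : E)), ∀ ξ : Fin q → E,
        IsAnAt K (𝓘(K, E).prod (𝓘(K, X.model).prod 𝓘(K, E)))
          (fun p' : G × (X × G) => V.ρ p'.1 (p p'.2.1 p'.2.2 ξ))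
          (z.1.1, (z.1.2, h₀ * coord K z.2)) := by
      filter_upwards [hloc.eventually_nhds, hsrc, t3.eventually hreg,
        t2.eventually hΩ₂.eventually_analyticAt] with z h1 h2 h3 h4 ξ
      refine isAnAt_of_coord (W := W₂) (g₀, x₀) h2 h3 h₀ (φ := fun z =>
        eulerContraction (K := K) G Ω₂ z ξ) ?_ (h1.mono fun z hz => hz ξ)
      exact ContDiffAt.clm_apply_fun (B := E [⋀^Fin q]→L[K] W₂.carrier)
        (ContinuousAlternatingMap.apply K E W₂.carrier ξ)
        (contDiffAt_eulerContraction h4 h3.contDiffAt_frame)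
    have t4 : Tendsto (fun z : (X × E) × G => ((z.2, z.1.1), z.1.2)) (𝓝 ((x₀, 0), g₀))
        (𝓝 ((g₀, x₀), 0)) :=
      Continuous.tendsto (f := fun z : (X × E) × G => ((z.2, z.1.1), z.1.2)) (by fun_prop)
        ((x₀, (0 : E)), g₀)
    exact t4.eventually hfin
  -- Tube lemma: the neighbourhoods found for the individual g₀ are replaced by one serving all of
  -- G.
  have han' := isCompact_univ.eventually_forall_of_forall_eventually (x₀ := (x₀, (0 : E)))
    (P := fun z g => ∀ ξ : Fin q → E, IsAnAt K (𝓘(K, E).prod (𝓘(K, X.model).prod 𝓘(K, E)))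
        (fun p' : G × (X × G) => V.ρ p'.1 (p p'.2.1 p'.2.2 ξ)) (g, (z.1, h₀ * coord K z.2)))
    fun g _ => han g
  have t5 : Tendsto (fun z : X × E => z.2) (𝓝 (x₀, 0)) (𝓝 0) := continuous_snd.tendsto _
  have hprim : ∀ᶠ z in 𝓝 (x₀, (0 : E)), ∀ ξ : Fin (q + 1) → E,
      dRaw (p z.1) (h₀ * coord K z.2) ξ = f z.1 (h₀ * coord K z.2) ξ := by
    filter_upwards [hfθ, t5.eventually hreg, t5.eventually hreg.eventually_nhds,
      hct.eventually hd₁, hct.eventually hΩ₁.eventually_analyticAt] with z h1 h2 h3 h4 h5 ξ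
    have h6 : DifferentiableAt K (fun e => β (c z.1, e)) z.2 :=
      DifferentiableAt.comp (g := β) z.2
        ((contDiffAt_eulerContraction h5 h2.contDiffAt_frame).differentiableAt (by simp))
        (f := fun e => (c z.1, e)) (by fun_prop)
    refine (dRaw_eq_extDeriv W₁.incl h2 h6 h₀ (h3.mono fun e he => hp z.1 e he) ξ).trans ?_
    refine Eq.trans ?_ (h1 ξ).symm
    have h7 : (fun e => (β (c z.1, e)).compContinuousLinearMap (frame K G e).inverse) =ᶠ[𝓝 z.2]
        fun e => (Ω₁ (c z.1, e)).curryLeft e := by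
      filter_upwards [h2.isInvertible] with e he
      ext v
      change (Ω₁ (c z.1, e)).curryLeft e (fun i => frame K G e ((frame K G e).inverse (v i))) = _
      congr 1
      funext i
      exact he.self_apply_inverse _
    rw [h7.extDeriv_eq]
    have h4' : extDeriv (fun e => (Ω₁ (c z.1, e)).curryLeft e) z.2 = θ₁ (c z.1, z.2) := h4
    rw [h4']
  refine ⟨p, ?_⟩
  have t6 : Tendsto (fun y : X × G => (y.1, coordInv K E (h₀⁻¹ * y.2))) (𝓝 (x₀, h₀))
      (𝓝 (x₀, 0)) := by
    have h1 : Tendsto (fun y : X × G => h₀⁻¹ * y.2) (𝓝 (x₀, h₀)) (𝓝 1) := by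
      have := Continuous.tendsto (f := fun y : X × G => h₀⁻¹ * y.2) (by fun_prop) (x₀, h₀)
      rwa [inv_mul_cancel] at this
    exact (continuous_fst.tendsto _).prodMk_nhds ((tendsto_coordInv K (E := E)).comp h1)
  have t7 : ∀ᶠ y in 𝓝 (x₀, h₀), h₀ * coord K (coordInv K E (h₀⁻¹ * y.2)) = y.2 := by
    have h1 : Tendsto (fun y : X × G => h₀⁻¹ * y.2) (𝓝 (x₀, h₀)) (𝓝 1) := by
      have := Continuous.tendsto (f := fun y : X × G => h₀⁻¹ * y.2) (by fun_prop) (x₀, h₀)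
      rwa [inv_mul_cancel] at this
    filter_upwards [h1.eventually (eventually_coord_coordInv K (E := E) (G := G))] with y hy
    rw [hy, mul_inv_cancel_left]
  filter_upwards [t6.eventually han', t6.eventually hprim, t7] with y h1 h2 h3
  simp only [h3] at h1 h2
  exact ⟨fun g ξ => h1 g trivial ξ, h2⟩

/-- Locally on the parameter space, closed admissible forms of positive degree are exact. -/
theorem IsAdmForm.exists_primitive [T2Space G] [CompactSpace G] {f : X → G → V.Cochain (q + 1)}
    (hf : V.IsAdmForm X f) (hd : ∀ x h ξ, dRaw (f x) h ξ = 0) (x₀ : X) :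
    ∃ (U : Set X) (p : X → G → V.Cochain q), IsOpen U ∧ x₀ ∈ U ∧ ∀ x ∈ U,
      (∀ g h ξ, IsAnAt K (𝓘(K, E).prod (𝓘(K, X.model).prod 𝓘(K, E)))
        (fun p' : G × (X × G) => V.ρ p'.1 (p p'.2.1 p'.2.2 ξ)) (g, (x, h))) ∧
      ∀ h ξ, dRaw (p x) h ξ = f x h ξ := by
  have hG : IsTopologicalGroup G := topologicalGroup_of_lieGroup 𝓘(K, E) ω
  choose p hp using hf.exists_primitive_near hd x₀
  have h1 := fun h₀ => mem_nhds_prod_iff.1 (eventually_iff.1 (hp h₀))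
  choose U hU N hN hUN using h1
  obtain ⟨H, t, ht⟩ := exists_openSubgroup_refining K E N hN
  choose τ hτ hτN using ht
  -- σ depends only on the coset of h, so it is locally constant. Since the cosets are disjoint,
  -- primitives chosen coset by coset need not agree anywhere.
  let σ : G → G := fun h => τ (QuotientGroup.mk h : G ⧸ (H : Subgroup G)).out
  have hσ : ∀ h, h ∈ N (σ h) := fun h => by
    have h2 := hτN (QuotientGroup.mk h : G ⧸ (H : Subgroup G)).out
      ((QuotientGroup.mk h : G ⧸ (H : Subgroup G)).out⁻¹ * h)
      (QuotientGroup.eq.1 (QuotientGroup.out_eq' _))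
    rwa [mul_inv_cancel_left] at h2
  have hσc : ∀ h, ∀ᶠ h' in 𝓝 h, σ h' = σ h := fun h => by
    have h2 : (fun h' => h⁻¹ * h') ⁻¹' (H : Set G) ∈ 𝓝 h := by
      refine (continuous_const_mul h⁻¹).continuousAt.preimage_mem_nhds ?_
      rw [inv_mul_cancel]
      exact H.mem_nhds_one
    filter_upwards [h2] with h' hh
    have : (QuotientGroup.mk h' : G ⧸ (H : Subgroup G)) = QuotientGroup.mk h :=
      (QuotientGroup.eq.2 hh).symm
    simp only [σ, this]
  have hV : ⋂ h₀ ∈ t, U h₀ ∈ 𝓝 x₀ := (biInter_finset_mem t).2 fun h₀ _ => hU h₀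
  refine ⟨interior (⋂ h₀ ∈ t, U h₀), fun x h => p (σ h) x h, isOpen_interior,
    mem_interior_iff_mem_nhds.2 hV, fun x hx => ?_⟩
  have hx' : ∀ h, x ∈ U (σ h) := fun h =>
    Set.mem_iInter₂.1 (interior_subset hx) _ (hτ _)
  have hall := fun h => hUN (σ h) (Set.mk_mem_prod (hx' h) (hσ h))
  refine ⟨fun g h ξ => ((hall h).1 g ξ).congr ?_, fun h ξ => ?_⟩
  · have : Tendsto (fun p' : G × (X × G) => p'.2.2) (𝓝 (g, (x, h))) (𝓝 h) :=
      Continuous.tendsto (f := fun p' : G × (X × G) => p'.2.2) (by fun_prop) (g, (x, h))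
    filter_upwards [this.eventually (hσc h)] with p' hp'
    rw [hp']
  · rw [← (hall h).2 ξ]
    refine congrFun (dRaw_congr ?_) ξ
    filter_upwards [hσc h] with h' hh
    rw [hh]

/-- In degree 0, closedness gives D_e θ(e) = 0, the homogeneous Euler equation with q = 0, whose
solutions are constant in e. -/
theorem IsAdmForm.eventually_eq_of_closed {f : X → G → V.Cochain 0}
    (hf : V.IsAdmForm X f) (hd : ∀ x h ξ, dRaw (f x) h ξ = 0) (x₀ : X) (h₀ : G) :
    ∀ᶠ y in 𝓝 (x₀, h₀), f y.1 y.2 = f y.1 h₀ := by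
  have hG : ContinuousMul G := ⟨(contMDiff_mul 𝓘(K, E) (n := ω) (G := G)).continuous⟩
  obtain ⟨W, θ, hθ, hc, hfθ⟩ := hf.exists_closed_factor hd ((1 : G), x₀) h₀
  have hE : ∀ᶠ z in 𝓝 (chartGX K E ((1 : G), x₀) ((1 : G), x₀), (0 : E)), θ z = θ (z.1, 0) := by
    have h1 := hθ.eventually_eq_of_euler 0 (by
      filter_upwards [hc, hθ.eventually_analyticAt] with z h1 h2
      have h3 : DifferentiableAt K (fun e => θ (z.1, e)) z.2 :=
        DifferentiableAt.comp (g := θ) z.2 h2.differentiableAt (f := fun e => (z.1, e))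
          (by fun_prop)
      have h4 : extDeriv (fun e => θ (z.1, e)) z.2 (fun _ => z.2) = 0 := by rw [h1]; rfl
      rw [extDeriv, ContinuousAlternatingMap.alternatizeUncurryFin_apply] at h4
      rw [fderiv_slice h2.differentiableAt] at h4
      rw [Nat.cast_zero, zero_smul, zero_add]
      ext v
      have h5 : v = Fin.removeNth (0 : Fin 1) (α := fun _ => E) (fun _ => z.2) :=
        Subsingleton.elim _ _
      rw [h5]
      simpa using h4)
    simpa using h1
  have ht : Tendsto (fun y : X × G => (((1 : G), y.1), coordInv K E (h₀⁻¹ * y.2)))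
      (𝓝 (x₀, h₀)) (𝓝 (((1 : G), x₀), 0)) := by
    have h1 : Tendsto (fun y : X × G => h₀⁻¹ * y.2) (𝓝 (x₀, h₀)) (𝓝 1) := by
      have := Continuous.tendsto (f := fun y : X × G => h₀⁻¹ * y.2) (by fun_prop) (x₀, h₀)
      rwa [inv_mul_cancel] at this
    exact (tendsto_const_nhds.prodMk_nhds (continuous_fst.tendsto _)).prodMk_nhds
      ((tendsto_coordInv K (E := E)).comp h1)
  have ht0 : Tendsto (fun y : X × G => (((1 : G), y.1), (0 : E)))
      (𝓝 (x₀, h₀)) (𝓝 (((1 : G), x₀), 0)) :=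
    Continuous.tendsto (f := fun y : X × G => (((1 : G), y.1), (0 : E))) (by fun_prop) (x₀, h₀)
  have h1 : Tendsto (fun y : X × G => h₀⁻¹ * y.2) (𝓝 (x₀, h₀)) (𝓝 1) := by
    have := Continuous.tendsto (f := fun y : X × G => h₀⁻¹ * y.2) (by fun_prop) (x₀, h₀)
    rwa [inv_mul_cancel] at this
  filter_upwards [ht.eventually hfθ, ht0.eventually hfθ,
    h1.eventually (eventually_coord_coordInv K (E := E) (G := G)),
    ht.eventually ((tendsto_chartGX (K := K) (E := E) ((1 : G), x₀)).eventually hE)]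
    with y a1 a2 a3 a4
  ext ξ
  have b1 := a1 ξ
  have b2 := a2 ξ
  simp only [ρ_one] at b1 b2
  rw [a3, mul_inv_cancel_left] at b1
  rw [coord_zero, mul_one] at b2
  rw [b1, b2, a4]
  congr 2
  exact Subsingleton.elim _ _

/-- Closed admissible functions are locally constant along `G`, locally uniformly in the
parameter. -/
theorem IsAdmForm.exists_openSubgroup [T2Space G] [CompactSpace G] {f : X → G → V.Cochain 0}
    (hf : V.IsAdmForm X f) (hd : ∀ x h ξ, dRaw (f x) h ξ = 0) (x₀ : X) :
    ∃ (U : Set X) (H : OpenSubgroup G), IsOpen U ∧ x₀ ∈ U ∧ ∀ x ∈ U, ∀ h, ∀ k ∈ H,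
      f x (h * k) = f x h := by
  have h1 := fun h₀ => mem_nhds_prod_iff.1 (eventually_iff.1 <| hf.eventually_eq_of_closed hd x₀ h₀)
  choose U hU N hN hUN using h1
  obtain ⟨H, t, ht⟩ := exists_openSubgroup_refining K E N hN
  have hV : ⋂ h₀ ∈ t, U h₀ ∈ 𝓝 x₀ := (biInter_finset_mem t).2 fun h₀ _ => hU h₀
  refine ⟨interior (⋂ h₀ ∈ t, U h₀), H, isOpen_interior,
    mem_interior_iff_mem_nhds.2 hV, fun x hx h k hk => ?_⟩
  obtain ⟨h₀, h₀t, hh⟩ := ht h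
  have hx' : x ∈ U h₀ := Set.mem_iInter₂.1 (interior_subset hx) _ h₀t
  have e1 : f x (h * k) = f x h₀ := hUN h₀ (Set.mk_mem_prod hx' (hh k hk))
  have e2 : f x (h * 1) = f x h₀ := hUN h₀ (Set.mk_mem_prod hx' (hh 1 (one_mem H)))
  rw [mul_one] at e2
  rw [e1, e2]

end LocAnRep

end Primitive

end LocAnCohom

namespace LocAnCohom

/-! ### Sheaves of functions with values in a group with an action of `G` -/

section FunctionSheaves

variable (K : Type u) [NontriviallyNormedField K]
  (E : Type u) [NormedAddCommGroup E] [NormedSpace K E]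
  (G : Type u) [TopologicalSpace G] [ChartedSpace E G] [Group G] [LieGroup 𝓘(K, E) ω G]

/-- A class of functions on manifolds with values in an abelian group with `G`-action that is
local and stable under restriction and under the action of `y(G)`. -/
structure FunData where
  carrier : Type u
  [addCommGroup : AddCommGroup carrier]
  [distribMulAction : DistribMulAction G carrier]
  sec (X : AnMfd K) : AddSubgroup (X → carrier)
  res {X Y : AnMfd K} (k : X ⟶ Y) {f : Y → carrier} (hf : f ∈ sec Y) : (fun x => f (k x)) ∈ sec X
  act {X : AnMfd K} (ρ : Pts K E G X) {f : X → carrier} (hf : f ∈ sec X) :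
    (fun x => ρ x • f x) ∈ sec X
  loc {X : AnMfd K} {f : X → carrier} (hf : ∀ x : X, ∃ (Y : AnMfd K) (j : Y ⟶ X) (r : X → Y),
    IsOpen (Set.range j) ∧ x ∈ Set.range j ∧
    (∀ y ∈ Set.range j, j (r y) = y ∧ ContMDiffAt 𝓘(K, X.model) 𝓘(K, Y.model) ω r y) ∧
    (fun y => f (j y)) ∈ sec Y) : f ∈ sec X

namespace FunData

attribute [instance] addCommGroup distribMulAction

variable {K E G}

/-- The presheaf of functions of a given class. -/
def presheaf (D : FunData K E G) : (AnMfd K)ᵒᵖ ⥤ AddCommGrpCat.{u + 1} where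
  obj X := AddCommGrpCat.of (ULift.{u + 1} (D.sec X.unop))
  map f := AddCommGrpCat.ofHom
    { toFun s := ULift.up ⟨fun y => s.down.1 (f.unop y), D.res f.unop s.down.2⟩
      map_zero' := rfl
      map_add' _ _ := rfl }
  map_id _ := rfl
  map_comp _ _ := rfl

/-- Sections are functions, so the glued section is found pointwise by restricting the family to
one-point manifolds; that it belongs to the class is a local matter, granted by `loc`. -/
theorem isSheaf_presheaf (D : FunData K E G) :
    Presheaf.IsSheaf (AnMfd.topology K) D.presheaf := by
  rw [Presheaf.isSheaf_iff_isSheaf_forget _ _ (forget AddCommGrpCat.{u + 1}),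
    isSheaf_iff_isSheaf_of_type]
  intro X S hS x hx
  have hpt : ∀ p : X, S (AnMfd.ptTo X p) := by
    intro p
    obtain ⟨U, hU, hp, h⟩ := hS p
    refine h _ _ ?_
    rintro _ ⟨z, rfl⟩
    exact hp
  let val : ∀ {Y : AnMfd K} (f : Y ⟶ X), S f → Y → D.carrier := fun f hf => (ULift.down (x f hf)).1
  have hval : ∀ {Y : AnMfd K} (f : Y ⟶ X) (hf : S f), val f hf ∈ D.sec Y :=
    fun f hf => (ULift.down (x f hf)).2
  let t : X → D.carrier := fun p => val (AnMfd.ptTo X p) (hpt p) PUnit.unit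
  have ht : ∀ {Y : AnMfd K} (f : Y ⟶ X) (hf : S f) (y : Y), t (f y) = val f hf y := by
    intro Y f hf y
    have h := hx (𝟙 _) (AnMfd.ptTo Y y) (hpt (f y)) hf (by rfl)
    exact congrFun (congrArg (fun s : ULift.{u + 1} (D.sec AnMfd.pt) => s.down.1) h)
      PUnit.unit
  have hadm : t ∈ D.sec X := by
    refine D.loc fun p => ?_
    obtain ⟨U, hU, hp, h⟩ := hS p
    obtain ⟨Y, j, r, hjU, hjo, hpj, -, -, hr⟩ := AnMfd.exists_open X p U hU hp
    refine ⟨Y, j, r, hjo, hpj, hr, ?_⟩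
    have : (fun y => t (j y)) = val j (h Y j hjU) := funext fun y => ht j _ y
    rw [this]
    exact hval _ _
  refine ⟨ULift.up ⟨t, hadm⟩, ?_, ?_⟩
  · intro Y f hf
    exact ULift.ext _ _ (Subtype.ext (funext fun y => ht f hf y))
  · intro t' ht'
    refine ULift.ext _ _ (Subtype.ext (funext fun p => ?_))
    have h := ht' (AnMfd.ptTo X p) (hpt p)
    exact congrFun (congrArg (fun s : ULift.{u + 1} (D.sec AnMfd.pt) => s.down.1) h)
      PUnit.unit

/-- The sheaf of functions of a given class with its action of `y(G)`. -/
def toSheaf (D : FunData K E G) : EquivSheaf K E G where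
  sheaf := ⟨D.presheaf, D.isSheaf_presheaf⟩
  act X :=
    { toFun ρ := (
        { toFun s := ULift.up ⟨fun x => ρ x • s.down.1 x, D.act ρ s.down.2⟩
          map_zero' := ULift.ext _ _ (Subtype.ext (funext fun _ => smul_zero _))
          map_add' _ _ := ULift.ext _ _ (Subtype.ext (funext fun _ => smul_add _ _ _)) } :
        ULift.{u + 1} (D.sec X) →+ ULift.{u + 1} (D.sec X))
      map_one' := by
        refine AddMonoidHom.ext fun s => ?_
        exact ULift.ext _ _ (Subtype.ext (funext fun _ => one_smul G _))
      map_mul' ρ σ := by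
        refine AddMonoidHom.ext fun s => ?_
        exact ULift.ext _ _ (Subtype.ext (funext fun _ => mul_smul _ _ _)) }
  act_res f ρ s := rfl

/-- Maps between classes of functions. -/
structure Hom (D D' : FunData K E G) where
  toFun : D.carrier →+ D'.carrier
  map_smul (g : G) (v : D.carrier) : toFun (g • v) = g • toFun v
  map_sec {X : AnMfd K} {f : X → D.carrier} (hf : f ∈ D.sec X) : (fun x => toFun (f x)) ∈ D'.sec X

/-- The map of sheaves induced by a map of classes of functions. -/
def Hom.toSheafHom {D D' : FunData K E G} (T : Hom D D') : D.toSheaf ⟶ D'.toSheaf where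
  hom := ⟨{
    app X := AddCommGrpCat.ofHom (
      { toFun s := ULift.up ⟨fun x => T.toFun (s.down.1 x), T.map_sec s.down.2⟩
        map_zero' := ULift.ext _ _ (Subtype.ext (funext fun _ => map_zero T.toFun))
        map_add' _ _ := ULift.ext _ _ (Subtype.ext (funext fun _ => map_add T.toFun _ _)) } :
      ULift.{u + 1} (D.sec X.unop) →+ ULift.{u + 1} (D'.sec X.unop))
    naturality _ _ _ := rfl }⟩
  equivariant _ _ _ := ULift.ext _ _ (Subtype.ext (funext fun _ => T.map_smul _ _))

theorem hom_ext {D D' : FunData K E G} {φ ψ : D.toSheaf ⟶ D'.toSheaf}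
    (h : ∀ (X : AnMfd K) (s : ULift.{u + 1} (D.sec X)) (x : X),
      ((φ.hom.hom.app (op X)).hom s : ULift.{u + 1} (D'.sec X)).down.1 x =
        ((ψ.hom.hom.app (op X)).hom s : ULift.{u + 1} (D'.sec X)).down.1 x) : φ = ψ := by
  refine EquivSheaf.hom_ext (Sheaf.hom_ext (NatTrans.ext (funext fun X => ?_)))
  refine AddCommGrpCat.hom_ext (AddMonoidHom.ext fun s => ?_)
  exact ULift.ext _ _ (Subtype.ext (funext fun x => h X.unop s x))

theorem toSheafHom_ext {D D' : FunData K E G} {S T : Hom D D'} (h : ∀ v, S.toFun v = T.toFun v) :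
    S.toSheafHom = T.toSheafHom := hom_ext fun _ _ _ => h _

/-- The identity. -/
def Hom.id (D : FunData K E G) : Hom D D := ⟨AddMonoidHom.id _, fun _ _ => rfl, fun h => h⟩

/-- The composition. -/
def Hom.comp {D D' D'' : FunData K E G} (S : Hom D D') (T : Hom D' D'') : Hom D D'' :=
  ⟨T.toFun.comp S.toFun, fun g v => by
    rw [AddMonoidHom.comp_apply, S.map_smul, T.map_smul]; rfl, fun h => T.map_sec (S.map_sec h)⟩

end FunData

namespace LocAnRep
variable {K E G}

/-- Admissible functions as a class of functions. -/
def admData (V : LocAnRep K E G) : FunData K E G where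
  carrier := V
  distribMulAction :=
    { smul g v := V.ρ g v
      one_smul v := V.ρ_one v
      mul_smul g h v := V.ρ_mul g h v
      smul_zero g := map_zero (V.ρ g)
      smul_add g := map_add (V.ρ g) }
  sec X := V.admissible X
  res k f hf := (V.admRes k ⟨f, hf⟩).2
  act {X} ρ f hf := ((show V.admissible X →+ V.admissible X from V.admAct X ρ) ⟨f, hf⟩).2
  loc {X f} hf := by
    have key : ∀ p : X, ∃ (Y : AnMfd K) (j : Y ⟶ X) (r : X → Y), V.IsAdmissible Y (fun y => f (j y)) ∧
        (∀ᶠ q in 𝓝 p, f q = f (j (r q))) ∧ ContMDiffAt 𝓘(K, X.model) 𝓘(K, Y.model) ω r p := by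
      intro p
      obtain ⟨Y, j, r, hjo, hpj, hr, h⟩ := hf p
      refine ⟨Y, j, r, h, ?_, (hr p hpj).2⟩
      filter_upwards [hjo.mem_nhds hpj] with q hq
      rw [(hr q hq).1]
    refine ⟨fun p => ?_, fun p => ?_⟩
    · obtain ⟨Y, j, r, h, h1, h2⟩ := key p
      exact ((h.1 (r p)).comp h2).congr (h1.mono fun q hq => hq.symm)
    · obtain ⟨Y, j, r, h, h1, h2⟩ := key p.2
      refine ((h.2 (p.1, r p.2)).comp (r := fun q : G × X => (q.1, r q.2))
        (contMDiffAt_fst.prodMk (h2.comp p contMDiffAt_snd))).congr ?_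
      filter_upwards [continuous_snd.continuousAt.eventually h1] with q hq
      rw [← hq]

/-- A map of representations as a map of classes of functions. -/
def admDataMap {V V' : LocAnRep K E G} (T : V ⟶ V') : FunData.Hom V.admData V'.admData where
  toFun := (T.toCLM : V →+ V')
  map_smul g v := T.equivariant g v
  map_sec {X f} hf := (((((admSheaf K E G).map T).hom.hom.app (op X)).hom
    (ULift.up ⟨f, hf⟩ : ULift.{u + 1} (V.admissible X)) : ULift.{u + 1} (V'.admissible X))).down.2

end LocAnRep

end FunctionSheaves

end LocAnCohom

namespace LocAnCohom

/-! ### Sections -/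

section Sections

variable {K : Type u} [NontriviallyNormedField K]
  {E : Type u} [NormedAddCommGroup E] [NormedSpace K E]
  {G : Type u} [TopologicalSpace G] [ChartedSpace E G] [Group G] [LieGroup 𝓘(K, E) ω G]

theorem AnMfd.exists_open_factor (X : AnMfd K) (x : X) (U : Set X) (hU : IsOpen U) (hx : x ∈ U) :
    ∃ (Y : AnMfd K) (j : Y ⟶ X), Set.range j ⊆ U ∧ IsOpen (Set.range j) ∧ x ∈ Set.range j ∧
      Function.Injective j ∧
      ∀ (Z : AnMfd K) (k : Z ⟶ X), Set.range k ⊆ Set.range j → ∃ k' : Z ⟶ Y, k' ≫ j = k := by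
  obtain ⟨Y, j, r, hjU, hjo, hxj, hinj, -, hr⟩ := AnMfd.exists_open X x U hU hx
  refine ⟨Y, j, hjU, hjo, hxj, hinj, fun Z k hk => ?_⟩
  exact ⟨⟨fun z => r (k z), fun z => (hr _ (hk ⟨z, rfl⟩)).2.comp z ((AnMfd.hom_contMDiff k) z)⟩,
    AnMfd.hom_ext fun z => (hr _ (hk ⟨z, rfl⟩)).1⟩

namespace EquivSheaf

/-- The sections over `X`. -/
abbrev Sec (A : EquivSheaf K E G) (X : AnMfd K) : Type (u + 1) := A.sheaf.obj.obj (op X)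

/-- The restriction of sections. -/
def res (A : EquivSheaf K E G) {X Y : AnMfd K} (k : X ⟶ Y) : A.Sec Y →+ A.Sec X :=
  (A.sheaf.obj.map k.op).hom

/-- The action of a map on sections. -/
def app {A B : EquivSheaf K E G} (φ : A ⟶ B) (X : AnMfd K) : A.Sec X →+ B.Sec X :=
  (φ.hom.hom.app (op X)).hom

variable {A B C : EquivSheaf K E G} {X Y Z : AnMfd K}

theorem res_res (k : X ⟶ Y) (l : Y ⟶ Z) (s : A.Sec Z) : A.res k (A.res l s) = A.res (k ≫ l) s := by
  unfold res
  rw [op_comp, A.sheaf.obj.map_comp]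
  rfl

theorem res_id (s : A.Sec X) : A.res (𝟙 X) s = s := by
  unfold res
  rw [op_id, A.sheaf.obj.map_id]
  rfl

theorem app_res (φ : A ⟶ B) (k : X ⟶ Y) (s : A.Sec Y) :
    app φ X (A.res k s) = B.res k (app φ Y s) :=
  NatTrans.naturality_apply φ.hom.hom k.op s

theorem app_act (φ : A ⟶ B) (ρ : Pts K E G X) (s : A.Sec X) :
    app φ X (A.act X ρ s) = B.act X ρ (app φ X s) := φ.equivariant X ρ s

theorem res_act (k : X ⟶ Y) (ρ : Pts K E G Y) (s : A.Sec Y) :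
    A.res k (A.act Y ρ s) = A.act X (ρ.res k) (A.res k s) := A.act_res k ρ s

theorem act_one (s : A.Sec X) : A.act X 1 s = s := by
  rw [map_one]
  rfl

theorem act_mul (ρ σ : Pts K E G X) (s : A.Sec X) :
    A.act X (ρ * σ) s = A.act X ρ (A.act X σ s) := by
  rw [map_mul]
  rfl

theorem app_comp (φ : A ⟶ B) (ψ : B ⟶ C) (s : A.Sec X) :
    app (φ ≫ ψ) X s = app ψ X (app φ X s) := rfl

theorem app_add (φ ψ : A ⟶ B) (s : A.Sec X) : app (φ + ψ) X s = app φ X s + app ψ X s :=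
  add_hom_app φ ψ (op X) s

theorem hom_ext_app {φ ψ : A ⟶ B} (h : ∀ X (s : A.Sec X), app φ X s = app ψ X s) : φ = ψ := by
  refine EquivSheaf.hom_ext (Sheaf.hom_ext (NatTrans.ext (funext fun X => ?_)))
  exact AddCommGrpCat.hom_ext (AddMonoidHom.ext fun s => h X.unop s)

variable (K E G) in
/-- The functor of sections over `X`. -/
def secFunctor (X : AnMfd K) : EquivSheaf K E G ⥤ AddCommGrpCat.{u + 1} :=
  toTw K E G ⋙ sheafToPresheaf _ _ ⋙ (evaluation _ _).obj (op ⟨X⟩)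

instance (X : AnMfd K) : (secFunctor K E G X).Additive where
  map_add {_ _ f g} := AddCommGrpCat.hom_ext (AddMonoidHom.ext fun s => add_hom_app f g (op X) s)

instance (X : AnMfd K) : Limits.PreservesFiniteLimits (secFunctor K E G X) := by
  unfold secFunctor
  infer_instance

theorem app_zero (s : A.Sec X) : app (0 : A ⟶ B) X s = 0 := by
  have h := (secFunctor K E G X).map_zero A B
  exact congrArg (fun f : (secFunctor K E G X).obj A ⟶ (secFunctor K E G X).obj B => f.hom s) h

theorem mono_iff (φ : A ⟶ B) : Mono φ ↔ ∀ X, Function.Injective (app φ X) := by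
  constructor
  · intro h X
    have : Mono ((secFunctor K E G X).map φ) := inferInstance
    exact (AddCommGrpCat.mono_iff_injective _).1 this
  · intro h
    refine ⟨fun u v huv => hom_ext_app fun X s => h X ?_⟩
    rw [← app_comp, ← app_comp, huv]

theorem app_injective (φ : A ⟶ B) [Mono φ] (X : AnMfd K) : Function.Injective (app φ X) :=
  (mono_iff φ).1 inferInstance X

/-- The section `s` is locally in the image of `φ`. -/
def LocallyLifts (φ : A ⟶ B) {X : AnMfd K} (s : B.Sec X) : Prop :=
  ∀ x : X, ∃ U : Set X, IsOpen U ∧ x ∈ U ∧ ∀ (Y : AnMfd K) (k : Y ⟶ X), Set.range k ⊆ U →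
    ∃ t : A.Sec Y, app φ Y t = B.res k s

/-- Epimorphisms of sheaves are the locally surjective maps, and covering sieves of G × X are
detected on X. -/
theorem epi_iff (φ : A ⟶ B) : Epi φ ↔ ∀ (X : AnMfd K) (s : B.Sec X), LocallyLifts φ s := by
  rw [← (toTw K E G).epi_map_iff_epi φ, ← Sheaf.isLocallySurjective_iff_epi']
  have key : ∀ (X : AnMfd K) (s : B.Sec X) {Y : AnMfd K} (k : Y ⟶ X),
      Tw.base (Presheaf.imageSieve ((toTw K E G).map φ).hom (U := ⟨X⟩) s) k ↔
        ∃ t : A.Sec Y, app φ Y t = B.res k s := by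
    intro X s Y k
    change (∃ t : A.Sec Y, app φ Y t = B.toPresheaf.map (Tw.lift (X := ⟨Y⟩) (Y := ⟨X⟩) k).op s) ↔ _
    have h := B.toPresheaf_map_lift (X := ⟨Y⟩) (Y := ⟨X⟩) k s
    rw [h]
    rfl
  constructor
  · intro h X s x
    have h1 : Tw.base (Presheaf.imageSieve ((toTw K E G).map φ).hom (U := ⟨X⟩) s) ∈
      AnMfd.topology K X := h.imageSieve_mem (U := ⟨X⟩) s
    obtain ⟨U, hU, hx, hk⟩ := h1 x
    exact ⟨U, hU, hx, fun Y k hr => (key X s k).1 (hk Y k hr)⟩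
  · intro h
    refine ⟨fun {X} s => ?_⟩
    change Tw.base _ ∈ AnMfd.topology K X.mfd
    intro x
    obtain ⟨U, hU, hx, hk⟩ := h X.mfd s x
    exact ⟨U, hU, hx, fun Y k hr => (key X.mfd s k).2 (hk Y k hr)⟩

theorem exists_lift_of_exact {S : ShortComplex (EquivSheaf K E G)} (hS : S.Exact) [Mono S.f]
    (s : S.X₂.Sec X) (hs : app S.g X s = 0) : ∃ t : S.X₁.Sec X, app S.f X t = s := by
  have h := hS.map_of_mono_of_preservesKernel (secFunctor K E G X) inferInstance inferInstance
  exact (ShortComplex.ab_exact_iff _).1 h s hs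

theorem exact_of_locallyLifts (S : ShortComplex (EquivSheaf K E G))
    (h : ∀ (X : AnMfd K) (s : S.X₂.Sec X), app S.g X s = 0 → LocallyLifts S.f s) : S.Exact := by
  rw [S.exact_iff_epi_kernel_lift, epi_iff]
  intro X s x
  have h1 : app S.g X (app (Limits.kernel.ι S.g) X s) = 0 := by
    rw [← app_comp, Limits.kernel.condition, app_zero]
  obtain ⟨U, hU, hx, hk⟩ := h X _ h1 x
  refine ⟨U, hU, hx, fun Y k hr => ?_⟩
  obtain ⟨t, ht⟩ := hk Y k hr
  refine ⟨t, app_injective (Limits.kernel.ι S.g) Y ?_⟩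
  rw [← app_comp, Limits.kernel.lift_ι, ht, app_res]

theorem locallyLifts_of_app (φ : A ⟶ B) {s : B.Sec X} (t : A.Sec X) (h : app φ X t = s) :
    LocallyLifts φ s := fun x => ⟨Set.univ, isOpen_univ, trivial, fun Y k _ =>
  ⟨A.res k t, by rw [app_res, h]⟩⟩

/-- The sheaf condition. -/
theorem exists_glue (A : EquivSheaf K E G) (S : Sieve X) (hS : S ∈ AnMfd.topology K X)
    (t : ∀ (Y : AnMfd K) (k : Y ⟶ X), S k → A.Sec Y)
    (ht : ∀ (Y Z : AnMfd K) (k : Y ⟶ X) (hk : S k) (m : Z ⟶ Y),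
      A.res m (t Y k hk) = t Z (m ≫ k) (S.downward_closed hk m)) :
    ∃ s : A.Sec X, ∀ (Y : AnMfd K) (k : Y ⟶ X) (hk : S k), A.res k s = t Y k hk := by
  have h := A.sheaf.property
  rw [Presheaf.isSheaf_iff_isSheaf_forget _ _ (forget AddCommGrpCat.{u + 1}),
    isSheaf_iff_isSheaf_of_type] at h
  obtain ⟨s, hs, -⟩ := h S hS (fun Y k hk => t Y k hk) (by
    intro Y₁ Y₂ Z g₁ g₂ f₁ f₂ h₁ h₂ e
    refine (ht _ _ f₁ h₁ g₁).trans (Eq.trans ?_ (ht _ _ f₂ h₂ g₂).symm)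
    congr 1)
  exact ⟨s, fun Y k hk => hs k hk⟩

theorem eq_of_locally_eq {s t : A.Sec X} (h : ∀ x : X, ∃ U : Set X, IsOpen U ∧ x ∈ U ∧
    ∀ (Y : AnMfd K) (k : Y ⟶ X), Set.range k ⊆ U → A.res k s = A.res k t) : s = t := by
  have h' := A.sheaf.property
  rw [Presheaf.isSheaf_iff_isSheaf_forget _ _ (forget AddCommGrpCat.{u + 1}),
    isSheaf_iff_isSheaf_of_type] at h'
  let S : Sieve X :=
    { arrows Y k := A.res k s = A.res k t
      downward_closed {Y Z k} hk m := by rw [← res_res, ← res_res, hk] }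
  have hS : S ∈ AnMfd.topology K X := h
  exact (h' S hS).isSeparatedFor.ext fun Y k hk => hk

theorem subsingleton_of_isEmpty (A : EquivSheaf K E G) [IsEmpty X] : Subsingleton (A.Sec X) :=
  ⟨fun _ _ => eq_of_locally_eq fun x => isEmptyElim x⟩

/-- A family of sections over open sets covering `X` that agree on the overlaps comes from a section
over `X`. -/
theorem exists_glue_open (A : EquivSheaf K E G) (U : X → Set X) (hU : ∀ x, IsOpen (U x))
    (hxU : ∀ x, x ∈ U x) (t : ∀ (x : X) (Y : AnMfd K) (k : Y ⟶ X), Set.range k ⊆ U x → A.Sec Y)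
    (hres : ∀ (x : X) (Y Z : AnMfd K) (k : Y ⟶ X) (hk : Set.range k ⊆ U x) (m : Z ⟶ Y)
      (hm : Set.range (m ≫ k) ⊆ U x), A.res m (t x Y k hk) = t x Z (m ≫ k) hm)
    (hcompat : ∀ (x y : X) (Y : AnMfd K) (k : Y ⟶ X) (hx : Set.range k ⊆ U x)
      (hy : Set.range k ⊆ U y), t x Y k hx = t y Y k hy) :
    ∃ s : A.Sec X, ∀ (x : X) (Y : AnMfd K) (k : Y ⟶ X) (hk : Set.range k ⊆ U x),
      A.res k s = t x Y k hk := by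
  have hsub : ∀ {x : X} {Y Z : AnMfd K} {k : Y ⟶ X} (m : Z ⟶ Y), Set.range k ⊆ U x →
      Set.range (m ≫ k) ⊆ U x := by
    rintro x Y Z k m hk _ ⟨z, rfl⟩
    exact hk ⟨m z, rfl⟩
  let S : Sieve X :=
    { arrows Y k := ∃ x, Set.range k ⊆ U x
      downward_closed := fun ⟨x, hx⟩ m => ⟨x, hsub m hx⟩ }
  have hS : S ∈ AnMfd.topology K X := fun x => ⟨U x, hU x, hxU x, fun Y k hk => ⟨x, hk⟩⟩
  obtain ⟨s, hs⟩ := A.exists_glue S hS (fun Y k hk => t hk.choose Y k hk.choose_spec)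
    (fun Y Z k hk m => by
      rw [hres _ _ _ _ _ m (hsub m hk.choose_spec)]
      exact hcompat _ _ _ _ _ _)
  exact ⟨s, fun x Y k hk => (hs Y k ⟨x, hk⟩).trans (hcompat _ _ _ _ _ _)⟩

/-- A section locally in the image of a monomorphism is in the image. -/
theorem LocallyLifts.exists_app_eq {φ : A ⟶ B} [Mono φ] {s : B.Sec X} (h : LocallyLifts φ s) :
    ∃ t : A.Sec X, app φ X t = s := by
  choose U hU hx ht using h
  choose t ht using ht
  obtain ⟨r, hr⟩ := A.exists_glue_open U hU hx t
    (fun x Y Z k hk m hm => app_injective φ Z (by rw [app_res, ht, ht, res_res]))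
    (fun x y Y k hx hy => app_injective φ Y (by rw [ht, ht]))
  exact ⟨r, eq_of_locally_eq fun x => ⟨U x, hU x, hx x, fun Y k hk => by
    rw [← app_res, hr x Y k hk, ht]⟩⟩

/-- A locally liftable section lifts, compatibly with restrictions, over a neighbourhood of every
point. -/
theorem LocallyLifts.exists_compatible {φ : A ⟶ B} {s : B.Sec X} (h : LocallyLifts φ s) (x : X) :
    ∃ U : Set X, IsOpen U ∧ x ∈ U ∧ ∃ t : ∀ (Y : AnMfd K) (k : Y ⟶ X), Set.range k ⊆ U → A.Sec Y,
      (∀ (Y Z : AnMfd K) (k : Y ⟶ X) (hk : Set.range k ⊆ U) (m : Z ⟶ Y)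
        (hm : Set.range (m ≫ k) ⊆ U), A.res m (t Y k hk) = t Z (m ≫ k) hm) ∧
      ∀ (Y : AnMfd K) (k : Y ⟶ X) (hk : Set.range k ⊆ U), app φ Y (t Y k hk) = B.res k s := by
  obtain ⟨U, hU, hx, hk⟩ := h x
  obtain ⟨Y₀, j, hjU, hjo, hxj, hinj, hfac⟩ := AnMfd.exists_open_factor X x U hU hx
  obtain ⟨t₀, ht₀⟩ := hk Y₀ j hjU
  choose fac hfac using hfac
  -- A single lift over a small open submanifold is chosen and then restricted. As φ need not be a
  -- monomorphism, separate choices would not be compatible.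
  refine ⟨Set.range j, hjo, hxj, fun Y k hk => A.res (fac Y k hk) t₀, ?_, ?_⟩
  · intro Y Z k hk m hm
    rw [res_res]
    congr 2
    refine AnMfd.hom_ext fun z => hinj ?_
    have h1 := congrArg (fun f : Z ⟶ X => f z) (hfac Z (m ≫ k) hm)
    have h2 := congrArg (fun f : Y ⟶ X => f (m z)) (hfac Y k hk)
    exact h2.trans h1.symm
  · intro Y k hk
    rw [app_res, ht₀, res_res, hfac]

end EquivSheaf

end Sections

end LocAnCohom

namespace LocAnCohom

/-! ### Coinduction -/

section Coinduction

variable {K : Type u} [NontriviallyNormedField K]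
  {E : Type u} [NormedAddCommGroup E] [NormedSpace K E] [FiniteDimensional K E]
  {G : Type u} [TopologicalSpace G] [ChartedSpace E G] [Group G] [LieGroup 𝓘(K, E) ω G]
  [T2Space G] [CompactSpace G]

namespace AnMfd

variable (E G) in
/-- The manifold `X × G`. -/
def prodG (X : AnMfd K) : AnMfd K where
  carrier := X × G
  model := X.model × E
  chartedSpace := prodChartedSpace X.model X E G
  isManifold := by
    rw [modelWithCornersSelf_prod]
    exact IsManifold.prod X G

variable {X Y Z : AnMfd K}

variable (E G) in
/-- The projection `X × G → X`. -/
def fst (X : AnMfd K) : prodG E G X ⟶ X :=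
  ⟨fun p : X × G => p.1, by
    have h := contMDiff_fst (I := 𝓘(K, X.model)) (J := 𝓘(K, E)) (M := X) (N := G) (n := ω)
    rw [← modelWithCornersSelf_prod] at h
    exact h⟩

variable (E G) in
/-- The projection `X × G → G`. -/
def snd (X : AnMfd K) : Pts K E G (prodG E G X) :=
  ⟨fun p : X × G => p.2, by
    have h := contMDiff_snd (I := 𝓘(K, X.model)) (J := 𝓘(K, E)) (M := X) (N := G) (n := ω)
    rw [← modelWithCornersSelf_prod] at h
    exact h⟩

/-- The map to `X × G` with given components. -/
def pair (k : Y ⟶ X) (ρ : Pts K E G Y) : Y ⟶ prodG E G X :=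
  ⟨fun y => ((k y, ρ y) : X × G), by
    have h := ContMDiff.prodMk (hom_contMDiff k) ρ.contMDiff
    rw [← modelWithCornersSelf_prod] at h
    exact h⟩

variable (E G) in
/-- The map `k × id : Y × G → X × G`. -/
def prodGMap (k : Y ⟶ X) : prodG E G Y ⟶ prodG E G X := pair (fst E G Y ≫ k) (snd E G Y)

variable (E G) in
/-- The functor `X ↦ X × G`. -/
def prodGFunctor : AnMfd K ⥤ AnMfd K where
  obj X := prodG E G X
  map k := prodGMap E G k
  map_id _ := rfl
  map_comp _ _ := rfl

/-- The automorphism `(x, h) ↦ (x, ρ(x)⁻¹ h)` of `X × G`. -/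
def shear (ρ : Pts K E G X) : prodG E G X ⟶ prodG E G X :=
  pair (fst E G X) ((ρ.res (fst E G X))⁻¹ * snd E G X)

variable (E G) in
/-- The map `x ↦ (x, 1)`. -/
def oneSec (X : AnMfd K) : X ⟶ prodG E G X := pair (𝟙 X) 1

theorem shear_one : shear (1 : Pts K E G X) = 𝟙 _ :=
  hom_ext fun p => Prod.ext rfl (by
    change (1 : G)⁻¹ * p.2 = p.2
    rw [inv_one, one_mul])

theorem shear_mul (ρ σ : Pts K E G X) : shear (ρ * σ) = shear ρ ≫ shear σ :=
  hom_ext fun p => Prod.ext rfl (by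
    change (ρ p.1 * σ p.1)⁻¹ * p.2 = (σ p.1)⁻¹ * ((ρ p.1)⁻¹ * p.2)
    rw [mul_inv_rev, mul_assoc])

end AnMfd

open AnMfd

namespace EquivSheaf

variable {A B C : EquivSheaf K E G} {X Y Z : AnMfd K}

/-- A covering of X pulls back to a covering of X × G. A map from Z to X × G factors through Z × G
by means of its second component, so a family over the products Y × G determines sections over all
such Z. -/
theorem isSheaf_coind (A : EquivSheaf K E G) :
    Presheaf.IsSheaf (AnMfd.topology K) ((prodGFunctor E G).op ⋙ A.sheaf.obj) := by
  rw [Presheaf.isSheaf_iff_isSheaf_forget _ _ (forget AddCommGrpCat.{u + 1}),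
    isSheaf_iff_isSheaf_of_type]
  intro X S hS x hx
  let S' : Sieve (prodG E G X) :=
    { arrows Z k := S (k ≫ fst E G X)
      downward_closed {Y Z k} hk m := by
        rw [Category.assoc]
        exact S.downward_closed hk m }
  have hS' : S' ∈ AnMfd.topology K (prodG E G X) :=
    (AnMfd.topology K).pullback_stable (fst E G X) hS
  have hx' : ∀ (Y Z : AnMfd K) (k : Y ⟶ X) (hk : S k) (m : Z ⟶ Y) (hm : S (m ≫ k)),
      A.res (prodGMap E G m) (x k hk : A.Sec (prodG E G Y)) = x (m ≫ k) hm := by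
    intro Y Z k hk m hm
    exact (hx m (𝟙 Z) hk hm (Category.id_comp _).symm).trans (A.res_id (X := prodG E G Z) _)
  obtain ⟨t, ht⟩ := A.exists_glue S' hS'
    (fun Z k hk => A.res (pair (𝟙 Z) ((snd E G X).res k))
      (x (k ≫ fst E G X) hk : A.Sec (prodG E G Z)))
    (fun Y Z k hk m => by
      have h1 := hx' Y Z (k ≫ fst E G X) hk m (S.downward_closed hk m)
      refine (A.res_res _ _ _).trans ?_
      refine Eq.trans ?_ (congrArg (A.res (pair (𝟙 Z) ((snd E G X).res (m ≫ k)))) h1)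
      exact (A.res_res (pair (𝟙 Z) ((snd E G X).res (m ≫ k))) (prodGMap E G m)
        (x (k ≫ fst E G X) hk : A.Sec (prodG E G Y))).symm)
  refine ⟨t, fun Y k hk => ?_, fun t' ht' => ?_⟩
  · have h1 := ht (prodG E G Y) (prodGMap E G k) (S.downward_closed hk (fst E G Y))
    refine h1.trans ?_
    have h2 := hx' _ _ k hk (fst E G Y) (S.downward_closed hk (fst E G Y))
    refine (congrArg (A.res _) h2).symm.trans ?_
    exact (A.res_res _ _ _).trans (A.res_id (X := prodG E G Y) _)
  · refine eq_of_locally_eq (A := A) (X := prodG E G X) fun p => ?_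
    obtain ⟨U, hU, hp, hk⟩ := hS (fst E G X p)
    refine ⟨fst E G X ⁻¹' U, hU.preimage (hom_contMDiff (fst E G X)).continuous, hp,
      fun Z k hr => ?_⟩
    have hkS : S (k ≫ fst E G X) := hk Z _ (by
      rintro _ ⟨z, rfl⟩
      exact hr ⟨z, rfl⟩)
    have h1 : A.res (prodGMap E G (k ≫ fst E G X)) (t' : A.Sec (prodG E G X)) = x (k ≫ fst E G X) hkS := ht' _ hkS
    have h2 : A.res (prodGMap E G (k ≫ fst E G X)) t = x (k ≫ fst E G X) hkS := by
      have h3 := ht (prodG E G Z) (prodGMap E G (k ≫ fst E G X))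
        (S.downward_closed hkS (fst E G Z))
      refine h3.trans ?_
      have h2 := hx' _ _ (k ≫ fst E G X) hkS (fst E G Z) (S.downward_closed hkS (fst E G Z))
      refine (congrArg (A.res _) h2).symm.trans ?_
      exact (A.res_res _ _ _).trans (A.res_id (X := prodG E G Z) _)
    have h3 := congrArg (A.res (pair (𝟙 Z) ((snd E G X).res k))) (h1.trans h2.symm)
    exact (A.res_res _ _ _).symm.trans (h3.trans (A.res_res _ _ _))

/-- The coinduced sheaf `X ↦ A(X × G)`, on which `y(G)` acts by left translation of the second
factor. -/
def coind (A : EquivSheaf K E G) : EquivSheaf K E G where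
  sheaf := ⟨(prodGFunctor E G).op ⋙ A.sheaf.obj, A.isSheaf_coind⟩
  act X :=
    { toFun ρ := A.res (shear ρ)
      map_one' := by
        refine AddMonoidHom.ext fun s => ?_
        rw [shear_one]
        exact A.res_id (X := prodG E G X) s
      map_mul' ρ σ := by
        refine AddMonoidHom.ext fun s => ?_
        rw [shear_mul]
        exact (A.res_res (shear ρ) (shear σ) s).symm }
  act_res {X Y} f ρ s := (A.res_res (prodGMap E G f) (shear ρ) s).trans
    (A.res_res (shear (ρ.res f)) (prodGMap E G f) s).symm

theorem coind_res (k : Y ⟶ X) (s : A.Sec (prodG E G X)) :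
    A.coind.res k s = A.res (prodGMap E G k) s := rfl

theorem coind_act (ρ : Pts K E G X) (s : A.Sec (prodG E G X)) :
    A.coind.act X ρ s = A.res (shear ρ) s := rfl

/-- The functoriality of coinduction. -/
def coindMap (φ : A ⟶ B) : A.coind ⟶ B.coind where
  hom := ⟨Functor.whiskerLeft (prodGFunctor E G).op φ.hom.hom⟩
  equivariant _ ρ s := app_res φ (shear ρ) s

theorem app_coindMap (φ : A ⟶ B) (s : A.Sec (prodG E G X)) :
    app (coindMap φ) X s = app φ (prodG E G X) s := rfl

theorem coindMap_zero : coindMap (0 : A ⟶ B) = 0 :=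
  hom_ext_app fun X s => (app_zero (X := prodG E G X) s).trans (app_zero (A := A.coind) (B := B.coind) s).symm

theorem coindMap_comp (φ : A ⟶ B) (ψ : B ⟶ C) : coindMap (φ ≫ ψ) = coindMap φ ≫ coindMap ψ := rfl

/-- The unit `A → coind A`, `s ↦ ((x, h) ↦ h⁻¹ s(x))`. -/
def toCoind (A : EquivSheaf K E G) : A ⟶ A.coind where
  hom := ⟨{
    app X := AddCommGrpCat.ofHom
      ((show A.Sec (prodG E G X.unop) →+ A.Sec (prodG E G X.unop) from
        A.act (prodG E G X.unop) (snd E G X.unop)⁻¹).comp (A.res (fst E G X.unop)))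
    naturality X Y k := by
      ext s
      change A.act (prodG E G Y.unop) (snd E G Y.unop)⁻¹ (A.res (fst E G Y.unop) (A.res k.unop s)) =
        A.res (prodGMap E G k.unop)
          (A.act (prodG E G X.unop) (snd E G X.unop)⁻¹ (A.res (fst E G X.unop) s))
      rw [res_act, res_res, res_res]
      rfl }⟩
  equivariant X ρ s := by
    change A.act (prodG E G X) (snd E G X)⁻¹ (A.res (fst E G X) (A.act X ρ s)) =
      A.res (shear ρ) (A.act (prodG E G X) (snd E G X)⁻¹ (A.res (fst E G X) s))
    rw [res_act, res_act, res_res, ← act_mul]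
    congr 2
    refine ContMDiffMap.ext fun p => ?_
    change p.2⁻¹ * ρ p.1 = ((ρ p.1)⁻¹ * p.2)⁻¹
    rw [mul_inv_rev, inv_inv]

theorem app_toCoind (s : A.Sec X) : app A.toCoind X s =
    A.act (prodG E G X) (snd E G X)⁻¹ (A.res (fst E G X) s) := rfl

theorem toCoind_naturality (φ : A ⟶ B) : φ ≫ B.toCoind = A.toCoind ≫ coindMap φ :=
  hom_ext_app fun X s => by
    rw [app_comp, app_comp, app_toCoind, app_toCoind, app_coindMap, app_act, app_res]

/-- Evaluation at h = 1 undoes the unit. It is not equivariant, so it shows that the unit is a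
monomorphism without splitting it in the category. -/
theorem res_oneSec_toCoind (s : A.Sec X) :
    A.res (oneSec E G X) (app A.toCoind X s : A.Sec (prodG E G X)) = s := by
  rw [app_toCoind, res_act, res_res]
  have h1 : (snd E G X)⁻¹.res (oneSec E G X) = 1 :=
    ContMDiffMap.ext fun x => (inv_one : (1 : G)⁻¹ = 1)
  have h2 : oneSec E G X ≫ fst E G X = 𝟙 X := rfl
  rw [h1, h2, res_id, act_one]

instance : Mono A.toCoind := (mono_iff _).2 fun X s t h => by
  rw [← res_oneSec_toCoind s, h, res_oneSec_toCoind]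

instance (φ : A ⟶ B) [Mono φ] : Mono (coindMap φ) :=
  (mono_iff _).2 fun X => app_injective φ (prodG E G X)

theorem prodG_isOpen_coset (H : OpenSubgroup G) (h : G) :
    IsOpen {p : prodG E G X | h⁻¹ * (snd E G X p) ∈ H} := by
  have hG : ContinuousMul G := ⟨(contMDiff_mul 𝓘(K, E) (n := ω) (G := G)).continuous⟩
  exact H.isOpen.preimage ((continuous_const_mul h⁻¹).comp (snd E G X).contMDiff.continuous)

variable [IsUltrametricDist K] [CompleteSpace K]

/-- By compactness a neighbourhood of {x₀} × G is covered by finitely many products on which a lift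
exists. Over the disjoint cosets of a small open subgroup these lifts glue without any condition, so
coinduction preserves epimorphisms. -/
theorem LocallyLifts.exists_lift_prodG {φ : A ⟶ B} {s : B.Sec (prodG E G X)}
    (h : LocallyLifts φ s) (x₀ : X) :
    ∃ U : Set X, IsOpen U ∧ x₀ ∈ U ∧ ∀ (Y : AnMfd K) (k : Y ⟶ X), Set.range k ⊆ U →
      ∃ t : A.Sec (prodG E G Y), app φ _ t = B.res (prodGMap E G k) s := by
  have h0 : ∀ h₀ : G, ∃ W : Set (prodG E G X), IsOpen W ∧ ((x₀, h₀) : X × G) ∈ W ∧ _ :=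
    fun h₀ => h.exists_compatible ((x₀, h₀) : X × G)
  choose W hW hxW t ht₁ ht₂ using h0
  have h1 : ∀ h₀, ∃ U ∈ 𝓝 x₀, ∃ N ∈ 𝓝 h₀, U ×ˢ N ⊆ (W h₀ : Set (X × G)) := fun h₀ =>
    mem_nhds_prod_iff.1 ((hW h₀).mem_nhds (hxW h₀))
  choose U hU N hN hUN using h1
  obtain ⟨H, T, hT⟩ := exists_openSubgroup_refining K E N hN
  choose τ hτ hτN using hT
  have hV : ⋂ h₀ ∈ T, U h₀ ∈ 𝓝 x₀ := (biInter_finset_mem T).2 fun h₀ _ => hU h₀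
  refine ⟨interior (⋂ h₀ ∈ T, U h₀), isOpen_interior, mem_interior_iff_mem_nhds.2 hV,
    fun Y k hk => ?_⟩
  let c : G → G := fun h => (QuotientGroup.mk h : G ⧸ (H : Subgroup G)).out
  have hc : ∀ h : G, (c h)⁻¹ * h ∈ H := fun h => QuotientGroup.eq.1 (QuotientGroup.out_eq' _)
  have hceq : ∀ h h' h'' : G, (c h)⁻¹ * h'' ∈ H → (c h')⁻¹ * h'' ∈ H → c h = c h' := by
    intro h h' h'' e e'
    have e1 : (QuotientGroup.mk h : G ⧸ (H : Subgroup G)) = QuotientGroup.mk h'' :=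
      (QuotientGroup.out_eq' _).symm.trans (QuotientGroup.eq.2 e)
    have e2 : (QuotientGroup.mk h' : G ⧸ (H : Subgroup G)) = QuotientGroup.mk h'' :=
      (QuotientGroup.out_eq' _).symm.trans (QuotientGroup.eq.2 e')
    simp only [c, e1, e2]
  let U' : prodG E G Y → Set (prodG E G Y) := fun p =>
    {q | (c (snd E G Y p))⁻¹ * (snd E G Y q) ∈ H}
  have hWsub : ∀ (p : prodG E G Y) (Z : AnMfd K) (m : Z ⟶ prodG E G Y), Set.range m ⊆ U' p →
      Set.range (m ≫ prodGMap E G k) ⊆ W (τ (c (snd E G Y p))) := by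
    rintro p Z m hm _ ⟨z, rfl⟩
    refine hUN _ (Set.mk_mem_prod ?_ ?_)
    · exact Set.mem_iInter₂.1 (interior_subset (hk ⟨(m z).1, rfl⟩)) _ (hτ _)
    · have h2 := hτN (c (snd E G Y p)) _ (hm ⟨z, rfl⟩)
      rwa [mul_inv_cancel_left] at h2
  have htc : ∀ (g g' : G) (Z : AnMfd K) (m : Z ⟶ prodG E G X) (e : g = g')
      (h : Set.range m ⊆ W g) (h' : Set.range m ⊆ W g'), t g Z m h = t g' Z m h' := by
    rintro g _ Z m rfl h h'
    rfl
  obtain ⟨r, hr⟩ := A.exists_glue_open U' (fun p => prodG_isOpen_coset H _)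
    (fun p => hc _) (fun p Z m hm => t _ Z (m ≫ prodGMap E G k) (hWsub p Z m hm))
    (fun p Z Z' m hm n hn => ht₁ _ _ _ _ _ n _)
    (fun p p' Z m hm hm' => by
      -- Two pieces with a common point belong to the same coset and carry the same lift. Over the
      -- empty manifold there is only one section.
      rcases isEmpty_or_nonempty Z with hZ | ⟨⟨z⟩⟩
      · exact (A.subsingleton_of_isEmpty).elim _ _
      · exact htc _ _ _ _ (congrArg τ (hceq _ _ _ (hm ⟨z, rfl⟩) (hm' ⟨z, rfl⟩))) _ _)
  refine ⟨r, eq_of_locally_eq fun p => ⟨U' p, prodG_isOpen_coset H _, hc _, fun Z m hm => ?_⟩⟩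
  rw [← app_res, hr p Z m hm, ht₂, res_res]

instance epi_coindMap (φ : A ⟶ B) [Epi φ] : Epi (coindMap φ) := by
  rw [epi_iff]
  intro X s
  exact ((epi_iff φ).1 inferInstance (prodG E G X) s).exists_lift_prodG

/-- Coinduction is exact. -/
theorem shortExact_coind {S : ShortComplex (EquivSheaf K E G)} (hS : S.ShortExact) :
    (ShortComplex.mk (coindMap S.f) (coindMap S.g)
      (by rw [← coindMap_comp, S.zero, coindMap_zero])).ShortExact := by
  have := hS.mono_f
  have := hS.epi_g
  refine ShortComplex.ShortExact.mk' (exact_of_locallyLifts _ fun X s hs => ?_)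
    (inferInstanceAs (Mono (coindMap S.f))) (inferInstanceAs (Epi (coindMap S.g)))
  obtain ⟨t, ht⟩ := exists_lift_of_exact hS.exact (X := prodG E G X) s hs
  exact locallyLifts_of_app (coindMap S.f) (X := X) t ht

end EquivSheaf

end Coinduction

end LocAnCohom

namespace LocAnCohom

/-! ### Resolutions by acyclic objects -/

section AcyclicResolutions

open Limits Abelian

universe w v₁ u₁

variable {C : Type u₁} [Category.{v₁} C] [Abelian C] [HasExt.{w} C]

/-- A resolution of `M` by objects acyclic for `Hom(Z, -)`. -/
structure AcycRes (Z M : C) where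
  obj : ℕ → C
  d (n : ℕ) : obj n ⟶ obj (n + 1)
  ι : M ⟶ obj 0
  mono_ι : Mono ι
  ι_d : ι ≫ d 0 = 0
  d_d (n : ℕ) : d n ≫ d (n + 1) = 0
  exact_zero : (ShortComplex.mk ι (d 0) ι_d).Exact
  exact_succ (n : ℕ) : (ShortComplex.mk (d n) (d (n + 1)) (d_d n)).Exact
  acyclic (n m : ℕ) : Subsingleton (Ext Z (obj n) (m + 1))

namespace AcycRes

attribute [instance] mono_ι

variable {Z M M' : C}

/-- The short exact sequence starting a resolution. -/
noncomputable def seq (R : AcycRes Z M) : ShortComplex C :=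
  ShortComplex.mk R.ι (cokernel.π R.ι) (cokernel.condition _)

theorem shortExact_seq (R : AcycRes Z M) : R.seq.ShortExact :=
  ShortComplex.ShortExact.mk' (ShortComplex.exact_cokernel R.ι) R.mono_ι
    (inferInstanceAs (Epi (cokernel.π R.ι)))

/-- The resolution of the cokernel of `M → J⁰`. -/
noncomputable def shift (R : AcycRes Z M) : AcycRes Z (cokernel R.ι) where
  obj n := R.obj (n + 1)
  d n := R.d (n + 1)
  ι := cokernel.desc R.ι (R.d 0) R.ι_d
  mono_ι := R.exact_zero.mono_cokernelDesc
  ι_d := by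
    rw [← cancel_epi (cokernel.π R.ι), cokernel.π_desc_assoc, R.d_d, comp_zero]
  d_d n := R.d_d (n + 1)
  exact_zero := by
    let φ : ShortComplex.mk (R.d 0) (R.d 1) (R.d_d 0) ⟶
        ShortComplex.mk (cokernel.desc R.ι (R.d 0) R.ι_d) (R.d 1) (by
          rw [← cancel_epi (cokernel.π R.ι), cokernel.π_desc_assoc, R.d_d, comp_zero]) :=
      { τ₁ := cokernel.π R.ι
        τ₂ := 𝟙 _
        τ₃ := 𝟙 _
        comm₁₂ := by simp
        comm₂₃ := by simp }
    have h1 : Epi φ.τ₁ := inferInstanceAs (Epi (cokernel.π R.ι))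
    have h2 : IsIso φ.τ₂ := inferInstanceAs (IsIso (𝟙 _))
    have h3 : Mono φ.τ₃ := inferInstanceAs (Mono (𝟙 _))
    exact (ShortComplex.exact_iff_of_epi_of_isIso_of_mono φ).1 (R.exact_succ 0)
  exact_succ n := R.exact_succ (n + 1)
  acyclic n m := R.acyclic (n + 1) m

/-- The cycles of the complex `Hom(Z, Jⁿ)`. -/
def cycles (R : AcycRes Z M) (n : ℕ) : AddSubgroup (Z ⟶ R.obj n) where
  carrier := {z | z ≫ R.d n = 0}
  zero_mem' := zero_comp
  add_mem' {a b} ha hb := by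
    have ha' : a ≫ R.d n = 0 := ha
    have hb' : b ≫ R.d n = 0 := hb
    change (a + b) ≫ R.d n = 0
    rw [Preadditive.add_comp, ha', hb', add_zero]
  neg_mem' {a} ha := by
    have ha' : a ≫ R.d n = 0 := ha
    change (-a) ≫ R.d n = 0
    rw [Preadditive.neg_comp, ha', neg_zero]

/-- Cycles of degree zero lift to `M`. -/
noncomputable def lift (R : AcycRes Z M) (z : R.cycles 0) : Z ⟶ M := R.exact_zero.lift z.1 z.2

theorem lift_ι (R : AcycRes Z M) (z : R.cycles 0) : R.lift z ≫ R.ι = z.1 :=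
  R.exact_zero.lift_f z.1 z.2

/-- The class of a cycle in `Extⁿ(Z, M)`. -/
noncomputable def toExt : (n : ℕ) → {M : C} → (R : AcycRes Z M) → R.cycles n →+ Ext Z M n
  | 0, M, R =>
    { toFun z := Ext.mk₀ (R.lift z)
      map_zero' := by
        rw [Ext.mk₀_eq_zero_iff, ← cancel_mono R.ι, lift_ι, zero_comp]
        rfl
      map_add' a b := by
        rw [← Ext.mk₀_add]
        congr 1
        rw [← cancel_mono R.ι, lift_ι, Preadditive.add_comp, lift_ι, lift_ι]
        rfl }
  -- Dimension shifting: a cycle of degree n + 1 is one of degree n for the resolution of the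
  -- cokernel of M → J⁰, followed by the connecting map.
  | n + 1, M, R => (R.shortExact_seq.extClass.postcomp Z rfl).comp (toExt n R.shift)

theorem toExt_zero (R : AcycRes Z M) (z : R.cycles 0) : toExt 0 R z = Ext.mk₀ (R.lift z) := rfl

theorem toExt_succ (R : AcycRes Z M) (n : ℕ) (z : R.cycles (n + 1)) :
    toExt (n + 1) R z =
      (toExt n R.shift (show R.shift.cycles n from z)).comp R.shortExact_seq.extClass rfl := rfl

/-- A class of positive degree dies in the acyclic J⁰, hence comes from the cokernel one degree
lower. -/
theorem toExt_surjective (n : ℕ) : ∀ {M : C} (R : AcycRes Z M),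
    Function.Surjective (toExt n R) := by
  induction n with
  | zero =>
    intro M R x
    obtain ⟨f, rfl⟩ := (Ext.mk₀_bijective Z M).2 x
    refine ⟨⟨f ≫ R.ι, ?_⟩, ?_⟩
    · change (f ≫ R.ι) ≫ R.d 0 = 0
      rw [Category.assoc, R.ι_d, comp_zero]
    · rw [toExt_zero]
      congr 1
      rw [← cancel_mono R.ι, lift_ι]
  | succ n ih =>
    intro M R x
    have := R.acyclic 0 n
    obtain ⟨y, hy⟩ := Ext.covariant_sequence_exact₁ Z R.shortExact_seq x
      (Subsingleton.elim (α := Ext Z (R.obj 0) (n + 1)) _ _) rfl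
    obtain ⟨z, rfl⟩ := ih R.shift y
    exact ⟨z, hy⟩

theorem toExt_zero_injective (R : AcycRes Z M) : Function.Injective (toExt 0 R) := by
  intro a b h
  have h1 := (Ext.mk₀_bijective Z M).1 h
  refine Subtype.ext ?_
  rw [← lift_ι, ← lift_ι, h1]

/-- In degree 1 the kernel of the connecting map consists of the homomorphisms that come from J⁰,
which are the boundaries. In higher degrees the connecting map is injective, since J⁰ is acyclic. -/
theorem toExt_eq_zero_iff (n : ℕ) : ∀ {M : C} (R : AcycRes Z M) (z : R.cycles (n + 1)),
    toExt (n + 1) R z = 0 ↔ ∃ w : Z ⟶ R.obj n, w ≫ R.d n = z.1 := by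
  induction n with
  | zero =>
    intro M R z
    have key : toExt 1 R z = 0 ↔ ∃ w : Ext Z (R.obj 0) 0, w.comp (Ext.mk₀ (cokernel.π R.ι))
        (add_zero 0) = toExt 0 R.shift (show R.shift.cycles 0 from z) := by
      rw [toExt_succ]
      constructor
      · intro h
        exact Ext.covariant_sequence_exact₃ Z R.shortExact_seq _ _ h
      · rintro ⟨w, hw⟩
        rw [← hw]
        exact (Ext.comp_assoc_of_second_deg_zero _ _ _ _).trans ((congrArg (w.comp · _)
          R.shortExact_seq.comp_extClass).trans (Ext.comp_zero _ _ _ _ _))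
    rw [key]
    have h2 : ∀ w : Z ⟶ R.obj 0, (Ext.mk₀ w).comp (Ext.mk₀ (cokernel.π R.ι)) (add_zero 0) =
        toExt 0 R.shift (show R.shift.cycles 0 from z) ↔ w ≫ R.d 0 = z.1 := by
      intro w
      rw [Ext.mk₀_comp_mk₀, toExt_zero, (Ext.mk₀_bijective _ _).1.eq_iff,
        ← cancel_mono R.shift.ι, lift_ι, Category.assoc]
      change w ≫ cokernel.π R.ι ≫ cokernel.desc R.ι (R.d 0) R.ι_d = z.1 ↔ _
      rw [cokernel.π_desc]
    constructor
    · rintro ⟨w, hw⟩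
      obtain ⟨f, rfl⟩ := (Ext.mk₀_bijective Z _).2 w
      exact ⟨f, (h2 f).1 hw⟩
    · rintro ⟨f, hf⟩
      exact ⟨Ext.mk₀ f, (h2 f).2 hf⟩
  | succ n ih =>
    intro M R z
    refine Iff.trans ?_ (ih R.shift z)
    rw [toExt_succ R]
    constructor
    · intro h
      obtain ⟨w, hw⟩ := Ext.covariant_sequence_exact₃ Z R.shortExact_seq _ _ h
      have := R.acyclic 0 n
      have hw0 : w = 0 := Subsingleton.elim (α := Ext Z (R.obj 0) (n + 1)) _ _
      rw [← hw, hw0]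
      exact Ext.zero_comp _ _ _ _ _
    · intro h
      exact (congrArg (Ext.comp · _ _) h).trans (Ext.zero_comp _ _ _ _ _)

/-- Morphisms of resolutions. -/
structure Hom (R : AcycRes Z M) (R' : AcycRes Z M') (f : M ⟶ M') where
  hom (n : ℕ) : R.obj n ⟶ R'.obj n
  comm (n : ℕ) : hom n ≫ R'.d n = R.d n ≫ hom (n + 1)
  comm_ι : R.ι ≫ hom 0 = f ≫ R'.ι

variable {R : AcycRes Z M} {R' : AcycRes Z M'} {f : M ⟶ M'}

/-- The induced morphism of shifted resolutions. -/
noncomputable def Hom.shift (φ : Hom R R' f) :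
    Hom R.shift R'.shift (cokernel.map R.ι R'.ι f (φ.hom 0) φ.comm_ι) where
  hom n := φ.hom (n + 1)
  comm n := φ.comm (n + 1)
  comm_ι := by
    change cokernel.desc R.ι (R.d 0) R.ι_d ≫ φ.hom 1 =
      cokernel.map R.ι R'.ι f (φ.hom 0) φ.comm_ι ≫ cokernel.desc R'.ι (R'.d 0) R'.ι_d
    rw [← cancel_epi (cokernel.π R.ι)]
    simp [φ.comm]

/-- The action of a morphism of resolutions on cycles. -/
def Hom.cycles (φ : Hom R R' f) (n : ℕ) (z : R.cycles n) : R'.cycles n :=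
  ⟨z.1 ≫ φ.hom n, by
    have h : z.1 ≫ R.d n = 0 := z.2
    change (z.1 ≫ φ.hom n) ≫ R'.d n = 0
    rw [Category.assoc, φ.comm, reassoc_of% h, zero_comp]⟩

theorem toExt_naturality (n : ℕ) : ∀ {M M' : C} {R : AcycRes Z M} {R' : AcycRes Z M'}
    {f : M ⟶ M'} (φ : Hom R R' f) (z : R.cycles n),
    toExt n R' (φ.cycles n z) = (toExt n R z).comp (Ext.mk₀ f) (add_zero n) := by
  induction n with
  | zero =>
    intro M M' R R' f φ z
    rw [toExt_zero, toExt_zero, Ext.mk₀_comp_mk₀]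
    congr 1
    rw [← cancel_mono R'.ι, lift_ι, Category.assoc, ← φ.comm_ι, ← Category.assoc, lift_ι]
    rfl
  | succ n ih =>
    intro M M' R R' f φ z
    rw [toExt_succ, toExt_succ]
    refine (congrArg (Ext.comp · R'.shortExact_seq.extClass rfl) (ih φ.shift z)).trans ?_
    let ψ : R.seq ⟶ R'.seq :=
      { τ₁ := f
        τ₂ := φ.hom 0
        τ₃ := cokernel.map R.ι R'.ι f (φ.hom 0) φ.comm_ι
        comm₁₂ := φ.comm_ι.symm
        comm₂₃ := by simp [seq] }
    have h := ShortComplex.ShortExact.extClass_naturality R.shortExact_seq R'.shortExact_seq ψ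
    refine (Ext.comp_assoc_of_second_deg_zero _ _ _ _).trans ?_
    refine Eq.trans ?_ (Ext.comp_assoc_of_third_deg_zero _ _ _ _).symm
    exact congrArg (fun e => Ext.comp _ e _) h.symm

end AcycRes

end AcyclicResolutions

end LocAnCohom

namespace LocAnCohom

/-! ### Global sections as homomorphisms -/

section GlobalSections

variable {K : Type u} [NontriviallyNormedField K]
  {E : Type u} [NormedAddCommGroup E] [NormedSpace K E]
  {G : Type u} [TopologicalSpace G] [ChartedSpace E G] [Group G] [LieGroup 𝓘(K, E) ω G]

open AnMfd

namespace EquivSheaf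

instance : HasExt.{u + 1} (EquivSheaf K E G) := hasExt_of_enoughInjectives _

variable {A B : EquivSheaf K E G} {X Y : AnMfd K}

theorem mem_invariants_iff (s : A.Sec pt) : s ∈ A.invariants ↔
    ∀ (X : AnMfd K) (ρ : Pts K E G X), A.act X ρ (A.res X.toPt s) = A.res X.toPt s := Iff.rfl

theorem app_mem_invariants (φ : A ⟶ B) {s : A.Sec pt} (hs : s ∈ A.invariants) :
    app φ pt s ∈ B.invariants := fun X ρ => by
  change B.act X ρ (B.res X.toPt (app φ pt s)) = B.res X.toPt (app φ pt s)
  rw [← app_res, ← app_act]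
  exact congrArg _ (hs X ρ)

theorem res_toPt_pt (s : A.Sec pt) : A.res (toPt pt) s = s := A.res_id s

variable (K E G) in
/-- The constant presheaf `ℤ`. -/
def constPresheaf : (Tw K E G)ᵒᵖ ⥤ AddCommGrpCat.{u + 1} :=
  (Functor.const _).obj (AddCommGrpCat.of (ULift.{u + 1} ℤ))

theorem ulift_int_hom_ext {P : Type*} [AddCommGroup P] {f g : ULift.{u + 1} ℤ →+ P}
    (h : f ⟨1⟩ = g ⟨1⟩) : f = g := by
  have : f.comp AddEquiv.ulift.symm.toAddMonoidHom = g.comp AddEquiv.ulift.symm.toAddMonoidHom :=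
    AddMonoidHom.ext_int h
  refine AddMonoidHom.ext fun n => ?_
  exact DFunLike.congr_fun this n.down

theorem constPresheaf_hom_ext {M : EquivSheaf K E G} {φ ψ : constPresheaf K E G ⟶ M.toPresheaf}
    (h : (φ.app (op ⟨pt⟩)).hom (⟨1⟩ : ULift.{u + 1} ℤ) =
      (ψ.app (op ⟨pt⟩)).hom (⟨1⟩ : ULift.{u + 1} ℤ)) : φ = ψ := by
  refine NatTrans.ext (funext fun X => AddCommGrpCat.hom_ext (ulift_int_hom_ext ?_))
  let t : X.unop ⟶ ⟨pt⟩ := Tw.lift X.unop.mfd.toPt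
  have h1 := NatTrans.naturality_apply φ t.op (⟨1⟩ : ULift.{u + 1} ℤ)
  have h2 := NatTrans.naturality_apply ψ t.op (⟨1⟩ : ULift.{u + 1} ℤ)
  exact h1.trans ((congrArg (M.toPresheaf.map t.op) h).trans h2.symm)

/-- The map from the constant presheaf given by an invariant section. -/
def ofInvariant {M : EquivSheaf K E G} {s : M.Sec pt} (hs : s ∈ M.invariants) :
    constPresheaf K E G ⟶ M.toPresheaf where
  app X := AddCommGrpCat.ofHom ((zmultiplesHom _ (M.res X.unop.mfd.toPt s)).comp
    AddEquiv.ulift.toAddMonoidHom)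
  naturality X Y f := by
    refine AddCommGrpCat.hom_ext (ulift_int_hom_ext ?_)
    change (1 : ℤ) • M.res Y.unop.mfd.toPt s =
      M.act _ f.unop.pts (M.res f.unop.map ((1 : ℤ) • M.res X.unop.mfd.toPt s))
    rw [one_zsmul, one_zsmul, res_res]
    exact (hs _ _).symm

/-- The representing object is the sheafification of the constant presheaf of integers on the
objects G × X. A map out of the constant presheaf amounts to the image of 1 over the point, and
naturality along the maps G × X → G says that this image is invariant. -/
theorem exists_unit : ∃ (Z : EquivSheaf K E G) (z : Z.Sec pt), z ∈ Z.invariants ∧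
    ∀ (M : EquivSheaf K E G), ∀ s ∈ M.invariants, ∃! f : Z ⟶ M, app f pt z = s := by
  let P := (presheafToSheaf (Tw.topology K E G) AddCommGrpCat.{u + 1}).obj (constPresheaf K E G)
  let Z := (toTw K E G).objPreimage P
  let i : (toTw K E G).obj Z ≅ P := (toTw K E G).objObjPreimageIso P
  let j : constPresheaf K E G ⟶ P.obj := toSheafify (Tw.topology K E G) (constPresheaf K E G)
  let v : constPresheaf K E G ⟶ Z.toPresheaf := j ≫ i.inv.hom
  let z : Z.Sec pt := (v.app (op ⟨pt⟩)).hom (⟨1⟩ : ULift.{u + 1} ℤ)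
  have hz : z ∈ Z.invariants := by
    intro X ρ
    -- The two maps to the point that differ by ρ act identically on a constant presheaf; comparing
    -- them gives invariance.
    let t : (⟨X⟩ : Tw K E G) ⟶ ⟨pt⟩ := ⟨ρ, X.toPt⟩
    have h1 := NatTrans.naturality_apply v t.op (⟨1⟩ : ULift.{u + 1} ℤ)
    have h2 := NatTrans.naturality_apply v (Tw.lift (X := (⟨X⟩ : Tw K E G)) (Y := ⟨pt⟩) X.toPt).op
      (⟨1⟩ : ULift.{u + 1} ℤ)
    have h3 : Z.act X ρ (Z.res X.toPt z) = Z.act X 1 (Z.res X.toPt z) := h1.symm.trans h2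
    rw [act_one] at h3
    exact h3
  refine ⟨Z, z, hz, fun M s hs => ?_⟩
  let l : P ⟶ (toTw K E G).obj M :=
    ⟨sheafifyLift (Tw.topology K E G) (ofInvariant hs) M.isSheaf_toPresheaf⟩
  refine ⟨(toTw K E G).preimage (i.hom ≫ l), ?_, fun f hf => (toTw K E G).map_injective ?_⟩
  · have h1 : v ≫ ((toTw K E G).map ((toTw K E G).preimage (i.hom ≫ l))).hom = ofInvariant hs := by
      rw [Functor.map_preimage]
      change (j ≫ i.inv.hom) ≫ i.hom.hom ≫ l.hom = _
      have h2 : i.inv.hom ≫ i.hom.hom = 𝟙 _ := congrArg (fun f => f.hom) i.inv_hom_id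
      rw [Category.assoc, reassoc_of% h2]
      exact toSheafify_sheafifyLift _ _ _
    have h3 := congrArg (fun φ : constPresheaf K E G ⟶ M.toPresheaf =>
      (φ.app (op ⟨pt⟩)).hom (⟨1⟩ : ULift.{u + 1} ℤ)) h1
    refine h3.trans ?_
    change (1 : ℤ) • M.res (toPt pt) s = s
    rw [one_zsmul, res_toPt_pt]
  · rw [Functor.map_preimage]
    have h1 : v ≫ ((toTw K E G).map f).hom = ofInvariant hs := by
      refine constPresheaf_hom_ext ?_
      refine Eq.trans hf ?_
      change s = (1 : ℤ) • M.res (toPt pt) s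
      rw [one_zsmul, res_toPt_pt]
    rw [← cancel_epi i.inv, i.inv_hom_id_assoc]
    refine Sheaf.hom_ext (sheafifyLift_unique _ _ _ _ ?_)
    rw [← h1]
    exact (Category.assoc _ _ _).symm

variable (K E G) in
/-- The object representing the global section functor. -/
noncomputable def unitObj : EquivSheaf K E G := exists_unit.choose

variable (K E G) in
/-- The universal global section. -/
noncomputable def unitSec : (unitObj K E G).Sec pt := exists_unit.choose_spec.choose

theorem unitSec_mem : unitSec K E G ∈ (unitObj K E G).invariants :=
  exists_unit.choose_spec.choose_spec.1

theorem existsUnique_hom {s : A.Sec pt} (hs : s ∈ A.invariants) :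
    ∃! f : unitObj K E G ⟶ A, app f pt (unitSec K E G) = s :=
  exists_unit.choose_spec.choose_spec.2 A s hs

theorem unit_hom_ext {f g : unitObj K E G ⟶ A}
    (h : app f pt (unitSec K E G) = app g pt (unitSec K E G)) : f = g :=
  (existsUnique_hom (app_mem_invariants g unitSec_mem)).unique h rfl

variable (A) in
/-- Homomorphisms from the unit object are global sections. -/
noncomputable def unitHomEquiv : (unitObj K E G ⟶ A) ≃+ A.invariants where
  toFun f := ⟨app f pt (unitSec K E G), app_mem_invariants f unitSec_mem⟩
  invFun s := (existsUnique_hom s.2).choose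
  left_inv f := unit_hom_ext
    (existsUnique_hom (app_mem_invariants f unitSec_mem)).choose_spec.1
  right_inv s := Subtype.ext (existsUnique_hom s.2).choose_spec.1
  map_add' f g := Subtype.ext (app_add f g _)

theorem unitHomEquiv_comp (f : unitObj K E G ⟶ A) (φ : A ⟶ B) :
    (unitHomEquiv B (f ≫ φ)).1 = app φ pt (unitHomEquiv A f).1 := rfl

variable [FiniteDimensional K E] [T2Space G] [CompactSpace G]

/-- Invariance under the universal G-point (the projection to G), restricted to the diagonal,
replaces h by h⁻¹ h = 1. So an invariant section of a coinduced sheaf is constant along G. -/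
theorem eq_res_fst_of_mem_invariants {s : A.Sec (prodG E G pt)} (hs : s ∈ A.coind.invariants) :
    s = A.res (fst E G pt) (A.res (oneSec E G pt) s) := by
  have h1 := (mem_invariants_iff (A := A.coind) s).1 hs (prodG E G pt) (snd E G pt)
  rw [coind_res, coind_act] at h1
  let δ : prodG E G (pt : AnMfd K) ⟶ prodG E G (prodG E G pt) := pair (𝟙 _) (snd E G pt)
  have h2 := congrArg (A.res δ) h1
  rw [res_res, res_res, res_res] at h2
  have e1 : δ ≫ prodGMap E G (toPt (prodG E G pt)) = 𝟙 _ := rfl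
  have e2 : (δ ≫ shear (snd E G pt)) ≫ prodGMap E G (toPt (prodG E G pt)) =
      fst E G pt ≫ oneSec E G pt :=
    AnMfd.hom_ext fun p => Prod.ext rfl (inv_mul_cancel (p.2 : G))
  rw [e1, res_id, e2] at h2
  rw [res_res]
  exact h2.symm

theorem res_fst_mem_invariants (s : A.Sec pt) : A.res (fst E G pt) s ∈ A.coind.invariants := by
  refine (mem_invariants_iff (A := A.coind) _).2 fun X ρ => ?_
  rw [coind_res, coind_act, res_res, res_res]
  exact (A.res_res (prodGMap E G X.toPt) (fst E G pt) s).symm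

/-- Any covering of the point contains the identity, so sections over the point can be lifted. -/
theorem exists_app_pt_eq (φ : A ⟶ B) [Epi φ] (s : B.Sec pt) : ∃ t : A.Sec pt, app φ pt t = s := by
  obtain ⟨U, -, hU, h⟩ := (epi_iff φ).1 inferInstance pt s PUnit.unit
  obtain ⟨t, ht⟩ := h pt (𝟙 pt) (by rintro _ ⟨⟨⟩, rfl⟩; exact hU)
  rw [res_id] at ht
  exact ⟨t, ht⟩

/-- Global sections of a coinduced sheaf are the sections of the original sheaf over the point, and
these lift along epimorphisms. -/
theorem exists_lift_unit_coind (φ : A ⟶ B) [Epi φ] (f : unitObj K E G ⟶ B.coind) :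
    ∃ g : unitObj K E G ⟶ A.coind, g ≫ coindMap φ = f := by
  let s : B.Sec (prodG E G pt) := (unitHomEquiv _ f).1
  have hs : s ∈ B.coind.invariants := (unitHomEquiv _ f).2
  obtain ⟨t, ht⟩ := exists_app_pt_eq φ (B.res (oneSec E G pt) s)
  let t' : A.coind.invariants := ⟨A.res (fst E G pt) t, res_fst_mem_invariants t⟩
  refine ⟨(unitHomEquiv _).symm t', (unitHomEquiv _).injective (Subtype.ext ?_)⟩
  rw [unitHomEquiv_comp, AddEquiv.apply_symm_apply]
  refine (app_coindMap φ (X := pt) (A.res (fst E G pt) t)).trans ?_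
  rw [app_res, ht]
  exact (eq_res_fst_of_mem_invariants hs).symm

variable [IsUltrametricDist K] [CompleteSpace K]

open Limits Abelian

/-- Coinduction kills all classes of positive degree. -/
theorem ext_comp_toCoind (n : ℕ) : ∀ (M : EquivSheaf K E G) (x : Ext (unitObj K E G) M (n + 1)),
    x.comp (Ext.mk₀ M.toCoind) (add_zero _) = 0 := by
  induction n with
  | zero =>
    intro M x
    -- x is the connecting class of some f from the cokernel of an injective hull. The units map
    -- this sequence to its coinduction, which is exact, and the image of x can be computed there.
    let S := ShortComplex.mk (Injective.ι M) (cokernel.π (Injective.ι M)) (cokernel.condition _)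
    have hS : S.ShortExact := ShortComplex.ShortExact.mk' (ShortComplex.exact_cokernel _)
      (inferInstanceAs (Mono (Injective.ι M))) (inferInstanceAs (Epi (cokernel.π _)))
    have hS' := shortExact_coind hS
    have := Ext.subsingleton_of_injective.{u + 1} (unitObj K E G) (Injective.under M) 0
    obtain ⟨y, rfl⟩ := Ext.covariant_sequence_exact₁ _ hS x (Subsingleton.elim
      (α := Ext (unitObj K E G) (Injective.under M) (0 + 1)) _ _) rfl
    obtain ⟨f, rfl⟩ := (Ext.mk₀_bijective _ _).2 y
    let ψ : S ⟶ ShortComplex.mk (coindMap S.f) (coindMap S.g)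
        (by rw [← coindMap_comp, S.zero, coindMap_zero]) :=
      { τ₁ := toCoind _
        τ₂ := toCoind _
        τ₃ := toCoind _
        comm₁₂ := (toCoind_naturality _).symm
        comm₂₃ := (toCoind_naturality _).symm }
    have hn := ShortComplex.ShortExact.extClass_naturality hS hS' ψ
    have := hS.epi_g
    -- The pushed homomorphism lifts to the middle term, so its connecting class vanishes. In higher
    -- degrees the induction hypothesis already kills the class before the connecting map.
    obtain ⟨g, hg⟩ := exists_lift_unit_coind S.g (f ≫ toCoind _)
    refine (Ext.comp_assoc_of_third_deg_zero _ _ _ _).trans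
      ((congrArg (fun e => Ext.comp _ e _) hn).trans ?_)
    refine (Ext.comp_assoc_of_second_deg_zero _ _ _ _).symm.trans ?_
    have h1 : (Ext.mk₀ f).comp (Ext.mk₀ ψ.τ₃) (add_zero 0) =
        (Ext.mk₀ g).comp (Ext.mk₀ (coindMap S.g)) (add_zero 0) := by
      rw [Ext.mk₀_comp_mk₀, Ext.mk₀_comp_mk₀, hg]
    refine (congrArg (fun e => Ext.comp e hS'.extClass _) h1).trans ?_
    exact (Ext.comp_assoc_of_second_deg_zero _ _ _ _).trans ((congrArg ((Ext.mk₀ g).comp · _)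
      hS'.comp_extClass).trans (Ext.comp_zero _ _ _ _ _))
  | succ n ih =>
    intro M x
    let S := ShortComplex.mk (Injective.ι M) (cokernel.π (Injective.ι M)) (cokernel.condition _)
    have hS : S.ShortExact := ShortComplex.ShortExact.mk' (ShortComplex.exact_cokernel _)
      (inferInstanceAs (Mono (Injective.ι M))) (inferInstanceAs (Epi (cokernel.π _)))
    have hS' := shortExact_coind hS
    have := Ext.subsingleton_of_injective.{u + 1} (unitObj K E G) (Injective.under M) (n + 1)
    obtain ⟨y, rfl⟩ := Ext.covariant_sequence_exact₁ _ hS x (Subsingleton.elim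
      (α := Ext (unitObj K E G) (Injective.under M) (n + 1 + 1)) _ _) rfl
    let ψ : S ⟶ ShortComplex.mk (coindMap S.f) (coindMap S.g)
        (by rw [← coindMap_comp, S.zero, coindMap_zero]) :=
      { τ₁ := toCoind _
        τ₂ := toCoind _
        τ₃ := toCoind _
        comm₁₂ := (toCoind_naturality _).symm
        comm₂₃ := (toCoind_naturality _).symm }
    have hn := ShortComplex.ShortExact.extClass_naturality hS hS' ψ
    refine (Ext.comp_assoc_of_third_deg_zero _ _ _ _).trans
      ((congrArg (fun e => Ext.comp _ e _) hn).trans ?_)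
    refine (Ext.comp_assoc_of_second_deg_zero _ _ _ _).symm.trans ?_
    exact (congrArg (fun e => Ext.comp e hS'.extClass _) (ih _ y)).trans (Ext.zero_comp _ _ _ _ _)

/-- Retracts of coinduced objects are acyclic. -/
theorem subsingleton_ext_of_retract {M : EquivSheaf K E G} (r : M.coind ⟶ M)
    (hr : M.toCoind ≫ r = 𝟙 M) (n : ℕ) : Subsingleton (Ext (unitObj K E G) M (n + 1)) := by
  refine subsingleton_of_forall_eq 0 fun x => ?_
  rw [← Ext.comp_mk₀_id x, ← hr, ← Ext.mk₀_comp_mk₀,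
    ← Ext.comp_assoc_of_third_deg_zero x, ext_comp_toCoind, Ext.zero_comp]

end EquivSheaf

end GlobalSections

end LocAnCohom

namespace LocAnCohom

/-! ### Right derived functors of represented functors -/

section DerivedExt

open Limits Abelian

universe w v₁ u₁

/-- Two surjections with the same kernel have isomorphic targets. -/
theorem exists_addEquiv_of_ker_eq {P A B : Type*} [AddCommGroup P] [AddCommGroup A]
    [AddCommGroup B] (p : P →+ A) (q : P →+ B) (hp : Function.Surjective p)
    (hq : Function.Surjective q) (h : ∀ x, p x = 0 ↔ q x = 0) :
    ∃ e : A ≃+ B, ∀ x, e (p x) = q x := by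
  have h' : p.ker = q.ker := AddSubgroup.ext fun x => h x
  refine ⟨(QuotientAddGroup.quotientKerEquivOfSurjective p hp).symm.trans
    ((QuotientAddGroup.quotientAddEquivOfEq h').trans
      (QuotientAddGroup.quotientKerEquivOfSurjective q hq)), fun x => ?_⟩
  have : (QuotientAddGroup.quotientKerEquivOfSurjective p hp).symm (p x) =
      (QuotientAddGroup.mk x : P ⧸ p.ker) :=
    (AddEquiv.symm_apply_eq _).2 rfl
  rw [AddEquiv.trans_apply, this]
  rfl

variable {C : Type u₁} [Category.{v₁} C] [Abelian C] [HasExt.{w} C]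

/-- An injective resolution is a resolution by acyclic objects. -/
def AcycRes.ofInjective (Z : C) {M : C} (I : InjectiveResolution M) : AcycRes Z M where
  obj n := I.cocomplex.X n
  d n := I.cocomplex.d n (n + 1)
  ι := I.ι.f 0
  mono_ι := inferInstanceAs (Mono (I.ι.f 0))
  ι_d := I.ι_f_zero_comp_complex_d
  d_d n := I.cocomplex.d_comp_d _ _ _
  exact_zero := I.exact₀
  exact_succ n := I.exact_succ n
  acyclic n m := by
    have := I.injective n
    exact Ext.subsingleton_of_injective _ _ _

/-- The maps of acyclic resolutions given by maps of injective resolutions. -/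
def AcycRes.Hom.ofInjective (Z : C) {M N : C} (I : InjectiveResolution M)
    (J : InjectiveResolution N) (f : M ⟶ N) (φ : I.cocomplex ⟶ J.cocomplex)
    (comm : I.ι.f 0 ≫ φ.f 0 = f ≫ J.ι.f 0) :
    AcycRes.Hom (AcycRes.ofInjective Z I) (AcycRes.ofInjective Z J) f where
  hom n := φ.f n
  comm _ := φ.comm _ _
  comm_ι := comm

variable [EnoughInjectives C] {Z : C} (F : C ⥤ AddCommGrpCat.{w}) [F.Additive] (e : ∀ A : C, (Z ⟶ A) ≃+ F.obj A)
  (he : ∀ {A B : C} (f : Z ⟶ A) (φ : A ⟶ B), e B (f ≫ φ) = F.map φ (e A f))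

section

variable {M : C} (I : InjectiveResolution M) (n : ℕ)

/-- The complex computing the right derived functors. -/
abbrev derivedComplex : CochainComplex AddCommGrpCat.{w} ℕ :=
  (F.mapHomologicalComplex _).obj I.cocomplex

/-- The class in the right derived functor of a cycle of the complex. -/
noncomputable def derivedClass :
    ((derivedComplex F I).cycles n : AddCommGrpCat.{w}) →+ ((F.rightDerived n).obj M) :=
  ((derivedComplex F I).homologyπ n ≫ (I.isoRightDerivedObj F n).inv).hom

theorem derivedClass_surjective : Function.Surjective (derivedClass F I n) :=
  ((AddCommGrpCat.epi_iff_surjective (I.isoRightDerivedObj F n).inv).1 inferInstance).comp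
    ((AddCommGrpCat.epi_iff_surjective ((derivedComplex F I).homologyπ n)).1 inferInstance)

theorem derivedClass_eq_zero_iff (c : ((derivedComplex F I).cycles n : AddCommGrpCat.{w})) :
    derivedClass F I n c = 0 ↔ (derivedComplex F I).homologyπ n c = 0 := by
  have hi : Function.Injective (I.isoRightDerivedObj F n).inv :=
    (AddCommGrpCat.mono_iff_injective _).1 inferInstance
  exact map_eq_zero_iff _ hi

theorem homologyπ_zero_eq_zero_iff (c : ((derivedComplex F I).cycles 0 : AddCommGrpCat.{w})) :
    (derivedComplex F I).homologyπ 0 c = 0 ↔ c = 0 := by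
  have hi : Function.Injective ((derivedComplex F I).homologyπ 0) :=
    (AddCommGrpCat.mono_iff_injective _).1 inferInstance
  exact map_eq_zero_iff _ hi

/-- The inclusion of the cycles. -/
noncomputable def cyclesIncl :
    ((derivedComplex F I).cycles n : AddCommGrpCat.{w}) →+ F.obj (I.cocomplex.X n) :=
  ((derivedComplex F I).iCycles n).hom

theorem cyclesIncl_injective : Function.Injective (cyclesIncl F I n) :=
  (AddCommGrpCat.mono_iff_injective ((derivedComplex F I).iCycles n)).1 inferInstance

theorem homologyπ_succ_eq_zero_iff
    (c : ((derivedComplex F I).cycles (n + 1) : AddCommGrpCat.{w})) :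
    (derivedComplex F I).homologyπ (n + 1) c = 0 ↔
      ∃ w : F.obj (I.cocomplex.X n), F.map (I.cocomplex.d n (n + 1)) w =
        cyclesIncl F I (n + 1) c := by
  have hex := ShortComplex.exact_of_g_is_cokernel
    (ShortComplex.mk _ _ ((derivedComplex F I).toCycles_comp_homologyπ n (n + 1)))
    ((derivedComplex F I).homologyIsCokernel n (n + 1) (by simp))
  have hti := (derivedComplex F I).toCycles_i n (n + 1)
  constructor
  · intro h
    obtain ⟨w, hw⟩ := (ShortComplex.ab_exact_iff _).1 hex c h
    refine ⟨w, ?_⟩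
    rw [← hw]
    exact (ConcreteCategory.congr_hom hti w).symm
  · rintro ⟨w, hw⟩
    have : c = (derivedComplex F I).toCycles n (n + 1) w :=
      cyclesIncl_injective F I (n + 1) (hw.symm.trans (ConcreteCategory.congr_hom hti w).symm)
    rw [this]
    exact ConcreteCategory.congr_hom ((derivedComplex F I).toCycles_comp_homologyπ n (n + 1)) w

theorem map_d_cyclesIncl (c : ((derivedComplex F I).cycles n : AddCommGrpCat.{w})) :
    F.map (I.cocomplex.d n (n + 1)) (cyclesIncl F I n c) = 0 :=
  ConcreteCategory.congr_hom ((derivedComplex F I).iCycles_d n (n + 1)) c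

theorem exists_cyclesIncl_eq (y : F.obj (I.cocomplex.X n))
    (hy : F.map (I.cocomplex.d n (n + 1)) y = 0) :
    ∃ c, cyclesIncl F I n c = y := by
  have hex := ShortComplex.exact_of_f_is_kernel
    (ShortComplex.mk _ _ ((derivedComplex F I).iCycles_d n (n + 1)))
    ((derivedComplex F I).cyclesIsKernel n (n + 1) (by simp))
  exact (ShortComplex.ab_exact_iff _).1 hex y hy

theorem comp_eq_zero_iff
    (he : ∀ {A B : C} (f : Z ⟶ A) (φ : A ⟶ B), e B (f ≫ φ) = F.map φ (e A f)) {A B : C} (f : Z ⟶ A) (φ : A ⟶ B) :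
    f ≫ φ = 0 ↔ F.map φ (e A f) = 0 := by
  rw [← he, map_eq_zero_iff _ (e B).injective]

/-- Cycles of the complex computing the right derived functors, as homomorphisms. -/
noncomputable def cyclesHom : ((derivedComplex F I).cycles n : AddCommGrpCat.{w}) →+
    (AcycRes.ofInjective Z I).cycles n where
  toFun c := ⟨(e _).symm (cyclesIncl F I n c), by
    refine (comp_eq_zero_iff F e he _ _).2 ?_
    exact (congrArg _ (AddEquiv.apply_symm_apply _ _)).trans (map_d_cyclesIncl F I n c)⟩
  map_zero' := Subtype.ext (by
    change (e _).symm (cyclesIncl F I n 0) = 0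
    rw [map_zero, map_zero])
  map_add' a b := Subtype.ext (by
    change (e _).symm (cyclesIncl F I n (a + b)) = _
    rw [map_add, map_add]
    rfl)

theorem cyclesHom_apply (c : ((derivedComplex F I).cycles n : AddCommGrpCat.{w})) :
    e _ (cyclesHom F e he I n c).1 = cyclesIncl F I n c :=
  AddEquiv.apply_symm_apply _ _

theorem cyclesHom_bijective : Function.Bijective (cyclesHom F e he I n) := by
  constructor
  · intro a b h
    refine cyclesIncl_injective F I n ?_
    rw [← cyclesHom_apply F e he, ← cyclesHom_apply F e he, h]
  · intro z
    obtain ⟨c, hc⟩ := exists_cyclesIncl_eq F I n (e _ z.1) ((comp_eq_zero_iff F e he _ _).1 z.2)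
    refine ⟨c, Subtype.ext ((e _).injective ?_)⟩
    exact (cyclesHom_apply F e he I n c).trans hc

theorem derivedClass_eq_zero_iff_toExt (c : ((derivedComplex F I).cycles n : AddCommGrpCat.{w})) :
    derivedClass F I n c = 0 ↔
      AcycRes.toExt n (AcycRes.ofInjective Z I) (cyclesHom F e he I n c) = 0 := by
  rw [derivedClass_eq_zero_iff]
  cases n with
  | zero =>
    rw [homologyπ_zero_eq_zero_iff, map_eq_zero_iff _ (AcycRes.toExt_zero_injective _),
      map_eq_zero_iff _ (cyclesHom_bijective F e he I 0).1]
  | succ n =>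
    rw [homologyπ_succ_eq_zero_iff, AcycRes.toExt_eq_zero_iff]
    constructor
    · rintro ⟨w, hw⟩
      refine ⟨(e _).symm w, (e _).injective ?_⟩
      rw [cyclesHom_apply, ← hw]
      exact (he _ _).trans (congrArg _ (AddEquiv.apply_symm_apply _ _))
    · rintro ⟨w, hw⟩
      refine ⟨e _ w, ?_⟩
      rw [← cyclesHom_apply F e he, ← hw]
      exact (he _ _).symm

end

/-- Both groups are quotients of the cycles of one complex by the same boundaries. The formula on
cycles is recorded because it is what determines the isomorphism and proves its naturality. -/
theorem exists_derivedEquivExt (M : C) (n : ℕ) : ∃ ε : (F.rightDerived n).obj M ≃+ Ext Z M n,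
    ∀ c, ε (derivedClass F (InjectiveResolution.of M) n c) =
      AcycRes.toExt n (AcycRes.ofInjective Z (InjectiveResolution.of M))
        (cyclesHom F e he (InjectiveResolution.of M) n c) :=
  exists_addEquiv_of_ker_eq _ ((AcycRes.toExt n (AcycRes.ofInjective Z
    (InjectiveResolution.of M))).comp (cyclesHom F e he (InjectiveResolution.of M) n))
    (derivedClass_surjective _ _ _)
    ((AcycRes.toExt_surjective n _).comp (cyclesHom_bijective F e he _ n).2)
    (derivedClass_eq_zero_iff_toExt F e he _ n)

/-- The right derived functors of a functor represented by `Z` are the functors `Extⁿ(Z, -)`. -/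
noncomputable def derivedEquivExt (M : C) (n : ℕ) : (F.rightDerived n).obj M ≃+ Ext Z M n :=
  (exists_derivedEquivExt F e he M n).choose

theorem derivedEquivExt_naturality {M N : C} (f : M ⟶ N) (n : ℕ) (x : (F.rightDerived n).obj M) :
    derivedEquivExt F e he N n ((F.rightDerived n).map f x) =
      (derivedEquivExt F e he M n x).comp (Ext.mk₀ f) (add_zero n) := by
  let I := InjectiveResolution.of M
  let J := InjectiveResolution.of N
  let φ := InjectiveResolution.desc f J I
  have comm : I.ι.f 0 ≫ φ.f 0 = f ≫ J.ι.f 0 := InjectiveResolution.desc_commutes_zero f J I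
  obtain ⟨c, rfl⟩ := derivedClass_surjective F I n x
  let c' := (HomologicalComplex.cyclesMap ((F.mapHomologicalComplex _).map φ) n) c
  have h1 : (F.rightDerived n).map f (derivedClass F I n c) = derivedClass F J n c' := by
    have := I.isoRightDerivedObj_inv_naturality f J φ comm F n
    have h2 := HomologicalComplex.homologyπ_naturality ((F.mapHomologicalComplex _).map φ) n
    exact (ConcreteCategory.congr_hom this ((derivedComplex F I).homologyπ n c)).trans
      (congrArg (J.isoRightDerivedObj F n).inv (ConcreteCategory.congr_hom h2 c))
  let Φ := AcycRes.Hom.ofInjective Z I J f φ comm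
  have h4 : cyclesHom F e he J n c' = Φ.cycles n (cyclesHom F e he I n c) := by
    refine Subtype.ext ((e _).injective ?_)
    rw [cyclesHom_apply]
    refine Eq.trans ?_ (he _ _).symm
    rw [cyclesHom_apply]
    exact ConcreteCategory.congr_hom
      (HomologicalComplex.cyclesMap_i ((F.mapHomologicalComplex _).map φ) n) c
  rw [h1]
  refine ((exists_derivedEquivExt F e he N n).choose_spec c').trans ?_
  refine (congrArg _ h4).trans ((AcycRes.toExt_naturality n Φ _).trans ?_)
  exact congrArg (fun y => Ext.comp y (Ext.mk₀ f) (add_zero n))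
    ((exists_derivedEquivExt F e he M n).choose_spec c).symm

end DerivedExt

section

variable {K : Type u} [NontriviallyNormedField K]
  {E : Type u} [NormedAddCommGroup E] [NormedSpace K E]
  {G : Type u} [TopologicalSpace G] [ChartedSpace E G] [Group G] [LieGroup 𝓘(K, E) ω G]

namespace EquivSheaf

open Abelian

/-- The cohomology of `BG` as a group of extensions. -/
noncomputable def cohomologyEquivExt (M : EquivSheaf K E G) (n : ℕ) :
    (cohomology K E G n).obj M ≃+ Ext (unitObj K E G) M n :=
  derivedEquivExt (globalSections K E G) (fun A => unitHomEquiv A) (fun _ _ => rfl) M n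

theorem cohomologyEquivExt_naturality {M N : EquivSheaf K E G} (f : M ⟶ N) (n : ℕ)
    (x : (cohomology K E G n).obj M) :
    cohomologyEquivExt N n ((cohomology K E G n).map f x) =
      (cohomologyEquivExt M n x).comp (Ext.mk₀ f) (add_zero n) :=
  derivedEquivExt_naturality (globalSections K E G) (fun A => unitHomEquiv A) (fun _ _ => rfl) f n x

end EquivSheaf

end

end LocAnCohom

namespace LocAnCohom

/-! ### Cohomology of directed unions -/

section Exhaustion

variable {K : Type u} [NontriviallyNormedField K]
  {E : Type u} [NormedAddCommGroup E] [NormedSpace K E]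
  {G : Type u} [TopologicalSpace G] [ChartedSpace E G] [Group G] [LieGroup 𝓘(K, E) ω G]

open AnMfd Limits Abelian

namespace EquivSheaf

/-- The object `M` is the directed union of the subobjects `N i`. -/
structure IsDirectedUnion {M : EquivSheaf K E G} {I : Type*} {N : I → EquivSheaf K E G}
    (ι : ∀ i, N i ⟶ M) : Prop where
  nonempty : Nonempty I
  mono (i : I) : Mono (ι i)
  directed (i j : I) : ∃ (k : I) (a : N i ⟶ N k) (b : N j ⟶ N k), a ≫ ι k = ι i ∧ b ≫ ι k = ι j
  exhaust (X : AnMfd K) (s : M.Sec X) (x : X) : ∃ (i : I) (U : Set X), IsOpen U ∧ x ∈ U ∧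
    ∀ (Y : AnMfd K) (k : Y ⟶ X), Set.range k ⊆ U → ∃ t : (N i).Sec Y, app (ι i) Y t = M.res k s

variable [FiniteDimensional K E] [T2Space G] [CompactSpace G]
  {M : EquivSheaf K E G} {I : Type*} {N : I → EquivSheaf K E G} {ι : ∀ i, N i ⟶ M}

/-- The subsets of G along which, near x₀, a single member of the union suffices are stable under
finite unions by directedness. Every point of G has such a neighbourhood, so by compactness G itself
is one; the local lifts are unique and glue. Thus coinduction commutes with directed unions. -/
theorem IsDirectedUnion.exists_lift_prodG (h : IsDirectedUnion ι) {X : AnMfd K}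
    (s : M.Sec (prodG E G X)) (x₀ : X) :
    ∃ (i : I) (U : Set X), IsOpen U ∧ x₀ ∈ U ∧ ∀ (Y : AnMfd K) (k : Y ⟶ X), Set.range k ⊆ U →
      ∃ t : (N i).Sec (prodG E G Y), app (ι i) _ t = M.res (prodGMap E G k) s := by
  let P : Set G → Prop := fun S => ∃ (i : I) (U : Set X), IsOpen U ∧ x₀ ∈ U ∧
    ∀ p : prodG E G X, fst E G X p ∈ U → snd E G X p ∈ S → ∃ W : Set (prodG E G X), IsOpen W ∧
      p ∈ W ∧ ∀ (Y : AnMfd K) (k : Y ⟶ prodG E G X), Set.range k ⊆ W →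
        ∃ t : (N i).Sec Y, app (ι i) Y t = M.res k s
  have hP : P Set.univ := by
    refine isCompact_univ.induction_on (p := P) ?_ ?_ ?_ ?_
    · obtain ⟨i⟩ := h.nonempty
      exact ⟨i, Set.univ, isOpen_univ, trivial, fun p _ hp => hp.elim⟩
    · rintro S T hST ⟨i, U, hU, hx, hp⟩
      exact ⟨i, U, hU, hx, fun p h1 h2 => hp p h1 (hST h2)⟩
    · rintro S T ⟨i, U, hU, hx, hp⟩ ⟨j, U', hU', hx', hp'⟩
      obtain ⟨l, a, b, ha, hb⟩ := h.directed i j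
      refine ⟨l, U ∩ U', hU.inter hU', ⟨hx, hx'⟩, fun p h1 h2 => ?_⟩
      rcases h2 with h2 | h2
      · obtain ⟨W, hW, hpW, hk⟩ := hp p h1.1 h2
        refine ⟨W, hW, hpW, fun Y k hkW => ?_⟩
        obtain ⟨t, ht⟩ := hk Y k hkW
        exact ⟨app a Y t, by rw [← app_comp, ha, ht]⟩
      · obtain ⟨W, hW, hpW, hk⟩ := hp' p h1.2 h2
        refine ⟨W, hW, hpW, fun Y k hkW => ?_⟩
        obtain ⟨t, ht⟩ := hk Y k hkW
        exact ⟨app b Y t, by rw [← app_comp, hb, ht]⟩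
    · intro g _
      obtain ⟨i, W, hW, hxW, hk⟩ := h.exhaust (prodG E G X) s ((x₀, g) : X × G)
      obtain ⟨U, hU, S, hS, hUS⟩ := mem_nhds_prod_iff.1
        ((show IsOpen (W : Set (X × G)) from hW).mem_nhds hxW)
      obtain ⟨U', hU'U, hU', hx'⟩ := mem_nhds_iff.1 hU
      exact ⟨S, mem_nhdsWithin_of_mem_nhds hS, i, U', hU', hx', fun p h1 h2 =>
        ⟨W, hW, hUS ⟨hU'U h1, h2⟩, hk⟩⟩
  obtain ⟨i, U, hU, hx, hp⟩ := hP
  have := h.mono i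
  refine ⟨i, U, hU, hx, fun Y k hk => ?_⟩
  refine LocallyLifts.exists_app_eq (φ := ι i) fun q => ?_
  obtain ⟨W, hW, hqW, hl⟩ := hp (prodGMap E G k q) (hk ⟨_, rfl⟩) trivial
  refine ⟨prodGMap E G k ⁻¹' W, hW.preimage (hom_contMDiff _).continuous, hqW, fun Z m hm => ?_⟩
  obtain ⟨t, ht⟩ := hl Z (m ≫ prodGMap E G k) (by rintro _ ⟨z, rfl⟩; exact hm ⟨z, rfl⟩)
  exact ⟨t, by rw [ht, res_res]⟩

/-- The quotient of the coinduced object. -/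
noncomputable abbrev coindQuot (M : EquivSheaf K E G) : EquivSheaf K E G := cokernel M.toCoind

/-- The functoriality of the quotient of the coinduced object. -/
noncomputable abbrev coindQuotMap {A B : EquivSheaf K E G} (φ : A ⟶ B) :
    coindQuot A ⟶ coindQuot B :=
  cokernel.map A.toCoind B.toCoind φ (coindMap φ) (toCoind_naturality φ).symm

theorem coindQuotMap_comp {A B C : EquivSheaf K E G} (φ : A ⟶ B) (ψ : B ⟶ C) :
    coindQuotMap (φ ≫ ψ) = coindQuotMap φ ≫ coindQuotMap ψ := by
  rw [← cancel_epi (cokernel.π A.toCoind)]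
  simp [coindMap_comp]

/-- The short exact sequence given by coinduction. -/
noncomputable def coindSeq (M : EquivSheaf K E G) : ShortComplex (EquivSheaf K E G) :=
  ShortComplex.mk M.toCoind (cokernel.π M.toCoind) (cokernel.condition _)

theorem shortExact_coindSeq (M : EquivSheaf K E G) : (coindSeq M).ShortExact :=
  ShortComplex.ShortExact.mk' (ShortComplex.exact_cokernel _)
    (inferInstanceAs (Mono M.toCoind)) (inferInstanceAs (Epi (cokernel.π M.toCoind)))

/-- The functoriality of the short exact sequence given by coinduction. -/
noncomputable def coindSeqMap {A B : EquivSheaf K E G} (φ : A ⟶ B) : coindSeq A ⟶ coindSeq B where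
  τ₁ := φ
  τ₂ := coindMap φ
  τ₃ := coindQuotMap φ
  comm₁₂ := toCoind_naturality φ
  comm₂₃ := (cokernel.π_desc _ _ _).symm

theorem app_coindQuotMap {A B : EquivSheaf K E G} (φ : A ⟶ B) {X : AnMfd K} (s : A.coind.Sec X) :
    app (coindQuotMap φ) X (app (cokernel.π A.toCoind) X s) =
      app (cokernel.π B.toCoind) X (app (coindMap φ) X s) := by
  have : cokernel.π A.toCoind ≫ coindQuotMap φ = coindMap φ ≫ cokernel.π B.toCoind :=
    cokernel.π_desc _ _ _
  rw [← app_comp, this, app_comp]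

/-- If t in coind A becomes the unit image of some m in B, then evaluation at 1 shows that m is the
image of t(1). As φ is injective, t is itself the unit image of t(1), a section of A. -/
instance mono_coindQuotMap {A B : EquivSheaf K E G} (φ : A ⟶ B) [Mono φ] :
    Mono (coindQuotMap φ) := by
  refine (mono_iff _).2 fun X => (injective_iff_map_eq_zero _).2 fun s hs => ?_
  refine eq_of_locally_eq fun x => ?_
  obtain ⟨U, hU, hx, hk⟩ := (epi_iff (cokernel.π A.toCoind)).1 inferInstance X s x
  refine ⟨U, hU, hx, fun Y k hkU => ?_⟩
  obtain ⟨t, ht⟩ := hk Y k hkU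
  rw [map_zero, ← ht]
  have h1 : app (cokernel.π B.toCoind) Y (app (coindMap φ) Y t) = 0 := by
    rw [← app_coindQuotMap, ht, app_res, hs, map_zero]
  have : Mono (coindSeq B).f := (shortExact_coindSeq B).mono_f
  obtain ⟨m, hm'⟩ : ∃ m : B.Sec Y, app B.toCoind Y m = app (coindMap φ) Y t :=
    exists_lift_of_exact (shortExact_coindSeq B).exact (app (coindMap φ) Y t) h1
  let t' : A.Sec Y := A.res (oneSec E G Y) t
  have h2 : app φ Y t' = m := (app_res φ (oneSec E G Y) t).trans
    ((congrArg (B.res (oneSec E G Y)) hm'.symm).trans (res_oneSec_toCoind m))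
  have h3 : t = app A.toCoind Y t' := by
    refine app_injective (coindMap φ) Y ?_
    rw [← hm', ← h2, ← app_comp, ← app_comp, toCoind_naturality]
  rw [h3, ← app_comp, cokernel.condition, app_zero]

/-- A section of the quotient lifts locally to coind M, and there it comes locally from one coind (N
i). This permits dimension shifting within directed unions. -/
theorem IsDirectedUnion.coindQuot (h : IsDirectedUnion ι) :
    IsDirectedUnion fun i => coindQuotMap (ι i) where
  nonempty := h.nonempty
  mono i := by
    have := h.mono i
    infer_instance
  directed i j := by
    obtain ⟨k, a, b, ha, hb⟩ := h.directed i j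
    exact ⟨k, coindQuotMap a, coindQuotMap b, by rw [← coindQuotMap_comp, ha],
      by rw [← coindQuotMap_comp, hb]⟩
  exhaust X s x := by
    obtain ⟨U, hU, hx, hk⟩ := (epi_iff (cokernel.π M.toCoind)).1 inferInstance X s x
    obtain ⟨Y, j, r, hjU, hjo, ⟨y, rfl⟩, hinj, hopen, hr⟩ := exists_open X x U hU hx
    obtain ⟨t, ht⟩ := hk Y j hjU
    obtain ⟨i, W, hW, hyW, hl⟩ := h.exists_lift_prodG (X := Y) t y
    refine ⟨i, j '' W, hopen _ hW, ⟨y, hyW, rfl⟩, fun Z k hkW => ?_⟩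
    have hkr : ∀ z, k z ∈ Set.range j := fun z => Set.image_subset_range _ _ (hkW ⟨z, rfl⟩)
    let k' : Z ⟶ Y := ⟨fun z => r (k z), fun z => (hr _ (hkr z)).2.comp z ((hom_contMDiff k) z)⟩
    have hk' : k' ≫ j = k := AnMfd.hom_ext fun z => (hr _ (hkr z)).1
    obtain ⟨t', ht'⟩ := hl Z k' (by
      rintro _ ⟨z, rfl⟩
      obtain ⟨w, hw, hwk⟩ := hkW ⟨z, rfl⟩
      have : k' z = w := hinj (by rw [hwk]; exact (hr _ (hkr z)).1)
      rwa [this])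
    refine ⟨app (cokernel.π (N i).toCoind) Z t', (app_coindQuotMap (ι i) (X := Z) t').trans ?_⟩
    have h1 : app (coindMap (ι i)) Z t' = M.coind.res k' t := ht'
    rw [h1, app_res, ht, res_res, hk']

/-- Cohomology classes of a directed union come from a member of the union. -/
theorem IsDirectedUnion.exists_ext_comp [IsUltrametricDist K] [CompleteSpace K] (n : ℕ) :
    ∀ {M : EquivSheaf K E G} {N : I → EquivSheaf K E G} {ι : ∀ i, N i ⟶ M}
      (_ : IsDirectedUnion ι) (c : Ext (unitObj K E G) M n),
      ∃ (i : I) (c' : Ext (unitObj K E G) (N i) n), c = c'.comp (Ext.mk₀ (ι i)) (add_zero n) := by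
  induction n with
  | zero =>
    intro M N ι h c
    obtain ⟨f, rfl⟩ := (Ext.mk₀_bijective _ _).2 c
    obtain ⟨i, U, hU, hx, hk⟩ := h.exhaust pt (unitHomEquiv M f).1 PUnit.unit
    obtain ⟨t, ht⟩ := hk pt (𝟙 pt) (by rintro _ ⟨⟨⟩, rfl⟩; exact hx)
    rw [res_id] at ht
    have := h.mono i
    have ht' : t ∈ (N i).invariants := (mem_invariants_iff t).2 fun X ρ => by
      refine app_injective (ι i) X ?_
      rw [app_act, app_res, ht]
      exact (mem_invariants_iff _).1 (unitHomEquiv M f).2 X ρ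
    refine ⟨i, Ext.mk₀ ((unitHomEquiv (N i)).symm ⟨t, ht'⟩), ?_⟩
    rw [Ext.mk₀_comp_mk₀]
    congr 1
    refine (unitHomEquiv M).injective (Subtype.ext ?_)
    rw [unitHomEquiv_comp, AddEquiv.apply_symm_apply]
    exact ht.symm
  | succ n ih =>
    intro M N ι h c
    -- The class dies in coind M, so it comes from one degree lower. Coinduction is used for the
    -- shift, rather than an injective hull, because it is functorial and compatible with the union.
    obtain ⟨y, rfl⟩ := Ext.covariant_sequence_exact₁ _ (shortExact_coindSeq M) c
      (ext_comp_toCoind n M c) rfl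
    obtain ⟨i, y', rfl⟩ := ih h.coindQuot y
    refine ⟨i, y'.comp (shortExact_coindSeq (N i)).extClass rfl, ?_⟩
    have hn := ShortComplex.ShortExact.extClass_naturality (shortExact_coindSeq (N i))
      (shortExact_coindSeq M) (coindSeqMap (ι i))
    refine (Ext.comp_assoc_of_second_deg_zero _ _ _ _).trans
      (Eq.trans ?_ (Ext.comp_assoc_of_third_deg_zero _ _ _ _).symm)
    exact congrArg (fun e => Ext.comp y' e _) hn.symm

end EquivSheaf

end Exhaustion

end LocAnCohom

namespace LocAnCohom

/-! ### The resolution by sheaves of differential forms -/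

section FormSheaves

variable {K : Type u} [NontriviallyNormedField K]
  {E : Type u} [NormedAddCommGroup E] [NormedSpace K E]
  {G : Type u} [TopologicalSpace G] [ChartedSpace E G] [Group G] [LieGroup 𝓘(K, E) ω G]

open AnMfd EquivSheaf Limits Abelian

namespace LocAnRep

variable {V V' : LocAnRep K E G} {q q' : ℕ} {X : AnMfd K}

/-- Families of forms lying in a `G`-stable group of forms, as a class of functions. -/
noncomputable def formData (S : AddSubgroup (V.Form q)) (hS : ∀ (g : G), ∀ s ∈ S, g • s ∈ S) :
    FunData K E G where
  carrier := S
  distribMulAction :=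
    { smul g s := ⟨g • s.1, hS g s.1 s.2⟩
      one_smul s := Subtype.ext (one_smul G s.1)
      mul_smul g h s := Subtype.ext (mul_smul g h s.1)
      smul_zero g := Subtype.ext (smul_zero g)
      smul_add g s t := Subtype.ext (smul_add g s.1 t.1) }
  sec X :=
    { carrier := {f | V.IsAdmForm X fun x => (f x).1.1}
      zero_mem' := isAdmForm_zero
      add_mem' {f f'} hf hf' := IsAdmForm.add (f := fun x => (f x).1.1) (f' := fun x => (f' x).1.1) hf hf'
      neg_mem' {f} hf := IsAdmForm.neg (f := fun x => (f x).1.1) hf }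
  res k f hf := IsAdmForm.res (f := fun x => (f x).1.1) hf k
  act ρ f hf := IsAdmForm.act (f := fun x => (f x).1.1) hf ρ
  loc {X f} hf ξ p := by
    obtain ⟨Y, j, r, hjo, hpj, hr, h⟩ := hf p.2.1
    refine (((show V.IsAdmForm Y fun y => (f (j y)).1.1 from h) ξ (p.1, (r p.2.1, p.2.2))).comp
      (r := fun p : G × (X × G) => (p.1, (r p.2.1, p.2.2)))
      (contMDiffAt_fst.prodMk ((ContMDiffAt.comp p (hr _ hpj).2
        (contMDiffAt_fst.comp p contMDiffAt_snd)).prodMk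
          (contMDiffAt_snd.comp p contMDiffAt_snd)))).congr ?_
    filter_upwards [(continuous_fst.comp continuous_snd).continuousAt.eventually
      (hjo.mem_nhds hpj)] with p' hp'
    have hj : j (r p'.2.1) = p'.2.1 := (hr _ hp').1
    rw [hj]

/-- Maps of classes of functions given by maps of forms. -/
noncomputable def formHom {S : AddSubgroup (V.Form q)} {hS : ∀ (g : G), ∀ s ∈ S, g • s ∈ S}
    {S' : AddSubgroup (V'.Form q')} {hS' : ∀ (g : G), ∀ s ∈ S', g • s ∈ S'}
    (T : V.Form q →+ V'.Form q') (hT : ∀ (g : G) s, T (g • s) = g • T s)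
    (hSS' : ∀ s ∈ S, T s ∈ S')
    (hadm : ∀ (X : AnMfd K) (f : X → V.Form q), V.IsAdmForm X (fun x => (f x).1) →
      V'.IsAdmForm X fun x => (T (f x)).1) : FunData.Hom (formData S hS) (formData S' hS') where
  toFun := (T.comp S.subtype).codRestrict S' fun s => hSS' s.1 s.2
  map_smul g s := Subtype.ext (hT g s.1)
  map_sec {X f} hf := hadm X (fun x => (f x).1) hf

/-- The sheaf of families of differential forms of degree `q` on `G`. -/
noncomputable def formSheaf (V : LocAnRep K E G) (q : ℕ) : EquivSheaf K E G :=
  (formData (V := V) (q := q) ⊤ fun _ _ _ => trivial).toSheaf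

/-- The form at a point given by a section of the sheaf of families of forms. -/
def formSec (s : (V.formSheaf q).Sec X) (x : X) : V.Form q :=
  ((show ULift.{u + 1} ((formData (V := V) (q := q) ⊤ fun _ _ _ => trivial).sec X) from s).down.1
    x).1

theorem isAdmForm_formSec (s : (V.formSheaf q).Sec X) : V.IsAdmForm X fun x => (formSec s x).1 :=
  (show ULift.{u + 1} ((formData (V := V) (q := q) ⊤ fun _ _ _ => trivial).sec X) from s).down.2

/-- The section given by a family of forms. -/
def mkFormSec (f : X → V.Form q) (hf : V.IsAdmForm X fun x => (f x).1) : (V.formSheaf q).Sec X :=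
  (ULift.up ⟨fun x => ⟨f x, trivial⟩, hf⟩ :
    ULift.{u + 1} ((formData (V := V) (q := q) ⊤ fun _ _ _ => trivial).sec X))

theorem formSec_ext {s t : (V.formSheaf q).Sec X} (h : ∀ x, formSec s x = formSec t x) : s = t :=
  ULift.ext _ _ (Subtype.ext (funext fun x => Subtype.ext (h x)))

theorem formSec_zero (x : X) : formSec (0 : (V.formSheaf q).Sec X) x = 0 := rfl

/-- The map of sheaves of families of forms given by a map of forms. -/
noncomputable def formSheafHom (T : V.Form q →+ V'.Form q')
    (hT : ∀ (g : G) s, T (g • s) = g • T s)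
    (hadm : ∀ (X : AnMfd K) (f : X → V.Form q), V.IsAdmForm X (fun x => (f x).1) →
      V'.IsAdmForm X fun x => (T (f x)).1) : V.formSheaf q ⟶ V'.formSheaf q' :=
  (formHom (S := ⊤) (S' := ⊤) (hS := fun _ _ _ => trivial) (hS' := fun _ _ _ => trivial) T hT
    (fun _ _ => trivial) hadm).toSheafHom

theorem formSheaf_hom_ext {A : EquivSheaf K E G} {φ ψ : A ⟶ V.formSheaf q}
    (h : ∀ X (s : A.Sec X) x, formSec (app φ X s) x = formSec (app ψ X s) x) : φ = ψ :=
  hom_ext_app fun X s => formSec_ext (h X s)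

section

variable [FiniteDimensional K E] [T2Space G] [CompactSpace G]

variable (E) in
/-- The identity of `X × G`, as a map to the manifold `X × G`. -/
def toProdG (p : X × G) : prodG E G X := p

/-- The two sides use the model of a product and the product of the models, which are equal but not
by definition; only the identity map is at stake. -/
theorem contMDiff_toProdG : ContMDiff (𝓘(K, X.model).prod 𝓘(K, E)) 𝓘(K, (prodG E G X).model) ω
    (toProdG E : X × G → prodG E G X) := by
  have h : ∀ J : ModelWithCorners K (X.model × E) (ModelProd X.model E),
      J = 𝓘(K, X.model).prod 𝓘(K, E) →
        ContMDiff (𝓘(K, X.model).prod 𝓘(K, E)) J ω (id : X × G → X × G) := by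
    rintro _ rfl
    exact contMDiff_id
  exact h 𝓘(K, X.model × E) modelWithCornersSelf_prod

/-- The retraction sends a family s(x, h) of forms to the form with value h · s(x, h)(1) at h. On
the unit, where s(x, h) = h⁻¹ s(x), this gives back s(x)(h). Admissibility holds because g h acts as
g after h. -/
theorem isAdmForm_retract (s : (V.formSheaf q).Sec (prodG E G X)) :
    V.IsAdmForm X fun x h => (V.ρ h : V →L[K] V).toLinearMap.compAlternatingMap
      ((formSec s (toProdG E (x, h))).1 1) := fun ξ p => by
  refine ((isAdmForm_formSec s ξ (p.1 * p.2.2, (toProdG E p.2, 1))).comp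
    (r := fun p : G × (X × G) => (p.1 * p.2.2, (toProdG E p.2, (1 : G)))) ?_).congr
    (.of_forall fun p => V.ρ_mul _ _ _)
  exact (contMDiffAt_fst.mul (contMDiffAt_snd.comp p contMDiffAt_snd)).prodMk
    ((contMDiff_toProdG.contMDiffAt.comp p contMDiffAt_snd).prodMk contMDiffAt_const)

variable (V q) in
/-- The retraction of the form sheaf from the coinduced object. -/
noncomputable def formRetract : (V.formSheaf q).coind ⟶ V.formSheaf q where
  hom := ⟨{
    app X := AddCommGrpCat.ofHom (
      { toFun s := mkFormSec (fun x => ⟨_, (isAdmForm_retract s).mem_form x⟩) (isAdmForm_retract s)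
        map_zero' := formSec_ext fun x => Subtype.ext (funext fun h => AlternatingMap.ext fun _ =>
          map_zero (V.ρ h))
        map_add' _ _ := formSec_ext fun x => Subtype.ext (funext fun h =>
          AlternatingMap.ext fun _ => map_add (V.ρ h) _ _) } :
      (V.formSheaf q).Sec (prodG E G X.unop) →+ (V.formSheaf q).Sec X.unop)
    naturality _ _ _ := rfl }⟩
  equivariant X ρ s := formSec_ext fun x => Subtype.ext (funext fun h =>
    AlternatingMap.ext fun ξ => by
      change V.ρ h ((formSec s (toProdG E (x, (ρ x)⁻¹ * h))).1 1 ξ) =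
        V.ρ (ρ x) (V.ρ ((ρ x)⁻¹ * h) ((formSec s (toProdG E (x, (ρ x)⁻¹ * h))).1 1 ξ))
      rw [← ρ_mul, mul_inv_cancel_left])

theorem toCoind_formRetract : (V.formSheaf q).toCoind ≫ formRetract V q = 𝟙 _ :=
  formSheaf_hom_ext fun X s x => Subtype.ext (funext fun h => AlternatingMap.ext fun ξ => by
    change V.ρ h (V.ρ h⁻¹ ((formSec s x).1 (h⁻¹⁻¹ * 1) ξ)) = (formSec s x).1 h ξ
    rw [ρ_ρ_inv, inv_inv, mul_one])

end

section

variable [CompleteSpace K] [FiniteDimensional K E] [CharZero K]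

variable (V) in
/-- The group of closed functions. -/
noncomputable def closedFun : AddSubgroup (V.Form 0) := (Form.d (V := V) (q := 0)).ker

theorem mem_closedFun {s : V.Form 0} : s ∈ V.closedFun ↔ Form.d s = 0 := Iff.rfl

theorem smul_mem_closedFun (g : G) (s : V.Form 0) (hs : s ∈ V.closedFun) : g • s ∈ V.closedFun := by
  rw [mem_closedFun] at hs ⊢
  rw [Form.d_smul, hs, smul_zero]

variable (V) in
/-- The class of families of closed functions. -/
noncomputable def closedData : FunData K E G := formData V.closedFun smul_mem_closedFun

variable (V) in
/-- The sheaf of families of closed functions on `G`. -/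
noncomputable def closedSheaf : EquivSheaf K E G := V.closedData.toSheaf

variable (V) in
/-- The inclusion of the closed functions. -/
noncomputable def closedIncl : V.closedSheaf ⟶ V.formSheaf 0 :=
  (formHom (S := V.closedFun) (S' := ⊤) (hS := smul_mem_closedFun) (hS' := fun _ _ _ => trivial)
    (AddMonoidHom.id _) (fun _ _ => rfl) (fun _ _ => trivial) fun _ _ h => h).toSheafHom

theorem isAdmForm_d (f : X → V.Form q) (hf : V.IsAdmForm X fun x => (f x).1) :
    V.IsAdmForm X fun x => (Form.d (f x)).1 := fun ξ p =>
  ((IsAdmForm.isAn_dRaw hf ξ) p).congr (.of_forall fun p => by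
    change V.ρ p.1 (dRaw (f p.2.1).1 p.2.2 ξ) = V.ρ p.1 ((Form.d (f p.2.1)).1 p.2.2 ξ)
    rw [Form.d_apply])

variable (V q) in
/-- The differential of the sheaves of forms. -/
noncomputable def formD : V.formSheaf q ⟶ V.formSheaf (q + 1) :=
  formSheafHom Form.d Form.d_smul fun _ => isAdmForm_d

theorem formSec_d (s : (V.formSheaf q).Sec X) (x : X) :
    formSec (app (formD V q) X s) x = Form.d (formSec s x) := rfl

theorem mono_closedIncl : Mono V.closedIncl := (mono_iff _).2 fun X _ _ h =>
  ULift.ext _ _ (Subtype.ext (funext fun x => Subtype.ext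
    (congrArg (fun s : (V.formSheaf 0).Sec X => formSec s x) h)))

theorem closedIncl_formD : V.closedIncl ≫ V.formD 0 = 0 :=
  formSheaf_hom_ext fun X s x => by
    rw [app_zero, formSec_zero]
    exact ((show ULift.{u + 1} (V.closedData.sec X) from s).down.1 x).2

theorem formD_formD : V.formD q ≫ V.formD (q + 1) = 0 :=
  formSheaf_hom_ext fun X s x => by
    rw [app_zero, formSec_zero, app_comp, formSec_d, formSec_d, Form.d_d]

theorem exact_closedIncl : (ShortComplex.mk V.closedIncl (V.formD 0) closedIncl_formD).Exact := by
  refine exact_of_locallyLifts _ fun X s hs => ?_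
  have h : ∀ x, Form.d (formSec (V := V) (q := 0) s x) = 0 := fun x =>
    congrArg (fun s : (V.formSheaf 1).Sec X => formSec s x) hs
  exact locallyLifts_of_app V.closedIncl (X := X)
    (ULift.up ⟨fun x => ⟨formSec s x, h x⟩, isAdmForm_formSec s⟩ :
      ULift.{u + 1} (V.closedData.sec X)) rfl

/-- Primitives exist locally on the parameter manifold but over all of G at once, as the notion of a
section requires. -/
theorem exact_formD [IsUltrametricDist K] [T2Space G] [CompactSpace G] :
    (ShortComplex.mk (V.formD q) (V.formD (q + 1)) formD_formD).Exact := by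
  refine exact_of_locallyLifts _ fun X s hs x₀ => ?_
  have hd : ∀ x, Form.d (formSec (V := V) (q := q + 1) s x) = 0 := fun x =>
    congrArg (fun s : (V.formSheaf (q + 2)).Sec X => formSec s x) hs
  obtain ⟨U, p, hU, hx₀, h⟩ := IsAdmForm.exists_primitive (isAdmForm_formSec (V := V) s)
    (fun x h ξ => by rw [← Form.d_apply, hd]; rfl) x₀
  refine ⟨U, hU, hx₀, fun Y k hk => ?_⟩
  have hp : V.IsAdmForm Y fun y => p (k y) := fun ξ z =>
    ((h (k z.2.1) (hk ⟨_, rfl⟩)).1 z.1 z.2.2 ξ).comp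
      (r := fun z : G × (Y × G) => (z.1, (k z.2.1, z.2.2)))
      (contMDiffAt_fst.prodMk ((((AnMfd.hom_contMDiff k) _).comp z
        (contMDiffAt_fst.comp z contMDiffAt_snd)).prodMk (contMDiffAt_snd.comp z contMDiffAt_snd)))
  refine ⟨mkFormSec (fun y => ⟨p (k y), hp.mem_form y⟩) hp, formSec_ext fun y => ?_⟩
  refine Subtype.ext (funext fun g => AlternatingMap.ext fun ξ => ?_)
  exact (Form.d_apply _ _ _).trans ((h (k y) (hk ⟨_, rfl⟩)).2 g ξ)

variable [IsUltrametricDist K] [T2Space G] [CompactSpace G]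

variable (V) in
/-- The resolution of the sheaf of closed functions by sheaves of forms. -/
noncomputable def formRes : AcycRes (unitObj K E G) V.closedSheaf where
  obj q := V.formSheaf q
  d q := V.formD q
  ι := V.closedIncl
  mono_ι := mono_closedIncl
  ι_d := closedIncl_formD
  d_d _ := formD_formD
  exact_zero := exact_closedIncl
  exact_succ _ := exact_formD
  acyclic q n := subsingleton_ext_of_retract (formRetract V q) toCoind_formRetract n

end

end LocAnRep

end FormSheaves

end LocAnCohom

namespace LocAnCohom

/-! ### Lie algebra cohomology as the cohomology of the sheaf of closed functions -/

section LieComparison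

variable {K : Type u} [NontriviallyNormedField K]
  {E : Type u} [NormedAddCommGroup E] [NormedSpace K E]
  {G : Type u} [TopologicalSpace G] [ChartedSpace E G] [Group G] [LieGroup 𝓘(K, E) ω G]

open AnMfd EquivSheaf Limits Abelian

namespace LocAnRep

variable {V V' : LocAnRep K E G} {q : ℕ} {X : AnMfd K}

/-- The form given by a global section of the form sheaf. -/
noncomputable def formOfHom (f : unitObj K E G ⟶ V.formSheaf q) : V.Form q :=
  formSec (unitHomEquiv _ f).1 PUnit.unit

theorem smul_formOfHom (f : unitObj K E G ⟶ V.formSheaf q) (g : G) :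
    g • formOfHom f = formOfHom f := by
  have h := (mem_invariants_iff _).1 (unitHomEquiv _ f).2 pt ⟨fun _ => g, contMDiff_const⟩
  exact congrArg (fun s : (V.formSheaf q).Sec pt => formSec s PUnit.unit) h

section

variable [CompleteSpace K] [FiniteDimensional K E] [CharZero K]

theorem formOfHom_eq (f : unitObj K E G ⟶ V.formSheaf q) :
    formOfHom f = Form.ofCochain ((formOfHom f).1 1) := Form.eq_ofCochain _ (smul_formOfHom f)

theorem exists_formOfHom_eq (η : V.Cochain q) :
    ∃ f : unitObj K E G ⟶ V.formSheaf q, formOfHom f = Form.ofCochain η := by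
  let s : (V.formSheaf q).Sec pt := mkFormSec (fun _ => Form.ofCochain η)
    (Form.isAdmForm (Form.ofCochain η))
  have hs : s ∈ (V.formSheaf q).invariants := (mem_invariants_iff s).2 fun X ρ =>
    formSec_ext fun x => Form.smul_ofCochain (ρ x) η
  refine ⟨(unitHomEquiv _).symm ⟨s, hs⟩, ?_⟩
  rw [formOfHom, AddEquiv.apply_symm_apply]
  rfl

theorem ofCochain_one (η : V.Cochain q) : (Form.ofCochain η).1 1 = η :=
  AlternatingMap.ext fun _ => V.ρ_one _

variable (V q) in
/-- Global sections of the form sheaf are the cochains of the Lie algebra. -/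
noncomputable def homEquivCochain : (unitObj K E G ⟶ V.formSheaf q) ≃+ V.Cochain q :=
  AddEquiv.ofBijective
    ({  toFun f := (formOfHom f).1 1
        map_zero' := rfl
        map_add' f g := by
          rw [formOfHom, map_add]
          rfl } : (unitObj K E G ⟶ V.formSheaf q) →+ V.Cochain q)
    ⟨fun f g h => by
      have h' : formOfHom f = formOfHom g := by
        rw [formOfHom_eq f, formOfHom_eq g]
        exact congrArg _ h
      refine (unitHomEquiv _).injective (Subtype.ext (formSec_ext fun _ => h')),
    fun η => by
      obtain ⟨f, hf⟩ := exists_formOfHom_eq η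
      refine ⟨f, ?_⟩
      change (formOfHom f).1 1 = η
      rw [hf, ofCochain_one]⟩

theorem homEquivCochain_apply (f : unitObj K E G ⟶ V.formSheaf q) :
    homEquivCochain V q f = (formOfHom f).1 1 := rfl

theorem formOfHom_eq_ofCochain (f : unitObj K E G ⟶ V.formSheaf q) :
    formOfHom f = Form.ofCochain (homEquivCochain V q f) := formOfHom_eq f

theorem formOfHom_comp (f : unitObj K E G ⟶ V.formSheaf q) {q' : ℕ}
    (T : V.Form q →+ V'.Form q') (hT) (hadm) :
    formOfHom (f ≫ formSheafHom T hT hadm) = T (formOfHom f) := rfl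

theorem homEquivCochain_formD (f : unitObj K E G ⟶ V.formSheaf q) (x) :
    homEquivCochain V (q + 1) (f ≫ V.formD q) x = V.ceD (homEquivCochain V q f) x := by
  rw [← Form.d_ofCochain_one, ← formOfHom_eq_ofCochain]
  rfl

theorem comp_formD_eq_zero_iff (f : unitObj K E G ⟶ V.formSheaf q) :
    f ≫ V.formD q = 0 ↔ homEquivCochain V q f ∈ V.cocycles q := by
  rw [← map_eq_zero_iff _ (homEquivCochain V (q + 1)).injective]
  constructor
  · intro h x
    rw [← homEquivCochain_formD, h]
    rfl
  · intro h
    ext x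
    rw [homEquivCochain_formD]
    exact h x

variable (q) in
/-- The map on form sheaves induced by a map of representations. -/
noncomputable def formMap (T : V ⟶ V') : V.formSheaf q ⟶ V'.formSheaf q :=
  formSheafHom (Form.map T) (Form.map_smul T) fun _ _ => IsAdmForm.map T

theorem isAdmForm_rTrans (g : G) (X : AnMfd K) (f : X → V.Form q)
    (hf : V.IsAdmForm X fun x => (f x).1) : V.IsAdmForm X fun x => (Form.rTrans g (f x)).1 :=
  fun ξ p => (hf (fun i => Ad g⁻¹ (ξ i)) (p.1, (p.2.1, p.2.2 * g))).comp
    (r := fun p : G × (X × G) => (p.1, (p.2.1, p.2.2 * g)))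
    (contMDiffAt_fst.prodMk ((contMDiffAt_fst.comp p contMDiffAt_snd).prodMk
      ((contMDiffAt_snd.comp p contMDiffAt_snd).mul contMDiffAt_const)))

variable (V q) in
/-- The right translation of form sheaves. -/
noncomputable def formTrans (g : G) : V.formSheaf q ⟶ V.formSheaf q :=
  formSheafHom (Form.rTrans g) (Form.rTrans_smul g) (isAdmForm_rTrans g)

theorem homEquivCochain_formTrans (g : G) (f : unitObj K E G ⟶ V.formSheaf q) :
    homEquivCochain V q (f ≫ formTrans V q g) = V.cochainAct q g (homEquivCochain V q f) := by
  rw [homEquivCochain_apply, formTrans, formOfHom_comp, formOfHom_eq_ofCochain,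
    Form.rTrans_ofCochain, ofCochain_one]

/-- The map on closed functions induced by a map of representations. -/
noncomputable def closedMapData (T : V ⟶ V') : FunData.Hom V.closedData V'.closedData :=
  formHom (Form.map T) (Form.map_smul T) (fun s hs => by
    rw [mem_closedFun] at hs ⊢
    rw [Form.d_map, hs, map_zero]) fun _ _ => IsAdmForm.map T

/-- The map on sheaves of closed functions induced by a map of representations. -/
noncomputable def closedMap (T : V ⟶ V') : V.closedSheaf ⟶ V'.closedSheaf :=
  (closedMapData T).toSheafHom

variable (V) in
/-- The right translation of closed functions. -/
noncomputable def closedTransData (g : G) : FunData.Hom V.closedData V.closedData :=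
  formHom (Form.rTrans g) (Form.rTrans_smul g) (fun s hs => by
    rw [mem_closedFun] at hs ⊢
    rw [Form.d_rTrans, hs, map_zero]) (isAdmForm_rTrans g)

variable (V) in
/-- The right translation of the sheaf of closed functions. -/
noncomputable def closedTrans (g : G) : V.closedSheaf ⟶ V.closedSheaf :=
  (closedTransData V g).toSheafHom

variable [IsUltrametricDist K] [T2Space G] [CompactSpace G]

/-- The map of resolutions induced by a map of representations. -/
noncomputable def formResMap (T : V ⟶ V') :
    AcycRes.Hom V.formRes V'.formRes (closedMap T) where
  hom q := formMap q T
  comm q := formSheaf_hom_ext fun _ s x => Form.d_map T (formSec (V := V) (q := q) s x)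
  comm_ι := rfl

variable (V) in
/-- The right translation of resolutions. -/
noncomputable def formResTrans (g : G) : AcycRes.Hom V.formRes V.formRes (closedTrans V g) where
  hom q := formTrans V q g
  comm q := formSheaf_hom_ext fun _ s x => Form.d_rTrans g (formSec (V := V) (q := q) s x)
  comm_ι := rfl

variable (V) in
/-- The cohomology class of a cycle of global sections. -/
noncomputable def cyclesToLie (n : ℕ) : V.formRes.cycles n →+ V.lieCohomology n where
  toFun z := Submodule.Quotient.mk ⟨homEquivCochain V n z.1, (comp_formD_eq_zero_iff z.1).1 z.2⟩
  map_zero' := congrArg Submodule.Quotient.mk (Subtype.ext (map_zero (homEquivCochain V n)))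
  map_add' a b :=
    congrArg Submodule.Quotient.mk (Subtype.ext (map_add (homEquivCochain V n) a.1 b.1))

theorem cyclesToLie_surjective (n : ℕ) : Function.Surjective (cyclesToLie V n) := by
  intro y
  obtain ⟨η, rfl⟩ := Submodule.Quotient.mk_surjective _ y
  refine ⟨⟨(homEquivCochain V n).symm η.1, (comp_formD_eq_zero_iff _).2 ?_⟩, ?_⟩
  · rw [AddEquiv.apply_symm_apply]
    exact η.2
  · refine congrArg Submodule.Quotient.mk (Subtype.ext ?_)
    exact AddEquiv.apply_symm_apply _ _

theorem cyclesToLie_eq_zero_iff (n : ℕ) (z : V.formRes.cycles n) :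
    AcycRes.toExt n V.formRes z = 0 ↔ cyclesToLie V n z = 0 := by
  have h : cyclesToLie V n z = 0 ↔ homEquivCochain V n z.1 ∈ V.coboundaries n :=
    Submodule.Quotient.mk_eq_zero _
  rw [h]
  cases n with
  | zero =>
    rw [map_eq_zero_iff _ (AcycRes.toExt_zero_injective _)]
    refine Iff.trans ?_ (Submodule.mem_bot K).symm
    exact Subtype.ext_iff.trans (map_eq_zero_iff (homEquivCochain V 0) (EquivLike.injective _)).symm
  | succ n =>
    rw [AcycRes.toExt_eq_zero_iff]
    constructor
    · rintro ⟨w, hw⟩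
      refine ⟨homEquivCochain V n w, fun x => ?_⟩
      exact (congrArg (fun f => homEquivCochain V (n + 1) f x) hw.symm).trans
        (homEquivCochain_formD w x)
    · rintro ⟨η, hη⟩
      refine ⟨(homEquivCochain V n).symm η, (homEquivCochain V (n + 1)).injective ?_⟩
      ext x
      refine (homEquivCochain_formD _ x).trans ?_
      rw [AddEquiv.apply_symm_apply, ← hη]

/-- Global sections of the resolution are cochains with the Chevalley-Eilenberg differential, so
both groups are the cycles modulo the same boundaries. -/
theorem exists_extEquivLie (V : LocAnRep K E G) (n : ℕ) :
    ∃ e : Ext (unitObj K E G) V.closedSheaf n ≃+ V.lieCohomology n,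
      ∀ z, e (AcycRes.toExt n V.formRes z) = cyclesToLie V n z :=
  exists_addEquiv_of_ker_eq _ _ (AcycRes.toExt_surjective n _) (cyclesToLie_surjective n)
    (cyclesToLie_eq_zero_iff n)

/-- The cohomology of the sheaf of closed functions is Lie algebra cohomology. -/
noncomputable def extEquivLie (V : LocAnRep K E G) (n : ℕ) :
    Ext (unitObj K E G) V.closedSheaf n ≃+ V.lieCohomology n :=
  (exists_extEquivLie V n).choose

theorem extEquivLie_toExt (n : ℕ) (z : V.formRes.cycles n) :
    extEquivLie V n (AcycRes.toExt n V.formRes z) = cyclesToLie V n z :=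
  (exists_extEquivLie V n).choose_spec z

theorem extEquivLie_map (T : V ⟶ V') (n : ℕ) (x : Ext (unitObj K E G) V.closedSheaf n) :
    extEquivLie V' n (x.comp (Ext.mk₀ (closedMap T)) (add_zero n)) =
      lieCohomologyMap T n (extEquivLie V n x) := by
  obtain ⟨z, rfl⟩ := AcycRes.toExt_surjective n V.formRes x
  rw [← AcycRes.toExt_naturality n (formResMap T) z, extEquivLie_toExt, extEquivLie_toExt]
  rfl

/-- Right translation by g extends to the whole resolution by forms, and on global sections it is
the action of g on cochains. -/
theorem extEquivLie_trans (g : G) (n : ℕ) (x : Ext (unitObj K E G) V.closedSheaf n) :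
    extEquivLie V n (x.comp (Ext.mk₀ (closedTrans V g)) (add_zero n)) =
      V.lieCohomologyRep n g (extEquivLie V n x) := by
  obtain ⟨z, rfl⟩ := AcycRes.toExt_surjective n V.formRes x
  rw [← AcycRes.toExt_naturality n (formResTrans V g) z, extEquivLie_toExt, extEquivLie_toExt]
  exact congrArg Submodule.Quotient.mk (Subtype.ext (homEquivCochain_formTrans g z.1))

end

end LocAnRep

end LieComparison

end LocAnCohom

namespace LocAnCohom

/-! ### Averages of functions on finite coset spaces -/

section Averages

variable (K : Type*) [Field K] {G : Type*} [Group G] {W : Type*} [AddCommGroup W] [Module K W]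

/-- The average of a function that is invariant under right multiplication by `H`. -/
noncomputable def cosetAvg (H : Subgroup G) (ψ : G → W) : W :=
  (Nat.card (G ⧸ H) : K)⁻¹ • ∑ᶠ c : G ⧸ H, ψ c.out

variable {K} {H H' : Subgroup G} {ψ ψ' : G → W}

theorem eq_apply_out (hψ : ∀ h, ∀ k ∈ H, ψ (h * k) = ψ h) (h : G) :
    ψ (QuotientGroup.mk h : G ⧸ H).out = ψ h := by
  obtain ⟨k, hk⟩ := QuotientGroup.mk_out_eq_mul H h
  rw [hk, hψ h k k.2]

/-- Left multiplication by g permutes the cosets, and g c.out differs from the representative of g c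
by an element of H. -/
theorem finsum_mul_out (hψ : ∀ h, ∀ k ∈ H, ψ (h * k) = ψ h) (g : G) :
    ∑ᶠ c : G ⧸ H, ψ (g * c.out) = ∑ᶠ c : G ⧸ H, ψ c.out := by
  rw [← finsum_comp_equiv (MulAction.toPerm g : Equiv.Perm (G ⧸ H)) (f := fun c => ψ c.out)]
  refine finsum_congr fun c => ?_
  rw [MulAction.toPerm_apply, ← eq_apply_out hψ (g * c.out)]
  congr 2
  conv_rhs => rw [← Quotient.out_eq' c]
  rfl

variable [Finite (G ⧸ H)]

theorem cosetAvg_add : cosetAvg K H (fun h => ψ h + ψ' h) = cosetAvg K H ψ + cosetAvg K H ψ' := by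
  rw [cosetAvg, finsum_add_distrib (Set.toFinite _) (Set.toFinite _), smul_add]
  rfl

theorem cosetAvg_map {W' : Type*} [AddCommGroup W'] [Module K W'] (T : W →ₗ[K] W') :
    cosetAvg K H (fun h => T (ψ h)) = T (cosetAvg K H ψ) := by
  rw [cosetAvg, cosetAvg, map_smul]
  congr 1
  exact (AddMonoidHom.map_finsum T.toAddMonoidHom (Set.toFinite _)).symm

theorem cosetAvg_mul_left (hψ : ∀ h, ∀ k ∈ H, ψ (h * k) = ψ h) (g : G) :
    cosetAvg K H (fun h => ψ (g * h)) = cosetAvg K H ψ := by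
  rw [cosetAvg, finsum_mul_out hψ]
  rfl

variable [CharZero K]

theorem card_smul_cosetAvg : Nat.card (G ⧸ H) • cosetAvg K H ψ = ∑ᶠ c : G ⧸ H, ψ c.out := by
  rw [cosetAvg, ← Nat.cast_smul_eq_nsmul K, smul_smul, mul_inv_cancel₀, one_smul]
  exact Nat.cast_ne_zero.2 Nat.card_pos.ne'

theorem cosetAvg_const (w : W) : cosetAvg K H (fun _ => w) = w := by
  cases nonempty_fintype (G ⧸ H)
  rw [cosetAvg, finsum_eq_sum_of_fintype, Finset.sum_const, Finset.card_univ,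
    ← Nat.cast_smul_eq_nsmul K, smul_smul, Nat.card_eq_fintype_card, inv_mul_cancel₀, one_smul]
  exact Nat.cast_ne_zero.2 Fintype.card_pos.ne'

/-- All fibres of G / H' → G / H have [H : H'] elements. This makes the average independent of the
subgroup used. -/
theorem cosetAvg_eq_of_le [Finite (G ⧸ H')] (hψ : ∀ h, ∀ k ∈ H, ψ (h * k) = ψ h) (hle : H' ≤ H) :
    cosetAvg K H' ψ = cosetAvg K H ψ := by
  let e := Subgroup.quotientEquivProdOfLE hle
  have hfin : Finite ((G ⧸ H) × (H ⧸ H'.subgroupOf H)) := Finite.of_equiv _ e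
  have hfin' : Finite (H ⧸ H'.subgroupOf H) :=
    Finite.of_injective (fun d => ((QuotientGroup.mk 1 : G ⧸ H), d)) fun _ _ h => (Prod.ext_iff.1 h).2
  cases nonempty_fintype (G ⧸ H)
  cases nonempty_fintype (H ⧸ H'.subgroupOf H)
  have h1 : ∀ c : G ⧸ H', ψ c.out = ψ (e c).1.out := by
    intro c
    have h2 : (e c).1 = (QuotientGroup.mk c.out : G ⧸ H) := by
      conv_lhs => rw [← Quotient.out_eq' c]
      rfl
    rw [h2, eq_apply_out hψ]
  have h3 : ∑ᶠ c : G ⧸ H', ψ c.out =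
      Fintype.card (H ⧸ H'.subgroupOf H) • ∑ᶠ c : G ⧸ H, ψ c.out := by
    rw [finsum_congr h1, finsum_comp_equiv e (f := fun p => ψ p.1.out), finsum_eq_sum_of_fintype,
      finsum_eq_sum_of_fintype, Fintype.sum_prod_type, Finset.smul_sum]
    refine Finset.sum_congr rfl fun c _ => ?_
    exact Finset.sum_const (ψ c.out)
  have h4 : Nat.card (G ⧸ H') = Fintype.card (G ⧸ H) * Fintype.card (H ⧸ H'.subgroupOf H) := by
    rw [Nat.card_congr e, Nat.card_eq_fintype_card, Fintype.card_prod]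
  rw [cosetAvg, cosetAvg, h3, h4, Nat.card_eq_fintype_card, ← Nat.cast_smul_eq_nsmul K, smul_smul]
  congr 1
  have h5 : (Fintype.card (G ⧸ H) : K) ≠ 0 := Nat.cast_ne_zero.2 Fintype.card_pos.ne'
  have h6 : (Fintype.card (H ⧸ H'.subgroupOf H) : K) ≠ 0 := Nat.cast_ne_zero.2 Fintype.card_pos.ne'
  push_cast
  field_simp

end Averages

/-! ### Constant functions and averages of closed functions -/

section ClosedFunctions

theorem finite_quotient_openSubgroup (K : Type*) [NontriviallyNormedField K]
    (E : Type*) [NormedAddCommGroup E] [NormedSpace K E] {G : Type*} [TopologicalSpace G]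
    [ChartedSpace E G] [Group G] [LieGroup 𝓘(K, E) ω G] [CompactSpace G] (H : OpenSubgroup G) :
    Finite (G ⧸ (H : Subgroup G)) := by
  have : IsTopologicalGroup G := topologicalGroup_of_lieGroup 𝓘(K, E) ω
  exact Subgroup.quotient_finite_of_isOpen _ H.isOpen

variable {K : Type u} [NontriviallyNormedField K] [IsUltrametricDist K] [CompleteSpace K]
  [CharZero K] {E : Type u} [NormedAddCommGroup E] [NormedSpace K E] [FiniteDimensional K E]
  {G : Type u} [TopologicalSpace G] [T2Space G] [ChartedSpace E G] [Group G]
  [LieGroup 𝓘(K, E) ω G] [CompactSpace G]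

open AnMfd EquivSheaf Limits Abelian

namespace LocAnRep

variable {V V' : LocAnRep K E G} {X : AnMfd K}

/-- The function underlying a form of degree zero. -/
noncomputable def Form.val (s : V.Form 0) (h : G) : V := s.1 h Fin.elim0

theorem Form.apply_eq_val (s : V.Form 0) (h : G) (ξ) : s.1 h ξ = Form.val s h :=
  congrArg (s.1 h) (Subsingleton.elim _ _)

theorem Form.ext_val {s t : V.Form 0} (h : ∀ g, Form.val s g = Form.val t g) : s = t :=
  Subtype.ext (funext fun g => AlternatingMap.ext fun ξ => by
    rw [Form.apply_eq_val, Form.apply_eq_val, h])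

theorem Form.val_smul (g : G) (s : V.Form 0) (h : G) :
    Form.val (g • s) h = V.ρ g (Form.val s (g⁻¹ * h)) := rfl

theorem Form.val_add (s t : V.Form 0) (h : G) :
    Form.val (s + t) h = Form.val s h + Form.val t h := rfl

theorem Form.val_rTrans (g : G) (s : V.Form 0) (h : G) :
    Form.val (Form.rTrans g s) h = Form.val s (h * g) := by
  rw [Form.val, Form.rTrans_apply, Form.apply_eq_val]

variable (V) in
/-- The functions invariant under right multiplication by `H`. -/
def invFun (H : Subgroup G) : AddSubgroup (V.Form 0) where
  carrier := {s | ∀ h, ∀ k ∈ H, Form.val s (h * k) = Form.val s h}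
  zero_mem' _ _ _ := rfl
  add_mem' {s t} hs ht h k hk := by rw [Form.val_add, Form.val_add, hs h k hk, ht h k hk]
  neg_mem' {s} hs h k hk := congrArg Neg.neg (hs h k hk)

theorem smul_mem_invFun (H : Subgroup G) (g : G) (s : V.Form 0) (hs : s ∈ V.invFun H) :
    g • s ∈ V.invFun H := fun h k hk => by
  rw [Form.val_smul, Form.val_smul, ← mul_assoc, hs _ k hk]

/-- Since H is open, such a function is constant on the open cosets of H, so all its derivatives
vanish. -/
theorem invFun_le_closedFun (H : OpenSubgroup G) : V.invFun H ≤ V.closedFun := by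
  intro s hs
  rw [mem_closedFun]
  refine Subtype.ext (funext fun h => AlternatingMap.ext fun x => ?_)
  rw [Form.d_apply]
  have : IsTopologicalGroup G := topologicalGroup_of_lieGroup 𝓘(K, E) ω
  have h1 : s.1 =ᶠ[𝓝 h] fun _ => s.1 h := by
    have h2 : ∀ᶠ h' in 𝓝 h, h⁻¹ * h' ∈ H := by
      refine (continuous_const_mul h⁻¹).continuousAt.eventually_mem (H.isOpen.mem_nhds ?_)
      rw [inv_mul_cancel]
      exact H.one_mem
    filter_upwards [h2] with h' hh'
    refine AlternatingMap.ext fun ξ => ?_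
    rw [Form.apply_eq_val, Form.apply_eq_val, ← hs h _ hh', mul_inv_cancel_left]
  rw [dRaw_congr h1, dRaw]
  have h3 : ∀ (y : E) (v : V), lDeriv K (E := E) y (fun _ : G => v) h = 0 := by
    intro y v
    refine Tendsto.limUnder_eq (tendsto_const_nhds.congr fun t => ?_)
    rw [sub_self, smul_zero]
  have h4 : ∀ j : Fin 1, Finset.Iio j = ∅ := by decide
  simp only [h4, Finset.sum_empty, Finset.sum_const_zero, add_zero]
  refine Finset.sum_eq_zero fun i _ => ?_
  exact (congrArg _ (h3 (x i) _)).trans (smul_zero _)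

theorem exists_mem_invFun {f : X → V.Form 0} (hf : V.IsAdmForm X fun x => (f x).1)
    (hd : ∀ x, f x ∈ V.closedFun) (x₀ : X) :
    ∃ (U : Set X) (H : OpenSubgroup G), IsOpen U ∧ x₀ ∈ U ∧ ∀ x ∈ U, f x ∈ V.invFun H := by
  obtain ⟨U, H, hU, hx, h⟩ := IsAdmForm.exists_openSubgroup hf (fun x h ξ => by
    rw [← Form.d_apply, mem_closedFun.1 (hd x)]; rfl) x₀
  refine ⟨U, H, hU, hx, fun x hx g k hk => ?_⟩
  rw [Form.val, h x hx g k hk]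
  rfl

theorem exists_mem_invFun_of_closed {s : V.Form 0} (hs : s ∈ V.closedFun) :
    ∃ H : OpenSubgroup G, s ∈ V.invFun H := by
  obtain ⟨U, H, -, hx, h⟩ := exists_mem_invFun (X := pt) (f := fun _ => s) (Form.isAdmForm s)
    (fun _ => hs) PUnit.unit
  exact ⟨H, h _ hx⟩

/-- The average of a closed function. -/
noncomputable def closedAvg (s : V.closedFun) : V :=
  cosetAvg K ((exists_mem_invFun_of_closed s.2).choose : Subgroup G) (Form.val s.1)

/-- The chosen subgroup and H are compared through their intersection. -/
theorem closedAvg_eq (s : V.closedFun) (H : OpenSubgroup G) (hs : s.1 ∈ V.invFun H) :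
    closedAvg s = cosetAvg K (H : Subgroup G) (Form.val s.1) := by
  let H₀ := (exists_mem_invFun_of_closed s.2).choose
  have h₀ : s.1 ∈ V.invFun H₀ := (exists_mem_invFun_of_closed s.2).choose_spec
  have := finite_quotient_openSubgroup K E H
  have := finite_quotient_openSubgroup K E H₀
  have := finite_quotient_openSubgroup K E (H₀ ⊓ H)
  have h1 := cosetAvg_eq_of_le (K := K) (H := (H₀ : Subgroup G))
    (H' := ((H₀ ⊓ H : OpenSubgroup G) : Subgroup G)) h₀
    (inf_le_left : (H₀ ⊓ H : OpenSubgroup G) ≤ H₀)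
  have h2 := cosetAvg_eq_of_le (K := K) (H := (H : Subgroup G))
    (H' := ((H₀ ⊓ H : OpenSubgroup G) : Subgroup G)) hs
    (inf_le_right : (H₀ ⊓ H : OpenSubgroup G) ≤ H)
  exact h1.symm.trans h2

theorem invFun_mono {H H' : Subgroup G} (h : H ≤ H') : V.invFun H' ≤ V.invFun H :=
  fun _ hs g k hk => hs g k (h hk)

theorem closedAvg_add (s t : V.closedFun) : closedAvg (s + t) = closedAvg s + closedAvg t := by
  obtain ⟨H₁, h₁⟩ := exists_mem_invFun_of_closed s.2
  obtain ⟨H₂, h₂⟩ := exists_mem_invFun_of_closed t.2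
  let H := H₁ ⊓ H₂
  have hs : s.1 ∈ V.invFun H := invFun_mono (inf_le_left : H ≤ H₁) h₁
  have ht : t.1 ∈ V.invFun H := invFun_mono (inf_le_right : H ≤ H₂) h₂
  have := finite_quotient_openSubgroup K E H
  rw [closedAvg_eq s H hs, closedAvg_eq t H ht, closedAvg_eq (s + t) H (add_mem hs ht),
    ← cosetAvg_add]
  rfl

/-- Left translation only permutes the cosets, so the action on the values is all that remains. -/
theorem closedAvg_smul (g : G) (s : V.closedFun) :
    closedAvg ⟨g • s.1, smul_mem_closedFun g s.1 s.2⟩ = V.ρ g (closedAvg s) := by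
  obtain ⟨H, h⟩ := exists_mem_invFun_of_closed s.2
  have := finite_quotient_openSubgroup K E H
  rw [closedAvg_eq s H h, closedAvg_eq _ H (smul_mem_invFun _ g _ h),
    ← cosetAvg_mul_left (K := K) h g⁻¹]
  exact cosetAvg_map (V.ρ g : V →L[K] V).toLinearMap

theorem isAdmissible_of_isAn {f : X → V}
    (hf : IsAn K (𝓘(K, E).prod 𝓘(K, X.model)) fun p : G × X => V.ρ p.1 (f p.2)) :
    V.IsAdmissible X f :=
  ⟨fun x => ((hf (1, x)).comp (r := fun x : X => ((1 : G), x))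
    (contMDiffAt_const.prodMk contMDiffAt_id)).congr (.of_forall fun _ => V.ρ_one _), hf⟩

theorem isAnAt_sum {Y : AnMfd K} {ι : Type*} (t : Finset ι) {f : ι → G × Y → V} {p : G × Y}
    (hf : ∀ i, IsAnAt K (𝓘(K, E).prod 𝓘(K, Y.model)) (f i) p) :
    IsAnAt K (𝓘(K, E).prod 𝓘(K, Y.model)) (fun p => ∑ i ∈ t, f i p) p := by
  classical
  induction t using Finset.induction_on with
  | empty => exact isAnAt_zero p
  | insert i t hi ih =>
    refine ((hf i).add ih).congr (.of_forall fun p => ?_)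
    exact (Finset.sum_insert (f := fun i => f i p) hi).symm

variable (V) in
/-- The average, as a map of classes of functions. -/
noncomputable def avgData : FunData.Hom V.closedData V.admData where
  toFun := AddMonoidHom.mk' (fun s : V.closedFun => closedAvg s) closedAvg_add
  map_smul g s := closedAvg_smul g s
  map_sec {X f} hf := by
    refine isAdmissible_of_isAn fun p => ?_
    -- One subgroup H serves all parameters near p.2, so the average is locally a fixed finite sum
    -- of admissible functions.
    obtain ⟨U, H, hU, hx, h⟩ := exists_mem_invFun (f := fun x => (f x).1) hf (fun x => (f x).2) p.2
    have := finite_quotient_openSubgroup K E H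
    cases nonempty_fintype (G ⧸ (H : Subgroup G))
    have h1 : ∀ c : G ⧸ (H : Subgroup G), IsAnAt K (𝓘(K, E).prod 𝓘(K, X.model))
        (fun p : G × X => V.ρ p.1 (Form.val (f p.2).1 c.out)) p := fun c =>
      ((show V.IsAdmForm X fun x => (f x).1.1 from hf) Fin.elim0 (p.1, (p.2, c.out))).comp
        (r := fun p : G × X => (p.1, (p.2, c.out)))
        (contMDiffAt_fst.prodMk (contMDiffAt_snd.prodMk contMDiffAt_const))
    refine ((isAnAt_sum Finset.univ h1).clm_comp
      ((Nat.card (G ⧸ (H : Subgroup G)) : K)⁻¹ • ContinuousLinearMap.id K V)).congr ?_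
    filter_upwards [continuous_snd.continuousAt.eventually_mem (hU.mem_nhds hx)] with p' hp'
    change (Nat.card (G ⧸ (H : Subgroup G)) : K)⁻¹ • _ = V.ρ p'.1 (closedAvg (f p'.2))
    rw [closedAvg_eq _ H (h _ hp'), cosetAvg, map_smul, finsum_eq_sum_of_fintype]
    exact congrArg _ (map_sum (V.ρ p'.1) _ _).symm

/-- The constant functions. -/
noncomputable def constForm (v : V) : V.Form 0 :=
  ⟨fun _ => AlternatingMap.constOfIsEmpty K _ (Fin 0) v, fun _ p =>
    (V.isAn_orbit v p.1).comp (r := fun p : G × (AnMfd.carrier (AnMfd.pt : AnMfd K) × G) => p.1)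
      contMDiffAt_fst⟩

theorem constForm_mem_invFun (v : V) (H : Subgroup G) : constForm v ∈ V.invFun H :=
  fun _ _ _ => rfl

theorem constForm_mem_closedFun (v : V) : constForm v ∈ V.closedFun :=
  invFun_le_closedFun ⊤ (constForm_mem_invFun v _)

variable (V) in
/-- The inclusion of the constant functions, as a map of classes of functions. -/
noncomputable def constData : FunData.Hom V.admData V.closedData where
  toFun := AddMonoidHom.mk' (fun v : V => (⟨constForm v, constForm_mem_closedFun v⟩ : V.closedFun))
    fun _ _ => rfl
  map_smul _ _ := rfl
  map_sec {X _} hf := fun _ p =>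
    (hf.2 (p.1, p.2.1)).comp (r := fun p : G × (X × G) => (p.1, p.2.1))
      (contMDiffAt_fst.prodMk (contMDiffAt_fst.comp p contMDiffAt_snd))

variable (V) in
/-- The class of functions invariant under right multiplication by `H`. -/
noncomputable def invData (H : OpenSubgroup G) : FunData K E G :=
  formData (V.invFun H) (smul_mem_invFun (H : Subgroup G))

variable (V) in
/-- The inclusion of the functions invariant under right multiplication by `H`. -/
noncomputable def invIncl (H : OpenSubgroup G) : FunData.Hom (V.invData H) V.closedData :=
  formHom (AddMonoidHom.id _) (fun _ _ => rfl) (invFun_le_closedFun H) fun _ _ h => h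

variable (V) in
/-- The inclusion of sheaves of functions invariant under right multiplication by `H`. -/
noncomputable def invMap (H : OpenSubgroup G) : (V.invData H).toSheaf ⟶ V.closedSheaf :=
  (invIncl V H).toSheafHom

/-- A closed family is invariant under a common open subgroup locally on the parameter space, by
compactness of G. -/
theorem isDirectedUnion_invMap : IsDirectedUnion fun H : OpenSubgroup G => V.invMap H where
  nonempty := ⟨⊤⟩
  mono H := (mono_iff _).2 fun X _ _ h =>
    ULift.ext _ _ (Subtype.ext (funext fun x => Subtype.ext (congrArg
      (fun s : ULift.{u + 1} (V.closedData.sec X) => (s.down.1 x).1) h)))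
  directed H₁ H₂ := ⟨H₁ ⊓ H₂,
    (formHom (AddMonoidHom.id _) (fun _ _ => rfl)
      (invFun_mono (inf_le_left : H₁ ⊓ H₂ ≤ H₁)) fun _ _ h => h :
        FunData.Hom (V.invData H₁) (V.invData (H₁ ⊓ H₂))).toSheafHom,
    (formHom (AddMonoidHom.id _) (fun _ _ => rfl)
      (invFun_mono (inf_le_right : H₁ ⊓ H₂ ≤ H₂)) fun _ _ h => h :
        FunData.Hom (V.invData H₂) (V.invData (H₁ ⊓ H₂))).toSheafHom, rfl, rfl⟩
  exhaust X s x := by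
    let s' : ULift.{u + 1} (V.closedData.sec X) := s
    obtain ⟨U, H, hU, hx, h⟩ := exists_mem_invFun (f := fun x => (s'.down.1 x).1) s'.down.2
      (fun x => (s'.down.1 x).2) x
    refine ⟨H, U, hU, hx, fun Y k hk => ?_⟩
    exact ⟨(ULift.up ⟨fun y => ⟨(s'.down.1 (k y)).1, h _ (hk ⟨y, rfl⟩)⟩,
      IsAdmForm.res (f := fun x => (s'.down.1 x).1.1) s'.down.2 k⟩ :
        ULift.{u + 1} ((V.invData H).sec Y)), rfl⟩

end LocAnRep

end ClosedFunctions

end LocAnCohom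

namespace LocAnCohom

/-! ### The comparison theorem -/

section Comparison

variable {K : Type u} [NontriviallyNormedField K] [IsUltrametricDist K] [CompleteSpace K]
  [CharZero K] {E : Type u} [NormedAddCommGroup E] [NormedSpace K E] [FiniteDimensional K E]
  {G : Type u} [TopologicalSpace G] [T2Space G] [ChartedSpace E G] [Group G]
  [LieGroup 𝓘(K, E) ω G] [CompactSpace G]

open AnMfd EquivSheaf Limits Abelian

/-- The evaluation of homomorphisms on sections is additive. -/
noncomputable def EquivSheaf.appHom (A B : EquivSheaf K E G) (X : AnMfd K) :
    (A ⟶ B) →+ (A.Sec X →+ B.Sec X) :=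
  AddMonoidHom.mk' (fun φ => app φ X) fun φ ψ => AddMonoidHom.ext fun s => app_add φ ψ s

namespace LocAnRep

variable {V V' : LocAnRep K E G}

variable (V) in
/-- The inclusion of the constant functions into the closed functions. -/
noncomputable def constIncl : V.admData.toSheaf ⟶ V.closedSheaf := (constData V).toSheafHom

variable (V) in
/-- The average of closed functions. -/
noncomputable def avgMap : V.closedSheaf ⟶ V.admData.toSheaf := (avgData V).toSheafHom

theorem constIncl_avgMap : V.constIncl ≫ V.avgMap = 𝟙 _ := by
  refine FunData.toSheafHom_ext (S := (constData V).comp (avgData V)) (T := FunData.Hom.id _)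
    fun v => ?_
  have := finite_quotient_openSubgroup K E (⊤ : OpenSubgroup G)
  refine (closedAvg_eq ⟨constForm v, constForm_mem_closedFun v⟩ ⊤
    (constForm_mem_invFun v _)).trans ?_
  exact cosetAvg_const (K := K) (W := V) v

theorem constIncl_closedTrans (g : G) : V.constIncl ≫ V.closedTrans g = V.constIncl :=
  FunData.toSheafHom_ext (S := (constData V).comp (closedTransData V g)) (T := constData V)
    fun _ => Subtype.ext (Form.ext_val fun _ => Form.val_rTrans _ _ _)

theorem constIncl_naturality (T : V ⟶ V') :
    (admDataMap T).toSheafHom ≫ V'.constIncl = V.constIncl ≫ closedMap T :=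
  FunData.toSheafHom_ext (S := (admDataMap T).comp (constData V'))
    (T := (constData V).comp (closedMapData T)) fun _ => Subtype.ext (Form.ext_val fun _ => rfl)

/-- The sum of s over G / H does not change when s is translated to h ↦ s(h c), which writes it as a
sum of right translates at each h. A single right translation need not preserve invariance under H,
so the identity lives in the maps to `closedSheaf`; these form only an abelian group, so the index
is not divided out. -/
theorem card_smul_avgMap_constIncl (H : OpenSubgroup G) [Fintype (G ⧸ (H : Subgroup G))] :
    Fintype.card (G ⧸ (H : Subgroup G)) • (V.invMap H ≫ V.avgMap ≫ V.constIncl) =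
      ∑ c : G ⧸ (H : Subgroup G), V.invMap H ≫ V.closedTrans c.out := by
  refine hom_ext_app fun X s => ?_
  let s' : ULift.{u + 1} ((V.invData H).sec X) := s
  let ev (x : X) (h : G) : V.closedSheaf.Sec X →+ V := AddMonoidHom.mk'
    (fun t => Form.val ((show ULift.{u + 1} (V.closedData.sec X) from t).down.1 x).1 h)
    fun _ _ => rfl
  have hev : ∀ t t' : V.closedSheaf.Sec X, (∀ x h, ev x h t = ev x h t') → t = t' :=
    fun t t' h => ULift.ext _ _ (Subtype.ext (funext fun x => Subtype.ext (Form.ext_val (h x))))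
  refine hev _ _ fun x h => ?_
  let E' : ((V.invData H).toSheaf ⟶ V.closedSheaf) →+ V :=
    ((ev x h).comp (AddMonoidHom.eval s)).comp (appHom (V.invData H).toSheaf V.closedSheaf X)
  suffices h0 : E' (Fintype.card (G ⧸ (H : Subgroup G)) • (V.invMap H ≫ V.avgMap ≫ V.constIncl)) =
      E' (∑ c : G ⧸ (H : Subgroup G), V.invMap H ≫ V.closedTrans c.out) from h0
  rw [map_nsmul, map_sum]
  have h1 : E' (V.invMap H ≫ V.avgMap ≫ V.constIncl) =
      cosetAvg K (H : Subgroup G) (Form.val (s'.down.1 x).1) :=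
    closedAvg_eq ⟨(s'.down.1 x).1, invFun_le_closedFun H (s'.down.1 x).2⟩ H (s'.down.1 x).2
  have h2 : ∀ g : G, E' (V.invMap H ≫ V.closedTrans g) =
      Form.val (s'.down.1 x).1 (h * g) := fun g => Form.val_rTrans g (s'.down.1 x).1 h
  rw [h1, Finset.sum_congr rfl fun c _ => h2 c.out, ← finsum_eq_sum_of_fintype,
    finsum_mul_out (s'.down.1 x).2 h, ← card_smul_cosetAvg (K := K), Nat.card_eq_fintype_card]

/-- The comparison map from the cohomology of the group to the cohomology of the Lie algebra. -/
noncomputable def toLie (V : LocAnRep K E G) (n : ℕ) :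
    Ext (unitObj K E G) V.admData.toSheaf n →+ V.lieCohomology n :=
  (extEquivLie V n).toAddMonoidHom.comp
    ((Ext.mk₀ V.constIncl).postcomp (unitObj K E G) (add_zero n))

theorem toLie_apply (n : ℕ) (x : Ext (unitObj K E G) V.admData.toSheaf n) :
    toLie V n x = extEquivLie V n (x.comp (Ext.mk₀ V.constIncl) (add_zero n)) := rfl

/-- The average is a retraction of the inclusion of the constants, hence the inclusion induces split
injections on Ext. -/
theorem toLie_injective (n : ℕ) : Function.Injective (toLie V n) := by
  intro x y h
  have h1 := (extEquivLie V n).injective h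
  have h2 : ∀ z : Ext (unitObj K E G) V.admData.toSheaf n,
      (z.comp (Ext.mk₀ V.constIncl) (add_zero n)).comp (Ext.mk₀ V.avgMap) (add_zero n) = z := by
    intro z
    rw [Ext.comp_assoc_of_third_deg_zero, Ext.mk₀_comp_mk₀, constIncl_avgMap, Ext.comp_mk₀_id]
  rw [← h2 x, ← h2 y]
  exact congrArg (fun z => Ext.comp z (Ext.mk₀ V.avgMap) (add_zero n)) h1

theorem toLie_mem_invariants (n : ℕ) (x : Ext (unitObj K E G) V.admData.toSheaf n) :
    toLie V n x ∈ (V.lieCohomologyRep n).invariants := fun g => by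
  rw [toLie_apply, ← extEquivLie_trans, Ext.comp_assoc_of_third_deg_zero, Ext.mk₀_comp_mk₀,
    constIncl_closedTrans]

/-- The class comes from functions invariant under some open H of index N. There N times the average
is a sum of N right translations, each of which fixes the class; so N times the class equals N times
its average, which comes from the constants. -/
theorem exists_toLie_eq (n : ℕ) {w : V.lieCohomology n}
    (hw : w ∈ (V.lieCohomologyRep n).invariants) : ∃ x, toLie V n x = w := by
  obtain ⟨y, rfl⟩ := (extEquivLie V n).surjective w
  have hy : ∀ g : G, y.comp (Ext.mk₀ (V.closedTrans g)) (add_zero n) = y := fun g =>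
    (extEquivLie V n).injective ((extEquivLie_trans g n y).trans (hw g))
  obtain ⟨H, y', rfl⟩ := isDirectedUnion_invMap.exists_ext_comp n y
  have := finite_quotient_openSubgroup K E H
  cases nonempty_fintype (G ⧸ (H : Subgroup G))
  let N := Fintype.card (G ⧸ (H : Subgroup G))
  set y := y'.comp (Ext.mk₀ (V.invMap H)) (add_zero n) with hyy
  refine ⟨y.comp (Ext.mk₀ V.avgMap) (add_zero n), ?_⟩
  rw [toLie_apply]
  set z := (y.comp (Ext.mk₀ V.avgMap) (add_zero n)).comp (Ext.mk₀ V.constIncl) (add_zero n) with hz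
  have h1 : N • z = N • y := by
    have e1 : z = y'.comp (Ext.mk₀ (V.invMap H ≫ V.avgMap ≫ V.constIncl))
        (add_zero n) := by
      rw [hz, hyy, Ext.comp_assoc_of_third_deg_zero, Ext.comp_assoc_of_third_deg_zero,
        Ext.mk₀_comp_mk₀, Ext.mk₀_comp_mk₀]
    let P : ((V.invData H).toSheaf ⟶ V.closedSheaf) →+ Ext (unitObj K E G) V.closedSheaf n :=
      AddMonoidHom.mk' (fun φ => y'.comp (Ext.mk₀ φ) (add_zero n)) fun φ ψ => by
        rw [Ext.mk₀_add, Ext.comp_add]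
    have e2 : ∀ g : G, P (V.invMap H ≫ V.closedTrans g) = y := fun g => by
      refine Eq.trans ?_ (hy g)
      change y'.comp (Ext.mk₀ (V.invMap H ≫ V.closedTrans g)) (add_zero n) = _
      rw [hyy, ← Ext.mk₀_comp_mk₀, ← Ext.comp_assoc_of_third_deg_zero]
    have e3 : N • z = P (N • (V.invMap H ≫ V.avgMap ≫ V.constIncl)) := by
      rw [map_nsmul, e1]
      rfl
    rw [e3, card_smul_avgMap_constIncl, map_sum, Finset.sum_congr rfl fun c _ => e2 c.out,
      Finset.sum_const, Finset.card_univ]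
  -- Division by N takes place in Lie algebra cohomology, a K-vector space of characteristic 0; Ext
  -- is given only as an abelian group.
  have h2 := congrArg (extEquivLie V n) h1
  rw [map_nsmul, map_nsmul, ← Nat.cast_smul_eq_nsmul K, ← Nat.cast_smul_eq_nsmul K] at h2
  exact smul_right_injective _ (Nat.cast_ne_zero.2 Fintype.card_pos.ne') h2

theorem toLie_naturality (T : V ⟶ V') (n : ℕ) (x : Ext (unitObj K E G) V.admData.toSheaf n) :
    toLie V' n (x.comp (Ext.mk₀ (admDataMap T).toSheafHom) (add_zero n)) =
      lieCohomologyMap T n (toLie V n x) := by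
  rw [toLie_apply, toLie_apply, ← extEquivLie_map, Ext.comp_assoc_of_third_deg_zero,
    Ext.comp_assoc_of_third_deg_zero, Ext.mk₀_comp_mk₀, Ext.mk₀_comp_mk₀, constIncl_naturality]

/-- The comparison map is an isomorphism onto the invariants. -/
noncomputable def extEquivInvariants (V : LocAnRep K E G) (n : ℕ) :
    Ext (unitObj K E G) V.admData.toSheaf n ≃+ (V.lieCohomologyRep n).invariants :=
  AddEquiv.ofBijective
    (AddMonoidHom.mk' (fun x => ⟨toLie V n x, toLie_mem_invariants n x⟩)
      fun x y => Subtype.ext (map_add (toLie V n) x y))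
    ⟨fun _ _ h => toLie_injective n (congrArg Subtype.val h), fun w =>
      (exists_toLie_eq n w.2).imp fun _ h => Subtype.ext h⟩

/-- Locally analytic group cohomology as the invariants of Lie algebra cohomology. -/
noncomputable def anCohomologyEquiv (V : LocAnRep K E G) (n : ℕ) :
    V.anCohomology n ≃+ (V.lieCohomologyRep n).invariants :=
  -- The sheaf of admissible functions in the definition of the cohomology and `admData.toSheaf` are
  -- definitionally equal.
  AddEquiv.trans (cohomologyEquivExt ((admSheaf K E G).obj V) n) (extEquivInvariants V n)

theorem anCohomologyEquiv_naturality (T : V ⟶ V') (n : ℕ) (x : V.anCohomology n) :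
    (anCohomologyEquiv V' n (anCohomologyMap T n x) : V'.lieCohomology n) =
      lieCohomologyMap T n (anCohomologyEquiv V n x : V.lieCohomology n) := by
  refine Eq.trans ?_ (toLie_naturality T n (cohomologyEquivExt ((admSheaf K E G).obj V) n x))
  exact congrArg (toLie V' n) (cohomologyEquivExt_naturality ((admSheaf K E G).map T) n x)

theorem lieCohomologyMap_scalar (a : K) (n : ℕ) (y : V.lieCohomology n) :
    lieCohomologyMap (V.scalar a) n y = a • y := by
  obtain ⟨η, rfl⟩ := Submodule.Quotient.mk_surjective _ y
  exact congrArg Submodule.Quotient.mk (Subtype.ext (AlternatingMap.ext fun _ => rfl))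

end LocAnRep

end Comparison

end LocAnCohom

/-- The scalar a acts on the cohomology of G through the endomorphism a of the representation V, so
K-linearity is the case T = a of naturality. -/
theorem mainTheorem2
    {K : Type u} [NontriviallyNormedField K] [IsUltrametricDist K] [CompleteSpace K] [CharZero K]
    {E : Type u} [NormedAddCommGroup E] [NormedSpace K E] [FiniteDimensional K E]
    {G : Type u} [TopologicalSpace G] [T2Space G] [ChartedSpace E G] [Group G]
    [LieGroup 𝓘(K, E) ω G] [CompactSpace G] (n : ℕ) :
    ∃ Φ : ∀ V : LocAnCohom.LocAnRep K E G,
        V.anCohomology n ≃+ (V.lieCohomologyRep n).invariants,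
      (∀ (V : LocAnCohom.LocAnRep K E G) (a : K) (x : V.anCohomology n),
        Φ V (LocAnCohom.LocAnRep.anCohomologyMap (V.scalar a) n x) = a • Φ V x) ∧
      ∀ (V V' : LocAnCohom.LocAnRep K E G) (T : V ⟶ V') (x : V.anCohomology n),
        (Φ V' (LocAnCohom.LocAnRep.anCohomologyMap T n x) : V'.lieCohomology n) =
          LocAnCohom.LocAnRep.lieCohomologyMap T n (Φ V x : V.lieCohomology n) := by
  refine ⟨fun V => V.anCohomologyEquiv n,
    fun V a x => Subtype.ext
      ((LocAnCohom.LocAnRep.anCohomologyEquiv_naturality (V.scalar a) n x).trans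
        (LocAnCohom.LocAnRep.lieCohomologyMap_scalar a n _)),
    fun _ _ T x => LocAnCohom.LocAnRep.anCohomologyEquiv_naturality T n x⟩
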